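/- A semi-uniform space is a set $X$ together with a filter $\mathcal U$ of relations on $X$, each containing the diagonal, such that $U\in\mathcal U$ implies $U^{-1}\in\mathcal U$. A map $f:X\to X'$ is uniformly continuous if $(f\times f)^{-1}(U')\in\mathcal U$ for all $U'\in\mathcal U'$. The product $X\times Y$ of $(X,\mathcal U)$ and $(Y,\mathcal V)$ carries the filter generated by the relations $U\times V=\{((x,y),(x',y')) : (x,x')\in U,\ (y,y')\in V\}$ with $U\in\mathcal U$, $V\in\mathcal V$. For $U\in\mathcal U$ let $X^U$ be the simplicial set whose $n$-simplices are the tuples $(x_0,\dots,x_n)$ with $(x_i,x_j)\in U$ for all $i<j$ (faces omit an entry, degeneracies repeat one). Let $R$ be a commutative ring. For an $R$-module $G$ let $H_*(X^U;R)$ and $H^*(X^U;G)$ denote the homology of the complex of simplicial $R$-chains of $X^U$ and the cohomology of the complex of $R$-linear cochains with values in $G$, and put $H^q_{VR}(X;G)=\varinjlim_{U\in\mathcal U}H^q(X^U;G)$ for $q\in\mathbb Z$, where $\mathcal U$ is directed by reverse inclusion (so the group is $0$ for $q<0$). Call $\mathcal U$ generated by relations with finite-type homology (over $R$) if there is a collection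 $\{U_\alpha\}\subseteq\mathcal U$ such that every member of $\mathcal U$ contains some $U_\alpha$ and each $H_n(X^{U_\alpha};R)$ is a finitely generated $R$-module for all $n$ and $\alpha$. Theorem. Let $R$ be a principal ideal domain. Let $(X,\mathcal U)$, $(Y,\mathcal V)$ be semi-uniform spaces and $G$, $G'$ be $R$-modules with $\operatorname{Tor}_1^R(G,G')=0$. Suppose that either both $\mathcal U$ and $\mathcal V$ are generated by relations with finite-type homology, or $\mathcal V$ is generated by relations with finite-type homology and $G'$ is finitely generated. Then for every $q\in\mathbb Z$ there is a short exact sequence $$0\to\bigoplus_{i+j=q}H^i_{VR}(X;G)\otimes_R H^j_{VR}(Y;G')\to H^q_{VR}(X\times Y;G\otimes_R G')\to\bigoplus_{i+j=q+1}\operatorname{Tor}_1^R\bigl(H^i_{VR}(X;G),H^j_{VR}(Y;G')\bigr)\to 0,$$ natural in $X$ and $Y$ (for uniformly continuous maps) and in $G$ and $G'$ (for $R$-module homomorphisms), among all $X,Y,G,G'$ satisfying the hypotheses. Each of these sequences splits. The splitting is not canonical: for $R=\mathbb Z$ there are $G,G'$ with $\operatorname{Tor}_1^{\mathbb Z}(G,G')=0$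 such that no such natural short exact sequence admits splittings that are natural in $X$ and $Y$. -/

import Mathlib

open CategoryTheory Opposite TensorProduct DirectSum

universe u

/-- A semi-uniform space: a set `X` with a filter of relations on `X`, each containing the diagonal,
which is closed under `U ↦ U⁻¹`. (For nonempty `X` the filter is automatically proper.) -/
structure SemiUniformSpace : Type (u + 1) where
  carrier : Type u
  entourages : Filter (carrier × carrier)
  diag_mem : ∀ U ∈ entourages, ∀ x : carrier, (x, x) ∈ U
  inv_mem : ∀ U ∈ entourages, {p : carrier × carrier | (p.2, p.1) ∈ U} ∈ entourages

namespace SemiUniformSpace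

/-- The relations belonging to the semi-uniform structure. -/
@[ext]
structure Entourage (X : SemiUniformSpace.{u}) : Type u where
  val : Set (X.carrier × X.carrier)
  mem : val ∈ X.entourages

/-- `U ≤ V` iff `V ⊆ U`. -/
instance (X : SemiUniformSpace.{u}) : PartialOrder X.Entourage where
  le U V := V.val ⊆ U.val
  le_refl _ := subset_rfl
  le_trans _ _ _ h h' := h'.trans h
  le_antisymm _ _ h h' := Entourage.ext (h'.antisymm h)

/-- Uniformly continuous maps of semi-uniform spaces. -/
structure UniformMap (X Y : SemiUniformSpace.{u}) where
  toFun : X.carrier → Y.carrier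
  preimage_mem : ∀ V ∈ Y.entourages, Prod.map toFun toFun ⁻¹' V ∈ X.entourages

/-- The entourage `(f × f)⁻¹(V)`. -/
def UniformMap.pullback {X Y : SemiUniformSpace.{u}} (f : UniformMap X Y) (V : Y.Entourage) :
    X.Entourage :=
  ⟨Prod.map f.toFun f.toFun ⁻¹' V.val, f.preimage_mem V.val V.mem⟩

/-- The relation `U × V` on the product of two sets. -/
def prodRel {X Y : Type u} (U : Set (X × X)) (V : Set (Y × Y)) : Set ((X × Y) × (X × Y)) :=
  {p | (p.1.1, p.2.1) ∈ U ∧ (p.1.2, p.2.2) ∈ V}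

/-- The semi-uniform product: its structure is generated by the relations `U × V` with
`U` and `V` in the given structures. -/
def prod (X Y : SemiUniformSpace.{u}) : SemiUniformSpace.{u} where
  carrier := X.carrier × Y.carrier
  entourages :=
    { sets := {W | ∃ U ∈ X.entourages, ∃ V ∈ Y.entourages, prodRel U V ⊆ W}
      univ_sets := ⟨_, Filter.univ_mem, _, Filter.univ_mem, Set.subset_univ _⟩
      sets_of_superset := by
        rintro _ _ ⟨U, hU, V, hV, h⟩ h'
        exact ⟨U, hU, V, hV, h.trans h'⟩
      inter_sets := by
        rintro _ _ ⟨U, hU, V, hV, h⟩ ⟨U', hU', V', hV', h'⟩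
        exact ⟨_, Filter.inter_mem hU hU', _, Filter.inter_mem hV hV',
          fun p hp => ⟨h ⟨hp.1.1, hp.2.1⟩, h' ⟨hp.1.2, hp.2.2⟩⟩⟩ }
  diag_mem := by
    rintro _ ⟨U, hU, V, hV, h⟩ x
    exact h ⟨X.diag_mem U hU x.1, Y.diag_mem V hV x.2⟩
  inv_mem := by
    rintro _ ⟨U, hU, V, hV, h⟩
    exact ⟨_, X.inv_mem U hU, _, Y.inv_mem V hV, fun p hp => h hp⟩

/-- The product of two uniformly continuous maps. -/
def UniformMap.prodMap {X X' Y Y' : SemiUniformSpace.{u}} (f : UniformMap X X')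
    (g : UniformMap Y Y') : UniformMap (X.prod Y) (X'.prod Y') where
  toFun := Prod.map f.toFun g.toFun
  preimage_mem := by
    rintro _ ⟨U, hU, V, hV, h⟩
    exact ⟨_, f.preimage_mem U hU, _, g.preimage_mem V hV, fun p hp => h hp⟩

end SemiUniformSpace

noncomputable section

namespace VietorisRips

open SemiUniformSpace

/-- The Vietoris-Rips complex `X^U`: an `n`-simplex is a tuple `(x_0, …, x_n)` with
`(x_i, x_j) ∈ U` for all `i < j`; faces omit and degeneracies repeat an entry. -/
def complex {X : SemiUniformSpace.{u}} (U : X.Entourage) : SSet.{u} where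
  obj n := {x : Fin (n.unop.len + 1) → X.carrier // ∀ i j, i < j → (x i, x j) ∈ U.val}
  map θ := TypeCat.ofHom fun x => ⟨fun i => x.1 (θ.unop.toOrderHom i), fun i j hij => by
    rcases (θ.unop.toOrderHom.monotone hij.le).lt_or_eq with h | h
    · exact x.2 _ _ h
    · change (x.1 (θ.unop.toOrderHom i), x.1 (θ.unop.toOrderHom j)) ∈ U.val
      exact congrArg x.1 h ▸ X.diag_mem U.val U.mem _⟩

/-- A function `f : X → Y` with `(f × f)(U) ⊆ V` induces a simplicial map `X^U → Y^V`. -/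
def complexMap {X Y : SemiUniformSpace.{u}} (U : X.Entourage) (V : Y.Entourage)
    (f : X.carrier → Y.carrier) (h : ∀ p ∈ U.val, (f p.1, f p.2) ∈ V.val) :
    complex U ⟶ complex V where
  app n := TypeCat.ofHom fun x => ⟨fun i => f (x.1 i), fun i j hij => h _ (x.2 i j hij)⟩

variable (R : Type u) [CommRing R]

/-- The chain complex with the free `R`-module on the `n`-simplices in degree `n`, and differential
`∑ i, (-1) ^ i ∂_i`. -/
abbrev chains : SSet.{u} ⥤ ChainComplex (ModuleCat.{u} R) ℕ :=
  (SimplicialObject.whiskering _ _).obj (ModuleCat.free R) ⋙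
    AlgebraicTopology.alternatingFaceMapComplex (ModuleCat.{u} R)

/-- `H_n(X^U; R)`. -/
abbrev homologyAt {X : SemiUniformSpace.{u}} (U : X.Entourage) (n : ℕ) : ModuleCat.{u} R :=
  ((chains R).obj (complex U)).homology n

variable {R}

/-- The cochain complex `Hom_R(K, G)`, with coboundary `c ↦ c ∘ d`. -/
def cochains (K : ChainComplex (ModuleCat.{u} R) ℕ) (G : ModuleCat.{u} R) :
    CochainComplex (ModuleCat.{u} R) ℕ where
  X n := ModuleCat.of R (K.X n →ₗ[R] G)
  d i j := ModuleCat.ofHom (LinearMap.lcomp R G (K.d j i).hom)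
  shape i j h := by
    ext c : 2
    refine LinearMap.ext fun x => ?_
    simp [K.shape j i h]
  d_comp_d' i j k _ _ := by
    ext c : 2
    refine LinearMap.ext fun x => ?_
    have h : (K.d j i).hom ((K.d k j).hom x) = 0 := by
      rw [← LinearMap.comp_apply, ← ModuleCat.hom_comp, K.d_comp_d]
      rfl
    change c ((K.d j i).hom ((K.d k j).hom x)) = 0
    rw [h, map_zero]

/-- The cochain map `Hom_R(L, G) → Hom_R(K, G')`, `c ↦ φ ∘ c ∘ F`. -/
def cochainsMap {K L : ChainComplex (ModuleCat.{u} R) ℕ} (F : K ⟶ L) {G G' : ModuleCat.{u} R}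
    (φ : G ⟶ G') : cochains L G ⟶ cochains K G' where
  f n := ModuleCat.ofHom (LinearMap.lcomp R G' (F.f n).hom ∘ₗ LinearMap.llcomp R (L.X n) G G' φ.hom)
  comm' i j _ := by
    ext c : 2
    refine LinearMap.ext fun x => ?_
    have h := LinearMap.congr_fun (congrArg ModuleCat.Hom.hom (F.comm j i)) x
    exact congrArg (fun y => φ.hom ((show L.X i →ₗ[R] G from c) y)) h.symm

/-- `H^n(X^U; G)`. -/
abbrev cohomologyAt {X : SemiUniformSpace.{u}} (U : X.Entourage) (G : ModuleCat.{u} R) (n : ℕ) :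
    ModuleCat.{u} R :=
  (cochains ((chains R).obj (complex U)) G).homology n

/-- The map `H^n(Y^V; G) → H^n(X^U; G')` induced by `X^U → Y^V` and `G → G'`. -/
abbrev cohomologyAtMap {X Y : SemiUniformSpace.{u}} (U : X.Entourage) (V : Y.Entourage)
    (f : X.carrier → Y.carrier) (h : ∀ p ∈ U.val, (f p.1, f p.2) ∈ V.val)
    {G G' : ModuleCat.{u} R} (φ : G ⟶ G') (n : ℕ) : cohomologyAt V G n ⟶ cohomologyAt U G' n :=
  HomologicalComplex.homologyMap (cochainsMap ((chains R).map (complexMap U V f h)) φ) n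

/-- The transition map `H^n(X^U; G) → H^n(X^V; G)` for `V ⊆ U`, induced by the inclusion. -/
abbrev transition (X : SemiUniformSpace.{u}) (G : ModuleCat.{u} R) (n : ℕ) (U V : X.Entourage)
    (h : U ≤ V) : cohomologyAt U G n →ₗ[R] cohomologyAt V G n :=
  (cohomologyAtMap V U id (fun _ hp => h hp) (𝟙 G) n).hom

open Classical in
/-- `H^n_VR(X; G)`, the direct limit of the `H^n(X^U; G)`, for `n ≥ 0`. -/
abbrev cohomologyNat (X : SemiUniformSpace.{u}) (G : ModuleCat.{u} R) (n : ℕ) : ModuleCat.{u} R :=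
  ModuleCat.of R (Module.DirectLimit (fun U : X.Entourage => cohomologyAt U G n)
    (transition X G n))

theorem cohomologyAtMap_comp {X Y Z : SemiUniformSpace.{u}} (U : X.Entourage) (V : Y.Entourage)
    (W : Z.Entourage) (f : X.carrier → Y.carrier) (g : Y.carrier → Z.carrier)
    (k : X.carrier → Z.carrier) (hf : ∀ p ∈ U.val, (f p.1, f p.2) ∈ V.val)
    (hg : ∀ p ∈ V.val, (g p.1, g p.2) ∈ W.val) (hk : ∀ p ∈ U.val, (k p.1, k p.2) ∈ W.val)
    (hgf : ∀ x, g (f x) = k x)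
    {G G' G'' : ModuleCat.{u} R} (φ : G ⟶ G') (ψ : G' ⟶ G'') (χ : G ⟶ G'') (hχ : φ ≫ ψ = χ)
    (n : ℕ) :
    cohomologyAtMap V W g hg φ n ≫ cohomologyAtMap U V f hf ψ n =
      cohomologyAtMap U W k hk χ n := by
  obtain rfl : k = g ∘ f := funext fun x => (hgf x).symm
  subst hχ
  have e : complexMap U W (g ∘ f) hk = complexMap U V f hf ≫ complexMap V W g hg := rfl
  rw [cohomologyAtMap, cohomologyAtMap, cohomologyAtMap, e,
    ← HomologicalComplex.homologyMap_comp]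
  congr 1
  ext i : 1
  ext c : 2
  refine LinearMap.ext fun x => ?_
  rw [Functor.map_comp]
  rfl

open Classical in
/-- The map `H^n_VR(Y; G) → H^n_VR(X; G')` induced by a uniformly continuous map `f : X → Y` and a
homomorphism `φ : G → G'`, for `n ≥ 0`: on `H^n(Y^V; G)` it is the map to `H^n(X^U; G')` with
`U = (f × f)⁻¹(V)`. -/
def cohomologyNatMap {X Y : SemiUniformSpace.{u}} (f : UniformMap X Y) {G G' : ModuleCat.{u} R}
    (φ : G ⟶ G') (n : ℕ) : cohomologyNat Y G n →ₗ[R] cohomologyNat X G' n :=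
  Module.DirectLimit.lift R Y.Entourage _ _
    (fun V => Module.DirectLimit.of R X.Entourage (fun U => cohomologyAt U G' n)
        (transition X G' n) (f.pullback V) ∘ₗ
      (cohomologyAtMap (f.pullback V) V f.toFun (fun _ hp => hp) φ n).hom)
    (by
      intro V V' h x
      have hle : f.pullback V ≤ f.pullback V' := fun p hp => h hp
      simp only [LinearMap.comp_apply]
      rw [← Module.DirectLimit.of_f (hij := hle)]
      congr 1
      have h1 := cohomologyAtMap_comp (f.pullback V') V' V f.toFun id f.toFun (fun _ hp => hp)
        (fun _ hp => h hp) (fun _ hp => h hp) (fun _ => rfl) (𝟙 G) φ φ (by simp) n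
      have h2 := cohomologyAtMap_comp (f.pullback V') (f.pullback V) V id f.toFun f.toFun
        (fun _ hp => hle hp) (fun _ hp => hp) (fun _ hp => h hp) (fun _ => rfl) φ (𝟙 G') φ
        (by simp) n
      exact LinearMap.congr_fun (congrArg ModuleCat.Hom.hom (h1.trans h2.symm)) x)

/-- The Vietoris-Rips cohomology `H^q_VR(X; G)` for `q ∈ ℤ`; it is zero for `q < 0`, where
there are no simplices. -/
def cohomology (X : SemiUniformSpace.{u}) (G : ModuleCat.{u} R) : ℤ → ModuleCat.{u} R
  | Int.ofNat n => cohomologyNat X G n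
  | Int.negSucc _ => ModuleCat.of R PUnit

/-- The map `H^q_VR(Y; G) → H^q_VR(X; G')` induced by `f : X → Y` and `φ : G → G'`. -/
def cohomologyMap {X Y : SemiUniformSpace.{u}} (f : UniformMap X Y) {G G' : ModuleCat.{u} R}
    (φ : G ⟶ G') : (q : ℤ) → (cohomology Y G q →ₗ[R] cohomology X G' q)
  | Int.ofNat n => cohomologyNatMap f φ n
  | Int.negSucc _ => 0

/-- `Tor_1^R(M, N)`. -/
abbrev tor₁ (M N : ModuleCat.{u} R) : ModuleCat.{u} R := ((Tor (ModuleCat.{u} R) 1).obj M).obj N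

/-- `Tor_1^R` on morphisms. -/
abbrev tor₁Map {M M' N N' : ModuleCat.{u} R} (a : M ⟶ M') (b : N ⟶ N') :
    tor₁ M N →ₗ[R] tor₁ M' N' :=
  (((Tor (ModuleCat.{u} R) 1).map a).app N ≫ ((Tor (ModuleCat.{u} R) 1).obj M').map b).hom

/-- The coefficient module `G ⊗ G'`. -/
abbrev tensorCoeff (G G' : ModuleCat.{u} R) : ModuleCat.{u} R := ModuleCat.of R (G ⊗[R] G')

/-- `φ ⊗ ψ` on coefficient modules. -/
abbrev tensorCoeffMap {G G₁ G' G₁' : ModuleCat.{u} R} (φ : G ⟶ G₁) (ψ : G' ⟶ G₁') :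
    tensorCoeff G G' ⟶ tensorCoeff G₁ G₁' :=
  ModuleCat.ofHom (TensorProduct.map φ.hom ψ.hom)

/-- `⨁_{i+j=q} H^i_VR(X; G) ⊗ H^j_VR(Y; G')`. -/
abbrev tensorTerm (X Y : SemiUniformSpace.{u}) (G G' : ModuleCat.{u} R) (q : ℤ) : Type u :=
  ⨁ p : {p : ℤ × ℤ // p.1 + p.2 = q}, cohomology X G p.1.1 ⊗[R] cohomology Y G' p.1.2

/-- `⨁_{i+j=q+1} Tor_1(H^i_VR(X; G), H^j_VR(Y; G'))`. -/
abbrev torTerm (X Y : SemiUniformSpace.{u}) (G G' : ModuleCat.{u} R) (q : ℤ) : Type u :=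
  ⨁ p : {p : ℤ × ℤ // p.1 + p.2 = q + 1}, tor₁ (cohomology X G p.1.1) (cohomology Y G' p.1.2)

/-- `H^q_VR(X × Y; G ⊗ G')`. -/
abbrev productTerm (X Y : SemiUniformSpace.{u}) (G G' : ModuleCat.{u} R) (q : ℤ) :
    ModuleCat.{u} R :=
  cohomology (X.prod Y) (tensorCoeff G G') q

section Maps

variable {X X₁ Y Y₁ : SemiUniformSpace.{u}} {G G₁ G' G₁' : ModuleCat.{u} R}
  (f : UniformMap X X₁) (g : UniformMap Y Y₁) (φ : G ⟶ G₁) (ψ : G' ⟶ G₁') (q : ℤ)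

/-- The induced map on tensor terms. -/
abbrev tensorTermMap : tensorTerm X₁ Y₁ G G' q →ₗ[R] tensorTerm X Y G₁ G₁' q :=
  DirectSum.lmap fun p =>
    TensorProduct.map (cohomologyMap f φ p.1.1) (cohomologyMap g ψ p.1.2)

/-- The induced map on torsion terms. -/
abbrev torTermMap : torTerm X₁ Y₁ G G' q →ₗ[R] torTerm X Y G₁ G₁' q :=
  DirectSum.lmap fun p =>
    tor₁Map (ModuleCat.ofHom (cohomologyMap f φ p.1.1)) (ModuleCat.ofHom (cohomologyMap g ψ p.1.2))

/-- The induced map on the cohomology of the product. -/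
abbrev productTermMap : productTerm X₁ Y₁ G G' q →ₗ[R] productTerm X Y G₁ G₁' q :=
  cohomologyMap (f.prodMap g) (tensorCoeffMap φ ψ) q

end Maps

variable (R)

/-- The structure of `X` is generated by a collection of relations `U` (a filter base) such that
each `H_n(X^U; R)` is finitely generated. -/
def GeneratedByFiniteType (X : SemiUniformSpace.{u}) : Prop :=
  ∃ B : Set X.Entourage, (∀ W : X.Entourage, ∃ U ∈ B, U.val ⊆ W.val) ∧
    ∀ U ∈ B, ∀ n : ℕ, Module.Finite R (homologyAt R U n)

variable {R}

/-- The hypotheses on the spaces and on the coefficients. -/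
structure KunnethHypotheses (X Y : SemiUniformSpace.{u}) (G G' : ModuleCat.{u} R) : Prop where
  tor_eq_zero : Limits.IsZero (tor₁ G G')
  finiteType : (GeneratedByFiniteType R X ∧ GeneratedByFiniteType R Y) ∨
    (GeneratedByFiniteType R Y ∧ Module.Finite R G')

variable (R)

/-- A short exact sequence `0 → tensorTerm → productTerm → torTerm → 0` for all `X`, `Y`, `G`, `G'`
satisfying the hypotheses and all `q ∈ ℤ`, natural in `X` and `Y` (for uniformly continuous maps)
and in `G` and `G'`. -/
structure NaturalKunnethSequence where
  /-- The map from the tensor term. -/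
  α : ∀ {X Y : SemiUniformSpace.{u}} {G G' : ModuleCat.{u} R}, KunnethHypotheses X Y G G' →
    ∀ q : ℤ, tensorTerm X Y G G' q →ₗ[R] productTerm X Y G G' q
  /-- The map to the torsion term. -/
  β : ∀ {X Y : SemiUniformSpace.{u}} {G G' : ModuleCat.{u} R}, KunnethHypotheses X Y G G' →
    ∀ q : ℤ, productTerm X Y G G' q →ₗ[R] torTerm X Y G G' q
  injective : ∀ {X Y : SemiUniformSpace.{u}} {G G' : ModuleCat.{u} R}
    (h : KunnethHypotheses X Y G G') (q : ℤ), Function.Injective (α h q)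
  exact : ∀ {X Y : SemiUniformSpace.{u}} {G G' : ModuleCat.{u} R}
    (h : KunnethHypotheses X Y G G') (q : ℤ), Function.Exact (α h q) (β h q)
  surjective : ∀ {X Y : SemiUniformSpace.{u}} {G G' : ModuleCat.{u} R}
    (h : KunnethHypotheses X Y G G') (q : ℤ), Function.Surjective (β h q)
  natural_α : ∀ {X X₁ Y Y₁ : SemiUniformSpace.{u}} {G G₁ G' G₁' : ModuleCat.{u} R}
    (h : KunnethHypotheses X₁ Y₁ G G') (h₁ : KunnethHypotheses X Y G₁ G₁')
    (f : UniformMap X X₁) (g : UniformMap Y Y₁) (φ : G ⟶ G₁) (ψ : G' ⟶ G₁') (q : ℤ),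
    productTermMap f g φ ψ q ∘ₗ α h q = α h₁ q ∘ₗ tensorTermMap f g φ ψ q
  natural_β : ∀ {X X₁ Y Y₁ : SemiUniformSpace.{u}} {G G₁ G' G₁' : ModuleCat.{u} R}
    (h : KunnethHypotheses X₁ Y₁ G G') (h₁ : KunnethHypotheses X Y G₁ G₁')
    (f : UniformMap X X₁) (g : UniformMap Y Y₁) (φ : G ⟶ G₁) (ψ : G' ⟶ G₁') (q : ℤ),
    torTermMap f g φ ψ q ∘ₗ β h q = β h₁ q ∘ₗ productTermMap f g φ ψ q

variable {R}

/-- Every one of the sequences splits. -/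
def NaturalKunnethSequence.Splits (K : NaturalKunnethSequence.{u} R) : Prop :=
  ∀ {X Y : SemiUniformSpace.{u}} {G G' : ModuleCat.{u} R} (h : KunnethHypotheses X Y G G') (q : ℤ),
    ∃ s : torTerm X Y G G' q →ₗ[R] productTerm X Y G G' q, K.β h q ∘ₗ s = LinearMap.id

/-- For the fixed coefficients `G`, `G'`, the sequences admit splittings that are natural in
`X` and `Y`. -/
def NaturalKunnethSequence.SplitsCanonically (K : NaturalKunnethSequence.{u} R)
    (G G' : ModuleCat.{u} R) : Prop :=
  ∃ s : ∀ {X Y : SemiUniformSpace.{u}}, KunnethHypotheses X Y G G' →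
      ∀ q : ℤ, torTerm X Y G G' q →ₗ[R] productTerm X Y G G' q,
    (∀ {X Y : SemiUniformSpace.{u}} (h : KunnethHypotheses X Y G G') (q : ℤ),
      K.β h q ∘ₗ s h q = LinearMap.id) ∧
    ∀ {X X₁ Y Y₁ : SemiUniformSpace.{u}} (h : KunnethHypotheses X₁ Y₁ G G')
      (h₁ : KunnethHypotheses X Y G G') (f : UniformMap X X₁) (g : UniformMap Y Y₁) (q : ℤ),
      productTermMap f g (𝟙 G) (𝟙 G') q ∘ₗ s h q = s h₁ q ∘ₗ torTermMap f g (𝟙 G) (𝟙 G') q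

end VietorisRips

end

/-! Everything is first rewritten in terms of germs. A compatible system of cochains on small `X^U`
is the same as a function on `(n+1)`-tuples modulo functions vanishing on the cliques of some
entourage, so Vietoris-Rips cohomology is the cohomology of a complex of germs near the diagonal
(`germIso`). Both limits and finiteness hypotheses can then be handled with elements.

Product of spaces. Germs on tuples in `X × Y` and the double complex of germs on pairs (tuple in
`X`, tuple in `Y`) both coaugment a complex of germs on triples of tuples that are mutually close.
Prepending a vertex contracts each direction, so both coaugmentations are quasi-isomorphisms
(`SU.ezCol_qi`, `SU.ezRow_qi`), and this gives the Eilenberg-Zilber isomorphism `SU.ez`. Closeness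
is a condition on pairs of points, so inverses of relations are needed but compositions are not.

Algebra. For a complex `C` and a complex `F` of flat modules over a principal ideal domain, the
torsion product is the kernel of `H(C) ⊗ B(F) → H(C) ⊗ Z(F)` (`FlatPres.torMap_injective`,
`FlatPres.mem_range_torMap`), and projecting the second factor to coboundaries defines the torsion
map. Exactness is `kα_injective`, `kβ_kα`, `exists_kα`, `kβ_surjective`. For the splitting
(`exists_section`), two-term complexes with the cohomology of `C`, respectively `F`, in one degree
are mapped to `C` and `F`; for them the torsion map is bijective, and its inverse is pushed forward.

Flatness. Germs with values in `G'` need not be flat. They are replaced by the mapping cone of germs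
in the relations mapping to germs in the free module of the canonical presentation of `G'`
(`SFilt.flatCx`). This is functorial, consists of torsion-free hence flat modules, and computes the
cohomology shifted by one; this is the source of every `n + 1` in the assembly.

Finiteness. It remains to see that the cross product `SFilt.Θ` from the tensor product to the
shifted germs on pairs is a quasi-isomorphism (`Θ_qi`). For one relation with finite-type homology,
the identity of the free chain complex is homotopic to a map through finite free modules, so
cochains commute with tensor products up to quasi-isomorphism (`level_isTame`). The condition
`Tor_1(G, G') = 0` keeps the presentation of `G'` exact after tensoring with `G`. If only the second
relation has finite type, finite generation of `G'` makes germs on the first factor commute with `⊗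
G'` (`germR_bijective_of_finite`). The limit is reached by `Cx.QI.of_approx`: any given lifting
problem involves finitely many equations of germs, which hold at all sufficiently small relations.

No natural splitting. Take `Y` a point, `G = ℤ`, `G' = ℤ/2`. In degree one the tensor term of a
projective plane vanishes, and the torsion term of a circle vanishes. A natural splitting would then
make the restriction `H^1(plane; ℤ/2) → H^1(circle; ℤ/2)` zero for every embedded circle, but it is
nonzero for the circle round which the boundary of the disc is wrapped twice. -/

noncomputable section

namespace VietorisRips

/-! ### Cochain complexes and quasi-isomorphisms, in elements -/

section Complexes

variable {R : Type u} [CommRing R]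

/-- A cochain complex of `R`-modules indexed by `ℕ`. -/
structure Cx (R : Type u) [CommRing R] where
  X : ℕ → Type u
  [grp : ∀ n, AddCommGroup (X n)]
  [mod : ∀ n, Module R (X n)]
  d : ∀ n, X n →ₗ[R] X (n + 1)
  dd : ∀ n x, d (n + 1) (d n x) = 0

attribute [instance] Cx.grp Cx.mod

namespace Cx

/-- A morphism of cochain complexes. -/
structure Hom (K L : Cx R) where
  f : ∀ n, K.X n →ₗ[R] L.X n
  comm : ∀ n x, f (n + 1) (K.d n x) = L.d n (f n x)

/-- Composition of morphisms. -/
def Hom.comp {K L M : Cx R} (g : Hom L M) (f : Hom K L) : Hom K M where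
  f n := g.f n ∘ₗ f.f n
  comm n x := by simp [f.comm, g.comm]

variable (K L M : Cx R)

/-- The coboundaries. -/
def B : ∀ n, Submodule R (K.X n)
  | 0 => ⊥
  | n + 1 => LinearMap.range (K.d n)

/-- The cocycles. -/
def Z (n : ℕ) : Submodule R (K.X n) := LinearMap.ker (K.d n)

variable {K L M}

theorem mem_Z {n : ℕ} {x : K.X n} : x ∈ K.Z n ↔ K.d n x = 0 := Iff.rfl

theorem B_le_Z (n : ℕ) : K.B n ≤ K.Z n := by
  cases n with
  | zero => exact bot_le
  | succ n => rintro _ ⟨y, rfl⟩; exact K.dd n y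

theorem d_of_mem_B {n : ℕ} {x : K.X n} (h : x ∈ K.B n) : K.d n x = 0 := B_le_Z n h

theorem d_mem_B {n : ℕ} (x : K.X n) : K.d n x ∈ K.B (n + 1) := ⟨x, rfl⟩

theorem Hom.map_B (f : Hom K L) {n : ℕ} {x : K.X n} (h : x ∈ K.B n) : f.f n x ∈ L.B n := by
  cases n with
  | zero =>
    have h' : x = 0 := h
    rw [h', map_zero]; exact zero_mem _
  | succ n =>
    obtain ⟨y, rfl⟩ := h
    exact ⟨f.f n y, (f.comm n y).symm⟩

theorem Hom.map_Z (f : Hom K L) {n : ℕ} {x : K.X n} (h : x ∈ K.Z n) : f.f n x ∈ L.Z n := by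
  rw [mem_Z] at *
  rw [← f.comm, h, map_zero]

variable (K) in
/-- The cohomology. -/
abbrev H (n : ℕ) : Type u := K.Z n ⧸ (K.B n).submoduleOf (K.Z n)

variable (K) in
/-- The class of a cocycle. -/
def cls (n : ℕ) : K.Z n →ₗ[R] K.H n := Submodule.mkQ _

theorem cls_surjective (n : ℕ) : Function.Surjective (K.cls n) := Submodule.mkQ_surjective _

theorem cls_eq_zero {n : ℕ} {z : K.Z n} : K.cls n z = 0 ↔ (z : K.X n) ∈ K.B n :=
  Submodule.Quotient.mk_eq_zero _

theorem cls_eq_cls {n : ℕ} {z w : K.Z n} : K.cls n z = K.cls n w ↔ (z - w : K.X n) ∈ K.B n := by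
  rw [← sub_eq_zero, ← map_sub, cls_eq_zero]; rfl

/-- The map on cocycles. -/
def Hom.mapZ (f : Hom K L) (n : ℕ) : K.Z n →ₗ[R] L.Z n :=
  (f.f n).restrict fun _ h => f.map_Z h

@[simp] theorem Hom.mapZ_coe (f : Hom K L) (n : ℕ) (z : K.Z n) :
    (f.mapZ n z : L.X n) = f.f n z := rfl

/-- The map on cohomology. -/
def Hom.mapH (f : Hom K L) (n : ℕ) : K.H n →ₗ[R] L.H n :=
  Submodule.mapQ _ _ (f.mapZ n) fun _ h => f.map_B h

@[simp] theorem Hom.mapH_cls (f : Hom K L) (n : ℕ) (z : K.Z n) :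
    f.mapH n (K.cls n z) = L.cls n (f.mapZ n z) := rfl

theorem Hom.mapH_comp (g : Hom L M) (f : Hom K L) (n : ℕ) :
    (g.comp f).mapH n = g.mapH n ∘ₗ f.mapH n := by
  apply LinearMap.ext
  intro x
  obtain ⟨z, rfl⟩ := cls_surjective n x
  rfl

theorem Hom.ext' {f g : Hom K L} (h : ∀ n x, f.f n x = g.f n x) : f = g := by
  cases f; cases g
  congr
  funext n
  exact LinearMap.ext (h n)

/-- Quasi-isomorphisms. -/
def QI (f : Hom K L) : Prop := ∀ n, Function.Bijective (f.mapH n)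

theorem qi_iff {f : Hom K L} : QI f ↔ ∀ n,
    (∀ a ∈ K.Z n, f.f n a ∈ L.B n → a ∈ K.B n) ∧
      ∀ b ∈ L.Z n, ∃ a ∈ K.Z n, b - f.f n a ∈ L.B n := by
  refine forall_congr' fun n => and_congr ?_ ?_
  · rw [injective_iff_map_eq_zero]
    constructor
    · intro h a ha hf
      exact cls_eq_zero.1 (h (K.cls n ⟨a, ha⟩) (cls_eq_zero.2 hf))
    · intro h x hx
      obtain ⟨z, rfl⟩ := cls_surjective n x
      exact cls_eq_zero.2 (h z.1 z.2 (cls_eq_zero.1 hx))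
  · constructor
    · intro h b hb
      obtain ⟨x, hx⟩ := h (L.cls n ⟨b, hb⟩)
      obtain ⟨z, rfl⟩ := cls_surjective n x
      exact ⟨z.1, z.2, cls_eq_cls.1 hx.symm⟩
    · intro h y
      obtain ⟨z, rfl⟩ := cls_surjective n y
      obtain ⟨a, ha, hb⟩ := h z.1 z.2
      exact ⟨K.cls n ⟨a, ha⟩, (cls_eq_cls.2 hb).symm⟩

/-- This is acyclicity of the mapping cone: the cone cocycle `(a', b)` bounds. Injectivity in degree
`n + 1` and surjectivity in degree `n` are delivered by one lifting problem, and this is the form in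
which quasi-isomorphisms are used and constructed throughout. -/
theorem QI.cone {f : Hom K L} (hf : QI f) {n : ℕ} {b : L.X n} {a' : K.X (n + 1)}
    (ha' : K.d _ a' = 0) (hb : L.d n b = f.f _ a') :
    ∃ a, K.d n a = a' ∧ b - f.f n a ∈ L.B n := by
  rw [qi_iff] at hf
  obtain ⟨a₀, ha₀⟩ := (hf (n + 1)).1 a' ha' ⟨b, hb⟩
  have hz : b - f.f n a₀ ∈ L.Z n := by
    rw [mem_Z, map_sub, hb, ← ha₀, f.comm, sub_self]
  obtain ⟨a₁, ha₁, h⟩ := (hf n).2 _ hz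
  refine ⟨a₀ + a₁, ?_, ?_⟩
  · rw [map_add, ha₀, mem_Z.1 ha₁, add_zero]
  · rw [map_add, ← sub_sub]; exact h

theorem QI.eq_zero {f : Hom K L} (hf : QI f) {a : K.X 0} (h : K.d 0 a = 0) (h' : f.f 0 a = 0) :
    a = 0 :=
  (qi_iff.1 hf 0).1 a h (by rw [h']; exact zero_mem _)

/-- The cone problem in degree `n` yields injectivity only in degree `n + 1`; injectivity in degree
`0` has to be supplied separately as `h₀`. -/
theorem QI.of_cone {f : Hom K L} (h₀ : ∀ a : K.X 0, K.d 0 a = 0 → f.f 0 a = 0 → a = 0)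
    (h : ∀ n (b : L.X n) (a' : K.X (n + 1)), K.d _ a' = 0 → L.d n b = f.f _ a' →
      ∃ a, K.d n a = a' ∧ b - f.f n a ∈ L.B n) : QI f := by
  rw [qi_iff]
  intro n
  constructor
  · intro a ha hf
    cases n with
    | zero => exact h₀ a ha hf
    | succ n =>
      obtain ⟨b, hb⟩ := hf
      obtain ⟨a₀, h1, -⟩ := h n b a ha hb
      exact ⟨a₀, h1⟩
  · intro b hb
    obtain ⟨a, h1, h2⟩ := h n b 0 (map_zero _) (by rw [map_zero]; exact hb)
    exact ⟨a, h1, h2⟩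

theorem QI.comp {g : Hom L M} {f : Hom K L} (hg : QI g) (hf : QI f) : QI (g.comp f) := by
  intro n
  rw [Hom.mapH_comp]
  exact (hg n).comp (hf n)

theorem QI.of_bijective {f : Hom K L} (h : ∀ n, Function.Bijective (f.f n)) : QI f := by
  refine QI.of_cone (fun a _ h' => (h 0).1 (by rw [h', map_zero])) fun n b a' _ hb => ?_
  obtain ⟨a, rfl⟩ := (h n).2 b
  exact ⟨a, (h _).1 (by rw [f.comm, hb]), by rw [sub_self]; exact zero_mem _⟩

/-- A morphism compatible with exhaustive finite filtrations is a quasi-isomorphism when it is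
one on the graded pieces. -/
theorem QI.of_filtration {f : Hom K L} (FK : ∀ n, ℕ → Submodule R (K.X n))
    (FL : ∀ n, ℕ → Submodule R (L.X n)) (K0 : ∀ n x, x ∈ FK n 0) (L0 : ∀ n x, x ∈ FL n 0)
    (Kt : ∀ n k, n < k → ∀ x ∈ FK n k, x = 0) (Lt : ∀ n k, n < k → ∀ x ∈ FL n k, x = 0)
        (inj : ∀ a : K.X 0, K.d 0 a = 0 → f.f 0 a = 0 → a = 0)
    (step : ∀ n k, k ≤ n + 1 → ∀ b ∈ FL n k, ∀ a' ∈ FK (n + 1) k, K.d _ a' = 0 →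
      L.d n b = f.f _ a' → ∃ a ∈ FK n k, ∃ b' ∈ L.B n,
        a' - K.d n a ∈ FK (n + 1) (k + 1) ∧ b - f.f n a - b' ∈ FL n (k + 1)) : QI f := by
  refine QI.of_cone inj ?_
  intro n
  -- Induction on the number `j` of filtration steps that remain before `k = n + 2`, where both `b`
  -- (degree `n`) and `a'` (degree `n + 1`) are zero. Each step solves the problem modulo the next
  -- filtration step.
  suffices h : ∀ j k, k + j = n + 2 → ∀ b ∈ FL n k, ∀ a' ∈ FK (n + 1) k, K.d _ a' = 0 →
      L.d n b = f.f _ a' → ∃ a, K.d n a = a' ∧ b - f.f n a ∈ L.B n from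
    fun b a' => h (n + 2) 0 (by omega) b (L0 _ _) a' (K0 _ _)
  intro j
  induction j with
  | zero =>
    intro k hk b hb a' ha' _ _
    rw [Kt _ _ (by omega) a' ha', Lt _ _ (by omega) b hb]
    exact ⟨0, map_zero _, by simp⟩
  | succ j ih =>
    intro k hk b hb a' ha' hda hdb
    obtain ⟨a, ha, b', hb', h1, h2⟩ := step n k (by omega) b hb a' ha' hda hdb
    obtain ⟨a₁, h3, h4⟩ := ih (k + 1) (by omega) _ h2 _ h1
      (by rw [map_sub, hda, K.dd, sub_zero])
      (by rw [map_sub, map_sub, hdb, d_of_mem_B hb', sub_zero, map_sub, f.comm])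
    refine ⟨a + a₁, by rw [map_add, h3]; abel, ?_⟩
    have h5 : b - f.f n (a + a₁) = (b - f.f n a - b' - f.f n a₁) + b' := by rw [map_add]; abel
    rw [h5]
    exact add_mem h4 hb'

end Cx

/-! ### Double complexes and their total complexes -/

/-- A first quadrant double complex of `R`-modules with commuting differentials. -/
structure DCx (R : Type u) [CommRing R] where
  X : ℕ → ℕ → Type u
  [grp : ∀ p q, AddCommGroup (X p q)]
  [mod : ∀ p q, Module R (X p q)]
  h : ∀ p q, X p q →ₗ[R] X (p + 1) q
  v : ∀ p q, X p q →ₗ[R] X p (q + 1)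
  hh : ∀ p q x, h (p + 1) q (h p q x) = 0
  vv : ∀ p q x, v p (q + 1) (v p q x) = 0
  hv : ∀ p q x, h p (q + 1) (v p q x) = v (p + 1) q (h p q x)

attribute [instance] DCx.grp DCx.mod

namespace DCx

/-- A morphism of double complexes. -/
structure Hom (A A' : DCx R) where
  f : ∀ p q, A.X p q →ₗ[R] A'.X p q
  comm_h : ∀ p q x, f (p + 1) q (A.h p q x) = A'.h p q (f p q x)
  comm_v : ∀ p q x, f p (q + 1) (A.v p q x) = A'.v p q (f p q x)

variable (A A' : DCx R)

/-- The column of index `p`. -/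
abbrev col (p : ℕ) : Cx R := ⟨A.X p, A.v p, A.vv p⟩

/-- The row of index `q`. -/
abbrev row (q : ℕ) : Cx R := ⟨fun p => A.X p q, fun p => A.h p q, fun p => A.hh p q⟩

/-- Exchange of the two directions. -/
abbrev swap : DCx R where
  X p q := A.X q p
  h p q := A.v q p
  v p q := A.h q p
  hh p q := A.vv q p
  vv p q := A.hh q p
  hv p q x := (A.hv q p x).symm

variable {A A'}

/-- The restriction of a morphism to a column. -/
def Hom.col (f : Hom A A') (p : ℕ) : Cx.Hom (A.col p) (A'.col p) := ⟨f.f p, f.comm_v p⟩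

/-- The restriction of a morphism to a row. -/
def Hom.row (f : Hom A A') (q : ℕ) : Cx.Hom (A.row q) (A'.row q) :=
  ⟨fun p => f.f p q, fun p => f.comm_h p q⟩

/-- Exchange of the two directions. -/
def Hom.swap (f : Hom A A') : Hom A.swap A'.swap :=
  ⟨fun p q => f.f q p, fun p q => f.comm_v q p, fun p q => f.comm_h q p⟩

/-- Composition of morphisms. -/
def Hom.comp {A'' : DCx R} (g : Hom A' A'') (f : Hom A A') : Hom A A'' where
  f p q := g.f p q ∘ₗ f.f p q
  comm_h p q x := by simp [f.comm_h, g.comm_h]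
  comm_v p q x := by simp [f.comm_v, g.comm_v]

variable (A)

/-- The module of total degree `n`. -/
abbrev totX (n : ℕ) : Type u := ∀ s : {s : ℕ × ℕ // s.1 + s.2 = n}, A.X s.1.1 s.1.2

/-- The component of index `(p, q)`. -/
def pr {n : ℕ} (p q : ℕ) (e : p + q = n) : A.totX n →ₗ[R] A.X p q :=
  LinearMap.proj (⟨(p, q), e⟩ : {s : ℕ × ℕ // s.1 + s.2 = n})

/-- The horizontal part of the total differential. -/
def hPart {n : ℕ} : ∀ p q : ℕ, p + q = n + 1 → (A.totX n →ₗ[R] A.X p q)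
  | 0, _, _ => 0
  | p + 1, q, e => A.h p q ∘ₗ A.pr p q (by omega)

/-- The vertical part of the total differential, without sign. -/
def vPart {n : ℕ} : ∀ p q : ℕ, p + q = n + 1 → (A.totX n →ₗ[R] A.X p q)
  | _, 0, _ => 0
  | p, q + 1, e => A.v p q ∘ₗ A.pr p q (by omega)

/-- The total differential. -/
def D (n : ℕ) : A.totX n →ₗ[R] A.totX (n + 1) :=
  LinearMap.pi fun s => A.hPart s.1.1 s.1.2 s.2 + (-1 : R) ^ s.1.1 • A.vPart s.1.1 s.1.2 s.2

theorem pr_D {n : ℕ} (p q : ℕ) (e : p + q = n + 1) (x : A.totX n) :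
    A.pr p q e (A.D n x) = A.hPart p q e x + (-1 : R) ^ p • A.vPart p q e x := rfl

variable {A} in
theorem totX_ext {n : ℕ} {x y : A.totX n} (h : ∀ p q e, A.pr p q e x = A.pr p q e y) : x = y := by
  funext ⟨⟨p, q⟩, e⟩
  exact h p q e

@[simp] theorem hPart_zero {n : ℕ} (q : ℕ) (e : 0 + q = n + 1) (x : A.totX n) :
    A.hPart 0 q e x = 0 := rfl

@[simp] theorem hPart_succ {n : ℕ} (p q : ℕ) (e : p + 1 + q = n + 1) (x : A.totX n) :
    A.hPart (p + 1) q e x = A.h p q (A.pr p q (by omega) x) := rfl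

@[simp] theorem vPart_zero {n : ℕ} (p : ℕ) (e : p + 0 = n + 1) (x : A.totX n) :
    A.vPart p 0 e x = 0 := by cases p <;> rfl

@[simp] theorem vPart_succ {n : ℕ} (p q : ℕ) (e : p + (q + 1) = n + 1) (x : A.totX n) :
    A.vPart p (q + 1) e x = A.v p q (A.pr p q (by omega) x) := by cases p <;> rfl

/-- The total complex. -/
abbrev tot : Cx R where
  X n := A.totX n
  d n := A.D n
  dd n x := by
    apply totX_ext
    intro p q e
    rw [pr_D, map_zero]
    rcases p with _ | _ | p <;> rcases q with _ | _ | q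
    all_goals first
      | omega
      | simp [pr_D, A.hh, A.vv, A.hv, pow_succ]

variable {A}

/-- The morphism of total complexes. -/
def Hom.tot (f : Hom A A') : Cx.Hom A.tot A'.tot where
  f n := LinearMap.pi fun s => f.f s.1.1 s.1.2 ∘ₗ LinearMap.proj s
  comm n x := by
    apply totX_ext
    intro p q e
    change f.f p q (A.pr p q e (A.D n x)) = A'.pr p q e (A'.D n _)
    rw [pr_D, pr_D, map_add, map_smul]
    congr 1
    · cases p with
      | zero => simp
      | succ p => rw [hPart_succ, f.comm_h, hPart_succ]; rfl
    · cases q with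
      | zero => simp
      | succ q => rw [vPart_succ, f.comm_v, vPart_succ]; rfl

@[simp] theorem Hom.pr_tot (f : Hom A A') {n p q : ℕ} (e : p + q = n) (x : A.totX n) :
    A'.pr p q e (f.tot.f n x) = f.f p q (A.pr p q e x) := rfl

variable (A) in
/-- The inclusion of the entry of index `(p, q)`. -/
def inc {n : ℕ} (p q : ℕ) (e : p + q = n) : A.X p q →ₗ[R] A.totX n :=
  LinearMap.single R (fun s : {s : ℕ × ℕ // s.1 + s.2 = n} => A.X s.1.1 s.1.2) ⟨(p, q), e⟩

@[simp] theorem pr_inc_same {n p q : ℕ} (e e' : p + q = n) (x : A.X p q) :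
    A.pr p q e (A.inc p q e' x) = x := by simp [pr, inc]

theorem pr_inc_of_ne {n p q p' q' : ℕ} (e : p + q = n) (e' : p' + q' = n) (h : p ≠ p')
    (x : A.X p' q') : A.pr p q e (A.inc p' q' e' x) = 0 := by
  simp only [pr, inc, LinearMap.proj_apply, LinearMap.single_apply]
  rw [Pi.single_eq_of_ne]
  intro h'
  exact h (congrArg (fun s => s.1.1) h')

theorem D_inc {n p q : ℕ} (e : p + q = n) (x : A.X p q) :
    A.D n (A.inc p q e x) = A.inc (p + 1) q (by omega) (A.h p q x) +
      (-1 : R) ^ p • A.inc p (q + 1) (by omega) (A.v p q x) := by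
  apply totX_ext
  intro p' q' e'
  rw [pr_D, map_add, map_smul]
  congr 1
  · cases p' with
    | zero => rw [hPart_zero, pr_inc_of_ne _ _ (by omega)]
    | succ p' =>
      rw [hPart_succ]
      by_cases hp : p' = p
      · subst hp
        obtain rfl : q' = q := by omega
        rw [pr_inc_same, pr_inc_same]
      · rw [pr_inc_of_ne _ _ hp, pr_inc_of_ne _ _ (by omega), map_zero]
  · by_cases hp : p' = p
    · subst hp
      obtain rfl : q' = q + 1 := by omega
      rw [vPart_succ, pr_inc_same, pr_inc_same]
    · rw [pr_inc_of_ne _ _ hp]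
      cases q' with
      | zero => simp
      | succ q' => rw [vPart_succ, pr_inc_of_ne _ _ hp, map_zero, smul_zero, smul_zero]

theorem hom_tot_inc (f : Hom A A') {n p q : ℕ} (e : p + q = n) (x : A.X p q) :
    f.tot.f n (A.inc p q e x) = A'.inc p q e (f.f p q x) := by
  apply totX_ext
  intro p' q' e'
  rw [Hom.pr_tot]
  by_cases hp : p' = p
  · subst hp
    obtain rfl : q' = q := by omega
    rw [pr_inc_same, pr_inc_same]
  · rw [pr_inc_of_ne _ _ hp, pr_inc_of_ne _ _ hp, map_zero]

variable (A) in
/-- The elements with vanishing entries of horizontal degree less than `k`. -/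
def supp (n k : ℕ) : Submodule R (A.totX n) where
  carrier := {x | ∀ p q e, p < k → A.pr p q e x = 0}
  add_mem' hx hy p q e hp := by rw [map_add, hx p q e hp, hy p q e hp, add_zero]
  zero_mem' p q e _ := map_zero _
  smul_mem' c x hx p q e hp := by rw [map_smul, hx p q e hp, smul_zero]

theorem supp_zero (n : ℕ) (x : A.totX n) : x ∈ A.supp n 0 := fun _ _ _ h => absurd h (by omega)

theorem eq_zero_of_mem_supp {n k : ℕ} (hk : n < k) {x : A.totX n} (hx : x ∈ A.supp n k) :
    x = 0 := by
  apply totX_ext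
  intro p q e
  rw [hx p q e (by omega), map_zero]

theorem hPart_eq_zero {n k : ℕ} {x : A.totX n} (hx : x ∈ A.supp n k) {p q : ℕ}
    (e : p + q = n + 1) (hp : p < k + 1) : A.hPart p q e x = 0 := by
  cases p with
  | zero => rfl
  | succ p => rw [hPart_succ, hx p q (by omega) (by omega), map_zero]

theorem D_mem_supp {n k : ℕ} {x : A.totX n} (hx : x ∈ A.supp n k) : A.D n x ∈ A.supp (n + 1) k := by
  intro p q e hp
  rw [pr_D, hPart_eq_zero hx e (by omega), zero_add]
  cases q with
  | zero => simp
  | succ q => rw [vPart_succ, hx p q (by omega) hp, map_zero, smul_zero]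

theorem inc_mem_supp {n p q : ℕ} (e : p + q = n) (x : A.X p q) : A.inc p q e x ∈ A.supp n p :=
  fun _ _ e' hp => pr_inc_of_ne e' e (by omega) x

theorem mem_supp_succ {n k m : ℕ} {x : A.totX n} (hx : x ∈ A.supp n k) (e : k + m = n)
    (h : A.pr k m e x = 0) : x ∈ A.supp n (k + 1) := by
  intro p q e' hp
  by_cases hpk : p = k
  · subst hpk
    obtain rfl : q = m := by omega
    exact h
  · exact hx p q e' (by omega)

theorem smul_sign_eq_zero {N : Type*} [AddCommGroup N] [Module R N] {p : ℕ} {x : N}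
    (h : (-1 : R) ^ p • x = 0) : x = 0 := by
  rcases neg_one_pow_eq_or R p with h' | h' <;> rw [h'] at h <;> simpa using h

theorem sign_sign {N : Type*} [AddCommGroup N] [Module R N] (p : ℕ) (x : N) :
    (-1 : R) ^ p • (-1 : R) ^ p • x = x := by
  rw [smul_smul, ← mul_pow]; simp

/-- A vertical coboundary `v y` is an entry of the total coboundary of `±y`. The only other entry,
`h y`, lies one column further to the right, so nothing to the left of column `p` is disturbed. -/
theorem inc_mem_B {n p q : ℕ} (e : p + q = n) {x : A.X p q} (hx : x ∈ (A.col p).B q) :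
    ∃ b ∈ A.tot.B n, A.pr p q e b = x ∧ b ∈ A.supp n p := by
  cases q with
  | zero =>
    have hx' : x = 0 := hx
    exact ⟨0, zero_mem _, by rw [hx', map_zero], zero_mem _⟩
  | succ q =>
    obtain ⟨y, rfl⟩ := hx
    obtain rfl : n = p + q + 1 := by omega
    refine ⟨A.D _ (A.inc p q rfl ((-1 : R) ^ p • y)), Cx.d_mem_B (K := A.tot) _, ?_,
      D_mem_supp (inc_mem_supp _ _)⟩
    rw [D_inc, map_add, pr_inc_of_ne _ _ (by omega), map_smul (A.v p q), map_smul (A.inc _ _ _),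
      sign_sign, pr_inc_same, zero_add]

/-- A morphism of double complexes that is a quasi-isomorphism on each column is one on the total
complexes. -/
theorem Hom.tot_qi_of_col (f : Hom A A') (hf : ∀ p, Cx.QI (f.col p)) : Cx.QI f.tot := by
  -- Filtration by columns. At step `k` the cone problem in column `k` is solved, and the error is
  -- pushed into the columns to the right.
  refine Cx.QI.of_filtration (fun n k => A.supp n k) (fun n k => A'.supp n k)
    (fun n => supp_zero n) (fun n => supp_zero n) (fun n k h x => eq_zero_of_mem_supp h)
    (fun n k h x => eq_zero_of_mem_supp h) ?_ ?_
  · intro a ha hfa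
    apply totX_ext
    intro p q e
    obtain ⟨rfl, rfl⟩ : p = 0 ∧ q = 0 := by omega
    rw [map_zero]
    refine (hf 0).eq_zero (a := A.pr 0 0 e a) ?_ ?_
    · have := congrArg (A.pr 0 1 rfl) ha
      change A.pr 0 1 rfl (A.D 0 a) = _ at this
      rw [pr_D, map_zero] at this
      simpa using this
    · exact congrArg (A'.pr 0 0 e) hfa
  · intro n k hk b hb a' ha' hda hdb
    obtain ⟨m, hm⟩ : ∃ m, k + m = n + 1 := ⟨n + 1 - k, by omega⟩
    have h1 : A.v k m (A.pr k m hm a') = 0 := by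
      have := congrArg (A.pr k (m + 1) (by omega)) hda
      change A.pr k (m + 1) (by omega) (A.D _ a') = _ at this
      rw [pr_D, map_zero, hPart_eq_zero ha' _ (by omega), zero_add, vPart_succ] at this
      exact smul_sign_eq_zero this
    -- For `m = 0` one has `k = n + 1`, so `b` has no entries left and only injectivity of column
    -- `k` in degree `0` is needed.
    cases m with
    | zero =>
      have hb0 : b = 0 := eq_zero_of_mem_supp (by omega) hb
      refine ⟨0, zero_mem _, 0, zero_mem _, ?_, ?_⟩
      · rw [map_zero, sub_zero]
        refine mem_supp_succ ha' hm ((hf k).eq_zero h1 ?_)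
        have := congrArg (A'.pr k 0 hm) hdb
        rw [hb0, map_zero, map_zero] at this
        exact this.symm
      · rw [hb0]; simp
    | succ m =>
      have hkm : k + m = n := by omega
      -- On column `k` the total differential is `(-1) ^ k • v`, so the problem for the column is
      -- posed with `b` rescaled by this sign.
      have h2 : A'.v k m ((-1 : R) ^ k • A'.pr k m hkm b) = f.f k (m + 1) (A.pr k (m + 1) hm a') := by
        have := congrArg (A'.pr k (m + 1) hm) hdb
        change A'.pr k (m + 1) hm (A'.D _ b) = _ at this
        rw [pr_D, hPart_eq_zero hb _ (by omega), zero_add, vPart_succ] at this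
        rw [map_smul, this]; rfl
      obtain ⟨a, ha, hB⟩ := (hf k).cone h1 h2
      have hB' : A'.pr k m hkm b - f.f k m ((-1 : R) ^ k • a) ∈ (A'.col k).B m := by
        have := Submodule.smul_mem _ ((-1 : R) ^ k) hB
        rw [smul_sub, sign_sign] at this
        rw [map_smul]
        exact this
      obtain ⟨b', hb', h3, h4⟩ := inc_mem_B hkm hB'
      refine ⟨A.inc k m hkm ((-1 : R) ^ k • a), inc_mem_supp _ _, b', hb', ?_, ?_⟩
      · refine mem_supp_succ (sub_mem ha' (D_mem_supp (inc_mem_supp _ _))) hm ?_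
        change A.pr k (m + 1) hm (a' - A.D n _) = 0
        rw [map_sub, D_inc, map_add, pr_inc_of_ne _ _ (by omega), zero_add, map_smul (A.v k m),
          map_smul (A.inc _ _ _), sign_sign, pr_inc_same, sub_eq_zero]
        exact ha.symm
      · have h5 : f.tot.f n (A.inc k m hkm ((-1 : R) ^ k • a)) ∈ A'.supp n k := by
          rw [hom_tot_inc]; exact inc_mem_supp _ _
        refine mem_supp_succ (sub_mem (sub_mem hb h5) h4) hkm ?_
        rw [map_sub, map_sub, h3, Hom.pr_tot, pr_inc_same, sub_self]

/-- The total complex of the exchanged double complex. -/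
def swapTot (A : DCx R) : Cx.Hom A.swap.tot A.tot where
  -- The sign `(-1) ^ (p * q)` converts the convention that puts signs on one direction into the
  -- convention that puts them on the other.
  f n := LinearMap.pi fun s => (-1 : R) ^ (s.1.1 * s.1.2) •
    A.swap.pr s.1.2 s.1.1 (by rw [add_comm]; exact s.2)
  comm n x := by
    apply totX_ext
    intro p q e
    change (-1 : R) ^ (p * q) • A.swap.pr q p (by omega) (A.swap.D n x) = A.pr p q e (A.D n _)
    rw [pr_D, pr_D, smul_add, add_comm]
    congr 1
    · cases p with
      | zero => rw [hPart_zero, vPart_zero, smul_zero, smul_zero]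
      | succ p =>
        rw [hPart_succ, vPart_succ, smul_smul]
        change _ = A.h p q ((-1 : R) ^ (p * q) • _)
        rw [map_smul, ← pow_add]
        have : (-1 : R) ^ ((p + 1) * q + q) = (-1 : R) ^ (p * q) := by
          rw [show (p + 1) * q + q = p * q + 2 * q by ring, pow_add, pow_mul _ 2 q]; simp
        rw [this]
    · cases q with
      | zero => rw [hPart_zero, vPart_zero, smul_zero, smul_zero]
      | succ q =>
        rw [hPart_succ, vPart_succ]
        change _ = (-1 : R) ^ p • A.v p q ((-1 : R) ^ (p * q) • _)
        rw [map_smul, smul_smul, ← pow_add]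
        have : (-1 : R) ^ (p * (q + 1)) = (-1 : R) ^ (p + p * q) := by
          congr 1; ring
        rw [this]

theorem swapTot_bijective (A : DCx R) (n : ℕ) : Function.Bijective ((swapTot A).f n) := by
  constructor
  · rw [injective_iff_map_eq_zero]
    intro x hx
    apply totX_ext
    intro p q e
    have := congrArg (A.pr q p (by omega)) hx
    rw [map_zero] at this ⊢
    exact smul_sign_eq_zero this
  · intro y
    refine ⟨fun s => (-1 : R) ^ (s.1.2 * s.1.1) • A.pr s.1.2 s.1.1 (by rw [add_comm]; exact s.2) y,
      ?_⟩
    apply totX_ext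
    intro p q e
    exact sign_sign _ _

/-- A morphism of double complexes that is a quasi-isomorphism on each row is one on the total
complexes. -/
theorem Hom.tot_qi_of_row (f : Hom A A') (hf : ∀ q, Cx.QI (f.row q)) : Cx.QI f.tot := by
  have h1 : Cx.QI f.swap.tot := Hom.tot_qi_of_col f.swap hf
  have h2 : Cx.QI (A'.swapTot.comp f.swap.tot) :=
    (Cx.QI.of_bijective (swapTot_bijective A')).comp h1
  have h3 : A'.swapTot.comp f.swap.tot = f.tot.comp A.swapTot := by
    refine Cx.Hom.ext' fun n x => ?_
    apply totX_ext
    intro p q e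
    change (-1 : R) ^ (p * q) • f.f p q (A.swap.pr q p _ x) = f.f p q ((-1 : R) ^ (p * q) • _)
    rw [map_smul]
  rw [h3] at h2
  intro n
  have := h2 n
  rw [Cx.Hom.mapH_comp] at this
  exact (Function.Bijective.of_comp_iff _ (Cx.QI.of_bijective (swapTot_bijective A) n)).1 this

/-! ### Coaugmented double complexes -/

/-- A coaugmentation of a double complex along the columns. -/
structure ColAug (K : Cx R) (V : DCx R) where
  ε : ∀ n, K.X n →ₗ[R] V.X n 0
  comm : ∀ n x, ε (n + 1) (K.d n x) = V.h n 0 (ε n x)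
  v_ε : ∀ n x, V.v n 0 (ε n x) = 0

namespace ColAug

variable {K : Cx R} {V : DCx R}

/-- The map to the total complex. -/
def hom (a : ColAug K V) : Cx.Hom K V.tot where
  f n := V.inc n 0 rfl ∘ₗ a.ε n
  comm n x := by
    change V.inc (n + 1) 0 rfl (a.ε (n + 1) (K.d n x)) = V.D n (V.inc n 0 rfl (a.ε n x))
    rw [D_inc, a.v_ε, map_zero, smul_zero, a.comm]
    exact (add_zero _).symm

/-- If the coaugmented columns are exact, the map to the total complex is a quasi-isomorphism. -/
theorem qi (a : ColAug K V) (inj : ∀ n, Function.Injective (a.ε n))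
    (ex₀ : ∀ n x, V.v n 0 x = 0 → ∃ y, a.ε n y = x)
    (ex : ∀ n m x, V.v n (m + 1) x = 0 → ∃ y, V.v n m y = x) : Cx.QI a.hom := by
  have hpr : ∀ n (x : K.X n) (e), V.pr n 0 e (a.hom.f n x) = a.ε n x :=
    fun n x e => pr_inc_same _ _ _
  -- An element of `K` in degree `n` is placed in column `n`, row `0`: steps `k ≤ n` of its
  -- filtration are everything, later ones are zero.
  refine Cx.QI.of_filtration (fun n k => {
      carrier := {x | n < k → x = 0}
      add_mem' := fun {x y : K.X n} hx hy h => by rw [hx h, hy h, add_zero]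
      zero_mem' := fun _ => rfl
      smul_mem' := fun c x hx h => by rw [hx h, smul_zero] }) (fun n k => V.supp n k)
    (fun n x h => absurd h (by omega)) (fun n => supp_zero n) (fun n k h x hx => hx h)
    (fun n k h x => eq_zero_of_mem_supp h) ?_ ?_
  · intro x _ hx
    apply inj 0
    rw [← hpr 0 x rfl, hx, map_zero, map_zero]
  · intro n k hk b hb a' ha' hda hdb
    obtain ⟨m, hm⟩ : ∃ m, k + m = n + 1 := ⟨n + 1 - k, by omega⟩
    -- Column `k` meets degree `n` in row `m - 1`. For `m = 0` nothing is left; `m = 1` is the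
    -- bottom row, where `ex₀` lifts the entry to `K`; for larger `m` the entry is a vertical
    -- coboundary by `ex`.
    rcases m with _ | _ | m
    · have hb0 : b = 0 := eq_zero_of_mem_supp (by omega) hb
      have ha0 : a' = 0 := by
        apply inj
        rw [← hpr _ a' rfl, ← hdb, hb0, map_zero, map_zero, map_zero]
      refine ⟨0, zero_mem _, 0, zero_mem _, ?_, ?_⟩
      · rw [ha0]; simp
      · rw [hb0]; simp
    · obtain rfl : k = n := by omega
      have h1 : V.v k 0 (V.pr k 0 rfl b) = 0 := by
        have := congrArg (V.pr k 1 rfl) hdb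
        change V.pr k 1 rfl (V.D _ b) = V.pr k 1 rfl (V.inc (k + 1) 0 rfl _) at this
        rw [pr_D, hPart_eq_zero hb _ (by omega), zero_add, vPart_succ,
          pr_inc_of_ne _ _ (by omega)] at this
        exact smul_sign_eq_zero this
      obtain ⟨y, hy⟩ := ex₀ _ _ h1
      have h2 : K.d k y = a' := by
        apply inj
        rw [a.comm, hy, ← hpr _ a' rfl, ← hdb]
        change _ = V.pr (k + 1) 0 rfl (V.D _ b)
        rw [pr_D, hPart_succ, vPart_zero, smul_zero]
        exact (add_zero _).symm
      refine ⟨y, fun h => absurd h (by omega), 0, zero_mem _, ?_, ?_⟩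
      · rw [h2, sub_self]; exact zero_mem _
      · rw [sub_zero]
        refine mem_supp_succ (sub_mem hb (inc_mem_supp _ _)) (add_zero k) ?_
        rw [map_sub, hpr, hy, sub_self]
    · have hkm : k + (m + 1) = n := by omega
      have h1 : V.v k (m + 1) (V.pr k (m + 1) hkm b) = 0 := by
        have := congrArg (V.pr k (m + 2) hm) hdb
        change V.pr k (m + 2) _ (V.D _ b) = V.pr k (m + 2) _ (V.inc (n + 1) 0 rfl _) at this
        rw [pr_D, hPart_eq_zero hb _ (by omega), zero_add, vPart_succ,
          pr_inc_of_ne _ _ (by omega)] at this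
        exact smul_sign_eq_zero this
      obtain ⟨y, hy⟩ := ex _ _ _ h1
      obtain ⟨b', hb', h3, h4⟩ := inc_mem_B hkm (A := V) ⟨y, hy⟩
      refine ⟨0, zero_mem _, b', hb', fun h => absurd h (by omega), ?_⟩
      rw [map_zero, sub_zero]
      refine mem_supp_succ (sub_mem hb h4) hkm ?_
      rw [map_sub, h3, sub_self]

end ColAug

/-- A coaugmentation of a double complex along the rows. -/
structure RowAug (K : Cx R) (V : DCx R) where
  ε : ∀ n, K.X n →ₗ[R] V.X 0 n
  comm : ∀ n x, ε (n + 1) (K.d n x) = V.v 0 n (ε n x)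
  h_ε : ∀ n x, V.h 0 n (ε n x) = 0

namespace RowAug

variable {K : Cx R} {V : DCx R}

/-- The coaugmentation of the exchanged double complex. -/
def toColAug (a : RowAug K V) : ColAug K V.swap := ⟨a.ε, a.comm, a.h_ε⟩

/-- The map to the total complex. -/
def hom (a : RowAug K V) : Cx.Hom K V.tot where
  f n := V.inc 0 n (zero_add n) ∘ₗ a.ε n
  comm n x := by
    change V.inc 0 (n + 1) _ (a.ε (n + 1) (K.d n x)) = V.D n (V.inc 0 n _ (a.ε n x))
    rw [D_inc, a.h_ε, map_zero, zero_add, pow_zero, one_smul, a.comm]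

/-- If the coaugmented rows are exact, the map to the total complex is a quasi-isomorphism. -/
theorem qi (a : RowAug K V) (inj : ∀ n, Function.Injective (a.ε n))
    (ex₀ : ∀ n x, V.h 0 n x = 0 → ∃ y, a.ε n y = x)
    (ex : ∀ n m x, V.h (m + 1) n x = 0 → ∃ y, V.h m n y = x) : Cx.QI a.hom := by
  have h1 : Cx.QI a.toColAug.hom := a.toColAug.qi inj ex₀ ex
  have h2 := (Cx.QI.of_bijective (swapTot_bijective V)).comp h1
  have h3 : V.swapTot.comp a.toColAug.hom = a.hom := by
    refine Cx.Hom.ext' fun n x => ?_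
    apply totX_ext
    intro p q e
    change (-1 : R) ^ (p * q) • V.swap.pr q p _ (V.swap.inc n 0 rfl (a.ε n x)) =
      V.pr p q e (V.inc 0 n _ (a.ε n x))
    by_cases hp : p = 0
    · subst hp
      obtain rfl : q = n := by omega
      rw [pr_inc_same, pr_inc_same]; simp
    · rw [pr_inc_of_ne _ _ hp, pr_inc_of_ne _ _ (by omega), smul_zero]
  rwa [h3] at h2

end RowAug

end DCx

end Complexes

end VietorisRips

namespace VietorisRips

/-! ### Alternating sums of face maps -/

section Alt

variable {R : Type u} [CommRing R] {A B C A' B' : Type*} [AddCommGroup A] [Module R A]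
  [AddCommGroup B] [Module R B] [AddCommGroup C] [Module R C] [AddCommGroup A'] [Module R A']
  [AddCommGroup B'] [Module R B']

/-- The alternating sum of a family of linear maps. -/
def alt {m : ℕ} (c : Fin m → (A →ₗ[R] B)) : A →ₗ[R] B := ∑ i : Fin m, (-1 : R) ^ (i : ℕ) • c i

theorem alt_apply {m : ℕ} (c : Fin m → (A →ₗ[R] B)) (x : A) :
    alt c x = ∑ i : Fin m, (-1 : R) ^ (i : ℕ) • c i x := by simp [alt, LinearMap.sum_apply]

/-- Terms cancel in pairs: the term of `c i` and `c' j` with `j ≤ i` against that of `c j` and `c'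
(i + 1)`, whose sign is opposite. Only a family of linear maps obeying the simplicial identity is
involved, so this serves every direction of every complex of germs below. -/
theorem alt_alt {m : ℕ} (c : Fin (m + 1) → (A →ₗ[R] B)) (c' : Fin (m + 2) → (B →ₗ[R] C))
    (h : ∀ i j : Fin (m + 1), i ≤ j → ∀ x, c' j.succ (c i x) = c' i.castSucc (c j x)) (x : A) :
    alt c' (alt c x) = 0 := by
  simp only [alt_apply, map_sum, Finset.smul_sum, ← Finset.sum_product', map_smul, smul_smul,
    ← pow_add]
  let P := Fin (m + 1) × Fin (m + 2)
  let S : Finset P := {ij : P | (ij.2 : ℕ) ≤ (ij.1 : ℕ)}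
  rw [Finset.univ_product_univ, ← Finset.sum_add_sum_compl S, ← eq_neg_iff_add_eq_zero, ← Finset.sum_neg_distrib]
  let φ : ∀ ij : P, ij ∈ S → P := fun ij hij =>
    (Fin.castLT ij.2 (lt_of_le_of_lt (Finset.mem_filter.mp hij).right (Fin.is_lt ij.1)), ij.1.succ)
  apply Finset.sum_bij φ
  · intro ij hij
    simp_rw [S, φ, Finset.compl_filter, Finset.mem_filter_univ, Fin.val_succ,
      Fin.val_castLT] at hij ⊢
    lia
  · rintro ⟨i, j⟩ hij ⟨i', j'⟩ hij' e
    rw [Prod.mk_inj]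
    exact ⟨by simpa [φ] using! congr_arg Prod.snd e,
      by simpa [φ, Fin.castSucc_castLT] using! congr_arg Fin.castSucc (congr_arg Prod.fst e)⟩
  · rintro ⟨i', j'⟩ hij'
    simp_rw [S, Finset.compl_filter, Finset.mem_filter_univ, not_le] at hij'
    refine ⟨(j'.pred <| ?_, Fin.castSucc i'), ?_, ?_⟩
    · rintro rfl
      simp only [Fin.val_zero, not_lt_zero] at hij'
    · simpa [S] using! Nat.le_sub_one_of_lt hij'
    · simp only [φ, Fin.castLT_castSucc, Fin.succ_pred]
  · rintro ⟨i, j⟩ hij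
    have hij' : (j : ℕ) ≤ i := by simpa [S] using hij
    dsimp [φ]
    rw [← neg_smul, h (Fin.castLT j _) i hij', Fin.castSucc_castLT]
    congr 1
    rw [← add_assoc, pow_succ, mul_neg_one, neg_neg, add_comm]

theorem alt_comm {m : ℕ} {c : Fin m → (A →ₗ[R] B)} {c' : Fin m → (A' →ₗ[R] B')}
    {a : A →ₗ[R] A'} {b : B →ₗ[R] B'} (h : ∀ i x, b (c i x) = c' i (a x)) (x : A) :
    b (alt c x) = alt c' (a x) := by
  simp only [alt_apply, map_sum, map_smul, h]

/-- Coning off: the zeroth face of a cone is the base, and the other faces are cones over the faces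
of the base. Their index moves by one, hence the minus sign. -/
theorem alt_contract {m : ℕ} {c : Fin (m + 1) → (A →ₗ[R] B)} {c' : Fin m → (A' →ₗ[R] A)}
    {s : A →ₗ[R] A'} {t : B →ₗ[R] A} (h₀ : ∀ x, t (c 0 x) = x)
    (h : ∀ i x, t (c i.succ x) = c' i (s x)) (x : A) : t (alt c x) = x - alt c' (s x) := by
  rw [alt_apply, map_sum, Fin.sum_univ_succ, map_smul, h₀, alt_apply]
  simp only [map_smul, map_neg, h, Fin.val_zero, pow_zero,
    one_smul, Fin.val_succ, pow_succ, mul_neg_one, neg_smul, Finset.sum_neg_distrib, sub_eq_add_neg]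

end Alt

/-! ### Germs of functions along a filter -/

section Germs

variable {R : Type u} [CommRing R] {S S' S'' : Type u} {F : Filter S} {F' : Filter S'}
  {F'' : Filter S''} {M N P : Type u} [AddCommGroup M] [Module R M] [AddCommGroup N] [Module R N]
  [AddCommGroup P] [Module R P]

variable (R) in
/-- The functions that vanish along a filter. -/
def vanishing (F : Filter S) (M : Type u) [AddCommGroup M] [Module R M] :
    Submodule R (S → M) where
  carrier := {f | ∀ᶠ s in F, f s = 0}
  add_mem' hf hg := by
    filter_upwards [hf, hg] with s h1 h2
    rw [Pi.add_apply, h1, h2, add_zero]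
  zero_mem' := Filter.Eventually.of_forall fun _ => rfl
  smul_mem' c f hf := by
    filter_upwards [hf] with s h
    rw [Pi.smul_apply, h, smul_zero]

variable (R) in
/-- The germs of functions along a filter. -/
abbrev GermMod (F : Filter S) (M : Type u) [AddCommGroup M] [Module R M] : Type u :=
  (S → M) ⧸ vanishing R F M

variable (R) in
/-- The germ of a function. -/
def germ (F : Filter S) (M : Type u) [AddCommGroup M] [Module R M] :
    (S → M) →ₗ[R] GermMod R F M := Submodule.mkQ _

theorem germ_surjective : Function.Surjective (germ R F M) := Submodule.mkQ_surjective _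

theorem germ_eq_zero {f : S → M} : germ R F M f = 0 ↔ ∀ᶠ s in F, f s = 0 :=
  Submodule.Quotient.mk_eq_zero _

theorem germ_eq_germ {f g : S → M} : germ R F M f = germ R F M g ↔ ∀ᶠ s in F, f s = g s := by
  rw [← sub_eq_zero, ← map_sub, germ_eq_zero]
  simp only [Pi.sub_apply, sub_eq_zero]

variable (R) in
/-- The pullback of germs. -/
def pull (M : Type u) [AddCommGroup M] [Module R M] (φ : S' → S) (h : Filter.Tendsto φ F' F) : GermMod R F M →ₗ[R] GermMod R F' M :=
  Submodule.mapQ _ _ (LinearMap.funLeft R M φ) fun _ hf => h.eventually hf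

@[simp] theorem pull_germ (φ : S' → S) (h : Filter.Tendsto φ F' F) (f : S → M) :
    pull R M φ h (germ R F M f) = germ R F' M (f ∘ φ) := rfl

/-- The map on germs induced by a map of coefficients. -/
def coef (a : M →ₗ[R] N) : GermMod R F M →ₗ[R] GermMod R F N :=
  Submodule.mapQ _ _ (a.compLeft S) fun f hf => by
    change ∀ᶠ s in F, f s = 0 at hf
    change ∀ᶠ s in F, a (f s) = 0
    filter_upwards [hf] with s h
    rw [h, map_zero]

@[simp] theorem coef_germ (a : M →ₗ[R] N) (f : S → M) :
    coef a (germ R F M f) = germ R F N (a ∘ f) := rfl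

theorem pull_pull (φ : S' → S) (h : Filter.Tendsto φ F' F) (ψ : S'' → S')
    (h' : Filter.Tendsto ψ F'' F') (x : GermMod R F M) :
    pull R M ψ h' (pull R M φ h x) = pull R M (φ ∘ ψ) (h.comp h') x := by
  obtain ⟨f, rfl⟩ := germ_surjective x
  rfl

theorem coef_pull (a : M →ₗ[R] N) (φ : S' → S) (h : Filter.Tendsto φ F' F) (x : GermMod R F M) :
    coef a (pull R M φ h x) = pull R N φ h (coef a x) := by
  obtain ⟨f, rfl⟩ := germ_surjective x
  rfl

theorem pull_congr {φ ψ : S' → S} (e : φ = ψ) (h : Filter.Tendsto φ F' F)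
    (h' : Filter.Tendsto ψ F' F) (x : GermMod R F M) : pull R M φ h x = pull R M ψ h' x := by
  subst e; rfl

theorem pull_id (h : Filter.Tendsto (id : S → S) F F) (x : GermMod R F M) : pull R M id h x = x := by
  obtain ⟨f, rfl⟩ := germ_surjective x
  rfl

theorem coef_surjective {a : M →ₗ[R] N} (ha : Function.Surjective a) :
    Function.Surjective (coef (F := F) a) := by
  intro x
  obtain ⟨f, rfl⟩ := germ_surjective x
  choose g hg using fun s => ha (f s)
  exact ⟨germ R F M g, by rw [coef_germ]; congr 1; funext s; exact hg s⟩

theorem coef_injective {a : M →ₗ[R] N} (ha : Function.Injective a) :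
    Function.Injective (coef (F := F) a) := by
  rw [injective_iff_map_eq_zero]
  intro x hx
  obtain ⟨f, rfl⟩ := germ_surjective x
  rw [coef_germ, germ_eq_zero] at hx
  rw [germ_eq_zero]
  filter_upwards [hx] with s hs
  exact ha (by rw [map_zero]; exact hs)

/-- Preimages are chosen point by point, with the value `0` at points where there is none; the germ
does not see these. Together with the two preceding lemmas: germs are an exact functor of the
coefficients. -/
theorem coef_exact {a : M →ₗ[R] N} {b : N →ₗ[R] P} (h : Function.Exact a b) {x : GermMod R F N}
    (hx : coef b x = 0) : ∃ y : GermMod R F M, coef a y = x := by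
  classical
  obtain ⟨f, rfl⟩ := germ_surjective x
  rw [coef_germ, germ_eq_zero] at hx
  refine ⟨germ R F M fun s => if hs : b (f s) = 0 then ((h _).1 hs).choose else 0, ?_⟩
  rw [coef_germ, germ_eq_germ]
  filter_upwards [hx] with s hs
  have hs' : b (f s) = 0 := hs
  simp only [Function.comp_apply, dif_pos hs']
  exact ((h _).1 hs').choose_spec

end Germs

/-! ### Filters generated by two filters -/

section Filters

variable {A B S S' : Type*} {𝒰 : Filter A} {𝒱 : Filter B}

/-- The filter generated by the sets `c U V` for `U` and `V` in two given filters. -/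
def gen (𝒰 : Filter A) (𝒱 : Filter B) (c : Set A → Set B → Set S)
    (hc : ∀ U U' V V', U ⊆ U' → V ⊆ V' → c U V ⊆ c U' V') : Filter S where
  sets := {s | ∃ U ∈ 𝒰, ∃ V ∈ 𝒱, c U V ⊆ s}
  univ_sets := ⟨_, Filter.univ_mem, _, Filter.univ_mem, Set.subset_univ _⟩
  sets_of_superset := by
    rintro _ _ ⟨U, hU, V, hV, h⟩ h'
    exact ⟨U, hU, V, hV, h.trans h'⟩
  inter_sets := by
    rintro _ _ ⟨U, hU, V, hV, h⟩ ⟨U', hU', V', hV', h'⟩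
    exact ⟨_, Filter.inter_mem hU hU', _, Filter.inter_mem hV hV', Set.subset_inter
      ((hc _ _ _ _ Set.inter_subset_left Set.inter_subset_left).trans h)
      ((hc _ _ _ _ Set.inter_subset_right Set.inter_subset_right).trans h')⟩

theorem eventually_gen {c : Set A → Set B → Set S} {hc} {p : S → Prop} :
    (∀ᶠ s in gen 𝒰 𝒱 c hc, p s) ↔ ∃ U ∈ 𝒰, ∃ V ∈ 𝒱, ∀ s ∈ c U V, p s := Iff.rfl

theorem tendsto_gen {F : Filter S'} {c : Set A → Set B → Set S} {hc} {φ : S' → S}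
    (h : ∀ U ∈ 𝒰, ∀ V ∈ 𝒱, ∀ᶠ s in F, φ s ∈ c U V) : Filter.Tendsto φ F (gen 𝒰 𝒱 c hc) := by
  rintro s ⟨U, hU, V, hV, hs⟩
  exact Filter.mem_of_superset (h U hU V hV) fun x hx => hs hx

end Filters

/-! ### Tuples near the diagonal and their complexes of germs -/

namespace SU

open SemiUniformSpace

/-- The `n`-simplices of `X^U`, as tuples. -/
def clique {X : Type u} (U : Set (X × X)) (n : ℕ) : Set (Fin (n + 1) → X) :=
  {x | ∀ i j, i < j → (x i, x j) ∈ U}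

theorem clique_mono {X : Type u} {U U' : Set (X × X)} (h : U ⊆ U') (n : ℕ) :
    clique U n ⊆ clique U' n := fun _ hx i j hij => h (hx i j hij)

theorem clique_map {X Y : Type u} {U : Set (X × X)} {V : Set (Y × Y)} {f : X → Y}
    (h : ∀ p ∈ U, (f p.1, f p.2) ∈ V) {n : ℕ} {x : Fin (n + 1) → X} (hx : x ∈ clique U n) :
    f ∘ x ∈ clique V n := fun i j hij => h _ (hx i j hij)

/-- The face of a tuple omitting an entry. -/
def face {X : Type u} {n : ℕ} (i : Fin (n + 2)) (x : Fin (n + 2) → X) : Fin (n + 1) → X :=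
  x ∘ i.succAbove

theorem face_face {X : Type u} {n : ℕ} {i j : Fin (n + 2)} (h : i ≤ j) (x : Fin (n + 3) → X) :
    face i (face j.succ x) = face j (face i.castSucc x) := by
  funext k
  have := congrArg (fun f => (SimplexCategory.Hom.toOrderHom f) k) (SimplexCategory.δ_comp_δ h)
  exact congrArg x this

theorem face_clique {X : Type u} {U : Set (X × X)} {n : ℕ} {x : Fin (n + 2) → X}
    (hx : x ∈ clique U (n + 1)) (i : Fin (n + 2)) : face i x ∈ clique U n :=
  fun _ _ hij => hx _ _ (Fin.strictMono_succAbove i hij)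

theorem face_zero_cons {X : Type u} {n : ℕ} (a : X) (x : Fin (n + 1) → X) :
    face 0 (Fin.cons a x : Fin (n + 2) → X) = x := by
  funext k
  simp [face]

theorem face_succ_cons {X : Type u} {n : ℕ} (a : X) (x : Fin (n + 2) → X) (i : Fin (n + 2)) :
    face i.succ (Fin.cons a x : Fin (n + 3) → X) = Fin.cons a (face i x) :=
  Fin.cons_comp_succ_succAbove a x i

theorem cons_clique {X : Type u} {U : Set (X × X)} {n : ℕ} {a : X} {x : Fin (n + 1) → X}
    (hx : x ∈ clique U n) (ha : ∀ i, (a, x i) ∈ U) :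
    (Fin.cons a x : Fin (n + 2) → X) ∈ clique U (n + 1) := by
  intro i j hij
  induction j using Fin.cases with
  | zero => exact absurd hij (Fin.not_lt_zero i)
  | succ j =>
    induction i using Fin.cases with
    | zero => simpa using ha j
    | succ i => simpa using hx i j (Fin.succ_lt_succ_iff.1 hij)

variable {X X₁ Y Y₁ Z : SemiUniformSpace.{u}}

/-- The filter of neighbourhoods of the diagonal in the set of `(n+1)`-tuples. -/
def cliqueFilter (X : SemiUniformSpace.{u}) (n : ℕ) : Filter (Fin (n + 1) → X.carrier) :=
  gen X.entourages (⊤ : Filter PUnit.{1}) (fun U _ => clique U n)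
    fun _ _ _ _ h _ => clique_mono h n

theorem eventually_clique {n : ℕ} {p : (Fin (n + 1) → X.carrier) → Prop} :
    (∀ᶠ x in cliqueFilter X n, p x) ↔ ∃ U ∈ X.entourages, ∀ x ∈ clique U n, p x :=
  ⟨fun ⟨U, hU, _, _, h⟩ => ⟨U, hU, h⟩, fun ⟨U, hU, h⟩ => ⟨U, hU, _, Filter.univ_mem, h⟩⟩

theorem tendsto_clique {S : Type*} {F : Filter S} {n : ℕ} {φ : S → Fin (n + 1) → X.carrier}
    (h : ∀ U ∈ X.entourages, ∀ᶠ s in F, φ s ∈ clique U n) :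
    Filter.Tendsto φ F (cliqueFilter X n) := tendsto_gen fun U hU _ _ => h U hU

theorem tendsto_face (n : ℕ) (i : Fin (n + 2)) :
    Filter.Tendsto (face i) (cliqueFilter X (n + 1)) (cliqueFilter X n) :=
  tendsto_clique fun U hU => eventually_clique.2 ⟨U, hU, fun _ hx => face_clique hx i⟩

theorem tendsto_map (f : UniformMap X Y) (n : ℕ) :
    Filter.Tendsto (fun x : Fin (n + 1) → X.carrier => f.toFun ∘ x) (cliqueFilter X n)
      (cliqueFilter Y n) :=
  tendsto_clique fun V hV => eventually_clique.2
    ⟨_, f.preimage_mem V hV, fun _ hx => clique_map (fun _ hp => hp) hx⟩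

variable {R : Type u} [CommRing R]

/-- The complex of germs near the diagonal of functions on tuples. -/
abbrev germCx (R : Type u) [CommRing R] (X : SemiUniformSpace.{u}) (M : Type u) [AddCommGroup M]
    [Module R M] : Cx R where
  X n := GermMod R (cliqueFilter X n) M
  d n := alt fun i => pull R M (face i) (tendsto_face n i)
  dd n x := by
    refine alt_alt _ _ (fun i j hij x => ?_) x
    rw [pull_pull, pull_pull]
    exact pull_congr (funext fun y => face_face hij y) _ _ x

variable {M N : Type u} [AddCommGroup M] [Module R M] [AddCommGroup N] [Module R N]

/-- The map of complexes of germs induced by a uniformly continuous map and a coefficient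
homomorphism. -/
def germMap (f : UniformMap X Y) (a : M →ₗ[R] N) : Cx.Hom (germCx R Y M) (germCx R X N) where
  f n := coef a ∘ₗ pull R M _ (tendsto_map f n)
  comm n x := by
    refine alt_comm (b := coef a ∘ₗ pull R M _ (tendsto_map f (n + 1)))
      (a := coef a ∘ₗ pull R M _ (tendsto_map f n)) (fun i x => ?_) x
    simp only [LinearMap.comp_apply]
    rw [← coef_pull, pull_pull, pull_pull]
    rfl

/-- The filter of neighbourhoods of the diagonal in pairs of tuples. -/
def pairFilter (X Y : SemiUniformSpace.{u}) (p q : ℕ) :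
    Filter ((Fin (p + 1) → X.carrier) × (Fin (q + 1) → Y.carrier)) :=
  gen X.entourages Y.entourages (fun U V => clique U p ×ˢ clique V q)
    fun _ _ _ _ h h' => Set.prod_mono (clique_mono h p) (clique_mono h' q)

theorem tendsto_pair_fst (p q : ℕ) (i : Fin (p + 2)) :
    Filter.Tendsto (Prod.map (face i) id) (pairFilter X Y (p + 1) q) (pairFilter X Y p q) :=
  tendsto_gen fun U hU V hV => eventually_gen.2
    ⟨U, hU, V, hV, fun _ hx => ⟨face_clique hx.1 i, hx.2⟩⟩

theorem tendsto_pair_snd (p q : ℕ) (i : Fin (q + 2)) :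
    Filter.Tendsto (Prod.map id (face i)) (pairFilter X Y p (q + 1)) (pairFilter X Y p q) :=
  tendsto_gen fun U hU V hV => eventually_gen.2
    ⟨U, hU, V, hV, fun _ hx => ⟨hx.1, face_clique hx.2 i⟩⟩

theorem tendsto_pair_map (f : UniformMap X X₁) (g : UniformMap Y Y₁) (p q : ℕ) :
    Filter.Tendsto (fun x : (Fin (p + 1) → X.carrier) × (Fin (q + 1) → Y.carrier) =>
      (f.toFun ∘ x.1, g.toFun ∘ x.2)) (pairFilter X Y p q) (pairFilter X₁ Y₁ p q) :=
  tendsto_gen fun U hU V hV => eventually_gen.2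
    ⟨_, f.preimage_mem U hU, _, g.preimage_mem V hV, fun _ hx =>
      ⟨clique_map (fun _ hp => hp) hx.1, clique_map (fun _ hp => hp) hx.2⟩⟩

/-- The double complex of germs near the diagonals of functions on pairs of tuples. -/
abbrev pairCx (R : Type u) [CommRing R] (X Y : SemiUniformSpace.{u}) (M : Type u)
    [AddCommGroup M] [Module R M] : DCx R where
  X p q := GermMod R (pairFilter X Y p q) M
  h p q := alt fun i => pull R M _ (tendsto_pair_fst p q i)
  v p q := alt fun i => pull R M _ (tendsto_pair_snd p q i)
  hh p q x := by
    refine alt_alt _ _ (fun i j hij x => ?_) x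
    rw [pull_pull, pull_pull]
    exact pull_congr (by funext y; exact Prod.ext (face_face hij y.1) rfl) _ _ x
  vv p q x := by
    refine alt_alt _ _ (fun i j hij x => ?_) x
    rw [pull_pull, pull_pull]
    exact pull_congr (by funext y; exact Prod.ext rfl (face_face hij y.2)) _ _ x
  hv p q x := by
    refine (alt_comm (fun i x => ?_) x).symm
    refine (alt_comm (fun j x => ?_) x).symm
    rw [pull_pull, pull_pull]
    rfl

/-- The map of double complexes of germs induced by uniformly continuous maps and a coefficient
homomorphism. -/
def pairMap (f : UniformMap X X₁) (g : UniformMap Y Y₁) (a : M →ₗ[R] N) :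
    DCx.Hom (pairCx R X₁ Y₁ M) (pairCx R X Y N) where
  f p q := coef a ∘ₗ pull R M _ (tendsto_pair_map f g p q)
  comm_h p q x := by
    refine alt_comm (fun i x => ?_) x
    simp only [LinearMap.comp_apply]
    rw [← coef_pull, pull_pull, pull_pull]
    rfl
  comm_v p q x := by
    refine alt_comm (fun i x => ?_) x
    simp only [LinearMap.comp_apply]
    rw [← coef_pull, pull_pull, pull_pull]
    rfl

end SU

end VietorisRips

namespace VietorisRips

/-! ### The Eilenberg-Zilber comparison -/

namespace SU

open SemiUniformSpace

variable {R : Type u} [CommRing R] {X X₁ Y Y₁ : SemiUniformSpace.{u}}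
  {M N : Type u} [AddCommGroup M] [Module R M] [AddCommGroup N] [Module R N]

/-- The entourage `U ∩ U⁻¹`. -/
def symm {X : Type u} (U : Set (X × X)) : Set (X × X) := {p | p ∈ U ∧ (p.2, p.1) ∈ U}

theorem symm_mem {U : Set (X.carrier × X.carrier)} (hU : U ∈ X.entourages) :
    symm U ∈ X.entourages := Filter.inter_mem hU (X.inv_mem U hU)

/-- A clique constrains only pairs `i < j`; intersecting with the inverse relation removes the
order. The contractions below need this because the new vertex is compared with points on both
sides. -/
theorem clique_symm {U : Set (X.carrier × X.carrier)} (hU : U ∈ X.entourages) {n : ℕ}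
    {x : Fin (n + 1) → X.carrier} (hx : x ∈ clique (symm U) n) (i j : Fin (n + 1)) :
    (x i, x j) ∈ U := by
  rcases lt_trichotomy i j with h | h | h
  · exact (hx i j h).1
  · subst h; exact X.diag_mem U hU _
  · exact (hx j i h).2

theorem clique_of_symm {X : Type u} {U : Set (X × X)} {n : ℕ} {x : Fin (n + 1) → X}
    (hx : x ∈ clique (symm U) n) : x ∈ clique U n := fun i j h => (hx i j h).1

/-- Triples consisting of an `n`-simplex of a product, a `p`-simplex of the first and a `q`-simplex
of the second factor which are mutually close. -/
structure Close {X Y : Type u} (U : Set (X × X)) (V : Set (Y × Y)) {n p q : ℕ}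
    (s : (Fin (n + 1) → X × Y) × (Fin (p + 1) → X) × (Fin (q + 1) → Y)) : Prop where
  z₁ : (fun i => (s.1 i).1) ∈ clique U n
  z₂ : (fun i => (s.1 i).2) ∈ clique V n
  x : s.2.1 ∈ clique U p
  y : s.2.2 ∈ clique V q
  zx : ∀ i j, ((s.1 i).1, s.2.1 j) ∈ U
  xz : ∀ i j, (s.2.1 j, (s.1 i).1) ∈ U
  zy : ∀ i j, ((s.1 i).2, s.2.2 j) ∈ V
  yz : ∀ i j, (s.2.2 j, (s.1 i).2) ∈ V

/-- The filter of neighbourhoods of the diagonals in the set of triples of tuples. -/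
def triFilter (X Y : SemiUniformSpace.{u}) (n p q : ℕ) :
    Filter ((Fin (n + 1) → X.carrier × Y.carrier) × (Fin (p + 1) → X.carrier) ×
      (Fin (q + 1) → Y.carrier)) :=
  gen X.entourages Y.entourages (fun U V => {s | Close U V s}) fun _ _ _ _ h h' _ hs =>
    ⟨clique_mono h _ hs.z₁, clique_mono h' _ hs.z₂, clique_mono h _ hs.x, clique_mono h' _ hs.y,
      fun i j => h (hs.zx i j), fun i j => h (hs.xz i j), fun i j => h' (hs.zy i j),
      fun i j => h' (hs.yz i j)⟩

/-- The face map in the first direction. -/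
def fz {X Y : Type u} {n p q : ℕ} (i : Fin (n + 2))
    (s : (Fin (n + 2) → X × Y) × (Fin (p + 1) → X) × (Fin (q + 1) → Y)) :
    (Fin (n + 1) → X × Y) × (Fin (p + 1) → X) × (Fin (q + 1) → Y) := (face i s.1, s.2)

/-- The face map in the second direction. -/
def fx {X Y : Type u} {n p q : ℕ} (i : Fin (p + 2))
    (s : (Fin (n + 1) → X × Y) × (Fin (p + 2) → X) × (Fin (q + 1) → Y)) :
    (Fin (n + 1) → X × Y) × (Fin (p + 1) → X) × (Fin (q + 1) → Y) := (s.1, face i s.2.1, s.2.2)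

/-- The face map in the third direction. -/
def fy {X Y : Type u} {n p q : ℕ} (i : Fin (q + 2))
    (s : (Fin (n + 1) → X × Y) × (Fin (p + 1) → X) × (Fin (q + 2) → Y)) :
    (Fin (n + 1) → X × Y) × (Fin (p + 1) → X) × (Fin (q + 1) → Y) := (s.1, s.2.1, face i s.2.2)

/-- The cone map in the first direction. -/
def kz {X Y : Type u} {n p q : ℕ}
    (s : (Fin (n + 1) → X × Y) × (Fin (p + 1) → X) × (Fin (q + 1) → Y)) :
    (Fin (n + 2) → X × Y) × (Fin (p + 1) → X) × (Fin (q + 1) → Y) :=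
  (Fin.cons (s.2.1 0, s.2.2 0) s.1, s.2)

/-- The cone map in the second direction. -/
def kx {X Y : Type u} {n p q : ℕ}
    (s : (Fin (n + 1) → X × Y) × (Fin (p + 1) → X) × (Fin (q + 1) → Y)) :
    (Fin (n + 1) → X × Y) × (Fin (p + 2) → X) × (Fin (q + 1) → Y) :=
  (s.1, Fin.cons (s.1 0).1 s.2.1, s.2.2)

/-- The cone map in the third direction. -/
def ky {X Y : Type u} {n p q : ℕ}
    (s : (Fin (n + 1) → X × Y) × (Fin (p + 1) → X) × (Fin (q + 1) → Y)) :
    (Fin (n + 1) → X × Y) × (Fin (p + 1) → X) × (Fin (q + 2) → Y) :=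
  (s.1, s.2.1, Fin.cons (s.1 0).2 s.2.2)

theorem tendsto_fz (n p q : ℕ) (i : Fin (n + 2)) :
    Filter.Tendsto (fz i) (triFilter X Y (n + 1) p q) (triFilter X Y n p q) :=
  tendsto_gen fun U hU V hV => eventually_gen.2 ⟨U, hU, V, hV, fun _ h =>
    ⟨face_clique h.z₁ i, face_clique h.z₂ i, h.x, h.y, fun _ j => h.zx _ j, fun _ j => h.xz _ j,
      fun _ j => h.zy _ j, fun _ j => h.yz _ j⟩⟩

theorem tendsto_fx (n p q : ℕ) (i : Fin (p + 2)) :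
    Filter.Tendsto (fx i) (triFilter X Y n (p + 1) q) (triFilter X Y n p q) :=
  tendsto_gen fun U hU V hV => eventually_gen.2 ⟨U, hU, V, hV, fun _ h =>
    ⟨h.z₁, h.z₂, face_clique h.x i, h.y, fun i _ => h.zx i _, fun i _ => h.xz i _,
      fun i j => h.zy i j, fun i j => h.yz i j⟩⟩

theorem tendsto_fy (n p q : ℕ) (i : Fin (q + 2)) :
    Filter.Tendsto (fy i) (triFilter X Y n p (q + 1)) (triFilter X Y n p q) :=
  tendsto_gen fun U hU V hV => eventually_gen.2 ⟨U, hU, V, hV, fun _ h =>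
    ⟨h.z₁, h.z₂, h.x, face_clique h.y i, fun i j => h.zx i j, fun i j => h.xz i j,
      fun i _ => h.zy i _, fun i _ => h.yz i _⟩⟩

theorem forall_cons {X : Type u} {n : ℕ} {P : X → Prop} {a : X} {x : Fin (n + 1) → X} (ha : P a)
    (hx : ∀ i, P (x i)) (i : Fin (n + 2)) : P ((Fin.cons a x : Fin (n + 2) → X) i) := by
  induction i using Fin.cases with
  | zero => exact ha
  | succ i => exact hx i

theorem comp_cons {X Y : Type u} (f : X → Y) {n : ℕ} (a : X) (x : Fin (n + 1) → X) :
    (fun i => f ((Fin.cons a x : Fin (n + 2) → X) i)) = (Fin.cons (f a) fun i => f (x i)) := by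
  funext i
  induction i using Fin.cases <;> rfl

/-- The vertex prepended to `z` is `(x 0, y 0)`, whose closeness to all entries of `z`, `x` and `y`
is already among the conditions in `Close` for symmetrized relations. No composition of relations
occurs, and a semi-uniform structure would not provide any. -/
theorem tendsto_kz (n p q : ℕ) :
    Filter.Tendsto kz (triFilter X Y n p q) (triFilter X Y (n + 1) p q) :=
  tendsto_gen fun U hU V hV => eventually_gen.2 ⟨_, symm_mem hU, _, symm_mem hV, fun s h =>
    ⟨by
        rw [show (fun i => ((kz s).1 i).1) = _ from comp_cons Prod.fst _ _]
        exact cons_clique (clique_of_symm h.z₁) fun i => (h.xz i 0).1,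
      by
        rw [show (fun i => ((kz s).1 i).2) = _ from comp_cons Prod.snd _ _]
        exact cons_clique (clique_of_symm h.z₂) fun i => (h.yz i 0).1,
      clique_of_symm h.x, clique_of_symm h.y,
      fun i j => forall_cons (P := fun a : X.carrier × Y.carrier => (a.1, s.2.1 j) ∈ U) (clique_symm hU h.x 0 j)
        (fun i => (h.zx i j).1) i,
      fun i j => forall_cons (P := fun a : X.carrier × Y.carrier => (s.2.1 j, a.1) ∈ U) (clique_symm hU h.x j 0)
        (fun i => (h.xz i j).1) i,
      fun i j => forall_cons (P := fun a : X.carrier × Y.carrier => (a.2, s.2.2 j) ∈ V) (clique_symm hV h.y 0 j)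
        (fun i => (h.zy i j).1) i,
      fun i j => forall_cons (P := fun a : X.carrier × Y.carrier => (s.2.2 j, a.2) ∈ V) (clique_symm hV h.y j 0)
        (fun i => (h.yz i j).1) i⟩⟩

theorem tendsto_kx (n p q : ℕ) :
    Filter.Tendsto kx (triFilter X Y n p q) (triFilter X Y n (p + 1) q) :=
  tendsto_gen fun U hU V hV => eventually_gen.2 ⟨_, symm_mem hU, V, hV, fun s h =>
    ⟨clique_of_symm h.z₁, h.z₂, cons_clique (clique_of_symm h.x) fun j => (h.zx 0 j).1, h.y,
      fun i j => forall_cons (P := fun a => ((s.1 i).1, a) ∈ U) (clique_symm hU h.z₁ i 0)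
        (fun j => (h.zx i j).1) j,
      fun i j => forall_cons (P := fun a => (a, (s.1 i).1) ∈ U) (clique_symm hU h.z₁ 0 i)
        (fun j => (h.xz i j).1) j, h.zy, h.yz⟩⟩

theorem tendsto_ky (n p q : ℕ) :
    Filter.Tendsto ky (triFilter X Y n p q) (triFilter X Y n p (q + 1)) :=
  tendsto_gen fun U hU V hV => eventually_gen.2 ⟨U, hU, _, symm_mem hV, fun s h =>
    ⟨h.z₁, clique_of_symm h.z₂, h.x, cons_clique (clique_of_symm h.y) fun j => (h.zy 0 j).1,
      h.zx, h.xz,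
      fun i j => forall_cons (P := fun a => ((s.1 i).2, a) ∈ V) (clique_symm hV h.z₂ i 0)
        (fun j => (h.zy i j).1) j,
      fun i j => forall_cons (P := fun a => (a, (s.1 i).2) ∈ V) (clique_symm hV h.z₂ 0 i)
        (fun j => (h.yz i j).1) j⟩⟩

/-- The differentials of the triple complex. -/
def dz (R : Type u) [CommRing R] (X Y : SemiUniformSpace.{u}) (M : Type u) [AddCommGroup M]
    [Module R M] (n p q : ℕ) :
    GermMod R (triFilter X Y n p q) M →ₗ[R] GermMod R (triFilter X Y (n + 1) p q) M :=
  alt fun i => pull R M _ (tendsto_fz n p q i)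

/-- The double complex of germs of functions on triples of tuples, for a fixed length of the first
tuple. -/
abbrev triCx (R : Type u) [CommRing R] (X Y : SemiUniformSpace.{u}) (M : Type u) [AddCommGroup M]
    [Module R M] (n : ℕ) : DCx R where
  X p q := GermMod R (triFilter X Y n p q) M
  h p q := alt fun i => pull R M _ (tendsto_fx n p q i)
  v p q := alt fun i => pull R M _ (tendsto_fy n p q i)
  hh p q x := by
    refine alt_alt _ _ (fun i j hij x => ?_) x
    rw [pull_pull, pull_pull]
    exact pull_congr (by
      funext s; exact Prod.ext rfl (Prod.ext (face_face hij s.2.1) rfl)) _ _ x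
  vv p q x := by
    refine alt_alt _ _ (fun i j hij x => ?_) x
    rw [pull_pull, pull_pull]
    exact pull_congr (by
      funext s; exact Prod.ext rfl (Prod.ext rfl (face_face hij s.2.2))) _ _ x
  hv p q x := by
    refine (alt_comm (fun i x => ?_) x).symm
    refine (alt_comm (fun j x => ?_) x).symm
    rw [pull_pull, pull_pull]
    rfl

/-- The third differential as a morphism of double complexes. -/
def dzHom (R : Type u) [CommRing R] (X Y : SemiUniformSpace.{u}) (M : Type u) [AddCommGroup M]
    [Module R M] (n : ℕ) : DCx.Hom (triCx R X Y M n) (triCx R X Y M (n + 1)) where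
  f := dz R X Y M n
  comm_h p q x := by
    refine alt_comm (fun i x => ?_) x
    refine (alt_comm (fun j x => ?_) x).symm
    rw [pull_pull, pull_pull]
    rfl
  comm_v p q x := by
    refine alt_comm (fun i x => ?_) x
    refine (alt_comm (fun j x => ?_) x).symm
    rw [pull_pull, pull_pull]
    rfl

theorem dz_dz (n p q : ℕ) (x : GermMod R (triFilter X Y n p q) M) :
    dz R X Y M (n + 1) p q (dz R X Y M n p q x) = 0 := by
  refine alt_alt _ _ (fun i j hij x => ?_) x
  rw [pull_pull, pull_pull]
  exact pull_congr (by funext s; exact Prod.ext (face_face hij s.1) rfl) _ _ x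

/-- The double complex comparing the complex of the product with the total complex. -/
abbrev ezCx (R : Type u) [CommRing R] (X Y : SemiUniformSpace.{u}) (M : Type u) [AddCommGroup M]
    [Module R M] : DCx R where
  X n m := (triCx R X Y M n).totX m
  h n m := (dzHom R X Y M n).tot.f m
  v n m := (triCx R X Y M n).D m
  hh n m x := by
    apply DCx.totX_ext
    intro p q e
    rw [DCx.Hom.pr_tot, DCx.Hom.pr_tot, map_zero]
    exact dz_dz _ _ _ _
  vv n m x := (triCx R X Y M n).tot.dd m x
  hv n m x := (dzHom R X Y M n).tot.comm m x

section Contraction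

theorem face_succ_cons_one {X : Type u} (a : X) (x : Fin 1 → X) (i : Fin 1) :
    face i.succ (Fin.cons a x : Fin 2 → X) = fun _ => a := by
  funext k
  obtain rfl : i = 0 := Subsingleton.elim (α := Fin 1) _ _
  obtain rfl : k = 0 := Subsingleton.elim (α := Fin 1) _ _
  rfl

/-- The cone over a one-entry tuple has the constant tuple as its other face, so the start of the
complex falls outside `alt_contract`; `exact_z_zero` treats it. -/
theorem contract_z (n p q : ℕ) (x : GermMod R (triFilter X Y (n + 1) p q) M) :
    pull R M kz (tendsto_kz (n + 1) p q) (dz R X Y M (n + 1) p q x) =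
      x - dz R X Y M n p q (pull R M kz (tendsto_kz n p q) x) := by
  refine alt_contract (fun x => ?_) (fun i x => ?_) x
  · rw [pull_pull, pull_congr (ψ := id) _ _ Filter.tendsto_id, pull_id]
    funext s; exact Prod.ext (face_zero_cons (s.2.1 0, s.2.2 0) s.1) rfl
  · rw [pull_pull, pull_pull]
    exact pull_congr (by funext s; exact Prod.ext (face_succ_cons (s.2.1 0, s.2.2 0) s.1 _) rfl) _ _ x

theorem contract_x (n p q : ℕ) (x : GermMod R (triFilter X Y n (p + 1) q) M) :
    pull R M kx (tendsto_kx n (p + 1) q) ((triCx R X Y M n).h (p + 1) q x) =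
      x - (triCx R X Y M n).h p q (pull R M kx (tendsto_kx n p q) x) := by
  refine alt_contract (fun x => ?_) (fun i x => ?_) x
  · rw [pull_pull, pull_congr (ψ := id) _ _ Filter.tendsto_id, pull_id]
    funext s; exact Prod.ext rfl (Prod.ext (face_zero_cons (s.1 0).1 s.2.1) rfl)
  · rw [pull_pull, pull_pull]
    exact pull_congr (by
      funext s; exact Prod.ext rfl (Prod.ext (face_succ_cons (s.1 0).1 s.2.1 _) rfl)) _ _ x

theorem contract_y (n p q : ℕ) (x : GermMod R (triFilter X Y n p (q + 1)) M) :
    pull R M ky (tendsto_ky n p (q + 1)) ((triCx R X Y M n).v p (q + 1) x) =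
      x - (triCx R X Y M n).v p q (pull R M ky (tendsto_ky n p q) x) := by
  refine alt_contract (fun x => ?_) (fun i x => ?_) x
  · rw [pull_pull, pull_congr (ψ := id) _ _ Filter.tendsto_id, pull_id]
    funext s; exact Prod.ext rfl (Prod.ext rfl (face_zero_cons (s.1 0).2 s.2.2))
  · rw [pull_pull, pull_pull]
    exact pull_congr (by
      funext s; exact Prod.ext rfl (Prod.ext rfl (face_succ_cons (s.1 0).2 s.2.2 _))) _ _ x

/-- Replace the first tuple by a constant one. -/
def rz {X Y : Type u} {p q : ℕ} (s : (Fin (p + 1) → X) × (Fin (q + 1) → Y)) :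
    (Fin 1 → X × Y) × (Fin (p + 1) → X) × (Fin (q + 1) → Y) :=
  (fun _ => (s.1 0, s.2 0), s)

theorem clique_one {X : Type u} {U : Set (X × X)} (x : Fin 1 → X) : x ∈ clique U 0 :=
  fun i j h => absurd h (by rw [Subsingleton.elim (α := Fin 1) i j]; exact lt_irrefl _)

theorem tendsto_rz (p q : ℕ) : Filter.Tendsto rz (pairFilter X Y p q) (triFilter X Y 0 p q) :=
  tendsto_gen fun _ hU _ hV => eventually_gen.2 ⟨_, symm_mem hU, _, symm_mem hV, fun _ h =>
    ⟨clique_one _, clique_one _, clique_of_symm h.1, clique_of_symm h.2,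
      fun _ j => clique_symm hU h.1 0 j, fun _ j => clique_symm hU h.1 j 0,
      fun _ j => clique_symm hV h.2 0 j, fun _ j => clique_symm hV h.2 j 0⟩⟩

theorem tendsto_snd (n p q : ℕ) :
    Filter.Tendsto (Prod.snd : (Fin (n + 1) → X.carrier × Y.carrier) × _ → _)
      (triFilter X Y n p q) (pairFilter X Y p q) :=
  tendsto_gen fun U hU V hV => eventually_gen.2 ⟨U, hU, V, hV, fun _ h => ⟨h.x, h.y⟩⟩

/-- Replace the second and third tuples by constant ones. -/
def rxy {X Y : Type u} {n : ℕ} (z : Fin (n + 1) → X × Y) :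
    (Fin (n + 1) → X × Y) × (Fin 1 → X) × (Fin 1 → Y) :=
  (z, fun _ => (z 0).1, fun _ => (z 0).2)

/-- The filter of neighbourhoods of the diagonal in the set of tuples in a product. -/
def prodFilter (X Y : SemiUniformSpace.{u}) (n : ℕ) :
    Filter (Fin (n + 1) → X.carrier × Y.carrier) := cliqueFilter (X.prod Y) n

theorem tendsto_prod_face (n : ℕ) (i : Fin (n + 2)) :
    Filter.Tendsto (face i) (prodFilter X Y (n + 1)) (prodFilter X Y n) :=
  tendsto_face (X := X.prod Y) n i

theorem tendsto_prod_map (f : UniformMap X X₁) (g : UniformMap Y Y₁) (n : ℕ) :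
    Filter.Tendsto (fun x : Fin (n + 1) → X.carrier × Y.carrier => Prod.map f.toFun g.toFun ∘ x)
      (prodFilter X Y n) (prodFilter X₁ Y₁ n) := tendsto_map (f.prodMap g) n

/-- The complex of germs of functions on tuples in a product. -/
abbrev prodCx (R : Type u) [CommRing R] (X Y : SemiUniformSpace.{u}) (M : Type u)
    [AddCommGroup M] [Module R M] : Cx R where
  X n := GermMod R (prodFilter X Y n) M
  d n := alt fun i => pull R M (face i) (tendsto_prod_face n i)
  dd := (germCx R (X.prod Y) M).dd

/-- The functoriality of the complexes of germs of functions on tuples in a product. -/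
def prodMap (f : UniformMap X X₁) (g : UniformMap Y Y₁) (a : M →ₗ[R] N) :
    Cx.Hom (prodCx R X₁ Y₁ M) (prodCx R X Y N) where
  f n := coef a ∘ₗ pull R M _ (tendsto_prod_map f g n)
  comm := (germMap (f.prodMap g) a).comm

theorem tendsto_rxy (n : ℕ) :
    Filter.Tendsto rxy (prodFilter X Y n) (triFilter X Y n 0 0) :=
  tendsto_gen fun U hU V hV => eventually_clique.2 ⟨prodRel (symm U) (symm V),
    ⟨_, symm_mem hU, _, symm_mem hV, subset_rfl⟩, fun z h => by
      have h1 : (fun i => (z i).1) ∈ clique (symm U) n := fun i j hij => (h i j hij).1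
      have h2 : (fun i => (z i).2) ∈ clique (symm V) n := fun i j hij => (h i j hij).2
      exact ⟨clique_of_symm h1, clique_of_symm h2, clique_one _, clique_one _,
        fun i _ => clique_symm hU h1 i 0, fun i _ => clique_symm hU h1 0 i,
        fun i _ => clique_symm hV h2 i 0, fun i _ => clique_symm hV h2 0 i⟩⟩

theorem tendsto_fst (n p q : ℕ) :
    Filter.Tendsto (Prod.fst : _ × ((Fin (p + 1) → X.carrier) × (Fin (q + 1) → Y.carrier)) → _)
      (triFilter X Y n p q) (prodFilter X Y n) :=
  fun W hW => by
    obtain ⟨W', ⟨U, hU, V, hV, hW'⟩, _, _, hW⟩ := hW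
    exact ⟨U, hU, V, hV, fun _ h =>
      hW fun i j hij => hW' ⟨h.z₁ i j hij, h.z₂ i j hij⟩⟩

theorem exact_z (n p q : ℕ) {x : GermMod R (triFilter X Y (n + 1) p q) M}
    (hx : dz R X Y M (n + 1) p q x = 0) :
    dz R X Y M n p q (pull R M kz (tendsto_kz n p q) x) = x := by
  have := contract_z n p q x
  rw [hx, map_zero] at this
  exact (sub_eq_zero.1 this.symm).symm

/-- The two faces of the coned tuple are the one-entry tuple `z` and the point `(x 0, y 0)`. A germ
killed by `dz` agrees on them, so it does not depend on `z`. -/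
theorem exact_z_zero (p q : ℕ) {x : GermMod R (triFilter X Y 0 p q) M}
    (hx : dz R X Y M 0 p q x = 0) :
    pull R M Prod.snd (tendsto_snd 0 p q) (pull R M rz (tendsto_rz p q) x) = x := by
  have h := congrArg (pull R M kz (tendsto_kz 0 p q)) hx
  rw [dz, alt_apply, Fin.sum_univ_two, map_zero] at h
  simp only [Fin.val_zero, pow_zero, one_smul, Fin.val_one, pow_one, neg_smul, map_add, map_neg,
    pull_pull] at h
  rw [pull_congr (ψ := id) _ _ Filter.tendsto_id, pull_id, add_neg_eq_zero] at h
  · rw [pull_pull]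
    refine Eq.trans ?_ h.symm
    exact pull_congr (by
      funext s; exact Prod.ext (face_succ_cons_one (s.2.1 0, s.2.2 0) s.1 0).symm rfl) _ _ x
  · funext s; exact Prod.ext (face_zero_cons (s.2.1 0, s.2.2 0) s.1) rfl

theorem exact_x (n p q : ℕ) {x : GermMod R (triFilter X Y n (p + 1) q) M}
    (hx : (triCx R X Y M n).h (p + 1) q x = 0) :
    (triCx R X Y M n).h p q (pull R M kx (tendsto_kx n p q) x) = x := by
  have := contract_x n p q x
  rw [hx, map_zero] at this
  exact (sub_eq_zero.1 this.symm).symm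

theorem exact_y (n p q : ℕ) {x : GermMod R (triFilter X Y n p (q + 1)) M}
    (hx : (triCx R X Y M n).v p (q + 1) x = 0) :
    (triCx R X Y M n).v p q (pull R M ky (tendsto_ky n p q) x) = x := by
  have := contract_y n p q x
  rw [hx, map_zero] at this
  exact (sub_eq_zero.1 this.symm).symm

/-- The same comparison of two faces, done twice: `x` may be replaced by the first coordinate of `z
0`, then `y` by the second, so the germ depends on `z` alone. -/
theorem exact_xy_zero (n : ℕ) {x : GermMod R (triFilter X Y n 0 0) M}
    (hx : (triCx R X Y M n).h 0 0 x = 0) (hy : (triCx R X Y M n).v 0 0 x = 0) :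
    pull R M Prod.fst (tendsto_fst n 0 0) (pull R M rxy (tendsto_rxy n) x) = x := by
  have h := congrArg (pull R M kx (tendsto_kx n 0 0)) hx
  rw [alt_apply, Fin.sum_univ_two, map_zero] at h
  simp only [Fin.val_zero, pow_zero, one_smul, Fin.val_one, pow_one, neg_smul, map_add, map_neg,
    pull_pull] at h
  rw [pull_congr (ψ := id) _ _ Filter.tendsto_id, pull_id, add_neg_eq_zero] at h
  swap
  · funext s; exact Prod.ext rfl (Prod.ext (face_zero_cons (s.1 0).1 s.2.1) rfl)
  have h' := congrArg (pull R M ky (tendsto_ky n 0 0)) hy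
  rw [alt_apply, Fin.sum_univ_two, map_zero] at h'
  simp only [Fin.val_zero, pow_zero, one_smul, Fin.val_one, pow_one, neg_smul, map_add, map_neg,
    pull_pull] at h'
  rw [pull_congr (ψ := id) _ _ Filter.tendsto_id, pull_id, add_neg_eq_zero] at h'
  swap
  · funext s; exact Prod.ext rfl (Prod.ext rfl (face_zero_cons (s.1 0).2 s.2.2))
  rw [pull_pull]
  refine Eq.trans ?_ h.symm
  conv_rhs => rw [h']
  rw [pull_pull]
  exact pull_congr (by
    funext s
    exact Prod.ext rfl (Prod.ext (face_succ_cons_one (s.1 0).1 s.2.1 0).symm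
      (face_succ_cons_one (s.1 0).2 s.2.2 0).symm)) _ _ x

end Contraction

/-- For a fixed length of the first tuple, the total complex in the other directions is acyclic. -/
theorem exact_tri (n m : ℕ) {x : (triCx R X Y M n).totX (m + 1)}
    (hx : (triCx R X Y M n).D (m + 1) x = 0) : ∃ y, (triCx R X Y M n).D m y = x := by
  -- `L` is the kernel of the first vertical differential. By `exact_y` it is quasi-isomorphic to
  -- the total complex, and `kx` commutes with the faces in the `y`-direction, so it preserves `L`
  -- and contracts it in positive degrees.
  let L : Cx R :=
    { X := fun p => LinearMap.ker ((triCx R X Y M n).v p 0)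
      d := fun p => ((triCx R X Y M n).h p 0).restrict fun x hx => by
        rw [LinearMap.mem_ker] at *
        rw [← (triCx R X Y M n).hv, hx, map_zero]
      dd := fun p x => Subtype.ext ((triCx R X Y M n).hh p 0 x) }
  let a : DCx.ColAug L (triCx R X Y M n) :=
    { ε := fun p => (LinearMap.ker ((triCx R X Y M n).v p 0)).subtype
      comm := fun _ _ => rfl
      v_ε := fun _ x => x.2 }
  have ha : Cx.QI a.hom := a.qi (fun p => Subtype.val_injective) (fun p x hx => ⟨⟨x, hx⟩, rfl⟩)
    fun p q x hx => ⟨_, exact_y n p q hx⟩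
  obtain ⟨l, hl, hB⟩ := (Cx.qi_iff.1 ha (m + 1)).2 x hx
  have hl' : (triCx R X Y M n).h (m + 1) 0 l.1 = 0 := congrArg Subtype.val hl
  have hlB : l ∈ L.B (m + 1) := by
    refine ⟨⟨pull R M kx (tendsto_kx n m 0) l.1, ?_⟩, Subtype.ext (exact_x n m 0 hl')⟩
    rw [LinearMap.mem_ker]
    refine ((alt_comm (fun i x => ?_) l.1).symm.trans
      (congrArg (pull R M kx (tendsto_kx n m 1)) l.2)).trans (map_zero _)
    rw [pull_pull, pull_pull]
    rfl
  have := add_mem hB (a.hom.map_B hlB)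
  rwa [sub_add_cancel] at this

variable (R X Y M) in
/-- The coaugmentation by the complex of the product. -/
def ezCol : DCx.ColAug (prodCx R X Y M) (ezCx R X Y M) where
  ε n := (triCx R X Y M n).inc 0 0 rfl ∘ₗ pull R M _ (tendsto_fst n 0 0)
  comm n x := by
    simp only [LinearMap.comp_apply]
    rw [DCx.hom_tot_inc]
    congr 1
    refine alt_comm (fun i x => ?_) x
    rw [pull_pull, pull_pull]
    rfl
  v_ε n x := by
    change (triCx R X Y M n).D 0 ((triCx R X Y M n).inc 0 0 rfl (pull R M _ _ x)) = 0
    rw [DCx.D_inc]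
    have h1 : (triCx R X Y M n).h 0 0 (pull R M _ (tendsto_fst n 0 0) x) = 0 := by
      rw [alt_apply, Fin.sum_univ_two, pull_pull, pull_pull]
      simp only [Fin.val_zero, pow_zero, one_smul, Fin.val_one, pow_one, neg_smul]
      exact add_neg_cancel _
    have h2 : (triCx R X Y M n).v 0 0 (pull R M _ (tendsto_fst n 0 0) x) = 0 := by
      rw [alt_apply, Fin.sum_univ_two, pull_pull, pull_pull]
      simp only [Fin.val_zero, pow_zero, one_smul, Fin.val_one, pow_one, neg_smul]
      exact add_neg_cancel _
    rw [h1, h2, map_zero, map_zero, smul_zero, add_zero]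

/-- For a fixed length of `z`, the remaining two directions resolve the germs on tuples in the
product: `exact_tri` in positive degrees, `exact_xy_zero` at the start, while `rxy` gives a left
inverse of the coaugmentation. -/
theorem ezCol_qi : Cx.QI (ezCol R X Y M).hom := by
  refine (ezCol R X Y M).qi (fun n => ?_) (fun n x hx => ?_) fun n m x hx => exact_tri n m hx
  · refine Function.LeftInverse.injective
      (g := fun x => pull R M rxy (tendsto_rxy n) ((triCx R X Y M n).pr 0 0 rfl x)) fun x => ?_
    change pull R M rxy _ ((triCx R X Y M n).pr 0 0 rfl ((triCx R X Y M n).inc 0 0 rfl _)) = x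
    rw [DCx.pr_inc_same, pull_pull]
    exact pull_id _ x
  · have hx' : (triCx R X Y M n).D 0 x = 0 := hx
    have h1 := congrArg ((triCx R X Y M n).pr 1 0 rfl) hx'
    rw [DCx.pr_D, DCx.hPart_succ, DCx.vPart_zero, smul_zero, add_zero, map_zero] at h1
    have h2 := congrArg ((triCx R X Y M n).pr 0 1 rfl) hx'
    rw [DCx.pr_D, DCx.hPart_zero, DCx.vPart_succ, pow_zero, one_smul, zero_add, map_zero] at h2
    refine ⟨pull R M rxy (tendsto_rxy n) ((triCx R X Y M n).pr 0 0 rfl x), ?_⟩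
    apply DCx.totX_ext
    intro p q e
    obtain ⟨rfl, rfl⟩ : p = 0 ∧ q = 0 := by omega
    change (triCx R X Y M n).pr 0 0 _ ((triCx R X Y M n).inc 0 0 rfl (pull R M _ _ _)) = _
    rw [DCx.pr_inc_same]
    exact exact_xy_zero n h1 h2

variable (R X Y M) in
/-- The map from the double complex of pairs. -/
def pairToTri : DCx.Hom (pairCx R X Y M) (triCx R X Y M 0) where
  f p q := pull R M _ (tendsto_snd 0 p q)
  comm_h p q x := by
    refine alt_comm (fun i x => ?_) x
    rw [pull_pull, pull_pull]
    rfl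
  comm_v p q x := by
    refine alt_comm (fun i x => ?_) x
    rw [pull_pull, pull_pull]
    rfl

variable (R X Y M) in
/-- The coaugmentation by the total complex of pairs. -/
def ezRow : DCx.RowAug (pairCx R X Y M).tot (ezCx R X Y M) where
  ε m := (pairToTri R X Y M).tot.f m
  comm m x := (pairToTri R X Y M).tot.comm m x
  h_ε m x := by
    apply DCx.totX_ext
    intro p q e
    rw [DCx.Hom.pr_tot, DCx.Hom.pr_tot, map_zero]
    change dz R X Y M 0 p q (pull R M _ (tendsto_snd 0 p q) _) = 0
    rw [dz, alt_apply, Fin.sum_univ_two, pull_pull, pull_pull]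
    simp only [Fin.val_zero, pow_zero, one_smul, Fin.val_one, pow_one, neg_smul]
    exact add_neg_cancel _

/-- The cone in the `z`-direction acts separately on each entry `(p, q)`, so exactness can be
checked entry by entry. -/
theorem ezRow_qi : Cx.QI (ezRow R X Y M).hom := by
  refine (ezRow R X Y M).qi (fun m => ?_) (fun m x hx => ?_) fun n m x hx => ?_
  · rw [injective_iff_map_eq_zero]
    intro x hx
    apply DCx.totX_ext
    intro p q e
    have h := congrArg (fun y => pull R M rz (tendsto_rz p q) ((triCx R X Y M 0).pr p q e y)) hx
    simp only [map_zero] at h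
    rw [map_zero]
    refine Eq.trans ?_ h
    change _ = pull R M rz _ (pull R M _ (tendsto_snd 0 p q) _)
    rw [pull_pull]
    exact (pull_id _ _).symm
  · refine ⟨fun s => pull R M rz (tendsto_rz _ _) (x s), ?_⟩
    funext s
    refine exact_z_zero _ _ ?_
    exact congrFun hx s
  · refine ⟨fun s => pull R M kz (tendsto_kz _ _ _) (x s), ?_⟩
    funext s
    refine exact_z _ _ _ ?_
    exact congrFun hx s

theorem tendsto_tri_map (f : UniformMap X X₁) (g : UniformMap Y Y₁) (n p q : ℕ) :
    Filter.Tendsto (fun s : (Fin (n + 1) → X.carrier × Y.carrier) × (Fin (p + 1) → X.carrier) ×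
        (Fin (q + 1) → Y.carrier) =>
      (Prod.map f.toFun g.toFun ∘ s.1, f.toFun ∘ s.2.1, g.toFun ∘ s.2.2)) (triFilter X Y n p q)
      (triFilter X₁ Y₁ n p q) :=
  tendsto_gen fun U hU V hV => eventually_gen.2
    ⟨_, f.preimage_mem U hU, _, g.preimage_mem V hV, fun _ h =>
      ⟨h.z₁, h.z₂, h.x, h.y, h.zx, h.xz, h.zy, h.yz⟩⟩

/-- The functoriality of the double complexes of triples. -/
def triMap (f : UniformMap X X₁) (g : UniformMap Y Y₁) (a : M →ₗ[R] N) (n : ℕ) :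
    DCx.Hom (triCx R X₁ Y₁ M n) (triCx R X Y N n) where
  f p q := coef a ∘ₗ pull R M _ (tendsto_tri_map f g n p q)
  comm_h p q x := by
    refine alt_comm (fun i x => ?_) x
    simp only [LinearMap.comp_apply]
    rw [← coef_pull, pull_pull, pull_pull]
    rfl
  comm_v p q x := by
    refine alt_comm (fun i x => ?_) x
    simp only [LinearMap.comp_apply]
    rw [← coef_pull, pull_pull, pull_pull]
    rfl

/-- The functoriality of the comparison double complex. -/
def ezMap (f : UniformMap X X₁) (g : UniformMap Y Y₁) (a : M →ₗ[R] N) :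
    DCx.Hom (ezCx R X₁ Y₁ M) (ezCx R X Y N) where
  f n m := (triMap f g a n).tot.f m
  comm_h n m x := by
    apply DCx.totX_ext
    intro p q e
    rw [DCx.Hom.pr_tot, DCx.Hom.pr_tot, DCx.Hom.pr_tot, DCx.Hom.pr_tot]
    refine alt_comm (b := coef a ∘ₗ pull R M _ (tendsto_tri_map f g (n + 1) p q))
      (a := coef a ∘ₗ pull R M _ (tendsto_tri_map f g n p q)) (fun i x => ?_) _
    simp only [LinearMap.comp_apply]
    rw [← coef_pull, pull_pull, pull_pull]
    rfl
  comm_v n m x := (triMap f g a n).tot.comm m x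

/-- The Eilenberg-Zilber isomorphism. -/
def ez (R : Type u) [CommRing R] (X Y : SemiUniformSpace.{u}) (M : Type u) [AddCommGroup M]
    [Module R M] (n : ℕ) : (pairCx R X Y M).tot.H n ≃ₗ[R] (germCx R (X.prod Y) M).H n :=
  ((LinearEquiv.ofBijective _ (ezRow_qi (R := R) (X := X) (Y := Y) (M := M) n)).trans
    (LinearEquiv.ofBijective _ (ezCol_qi (R := R) (X := X) (Y := Y) (M := M) n)).symm :
    (pairCx R X Y M).tot.H n ≃ₗ[R] (prodCx R X Y M).H n)

/-- One of the two quasi-isomorphisms is inverted only on cohomology. It is moved to the other side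
of the equation, where both coaugmentations commute strictly with the map of triple complexes. -/
theorem ez_natural (f : UniformMap X X₁) (g : UniformMap Y Y₁) (a : M →ₗ[R] N) (n : ℕ)
    (x : (pairCx R X₁ Y₁ M).tot.H n) :
    (germMap (f.prodMap g) a).mapH n (ez R X₁ Y₁ M n x) =
      ez R X Y N n ((pairMap f g a).tot.mapH n x) := by
  change (prodMap f g a).mapH n (LinearEquiv.trans _ _ x) = LinearEquiv.trans _ _ _
  rw [LinearEquiv.trans_apply, LinearEquiv.trans_apply, LinearEquiv.eq_symm_apply]
  obtain ⟨y, hy⟩ := (LinearEquiv.ofBijective _ (ezCol_qi (R := R) (X := X₁) (Y := Y₁) (M := M)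
    n)).surjective (LinearEquiv.ofBijective _ (ezRow_qi (R := R) n) x)
  rw [← hy, LinearEquiv.symm_apply_apply]
  rw [LinearEquiv.ofBijective_apply] at hy ⊢
  rw [LinearEquiv.ofBijective_apply] at hy
  rw [LinearEquiv.ofBijective_apply]
  rw [← LinearMap.comp_apply, ← LinearMap.comp_apply, ← Cx.Hom.mapH_comp, ← Cx.Hom.mapH_comp]
  have e1 : (ezCol R X Y N).hom.comp (prodMap f g a) =
      (ezMap f g a).tot.comp (ezCol R X₁ Y₁ M).hom := by
    refine Cx.Hom.ext' fun n x => ?_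
    change (ezCx R X Y N).inc n 0 _ ((triCx R X Y N n).inc 0 0 _ (pull R N _ _ (coef a
      (pull R M _ _ x)))) = (ezMap f g a).tot.f n ((ezCx R X₁ Y₁ M).inc n 0 _
        ((triCx R X₁ Y₁ M n).inc 0 0 _ (pull R M _ _ x)))
    rw [DCx.hom_tot_inc]
    change _ = (ezCx R X Y N).inc n 0 _ ((triMap f g a n).tot.f 0 _)
    rw [DCx.hom_tot_inc]
    congr 2
    change _ = coef a (pull R M _ _ _)
    rw [← coef_pull, pull_pull, pull_pull]
    rfl
  have e2 : (ezRow R X Y N).hom.comp (pairMap f g a).tot =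
      (ezMap f g a).tot.comp (ezRow R X₁ Y₁ M).hom := by
    refine Cx.Hom.ext' fun n x => ?_
    change (ezCx R X Y N).inc 0 n _ ((pairToTri R X Y N).tot.f n ((pairMap f g a).tot.f n x)) =
      (ezMap f g a).tot.f n ((ezCx R X₁ Y₁ M).inc 0 n _ ((pairToTri R X₁ Y₁ M).tot.f n x))
    rw [DCx.hom_tot_inc]
    congr 1
    apply DCx.totX_ext
    intro p q e
    change pull R N _ (tendsto_snd 0 p q) (coef a (pull R M _ (tendsto_pair_map f g p q) _)) =
      coef a (pull R M _ (tendsto_tri_map f g 0 p q) (pull R M _ (tendsto_snd 0 p q) _))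
    rw [← coef_pull, pull_pull, pull_pull]
    rfl
  rw [e1, e2, Cx.Hom.mapH_comp, Cx.Hom.mapH_comp, LinearMap.comp_apply, LinearMap.comp_apply, hy]

end SU

end VietorisRips

namespace VietorisRips

/-! ### Submodules of free and of flat modules over a principal ideal domain -/

section PID

theorem free_of_linearIndependent {R M κ : Type*} [CommRing R] [AddCommGroup M] [Module R M] (b : κ → M)
    (h : ∀ c : κ →₀ R, Finsupp.linearCombination R b c = 0 → c = 0)
    (h' : ⊤ ≤ Submodule.span R (Set.range b)) : Module.Free R M :=
  Module.Free.of_basis (Module.Basis.mk (linearIndependent_iff.2 h) h')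

variable {R : Type u} [CommRing R] [IsDomain R] [IsPrincipalIdealRing R]

/-- A submodule of a free module over a principal ideal domain is free. -/
theorem free_submodule_finsupp {ι : Type*} (N : Submodule R (ι →₀ R)) : Module.Free R N := by
  classical
  obtain ⟨_, hwf⟩ := exists_wellFoundedLT ι
  -- With the index set well-ordered, the coefficients at `i` of elements of `N` that vanish beyond
  -- `i` form an ideal, and `n i` realizes a generator. The `n i` whose leading coefficient is
  -- nonzero form a basis.
  have key : ∀ i : ι, ∃ n ∈ N, (∀ k, i < k → n k = 0) ∧
      ∀ x ∈ N, (∀ k, i < k → x k = 0) → ∃ r, x i = r * n i := by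
    intro i
    let I : Ideal R := (N ⊓ ⨅ k : {k // i < k}, LinearMap.ker (Finsupp.lapply (R := R) k.1)).map
      (Finsupp.lapply (R := R) i)
    obtain ⟨n, ⟨hn, hn'⟩, hg⟩ := Submodule.IsPrincipal.generator_mem I
    simp only [SetLike.mem_coe, Submodule.mem_iInf, LinearMap.mem_ker] at hn hn'
    refine ⟨n, hn, fun k hk => hn' ⟨k, hk⟩, fun x hx hx' => ?_⟩
    have hxI : x i ∈ I := ⟨x, ⟨hx, by
      simp only [SetLike.mem_coe, Submodule.mem_iInf, LinearMap.mem_ker]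
      exact fun k => hx' k.1 k.2⟩, rfl⟩
    obtain ⟨r, hr⟩ := (Submodule.IsPrincipal.mem_iff_eq_smul_generator I).1 hxI
    exact ⟨r, by rw [hr, ← hg]; rfl⟩
  choose n hn hn' hdiv using key
  let b : {i // n i i ≠ 0} → N := fun j => ⟨n j.1, hn j.1⟩
  have hli : ∀ c : {i // n i i ≠ 0} →₀ R, Finsupp.linearCombination R b c = 0 → c = 0 := by
    intro c hc
    by_contra hne
    have hs : c.support.Nonempty := Finsupp.support_nonempty_iff.2 hne
    set j := c.support.max' hs with hj
    have hval := congrArg (fun x : N => x.1 j.1) hc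
    simp only [Finsupp.linearCombination_apply, Finsupp.sum, Submodule.coe_sum,
      Finsupp.finsetSum_apply, Submodule.coe_smul, Finsupp.smul_apply, smul_eq_mul,
      ZeroMemClass.coe_zero, Finsupp.coe_zero, Pi.zero_apply] at hval
    rw [Finset.sum_eq_single_of_mem j (Finset.max'_mem _ hs)] at hval
    · rcases mul_eq_zero.1 hval with h | h
      · exact Finsupp.mem_support_iff.1 (Finset.max'_mem _ hs) h
      · exact j.2 h
    · intro k hk hkj
      have : k < j := lt_of_le_of_ne (Finset.le_max' _ k hk) hkj
      change c k * n k.1 j.1 = 0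
      rw [hn' k.1 j.1 this, mul_zero]
  refine free_of_linearIndependent b hli ?_
  -- Well-founded induction on the leading index: subtracting a multiple of `n i` makes it strictly
  -- smaller.
  · have hspan : ∀ i, ∀ x (hx : x ∈ N), (∀ k, i < k → x k = 0) →
        (⟨x, hx⟩ : N) ∈ Submodule.span R (Set.range b) := by
      intro i
      induction i using hwf.induction with
      | _ i ih =>
      intro x hx hx'
      obtain ⟨y, hy, hyx⟩ : ∃ y ∈ Submodule.span R (Set.range b),
          x i = y.1 i ∧ ∀ k, i < k → y.1 k = 0 := by
        obtain ⟨r, hr⟩ := hdiv i x hx hx'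
        by_cases h0 : n i i = 0
        · exact ⟨0, zero_mem _, by rw [hr, h0, mul_zero]; rfl, fun _ _ => rfl⟩
        · refine ⟨r • b ⟨i, h0⟩, Submodule.smul_mem _ _ (Submodule.subset_span ⟨_, rfl⟩), hr,
            fun k hk => ?_⟩
          change r * n i k = 0
          rw [hn' i k hk, mul_zero]
      have hz : ∀ k, i ≤ k → (x - y.1) k = 0 := by
        intro k hk
        rcases hk.eq_or_lt with rfl | hk
        · rw [Finsupp.sub_apply, hyx.1, sub_self]
        · rw [Finsupp.sub_apply, hx' k hk, hyx.2 k hk, sub_self]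
      have hmem : (⟨x - y.1, N.sub_mem hx y.2⟩ : N) ∈ Submodule.span R (Set.range b) := by
        by_cases h0 : x - y.1 = 0
        · have : (⟨x - y.1, N.sub_mem hx y.2⟩ : N) = 0 := Subtype.ext h0
          rw [this]; exact zero_mem _
        · have hs : (x - y.1).support.Nonempty := Finsupp.support_nonempty_iff.2 h0
          refine ih ((x - y.1).support.max' hs) ?_ _ _ fun k hk => ?_
          · by_contra hlt
            exact Finsupp.mem_support_iff.1 (Finset.max'_mem _ hs) (hz _ (not_lt.1 hlt))
          · by_contra hne
            exact absurd (Finset.le_max' _ k (Finsupp.mem_support_iff.2 hne)) (not_le.2 hk)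
      have : (⟨x, hx⟩ : N) = ⟨x - y.1, N.sub_mem hx y.2⟩ + y :=
        Subtype.ext (sub_add_cancel x y.1).symm
      rw [this]
      exact add_mem hmem hy
    rintro ⟨x, hx⟩ -
    by_cases h0 : x = 0
    · subst h0; exact zero_mem _
    · have hs : x.support.Nonempty := Finsupp.support_nonempty_iff.2 h0
      refine hspan (x.support.max' hs) x hx fun k hk => ?_
      by_contra hne
      exact absurd (Finset.le_max' _ k (Finsupp.mem_support_iff.2 hne)) (not_le.2 hk)

theorem free_submodule {M : Type*} [AddCommGroup M] [Module R M] [Module.Free R M]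
    (N : Submodule R M) : Module.Free R N := by
  let e := Module.Free.chooseBasis R M
  have := free_submodule_finsupp (N.map e.repr.toLinearMap)
  exact Module.Free.of_equiv (e.repr.submoduleMap N).symm

/-- Flat means torsion-free over such a ring, and torsion-freeness passes to submodules. -/
theorem flat_submodule {M : Type*} [AddCommGroup M] [Module R M] [Module.Flat R M]
    (N : Submodule R M) : Module.Flat R N := by
  rw [Module.Flat.flat_iff_torsion_eq_bot_of_isBezout]
  have h := Module.Flat.torsion_eq_bot (R := R) (M := M)
  rw [eq_bot_iff] at h ⊢
  rintro ⟨x, hx⟩ ⟨a, ha⟩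
  have : x ∈ Submodule.torsion R M := ⟨a, congrArg Subtype.val ha⟩
  exact Subtype.ext (h this)

end PID

/-! ### Injectivity after tensoring when the cokernel is flat -/

section Flat

variable {R : Type u} [CommRing R]

/-- This is `Tor_1(M, Q) = 0` for flat `Q`, as a diagram chase in the tensor product of `A → B → Q`
with the presentation `K → P → M`. Flatness of `Q` makes `κ ⊗ Q` injective, flatness of `P` makes `P
⊗ i` injective. -/
theorem lTensor_injective_aux {A B Q K P M : Type*} [AddCommGroup A] [Module R A]
    [AddCommGroup B] [Module R B] [AddCommGroup Q] [Module R Q] [Module.Flat R Q]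
    [AddCommGroup K] [Module R K] [AddCommGroup P] [Module R P] [Module.Flat R P]
    [AddCommGroup M] [Module R M] {i : A →ₗ[R] B} {p : B →ₗ[R] Q} (hi : Function.Injective i)
    (h : Function.Exact i p) (hp : Function.Surjective p) {κ : K →ₗ[R] P} {π : P →ₗ[R] M}
    (hκ' : Function.Injective κ) (hκ : Function.Exact κ π) (hπ : Function.Surjective π) :
    Function.Injective (i.lTensor M) := by
  rw [injective_iff_map_eq_zero]
  intro x hx
  obtain ⟨x, rfl⟩ := LinearMap.rTensor_surjective A hπ x
  have h1 : π.rTensor B (i.lTensor _ x) = 0 := by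
    rw [← LinearMap.comp_apply, LinearMap.rTensor_comp_lTensor, ← LinearMap.lTensor_comp_rTensor]
    exact hx
  obtain ⟨y, hy⟩ := (rTensor_exact B hκ hπ _).1 h1
  have h2 : p.lTensor _ y = 0 := by
    apply Module.Flat.rTensor_preserves_injective_linearMap (M := Q) κ hκ'
    rw [map_zero, ← LinearMap.comp_apply, LinearMap.rTensor_comp_lTensor,
      ← LinearMap.lTensor_comp_rTensor, LinearMap.comp_apply, hy]
    exact (lTensor_exact _ h hp _).2 ⟨_, rfl⟩
  obtain ⟨y, rfl⟩ := (lTensor_exact _ h hp _).1 h2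
  have h3 : κ.rTensor A y = x := by
    apply Module.Flat.lTensor_preserves_injective_linearMap (M := P) i hi
    rw [← hy, ← LinearMap.comp_apply, ← LinearMap.comp_apply, LinearMap.rTensor_comp_lTensor,
      ← LinearMap.lTensor_comp_rTensor]
  rw [← h3]
  exact (rTensor_exact A hκ hπ _).2 ⟨_, rfl⟩

theorem lTensor_injective_of_flat_quotient {A B Q : Type*} [AddCommGroup A] [Module R A]
    [AddCommGroup B] [Module R B] [AddCommGroup Q] [Module R Q] [Module.Flat R Q]
    {i : A →ₗ[R] B} {p : B →ₗ[R] Q} (hi : Function.Injective i) (h : Function.Exact i p)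
    (hp : Function.Surjective p) (M : Type*) [AddCommGroup M] [Module R M] :
    Function.Injective (i.lTensor M) :=
  lTensor_injective_aux hi h hp (Submodule.injective_subtype _)
    (LinearMap.exact_subtype_ker_map (Finsupp.linearCombination R (id : M → M)))
    (Finsupp.linearCombination_id_surjective R M)

end Flat

end VietorisRips

namespace VietorisRips

/-! ### Homology classes of complexes of modules, in elements -/

section ModuleComplexes

variable {R : Type u} [CommRing R]

/-- The homology class of a cycle of a short complex. -/
def scls (S : ShortComplex (ModuleCat.{u} R)) : LinearMap.ker S.g.hom →ₗ[R] S.homology :=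
  (S.moduleCatLeftHomologyData.π ≫ S.moduleCatHomologyIso.inv).hom

theorem scls_surjective (S : ShortComplex (ModuleCat.{u} R)) : Function.Surjective (scls S) :=
  (ModuleCat.epi_iff_surjective
    (S.moduleCatLeftHomologyData.π ≫ S.moduleCatHomologyIso.inv)).1 inferInstance

theorem scls_eq_zero {S : ShortComplex (ModuleCat.{u} R)} {x : LinearMap.ker S.g.hom} :
    scls S x = 0 ↔ ∃ y, S.f.hom y = (x : S.X₂) := by
  have inj := (ModuleCat.mono_iff_injective S.moduleCatHomologyIso.inv).1 inferInstance
  refine (map_eq_zero_iff S.moduleCatHomologyIso.inv.hom inj).trans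
    ((Submodule.Quotient.mk_eq_zero _).trans ?_)
  constructor
  · rintro ⟨y, rfl⟩; exact ⟨y, rfl⟩
  · rintro ⟨y, hy⟩; exact ⟨y, Subtype.ext hy⟩

theorem scls_natural {S T : ShortComplex (ModuleCat.{u} R)} (f : S ⟶ T)
    (x : LinearMap.ker S.g.hom) (hx : T.g.hom (f.τ₂.hom (x : S.X₂)) = 0) :
    (ShortComplex.homologyMap f).hom (scls S x) = scls T ⟨f.τ₂.hom (x : S.X₂), hx⟩ := by
  let a : S.moduleCatLeftHomologyData.K ⟶ T.moduleCatLeftHomologyData.K :=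
    ModuleCat.ofHom (LinearMap.restrict f.τ₂.hom fun y (hy : S.g.hom y = 0) => by
      have h := LinearMap.congr_fun (congrArg ModuleCat.Hom.hom f.comm₂₃) y
      exact h.trans ((congrArg f.τ₃.hom hy).trans (map_zero _)))
  have h1 : S.moduleCatCyclesIso.inv ≫ ShortComplex.cyclesMap f =
      a ≫ T.moduleCatCyclesIso.inv := by
    rw [← cancel_mono T.iCycles, Category.assoc, Category.assoc, ShortComplex.cyclesMap_i,
      ShortComplex.moduleCatCyclesIso_inv_iCycles, ← Category.assoc,
      ShortComplex.moduleCatCyclesIso_inv_iCycles]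
    rfl
  have h2 : (S.moduleCatLeftHomologyData.π ≫ S.moduleCatHomologyIso.inv) ≫
      ShortComplex.homologyMap f =
      a ≫ T.moduleCatLeftHomologyData.π ≫ T.moduleCatHomologyIso.inv := by
    rw [← ShortComplex.moduleCatCyclesIso_inv_π, ← ShortComplex.moduleCatCyclesIso_inv_π,
      Category.assoc, ShortComplex.homologyπ_naturality, ← Category.assoc, h1, Category.assoc]
  exact LinearMap.congr_fun (congrArg ModuleCat.Hom.hom h2) x

variable {ι : Type*} {c : ComplexShape ι} {K L : HomologicalComplex (ModuleCat.{u} R) c}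

/-- The homology class of a cycle. -/
def hcls (K : HomologicalComplex (ModuleCat.{u} R) c) (i j : ι) (hj : c.next i = j) :
    LinearMap.ker (K.d i j).hom →ₗ[R] K.homology i :=
  (scls (K.sc i) : LinearMap.ker (K.d i (c.next i)).hom →ₗ[R] K.homology i) ∘ₗ
    Submodule.inclusion (by subst hj; exact le_rfl)

theorem hcls_surjective (i j : ι) (hj : c.next i = j) : Function.Surjective (hcls K i j hj) := by
  subst hj
  exact scls_surjective (K.sc i)

theorem hcls_eq_zero {i j k : ι} (hj : c.next i = j) (hk : c.prev i = k)
    {x : LinearMap.ker (K.d i j).hom} :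
    hcls K i j hj x = 0 ↔ ∃ y, (K.d k i).hom y = (x : K.X i) := by
  subst hj hk
  exact scls_eq_zero (S := K.sc i)

theorem hcls_natural (f : K ⟶ L) (i j : ι) (hj : c.next i = j) (x : LinearMap.ker (K.d i j).hom)
    (hx : (L.d i j).hom ((f.f i).hom (x : K.X i)) = 0) :
    (HomologicalComplex.homologyMap f i).hom (hcls K i j hj x) =
      hcls L i j hj ⟨(f.f i).hom (x : K.X i), hx⟩ := by
  subst hj
  exact scls_natural ((HomologicalComplex.shortComplexFunctor _ c i).map f) x hx

theorem hom_map_ker (f : K ⟶ L) (i j : ι) (x : LinearMap.ker (K.d i j).hom) :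
    (L.d i j).hom ((f.f i).hom (x : K.X i)) = 0 :=
  (LinearMap.congr_fun (congrArg ModuleCat.Hom.hom (f.comm i j)) (x : K.X i)).trans
    ((congrArg (f.f j).hom x.2).trans (map_zero _))

end ModuleComplexes

/-! ### Torsion products from flat presentations -/

section Tor

variable {R : Type u} [CommRing R]

/-- The complex `M ⊗ P`. -/
abbrev torCx (M : ModuleCat.{u} R) {N : ModuleCat.{u} R} (P : ProjectiveResolution N) :
    ChainComplex (ModuleCat.{u} R) ℕ :=
  (((MonoidalCategory.tensoringLeft (ModuleCat.{u} R)).obj M).mapHomologicalComplex _).obj P.complex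

variable {M M' N N' : ModuleCat.{u} R}

/-- The class in `Tor_1` of a cycle. -/
def torCls (M : ModuleCat.{u} R) (P : ProjectiveResolution N) :
    LinearMap.ker ((P.complex.d 1 0).hom.lTensor M) →ₗ[R] tor₁ M N :=
  (P.isoLeftDerivedObj ((MonoidalCategory.tensoringLeft (ModuleCat.{u} R)).obj M) 1).inv.hom ∘ₗ
    hcls (torCx M P) 1 0 (by simp)

theorem torCls_surjective (P : ProjectiveResolution N) : Function.Surjective (torCls M P) :=
  ((ModuleCat.epi_iff_surjective (P.isoLeftDerivedObj
    ((MonoidalCategory.tensoringLeft (ModuleCat.{u} R)).obj M) 1).inv).1 inferInstance).comp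
    (hcls_surjective 1 0 _)

theorem torCls_eq_zero {P : ProjectiveResolution N}
    {x : LinearMap.ker ((P.complex.d 1 0).hom.lTensor M)} :
    torCls M P x = 0 ↔ ∃ y, (P.complex.d 2 1).hom.lTensor M y = x := by
  have inj := (ModuleCat.mono_iff_injective (P.isoLeftDerivedObj
    ((MonoidalCategory.tensoringLeft (ModuleCat.{u} R)).obj M) 1).inv).1 inferInstance
  exact (map_eq_zero_iff (P.isoLeftDerivedObj
    ((MonoidalCategory.tensoringLeft (ModuleCat.{u} R)).obj M) 1).inv.hom inj).trans
    (hcls_eq_zero (K := torCx M P) _ (by simp))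

/-- Naturality in the functor and naturality in the object are combined, because the torsion product
is varied in both arguments at once. -/
theorem isoLeftDerivedObj_inv_comp {F G : ModuleCat.{u} R ⥤ ModuleCat.{u} R} [F.Additive]
    [G.Additive] (α : F ⟶ G) (b : N ⟶ N') (P : ProjectiveResolution N)
    (Q : ProjectiveResolution N') (φ : P.complex ⟶ Q.complex)
    (hφ : φ.f 0 ≫ Q.π.f 0 = P.π.f 0 ≫ b) (n : ℕ) :
    (P.isoLeftDerivedObj F n).inv ≫ (NatTrans.leftDerived α n).app N ≫ (G.leftDerived n).map b =
      HomologicalComplex.homologyMap ((NatTrans.mapHomologicalComplex α _).app P.complex ≫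
        (G.mapHomologicalComplex _).map φ) n ≫ (Q.isoLeftDerivedObj G n).inv := by
  rw [ProjectiveResolution.leftDerived_app_eq α P n, HomologicalComplex.homologyMap_comp]
  simp only [Category.assoc]
  rw [Iso.inv_hom_id_assoc, ProjectiveResolution.isoLeftDerivedObj_inv_naturality b P Q φ hφ G n]
  rfl

theorem torCls_natural (a : M ⟶ M') (b : N ⟶ N') (P : ProjectiveResolution N)
    (Q : ProjectiveResolution N') (φ : P.complex ⟶ Q.complex)
    (hφ : φ.f 0 ≫ Q.π.f 0 = P.π.f 0 ≫ b) (x : LinearMap.ker ((P.complex.d 1 0).hom.lTensor M))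
    (hx : (Q.complex.d 1 0).hom.lTensor M' (TensorProduct.map a.hom (φ.f 1).hom x.1) = 0) :
    tor₁Map a b (torCls M P x) = torCls M' Q ⟨TensorProduct.map a.hom (φ.f 1).hom x.1, hx⟩ := by
  have h1 := isoLeftDerivedObj_inv_comp
    ((MonoidalCategory.tensoringLeft (ModuleCat.{u} R)).map a) b P Q φ hφ 1
  refine (LinearMap.congr_fun (congrArg ModuleCat.Hom.hom h1) (hcls (torCx M P) 1 0 _ x)).trans ?_
  refine congrArg (Q.isoLeftDerivedObj ((MonoidalCategory.tensoringLeft _).obj M') 1).inv.hom ?_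
  have key := hcls_natural (K := torCx M P) (L := torCx M' Q)
    ((NatTrans.mapHomologicalComplex ((MonoidalCategory.tensoringLeft _).map a) _).app P.complex ≫
      (((MonoidalCategory.tensoringLeft _).obj M').mapHomologicalComplex _).map φ) 1 0 (by simp) x
      (hom_map_ker (K := torCx M P) (L := torCx M' Q) _ 1 0 x)
  refine key.trans (congrArg _ (Subtype.ext ?_))
  change (φ.f 1).hom.lTensor M' (a.hom.rTensor _ x.1) = _
  rw [← LinearMap.comp_apply, LinearMap.lTensor_comp_rTensor]

/-- A short exact sequence `0 → B → Z → N → 0` with `Z` flat. -/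
structure FlatPres {B Z N : Type u} [AddCommGroup B] [Module R B] [AddCommGroup Z] [Module R Z]
    [AddCommGroup N] [Module R N] (i : B →ₗ[R] Z) (p : Z →ₗ[R] N) : Prop where
  inj : Function.Injective i
  exact : Function.Exact i p
  surj : Function.Surjective p
  flat : Module.Flat R Z

namespace FlatPres

variable {B Z N B' Z' N' : Type u} [AddCommGroup B] [Module R B] [AddCommGroup Z] [Module R Z]
    [AddCommGroup N] [Module R N] [AddCommGroup B'] [Module R B'] [AddCommGroup Z'] [Module R Z']
    [AddCommGroup N'] [Module R N'] {i : B →ₗ[R] Z} {p : Z →ₗ[R] N} {i' : B' →ₗ[R] Z'}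
    {p' : Z' →ₗ[R] N'}

/-- The augmentation of a resolution. -/
def aug (P : ProjectiveResolution (ModuleCat.of R N)) : P.complex.X 0 →ₗ[R] N := (P.π.f 0).hom

/-- A comparison of the beginning of a projective resolution with a presentation, over a
homomorphism `ν`. -/
structure Lift (P : ProjectiveResolution (ModuleCat.of R N)) (i : B' →ₗ[R] Z') (p : Z' →ₗ[R] N')
    (ν : N →ₗ[R] N') where
  u₀ : P.complex.X 0 →ₗ[R] Z'
  u₁ : P.complex.X 1 →ₗ[R] B'
  h₀ : ∀ x, p (u₀ x) = ν (aug P x)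
  h₁ : ∀ x, i (u₁ x) = u₀ ((P.complex.d 1 0).hom x)

theorem exists_map {A : ModuleCat.{u} R} [Projective A] {E F : Type u} [AddCommGroup E] [Module R E]
    [AddCommGroup F] [Module R F] (f : A →ₗ[R] F) (g : E →ₗ[R] F)
    (h : ∀ x, ∃ y, g y = f x) : ∃ k : A →ₗ[R] E, ∀ x, g (k x) = f x := by
  let f' : A ⟶ ModuleCat.of R (LinearMap.range g) := ModuleCat.ofHom (f.codRestrict _ h)
  let g' : ModuleCat.of R E ⟶ ModuleCat.of R (LinearMap.range g) := ModuleCat.ofHom g.rangeRestrict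
  have : Epi g' := (ModuleCat.epi_iff_surjective _).2 g.surjective_rangeRestrict
  refine ⟨(Projective.factorThru f' g').hom, fun x => ?_⟩
  have := LinearMap.congr_fun (congrArg ModuleCat.Hom.hom (Projective.factorThru_comp f' g')) x
  exact congrArg Subtype.val this

theorem π_d (P : ProjectiveResolution (ModuleCat.of R N)) (x : P.complex.X 1) :
    aug P ((P.complex.d 1 0).hom x) = 0 :=
  LinearMap.congr_fun (congrArg ModuleCat.Hom.hom P.complex_d_comp_π_f_zero) x

theorem π_exact (P : ProjectiveResolution (ModuleCat.of R N)) {x : P.complex.X 0}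
    (hx : aug P x = 0) : ∃ y, (P.complex.d 1 0).hom y = x :=
  ((ShortComplex.ShortExact.moduleCat_exact_iff_function_exact _).1 P.exact₀ x).1 hx

theorem d_d (P : ProjectiveResolution (ModuleCat.of R N)) (x : P.complex.X 2) :
    (P.complex.d 1 0).hom ((P.complex.d 2 1).hom x) = 0 :=
  LinearMap.congr_fun (congrArg ModuleCat.Hom.hom (P.complex.d_comp_d 2 1 0)) x

theorem d_exact (P : ProjectiveResolution (ModuleCat.of R N)) :
    Function.Exact (P.complex.d 2 1).hom (P.complex.d 1 0).hom :=
  (ShortComplex.ShortExact.moduleCat_exact_iff_function_exact _).1 (P.exact_succ 0)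

theorem π_surjective (P : ProjectiveResolution (ModuleCat.of R N)) :
    Function.Surjective (aug P) :=
  (ModuleCat.epi_iff_surjective (P.π.f 0)).1 inferInstance

theorem exists_lift (S : FlatPres i' p') (P : ProjectiveResolution (ModuleCat.of R N))
    (ν : N →ₗ[R] N') : Nonempty (Lift P i' p' ν) := by
  obtain ⟨u₀, h₀⟩ := exists_map (A := P.complex.X 0) (ν ∘ₗ aug P) p' fun x => S.surj _
  obtain ⟨u₁, h₁⟩ := exists_map (A := P.complex.X 1) (u₀ ∘ₗ (P.complex.d 1 0).hom) i' fun x => by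
    refine (S.exact _).1 ?_
    rw [LinearMap.comp_apply, h₀, LinearMap.comp_apply, π_d, map_zero]
  exact ⟨⟨u₀, u₁, h₀, h₁⟩⟩

/-- Two lifts differ by a homotopy `s`; its contribution to `u₁` factors through the differential
and so vanishes on cycles. Hence the map induced on `Tor_1` does not depend on the lift. -/
theorem lift_unique (S : FlatPres i' p') {P : ProjectiveResolution (ModuleCat.of R N)}
    {ν : N →ₗ[R] N'} (u v : Lift P i' p' ν) {M M' : Type u} [AddCommGroup M] [Module R M]
    [AddCommGroup M'] [Module R M'] (a : M →ₗ[R] M') {x : M ⊗[R] P.complex.X 1}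
    (hx : (P.complex.d 1 0).hom.lTensor M x = 0) :
    TensorProduct.map a u.u₁ x = TensorProduct.map a v.u₁ x := by
  obtain ⟨s, hs⟩ := exists_map (A := P.complex.X 0) (u.u₀ - v.u₀) i' fun x => by
    refine (S.exact _).1 ?_
    rw [LinearMap.sub_apply, map_sub, u.h₀, v.h₀, sub_self]
  have h : u.u₁ = v.u₁ + s ∘ₗ (P.complex.d 1 0).hom := by
    refine LinearMap.ext fun y => S.inj ?_
    rw [LinearMap.add_apply, map_add, LinearMap.comp_apply, hs, u.h₁, v.h₁, LinearMap.sub_apply,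
      add_sub_cancel]
  have h' : TensorProduct.map a (s ∘ₗ (P.complex.d 1 0).hom) x = 0 := by
    have : TensorProduct.map a (s ∘ₗ (P.complex.d 1 0).hom) =
        TensorProduct.map a s ∘ₗ (P.complex.d 1 0).hom.lTensor M := by
      rw [LinearMap.lTensor, ← TensorProduct.map_comp, LinearMap.comp_id]
    rw [this, LinearMap.comp_apply, hx, map_zero]
  rw [h, TensorProduct.map_add_right, LinearMap.add_apply, h', add_zero]

/-- The comparison map from `Tor_1`. -/
def torMap (S : FlatPres i p) (M : ModuleCat.{u} R) : tor₁ M (ModuleCat.of R N) →ₗ[R] M ⊗[R] B :=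
  let P := projectiveResolution (ModuleCat.of R N)
  let u := Classical.choice (S.exists_lift P LinearMap.id)
  (LinearMap.quotKerEquivOfSurjective _ (torCls_surjective P)).symm.toLinearMap |> fun e =>
    ((LinearMap.ker (torCls M P)).liftQ (u.u₁.lTensor M ∘ₗ Submodule.subtype _) (by
      intro x hx
      obtain ⟨y, hy⟩ := torCls_eq_zero.1 hx
      rw [LinearMap.mem_ker, LinearMap.comp_apply, Submodule.subtype_apply, ← hy,
        ← LinearMap.comp_apply, ← LinearMap.lTensor_comp]
      have : u.u₁ ∘ₗ (P.complex.d 2 1).hom = 0 := LinearMap.ext fun z => S.inj (by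
        rw [LinearMap.comp_apply, u.h₁, d_d, map_zero]; exact (map_zero _).symm)
      rw [this, LinearMap.lTensor_zero, LinearMap.zero_apply])) ∘ₗ e

theorem torMap_torCls' (S : FlatPres i p) (M : ModuleCat.{u} R) (x) :
    S.torMap M (torCls M (projectiveResolution (ModuleCat.of R N)) x) =
      (Classical.choice (S.exists_lift (projectiveResolution (ModuleCat.of R N))
        LinearMap.id)).u₁.lTensor M x.1 := by
  rw [torMap]
  simp only [LinearMap.comp_apply, LinearEquiv.coe_coe]
  have : (LinearMap.quotKerEquivOfSurjective _ (torCls_surjective (M := M)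
      (projectiveResolution (ModuleCat.of R N)))).symm (torCls M _ x) = Submodule.Quotient.mk x := by
    rw [LinearEquiv.symm_apply_eq]; rfl
  rw [this]
  rfl

/-- The comparison map is natural. -/
theorem torMap_natural (S : FlatPres i p) (S' : FlatPres i' p') {M M' : ModuleCat.{u} R} (a : M ⟶ M')
    (β : B →ₗ[R] B') (ζ : Z →ₗ[R] Z') (ν : N →ₗ[R] N') (h₁ : ∀ x, i' (β x) = ζ (i x))
    (h₀ : ∀ x, p' (ζ x) = ν (p x)) (x : tor₁ M (ModuleCat.of R N)) :
    S'.torMap M' (tor₁Map a (ModuleCat.ofHom ν) x) = TensorProduct.map a.hom β (S.torMap M x) := by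
  obtain ⟨x, rfl⟩ := torCls_surjective (projectiveResolution (ModuleCat.of R N)) x
  let P := projectiveResolution (ModuleCat.of R N)
  let P' := projectiveResolution (ModuleCat.of R N')
  let φ := ProjectiveResolution.lift (ModuleCat.ofHom ν) P P'
  have hφ := ProjectiveResolution.lift_commutes_zero (ModuleCat.ofHom ν) P P'
  have hd : ∀ y, (φ.f 0).hom ((P.complex.d 1 0).hom y) = (P'.complex.d 1 0).hom ((φ.f 1).hom y) :=
    fun y => LinearMap.congr_fun (congrArg ModuleCat.Hom.hom (φ.comm 1 0).symm) y
  have hx : (P'.complex.d 1 0).hom.lTensor M' (TensorProduct.map a.hom (φ.f 1).hom x.1) = 0 := by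
    have : (P'.complex.d 1 0).hom.lTensor M' ∘ₗ TensorProduct.map a.hom (φ.f 1).hom =
        TensorProduct.map a.hom (φ.f 0).hom ∘ₗ (P.complex.d 1 0).hom.lTensor M := by
      rw [LinearMap.lTensor, LinearMap.lTensor, ← TensorProduct.map_comp, ← TensorProduct.map_comp,
        LinearMap.comp_id, LinearMap.id_comp]
      congr 1
      exact LinearMap.ext fun y => (hd y).symm
    rw [← LinearMap.comp_apply, this, LinearMap.comp_apply, x.2, map_zero]
  rw [torCls_natural a (ModuleCat.ofHom ν) P P' φ hφ x hx, torMap_torCls', torMap_torCls']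
  generalize Classical.choice (S.exists_lift P LinearMap.id) = u
  generalize Classical.choice (S'.exists_lift P' LinearMap.id) = u'
  -- Both ways round the square are lifts of the same resolution over `ν`, so `lift_unique`
  -- identifies them on cycles.
  let v : Lift P i' p' ν := ⟨u'.u₀ ∘ₗ (φ.f 0).hom, u'.u₁ ∘ₗ (φ.f 1).hom, fun y => by
      rw [LinearMap.comp_apply, u'.h₀]
      exact LinearMap.congr_fun (congrArg ModuleCat.Hom.hom hφ) y, fun y => by
      rw [LinearMap.comp_apply, u'.h₁, LinearMap.comp_apply, hd]⟩
  let w : Lift P i' p' ν := ⟨ζ ∘ₗ u.u₀, β ∘ₗ u.u₁, fun y => by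
      rw [LinearMap.comp_apply, h₀, u.h₀]; rfl, fun y => by
      rw [LinearMap.comp_apply, h₁, u.h₁]; rfl⟩
  have key := S'.lift_unique v w a.hom x.2
  have e1 : TensorProduct.map a.hom v.u₁ =
      u'.u₁.lTensor M' ∘ₗ TensorProduct.map a.hom (φ.f 1).hom := by
    rw [LinearMap.lTensor, ← TensorProduct.map_comp, LinearMap.id_comp]
  have e2 : TensorProduct.map a.hom w.u₁ = TensorProduct.map a.hom β ∘ₗ u.u₁.lTensor M := by
    rw [LinearMap.lTensor, ← TensorProduct.map_comp, LinearMap.comp_id]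
  rw [e1, e2] at key
  exact key

theorem lTensor_prod_eq {M A E : Type u} [AddCommGroup M] [Module R M] [AddCommGroup A] [Module R A]
    [AddCommGroup E] [Module R E] {w w' : M ⊗[R] (A × E)}
    (h : (LinearMap.fst R A E).lTensor M w = (LinearMap.fst R A E).lTensor M w')
    (h' : (LinearMap.snd R A E).lTensor M w = (LinearMap.snd R A E).lTensor M w') : w = w' := by
  have : ∀ w : M ⊗[R] (A × E), w = (LinearMap.inl R A E).lTensor M
      ((LinearMap.fst R A E).lTensor M w) + (LinearMap.inr R A E).lTensor M
      ((LinearMap.snd R A E).lTensor M w) := fun w => by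
    rw [← LinearMap.comp_apply, ← LinearMap.comp_apply, ← LinearMap.lTensor_comp,
      ← LinearMap.lTensor_comp, ← LinearMap.add_apply, ← LinearMap.lTensor_add]
    have e : LinearMap.inl R A E ∘ₗ LinearMap.fst R A E + LinearMap.inr R A E ∘ₗ
        LinearMap.snd R A E = LinearMap.id := by
      refine LinearMap.ext fun y => ?_
      simp
    rw [e, LinearMap.lTensor_id, LinearMap.id_apply]
  rw [this w, this w', h, h']

/-- `P₁ → P₀ × B → Z` is part of the mapping cone of the comparison between the resolution and the
presentation. Its last term `Z` is flat, so the image of `P₁` stays embedded after tensoring, which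
gives `torMap_injective`; right exactness of the tensor product alone gives `mem_range_torMap`. -/
theorem exact_prod (S : FlatPres i p) {P : ProjectiveResolution (ModuleCat.of R N)}
    (u : Lift P i p LinearMap.id) :
    Function.Exact ((P.complex.d 1 0).hom.prod u.u₁) (u.u₀.coprod (-i)) := by
  rintro ⟨a, b⟩
  rw [LinearMap.coprod_apply, LinearMap.neg_apply, add_neg_eq_zero]
  constructor
  · intro h
    have h' : aug P a = 0 := by
      have := u.h₀ a
      rw [h, (S.exact _).2 ⟨b, rfl⟩] at this
      exact this.symm
    obtain ⟨y, rfl⟩ := π_exact P h'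
    exact ⟨y, Prod.ext rfl (S.inj (by rw [← h, ← u.h₁]; rfl))⟩
  · rintro ⟨y, hy⟩
    have h1 : (P.complex.d 1 0).hom y = a := congrArg Prod.fst hy
    have h2 : u.u₁ y = b := congrArg Prod.snd hy
    rw [← h1, ← h2, u.h₁]

theorem surjective_coprod (S : FlatPres i p) {P : ProjectiveResolution (ModuleCat.of R N)}
    (u : Lift P i p LinearMap.id) : Function.Surjective (u.u₀.coprod (-i)) := by
  intro z
  obtain ⟨a, ha⟩ := π_surjective P (p z)
  obtain ⟨b, hb⟩ := (S.exact (u.u₀ a - z)).1 (by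
    rw [map_sub, u.h₀, sub_eq_zero]; exact ha)
  refine ⟨(a, b), ?_⟩
  rw [LinearMap.coprod_apply, LinearMap.neg_apply, hb]
  change u.u₀ a + -(u.u₀ a - z) = z
  abel

theorem torMap_injective (S : FlatPres i p) (M : ModuleCat.{u} R) :
    Function.Injective (S.torMap M) := by
  rw [injective_iff_map_eq_zero]
  intro x hx
  obtain ⟨x, rfl⟩ := torCls_surjective (projectiveResolution (ModuleCat.of R N)) x
  rw [torMap_torCls'] at hx
  revert hx x
  generalize projectiveResolution (ModuleCat.of R N) = P
  intro x
  generalize Classical.choice (S.exists_lift P LinearMap.id) = u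
  intro hx
  rw [torCls_eq_zero]
  have := S.flat
  let δ := (P.complex.d 1 0).hom.prod u.u₁
  have hinj := lTensor_injective_of_flat_quotient (i := (LinearMap.range δ).subtype)
    (p := u.u₀.coprod (-i)) Subtype.val_injective (by
      rw [LinearMap.exact_iff, Submodule.range_subtype, LinearMap.exact_iff.1 (S.exact_prod u)])
    (S.surjective_coprod u) M
  have h1 : δ.rangeRestrict.lTensor M x.1 = 0 := by
    apply hinj
    rw [map_zero, ← LinearMap.comp_apply, ← LinearMap.lTensor_comp]
    apply lTensor_prod_eq
    · rw [← LinearMap.comp_apply, ← LinearMap.lTensor_comp, map_zero]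
      exact x.2
    · rw [← LinearMap.comp_apply, ← LinearMap.lTensor_comp, map_zero]
      exact hx
  -- Since `i` is injective, `δ` has the same kernel as `d 1 0`, namely the image of `d 2 1`; right
  -- exactness then makes `x` a boundary.
  refine (lTensor_exact M (f := (P.complex.d 2 1).hom) (g := δ.rangeRestrict) ?_
    δ.surjective_rangeRestrict x.1).1 h1
  intro y
  rw [← d_exact P y]
  constructor
  · intro h
    exact congrArg (fun t => t.1.1) h
  · intro h
    refine Subtype.ext (Prod.ext h (S.inj ?_))
    change i (u.u₁ y) = i 0
    rw [u.h₁, h, map_zero, map_zero]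

theorem mem_range_torMap (S : FlatPres i p) (M : ModuleCat.{u} R) {y : M ⊗[R] B} :
    y ∈ LinearMap.range (S.torMap M) ↔ i.lTensor M y = 0 := by
  constructor
  · rintro ⟨x, rfl⟩
    obtain ⟨x, rfl⟩ := torCls_surjective (projectiveResolution (ModuleCat.of R N)) x
    rw [torMap_torCls']
    generalize Classical.choice (S.exists_lift _ LinearMap.id) = u
    rw [← LinearMap.comp_apply, ← LinearMap.lTensor_comp]
    have : i ∘ₗ u.u₁ = u.u₀ ∘ₗ ((projectiveResolution (ModuleCat.of R N)).complex.d 1 0).hom :=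
      LinearMap.ext u.h₁
    rw [this, LinearMap.lTensor_comp, LinearMap.comp_apply, x.2, map_zero]
  · intro hy
    let P := projectiveResolution (ModuleCat.of R N)
    let u := Classical.choice (S.exists_lift P LinearMap.id)
    obtain ⟨x, hx⟩ := (lTensor_exact M (S.exact_prod u) (S.surjective_coprod u)
      ((LinearMap.inr R _ B).lTensor M y)).1 (by
        rw [← LinearMap.comp_apply, ← LinearMap.lTensor_comp, LinearMap.coprod_inr,
          LinearMap.lTensor_neg, LinearMap.neg_apply, hy, neg_zero])
    have h1 := congrArg ((LinearMap.fst R _ B).lTensor M) hx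
    have h2 := congrArg ((LinearMap.snd R _ B).lTensor M) hx
    rw [← LinearMap.comp_apply, ← LinearMap.lTensor_comp, LinearMap.fst_prod,
      ← LinearMap.comp_apply, ← LinearMap.lTensor_comp, LinearMap.fst_comp_inr,
      LinearMap.lTensor_zero, LinearMap.zero_apply] at h1
    rw [← LinearMap.comp_apply, ← LinearMap.lTensor_comp, LinearMap.snd_prod,
      ← LinearMap.comp_apply, ← LinearMap.lTensor_comp, LinearMap.snd_comp_inr,
      LinearMap.lTensor_id, LinearMap.id_apply] at h2
    exact ⟨torCls M P ⟨x, h1⟩, (S.torMap_torCls' M _).trans h2⟩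

end FlatPres

end Tor

end VietorisRips

namespace VietorisRips

instance (n : ℕ) : Fintype {s : ℕ × ℕ // s.1 + s.2 = n} :=
  Fintype.subtype (Finset.HasAntidiagonal.antidiagonal n) fun _ => Finset.HasAntidiagonal.mem_antidiagonal

/-! ### Tensor products of complexes and cross products of classes -/

section Kunneth

variable {R : Type u} [CommRing R]

theorem lTensor_rTensor {A A' E E' : Type*} [AddCommGroup A] [Module R A] [AddCommGroup A']
    [Module R A'] [AddCommGroup E] [Module R E] [AddCommGroup E'] [Module R E'] (f : A →ₗ[R] A')
    (g : E →ₗ[R] E') (x : A ⊗[R] E) :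
    g.lTensor A' (f.rTensor E x) = f.rTensor E' (g.lTensor A x) := by
  rw [← LinearMap.comp_apply, ← LinearMap.comp_apply, LinearMap.rTensor_comp_lTensor,
      LinearMap.lTensor_comp_rTensor]

/-- The tensor product of a complex with a module. -/
abbrev Cx.rT (C : Cx R) (N : Type u) [AddCommGroup N] [Module R N] : Cx R where
  X n := C.X n ⊗[R] N
  d n := (C.d n).rTensor N
  dd n x := by
    rw [← LinearMap.comp_apply, ← LinearMap.rTensor_comp,
      show C.d (n + 1) ∘ₗ C.d n = 0 from LinearMap.ext (C.dd n), LinearMap.rTensor_zero,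
      LinearMap.zero_apply]

/-- The tensor product of two complexes, as a double complex. -/
abbrev tens (C F : Cx R) : DCx R where
  X p q := C.X p ⊗[R] F.X q
  h p q := (C.d p).rTensor (F.X q)
  v p q := (F.d q).lTensor (C.X p)
  hh p q x := (C.rT (F.X q)).dd p x
  vv p q x := by
    rw [← LinearMap.comp_apply, ← LinearMap.lTensor_comp,
      show F.d (q + 1) ∘ₗ F.d q = 0 from LinearMap.ext (F.dd q), LinearMap.lTensor_zero,
      LinearMap.zero_apply]
  hv p q x := by
    rw [← LinearMap.comp_apply, ← LinearMap.comp_apply, LinearMap.rTensor_comp_lTensor,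
      LinearMap.lTensor_comp_rTensor]

variable {C C' F F' : Cx R}

/-- The functoriality of the tensor product of complexes. -/
def tensMap (f : Cx.Hom C C') (g : Cx.Hom F F') : DCx.Hom (tens C F) (tens C' F') where
  f p q := TensorProduct.map (f.f p) (g.f q)
  comm_h p q x := by
    change TensorProduct.map (f.f (p + 1)) (g.f q) ((C.d p).rTensor _ x) =
      (C'.d p).rTensor _ (TensorProduct.map (f.f p) (g.f q) x)
    rw [← LinearMap.comp_apply, ← LinearMap.comp_apply, LinearMap.map_comp_rTensor,
      LinearMap.rTensor_comp_map, show f.f (p + 1) ∘ₗ C.d p = C'.d p ∘ₗ f.f p from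
        LinearMap.ext (f.comm p)]
  comm_v p q x := by
    change TensorProduct.map (f.f p) (g.f (q + 1)) ((F.d q).lTensor _ x) =
      (F'.d q).lTensor _ (TensorProduct.map (f.f p) (g.f q) x)
    rw [← LinearMap.comp_apply, ← LinearMap.comp_apply, LinearMap.map_comp_lTensor,
      LinearMap.lTensor_comp_map, show g.f (q + 1) ∘ₗ F.d q = F'.d q ∘ₗ g.f q from
        LinearMap.ext (g.comm q)]

section Coefficients

variable (C) (N : Type u) [AddCommGroup N] [Module R N]

/-- The inclusion of `Z ⊗ N` into the cocycles of `C ⊗ N`. -/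
def zι (n : ℕ) : C.Z n ⊗[R] N →ₗ[R] (C.rT N).Z n :=
  ((C.Z n).subtype.rTensor N).codRestrict _ fun w => by
    change (C.d n).rTensor N ((C.Z n).subtype.rTensor N w) = 0
    rw [← LinearMap.comp_apply, ← LinearMap.rTensor_comp,
      show C.d n ∘ₗ (C.Z n).subtype = 0 from LinearMap.ext fun z => z.2, LinearMap.rTensor_zero,
      LinearMap.zero_apply]

theorem zι_coe (n : ℕ) (w : C.Z n ⊗[R] N) : (zι C N n w : C.X n ⊗[R] N) =
    (C.Z n).subtype.rTensor N w := rfl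

/-- The comparison map `H(C) ⊗ N → H(C ⊗ N)`. -/
def μ (n : ℕ) : C.H n ⊗[R] N →ₗ[R] (C.rT N).H n :=
  TensorProduct.lift (Submodule.liftQ _ (TensorProduct.curry ((C.rT N).cls n ∘ₗ zι C N n)) (by
    intro z hz
    refine LinearMap.ext fun y => Cx.cls_eq_zero.2 ?_
    change (z.1 ⊗ₜ[R] y : C.X n ⊗[R] N) ∈ (C.rT N).B n
    have hz' : z.1 ∈ C.B n := hz
    cases n with
    | zero =>
      have h : z.1 = 0 := hz'
      rw [h, TensorProduct.zero_tmul]; exact zero_mem _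
    | succ n =>
      obtain ⟨c, hc⟩ := hz'
      rw [← hc]; exact ⟨c ⊗ₜ y, rfl⟩))

theorem μ_cls (n : ℕ) (w : C.Z n ⊗[R] N) :
    μ C N n ((C.cls n).rTensor N w) = (C.rT N).cls n (zι C N n w) := by
  rw [← LinearMap.comp_apply, ← LinearMap.comp_apply]
  congr 1
  exact TensorProduct.ext' fun _ _ => rfl

theorem mem_B_of_cls {n : ℕ} {w : C.Z n ⊗[R] N} (h : (C.cls n).rTensor N w = 0) :
    (C.Z n).subtype.rTensor N w ∈ (C.rT N).B n :=
  Cx.cls_eq_zero.1 (by rw [← μ_cls, h, map_zero] : (C.rT N).cls n (zι C N n w) = 0)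

variable [Module.Flat R N]

theorem zι_inj (n : ℕ) : Function.Injective ((C.Z n).subtype.rTensor N) :=
  Module.Flat.rTensor_preserves_injective_linearMap _ Subtype.val_injective

variable {C N}

theorem exists_zι {n : ℕ} {x : C.X n ⊗[R] N} (hx : (C.d n).rTensor N x = 0) :
    ∃ w, (C.Z n).subtype.rTensor N w = x :=
  (Module.Flat.rTensor_exact N (LinearMap.exact_subtype_ker_map (C.d n)) x).1 hx

variable (C N)

/-- Tensoring with the flat module `N` preserves kernels, so `Z ⊗ N` is the module of all cocycles
of `C ⊗ N`; coboundaries correspond by right exactness. -/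
theorem μ_bijective (n : ℕ) : Function.Bijective (μ C N n) := by
  constructor
  · rw [injective_iff_map_eq_zero]
    intro x hx
    obtain ⟨w, rfl⟩ := LinearMap.rTensor_surjective N (Cx.cls_surjective n) x
    rw [μ_cls] at hx
    have h := Cx.cls_eq_zero.1 hx
    rw [zι_coe] at h
    cases n with
    | zero =>
      have h0 : (C.Z 0).subtype.rTensor N w = 0 := h
      rw [← map_zero ((C.Z 0).subtype.rTensor N)] at h0
      rw [zι_inj C N 0 h0, map_zero]
    | succ n =>
      obtain ⟨c, hc⟩ := h
      let d' : C.X n →ₗ[R] C.Z (n + 1) := (C.d n).codRestrict _ (C.dd n)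
      have h0 : w = d'.rTensor N c := zι_inj C N (n + 1) (by
        rw [← hc, ← LinearMap.comp_apply, ← LinearMap.rTensor_comp]
        rfl)
      rw [h0, ← LinearMap.comp_apply, ← LinearMap.rTensor_comp,
        show C.cls (n + 1) ∘ₗ d' = 0 from LinearMap.ext fun y =>
          Cx.cls_eq_zero.2 (Cx.d_mem_B y), LinearMap.rTensor_zero, LinearMap.zero_apply]
  · intro y
    obtain ⟨z, rfl⟩ := Cx.cls_surjective n y
    obtain ⟨w, hw⟩ := exists_zι (C := C) (N := N) (x := z.1) z.2
    exact ⟨(C.cls n).rTensor N w, (μ_cls C N n w).trans (congrArg _ (Subtype.ext hw))⟩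

variable {C N}

theorem cls_rTensor_eq_zero {n : ℕ} {w : C.Z n ⊗[R] N}
    (h : (C.Z n).subtype.rTensor N w ∈ (C.rT N).B n) : (C.cls n).rTensor N w = 0 := by
  apply (μ_bijective C N n).1
  rw [μ_cls, map_zero]
  exact Cx.cls_eq_zero.2 h

end Coefficients

variable (F) in
/-- The inclusion of the coboundaries into the cocycles. -/
def iB (q : ℕ) : LinearMap.range (F.d q) →ₗ[R] F.Z (q + 1) :=
  Submodule.inclusion (Cx.B_le_Z (K := F) (q + 1))

theorem cls_iB (q : ℕ) : F.cls (q + 1) ∘ₗ iB F q = 0 :=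
  LinearMap.ext fun b => Cx.cls_eq_zero.2 b.2

variable (C F) in
/-- The product of cocycles. -/
def zz {n : ℕ} (p q : ℕ) (e : p + q = n) : C.Z p ⊗[R] F.Z q →ₗ[R] (tens C F).tot.Z n :=
  LinearMap.codRestrict _
    ((tens C F).inc p q e ∘ₗ TensorProduct.map (C.Z p).subtype (F.Z q).subtype) fun w => by
    change (tens C F).inc p q e (TensorProduct.map _ _ w) ∈ _
    induction w with
    | zero => rw [map_zero, map_zero]; exact zero_mem _
    | add x y hx hy => rw [map_add, map_add]; exact add_mem hx hy
    | tmul x y =>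
      change (tens C F).D n ((tens C F).inc p q e (x.1 ⊗ₜ[R] y.1)) = 0
      rw [DCx.D_inc]
      change (tens C F).inc _ _ _ (C.d p x.1 ⊗ₜ[R] y.1) + (-1 : R) ^ p •
          (tens C F).inc _ _ _ (x.1 ⊗ₜ[R] F.d q y.1) = _
      rw [show F.d q y.1 = 0 from y.2, show C.d p x.1 = 0 from x.2, TensorProduct.tmul_zero,
        TensorProduct.zero_tmul, map_zero, map_zero, smul_zero, add_zero]

variable (C F) in
/-- The product of cohomology classes. -/
def kα {n : ℕ} (p q : ℕ) (e : p + q = n) : C.H p ⊗[R] F.H q →ₗ[R] (tens C F).tot.H n :=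
  TensorProduct.lift (LinearMap.flip (Submodule.liftQ _ (LinearMap.flip (Submodule.liftQ _
    (TensorProduct.curry ((tens C F).tot.cls n ∘ₗ zz C F p q e)) (by
    intro z hz
    refine LinearMap.ext fun y => Cx.cls_eq_zero.2 ?_
    change (tens C F).inc p q e (z.1 ⊗ₜ[R] y.1) ∈ (tens C F).tot.B n
    have hz' : z.1 ∈ C.B p := hz
    cases p with
    | zero =>
      have h : z.1 = 0 := hz'
      rw [h, TensorProduct.zero_tmul, map_zero]; exact zero_mem _
    | succ p =>
      obtain ⟨c, hc⟩ := hz'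
      cases n with
      | zero => omega
      | succ n =>
        refine ⟨(tens C F).inc p q (by omega) (c ⊗ₜ[R] y.1), ?_⟩
        change (tens C F).D n _ = _
        rw [DCx.D_inc]
        change (tens C F).inc _ _ _ (C.d p c ⊗ₜ[R] y.1) + (-1 : R) ^ p •
          (tens C F).inc _ _ _ (c ⊗ₜ[R] F.d q y.1) = _
        rw [show F.d q y.1 = 0 from y.2, TensorProduct.tmul_zero, map_zero, smul_zero, add_zero,
          hc]))) (by
    intro y hy
    refine LinearMap.ext fun x => ?_
    obtain ⟨z, rfl⟩ := Cx.cls_surjective p x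
    refine Cx.cls_eq_zero.2 ?_
    change (tens C F).inc p q e (z.1 ⊗ₜ[R] y.1) ∈ (tens C F).tot.B n
    have hy' : y.1 ∈ F.B q := hy
    cases q with
    | zero =>
      have h : y.1 = 0 := hy'
      rw [h, TensorProduct.tmul_zero, map_zero]; exact zero_mem _
    | succ q =>
      obtain ⟨c, hc⟩ := hy'
      cases n with
      | zero => omega
      | succ n =>
        refine ⟨(-1 : R) ^ p • (tens C F).inc p q (by omega) (z.1 ⊗ₜ[R] c), ?_⟩
        change (tens C F).D n _ = _
        rw [map_smul, DCx.D_inc]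
        change (-1 : R) ^ p • ((tens C F).inc _ _ _ (C.d p z.1 ⊗ₜ[R] c) + (-1 : R) ^ p •
          (tens C F).inc _ _ _ (z.1 ⊗ₜ[R] F.d q c)) = _
        rw [show C.d p z.1 = 0 from z.2, TensorProduct.zero_tmul, map_zero, zero_add,
          DCx.sign_sign, hc])))

theorem kα_cls {n : ℕ} (p q : ℕ) (e : p + q = n) (w : C.Z p ⊗[R] F.Z q) :
    kα C F p q e (TensorProduct.map (C.cls p) (F.cls q) w) =
      (tens C F).tot.cls n (zz C F p q e w) := by
  have : kα C F p q e ∘ₗ TensorProduct.map (C.cls p) (F.cls q) =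
      (tens C F).tot.cls n ∘ₗ zz C F p q e := TensorProduct.ext' fun _ _ => rfl
  exact LinearMap.congr_fun this w

theorem kα_natural (f : Cx.Hom C C') (g : Cx.Hom F F') {n : ℕ} (p q : ℕ) (e : p + q = n)
    (x : C.H p ⊗[R] F.H q) : (tensMap f g).tot.mapH n (kα C F p q e x) =
      kα C' F' p q e (TensorProduct.map (f.mapH p) (g.mapH q) x) := by
  rw [← LinearMap.comp_apply, ← LinearMap.comp_apply]
  congr 1
  refine TensorProduct.ext' fun x y => ?_
  obtain ⟨x, rfl⟩ := Cx.cls_surjective p x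
  obtain ⟨y, rfl⟩ := Cx.cls_surjective q y
  refine congrArg ((tens C' F').tot.cls n) (Subtype.ext ?_)
  exact DCx.hom_tot_inc (tensMap f g) e (x.1 ⊗ₜ[R] y.1)

variable (F) in
/-- The differential as a map onto the coboundaries. -/
abbrev bq (q : ℕ) : F.X q →ₗ[R] LinearMap.range (F.d q) := (F.d q).rangeRestrict

/-- Projecting the second factor onto coboundaries leaves only the horizontal part of the total
differential. Each entry of a total cocycle thus becomes a cocycle of `C ⊗ B(F)`, and each entry of
a coboundary a coboundary, so the torsion map can be defined one entry at a time. -/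
theorem bq_vPart {n : ℕ} (p q : ℕ) (e : p + q = n + 1) (x : (tens C F).totX n) :
    (bq F q).lTensor (C.X p) ((tens C F).vPart p q e x) = 0 := by
  cases q with
  | zero => rw [DCx.vPart_zero, map_zero]
  | succ q =>
    rw [DCx.vPart_succ]
    change (bq F (q + 1)).lTensor _ ((F.d q).lTensor _ _) = 0
    rw [← LinearMap.comp_apply, ← LinearMap.lTensor_comp, show bq F (q + 1) ∘ₗ F.d q = 0 from
      LinearMap.ext fun y => Subtype.ext (F.dd q y), LinearMap.lTensor_zero, LinearMap.zero_apply]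

theorem bq_hPart {n : ℕ} (p q : ℕ) (e : p + 1 + q = n + 1) (x : (tens C F).totX n) :
    (bq F q).lTensor (C.X (p + 1)) ((tens C F).hPart (p + 1) q e x) =
      (C.d p).rTensor _ ((bq F q).lTensor (C.X p) ((tens C F).pr p q (by omega) x)) := by
  rw [DCx.hPart_succ]
  exact lTensor_rTensor _ _ _

theorem bq_hPart_zero {n : ℕ} (p q : ℕ) (e : p + q = n) {x : (tens C F).totX n}
    (h : (bq F q).lTensor (C.X (p + 1)) ((tens C F).pr (p + 1) q (by omega)
      ((tens C F).D n x)) = 0) :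
    (C.d p).rTensor _ ((bq F q).lTensor (C.X p) ((tens C F).pr p q e x)) = 0 := by
  rw [DCx.pr_D, map_add, bq_hPart, map_smul, bq_vPart, smul_zero, add_zero] at h
  exact h

theorem bq_zz (p q : ℕ) (w : C.Z p ⊗[R] F.Z q) :
    (bq F q).lTensor (C.X p) (TensorProduct.map (C.Z p).subtype (F.Z q).subtype w) = 0 := by
  rw [← LinearMap.comp_apply, LinearMap.lTensor_comp_map, show bq F q ∘ₗ (F.Z q).subtype = 0 from
      LinearMap.ext fun y => Subtype.ext y.2, TensorProduct.map_zero_right, LinearMap.zero_apply]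

theorem exact_subtype_bq (q : ℕ) : Function.Exact (F.Z q).subtype (bq F q) := fun x => by
  constructor
  · intro h; exact ⟨⟨x, congrArg Subtype.val h⟩, rfl⟩
  · rintro ⟨z, rfl⟩; exact Subtype.ext z.2

section

variable {n : ℕ} (p q : ℕ) (e : p + q = n)

theorem bq_pr_mem_Z {t : (tens C F).totX n} (ht : t ∈ (tens C F).tot.Z n) :
    (bq F q).lTensor (C.X p) ((tens C F).pr p q e t) ∈ (C.rT (LinearMap.range (F.d q))).Z p :=
  bq_hPart_zero p q e (by
    rw [show (tens C F).D n t = 0 from ht, map_zero, map_zero])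

theorem bq_pr_mem_B {t : (tens C F).totX n} (ht : t ∈ (tens C F).tot.B n) :
    (bq F q).lTensor (C.X p) ((tens C F).pr p q e t) ∈ (C.rT (LinearMap.range (F.d q))).B p := by
  cases n with
  | zero =>
    have h : t = 0 := ht
    rw [h, map_zero, map_zero]; exact zero_mem _
  | succ n =>
    obtain ⟨r, hr⟩ := ht
    have hr' : (tens C F).D n r = t := hr
    rw [← hr', DCx.pr_D, map_add, map_smul, bq_vPart, smul_zero, add_zero]
    cases p with
    | zero => rw [DCx.hPart_zero, map_zero]; exact zero_mem _
    | succ p => rw [bq_hPart]; exact ⟨_, rfl⟩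

end

end Kunneth

end VietorisRips

namespace VietorisRips

/-! ### The torsion map and exactness of the algebraic Künneth sequence -/

section Kunneth

variable {R : Type u} [CommRing R] {C C' F F' : Cx R}

theorem lTensor_lTensor {A E E' E'' : Type*} [AddCommGroup A] [Module R A]
    [AddCommGroup E] [Module R E] [AddCommGroup E'] [Module R E'] [AddCommGroup E''] [Module R E'']
    {f : E →ₗ[R] E'} {g : E' →ₗ[R] E''} {k : E →ₗ[R] E''} (h : ∀ x, g (f x) = k x)
    (x : A ⊗[R] E) : g.lTensor A (f.lTensor A x) = k.lTensor A x := by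
  rw [← LinearMap.comp_apply, ← LinearMap.lTensor_comp, show g ∘ₗ f = k from LinearMap.ext h]

theorem lTensor_lTensor_zero {A E E' E'' : Type*} [AddCommGroup A] [Module R A]
    [AddCommGroup E] [Module R E] [AddCommGroup E'] [Module R E'] [AddCommGroup E''] [Module R E'']
    {f : E →ₗ[R] E'} {g : E' →ₗ[R] E''} (h : ∀ x, g (f x) = 0) (x : A ⊗[R] E) :
    g.lTensor A (f.lTensor A x) = 0 := by
  rw [lTensor_lTensor (k := 0) h, LinearMap.lTensor_zero, LinearMap.zero_apply]

theorem map_eq {A A' E E' : Type*} [AddCommGroup A] [Module R A] [AddCommGroup A']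
    [Module R A'] [AddCommGroup E] [Module R E] [AddCommGroup E'] [Module R E'] (f : A →ₗ[R] A')
    (g : E →ₗ[R] E') (x : A ⊗[R] E) :
    TensorProduct.map f g x = g.lTensor A' (f.rTensor E x) := by
  rw [← LinearMap.comp_apply, LinearMap.lTensor_comp_rTensor]

theorem map_eq' {A A' E E' : Type*} [AddCommGroup A] [Module R A] [AddCommGroup A']
    [Module R A'] [AddCommGroup E] [Module R E] [AddCommGroup E'] [Module R E'] (f : A →ₗ[R] A')
    (g : E →ₗ[R] E') (x : A ⊗[R] E) :
    TensorProduct.map f g x = f.rTensor E' (g.lTensor A x) := by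
  rw [← LinearMap.comp_apply, LinearMap.rTensor_comp_lTensor]

variable (C F) in
/-- The family of products of cocycles. -/
def zzPi {n : ℕ} (w : ∀ s : {s : ℕ × ℕ // s.1 + s.2 = n}, C.Z s.1.1 ⊗[R] F.Z s.1.2) :
    (tens C F).totX n :=
  fun s => TensorProduct.map (C.Z s.1.1).subtype (F.Z s.1.2).subtype (w s)

theorem zzPi_eq {n : ℕ} (w : ∀ s : {s : ℕ × ℕ // s.1 + s.2 = n}, C.Z s.1.1 ⊗[R] F.Z s.1.2) :
    (∑ s, (zz C F s.1.1 s.1.2 s.2 (w s)).1) = zzPi C F w :=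
  Finset.univ_sum_single (zzPi C F w)

theorem zzPi_mem {n : ℕ} (w : ∀ s : {s : ℕ × ℕ // s.1 + s.2 = n}, C.Z s.1.1 ⊗[R] F.Z s.1.2) :
    zzPi C F w ∈ (tens C F).tot.Z n := by
  rw [← zzPi_eq]
  exact sum_mem fun s _ => (zz C F s.1.1 s.1.2 s.2 (w s)).2

/-- The sum of the products of classes. -/
theorem sum_kα {n : ℕ} (w : ∀ s : {s : ℕ × ℕ // s.1 + s.2 = n}, C.Z s.1.1 ⊗[R] F.Z s.1.2) :
    ∑ s, kα C F s.1.1 s.1.2 s.2 (TensorProduct.map (C.cls s.1.1) (F.cls s.1.2) (w s)) =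
      (tens C F).tot.cls n ⟨zzPi C F w, zzPi_mem w⟩ := by
  simp only [kα_cls]
  rw [← map_sum]
  refine congrArg _ (Subtype.ext ?_)
  rw [Submodule.coe_sum]
  exact zzPi_eq w

/-- Primitives of the projected entries are lifted along the surjections onto `B(F)` to a cochain
`r`; its total coboundary has the same projected entries as `t`. In column `0` there are no
horizontal coboundaries, so the projected entry is zero already. -/
theorem exists_modify {n : ℕ} {t : (tens C F).totX n}
    (ht : ∀ p q e, (bq F q).lTensor (C.X p) ((tens C F).pr p q e t) ∈
      (C.rT (LinearMap.range (F.d q))).B p) :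
    ∃ b ∈ (tens C F).tot.B n, ∀ p q e,
      (bq F q).lTensor (C.X p) ((tens C F).pr p q e (t - b)) = 0 := by
  cases n with
  | zero =>
    refine ⟨0, zero_mem _, fun p q e => ?_⟩
    obtain rfl : p = 0 := by omega
    rw [sub_zero]
    exact ht 0 q e
  | succ n =>
    have hr : ∀ s : {s : ℕ × ℕ // s.1 + s.2 = n}, ∃ r : C.X s.1.1 ⊗[R] F.X s.1.2,
        (C.d s.1.1).rTensor _ ((bq F s.1.2).lTensor _ r) = (bq F s.1.2).lTensor (C.X (s.1.1 + 1))
          ((tens C F).pr (s.1.1 + 1) s.1.2 (by have := s.2; omega) t) := by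
      intro s
      obtain ⟨y, hy⟩ := ht (s.1.1 + 1) s.1.2 (by have := s.2; omega)
      obtain ⟨r, rfl⟩ := LinearMap.lTensor_surjective (C.X s.1.1)
        (F.d s.1.2).surjective_rangeRestrict y
      exact ⟨r, hy⟩
    choose r hr using hr
    refine ⟨(tens C F).D n r, ⟨r, rfl⟩, fun p q e => ?_⟩
    rw [map_sub, map_sub, DCx.pr_D, map_add, map_smul, bq_vPart, smul_zero, add_zero]
    cases p with
    | zero =>
      rw [DCx.hPart_zero, map_zero, sub_zero]
      exact ht 0 q e
    | succ p =>
      rw [bq_hPart, sub_eq_zero]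
      exact (hr ⟨(p, q), by omega⟩).symm

variable [IsDomain R] [IsPrincipalIdealRing R]

/-- Complexes of flat modules. -/
class Cx.IsFlat (F : Cx R) : Prop where
  flat : ∀ q, Module.Flat R (F.X q)

attribute [instance] Cx.IsFlat.flat

instance [F.IsFlat] (q : ℕ) : Module.Flat R (F.Z q) := flat_submodule _

instance [F.IsFlat] (q : ℕ) : Module.Flat R (LinearMap.range (F.d q)) := flat_submodule _

/-- The sequence `B → Z → H` is itself a flat presentation, as submodules of flat modules are flat
here. Only degrees `q + 1` occur: `H^0` is a submodule of a flat module and contributes no torsion.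
-/
theorem flatPres [F.IsFlat] (q : ℕ) : FlatPres (iB F q) (F.cls (q + 1)) where
  inj := Submodule.inclusion_injective _
  exact z := by
    rw [Cx.cls_eq_zero]
    exact ⟨fun h => ⟨⟨z.1, h⟩, rfl⟩, by rintro ⟨b, rfl⟩; exact b.2⟩
  surj := Cx.cls_surjective _
  flat := inferInstance

theorem lTensor_Z_injective [F.IsFlat] (q : ℕ) (M : Type u) [AddCommGroup M] [Module R M] :
    Function.Injective ((F.Z q).subtype.lTensor M) :=
  lTensor_injective_of_flat_quotient Subtype.val_injective (exact_subtype_bq q)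
    (F.d q).surjective_rangeRestrict M

section Beta

variable [F.IsFlat] {n : ℕ} (p q : ℕ) (e : p + q = n)

variable (C F) in
/-- The map to `H(C) ⊗ B(F)`. -/
def kβ' : (tens C F).tot.H n →ₗ[R] C.H p ⊗[R] LinearMap.range (F.d q) :=
  (LinearEquiv.ofBijective _ (μ_bijective C (LinearMap.range (F.d q)) p)).symm.toLinearMap ∘ₗ
    Submodule.mapQ _ _ (((bq F q).lTensor (C.X p) ∘ₗ (tens C F).pr p q e).restrict
      fun _ ht => bq_pr_mem_Z p q e ht) fun _ ht => bq_pr_mem_B p q e ht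

theorem μ_kβ' (z : (tens C F).tot.Z n) : μ C _ p (kβ' C F p q e ((tens C F).tot.cls n z)) =
    (C.rT (LinearMap.range (F.d q))).cls p ⟨_, bq_pr_mem_Z p q e z.2⟩ :=
  (LinearEquiv.ofBijective _ (μ_bijective C (LinearMap.range (F.d q)) p)).apply_symm_apply _

theorem kβ'_cls {z : (tens C F).tot.Z n} {w : C.Z p ⊗[R] LinearMap.range (F.d q)}
    (h : (C.Z p).subtype.rTensor _ w = (bq F q).lTensor (C.X p) ((tens C F).pr p q e z.1)) :
    kβ' C F p q e ((tens C F).tot.cls n z) = (C.cls p).rTensor _ w := by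
  apply (μ_bijective C (LinearMap.range (F.d q)) p).1
  rw [μ_kβ', μ_cls]
  exact congrArg _ (Subtype.ext h.symm)

theorem kβ'_eq_zero {z : (tens C F).tot.Z n} : kβ' C F p q e ((tens C F).tot.cls n z) = 0 ↔
    (bq F q).lTensor (C.X p) ((tens C F).pr p q e z.1) ∈
      (C.rT (LinearMap.range (F.d q))).B p := by
  rw [← map_eq_zero_iff _ (μ_bijective C (LinearMap.range (F.d q)) p).1, μ_kβ']
  exact Cx.cls_eq_zero

/-- The cocycle equation at `(p, q + 1)` says that the vertical differential of the entry at `(p,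
q)` is, up to sign, a horizontal coboundary. Its class in `H(C) ⊗ Z(F)` is therefore zero, which
places the value of `kβ'` in the kernel that is the torsion product. -/
theorem lTensor_iB_kβ' (x : (tens C F).tot.H n) : (iB F q).lTensor _ (kβ' C F p q e x) = 0 := by
  obtain ⟨z, rfl⟩ := Cx.cls_surjective n x
  obtain ⟨w, hw⟩ := exists_zι (bq_pr_mem_Z p q e z.2)
  rw [kβ'_cls p q e hw, lTensor_rTensor]
  apply lTensor_Z_injective (F := F) (q + 1)
  rw [map_zero, lTensor_rTensor, lTensor_lTensor (k := (LinearMap.range (F.d q)).subtype)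
    fun _ => rfl]
  apply cls_rTensor_eq_zero
  rw [← lTensor_rTensor, hw, lTensor_lTensor (k := F.d q) fun _ => rfl]
  have hz : (tens C F).D n z.1 = 0 := z.2
  have h := congrArg ((tens C F).pr p (q + 1) (by omega)) hz
  rw [DCx.pr_D, map_zero, DCx.vPart_succ] at h
  cases p with
  | zero =>
    rw [DCx.hPart_zero, zero_add] at h
    have h' : (F.d q).lTensor (C.X 0) ((tens C F).pr 0 q e z.1) = 0 := DCx.smul_sign_eq_zero h
    rw [h']; exact zero_mem _
  | succ p =>
    rw [DCx.hPart_succ] at h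
    have h' := congrArg (fun y => (-1 : R) ^ (p + 1) • y) (add_eq_zero_iff_eq_neg.1 h)
    rw [smul_neg, DCx.sign_sign] at h'
    have h'' : (F.d q).lTensor (C.X (p + 1)) ((tens C F).pr (p + 1) q e z.1) =
      -((-1 : R) ^ (p + 1) • (C.d p).rTensor _ ((tens C F).pr p (q + 1) (by omega) z.1)) := by
      refine (neg_neg _).symm.trans (congrArg Neg.neg h'.symm)
    rw [h'']
    exact neg_mem (Submodule.smul_mem _ _ ⟨_, rfl⟩)

variable (C F) in
/-- The map to the torsion product. -/
def kβ : (tens C F).tot.H n →ₗ[R] tor₁ (ModuleCat.of R (C.H p)) (ModuleCat.of R (F.H (q + 1))) :=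
  (LinearEquiv.ofInjective _ ((flatPres (F := F) q).torMap_injective
    (ModuleCat.of R (C.H p)))).symm.toLinearMap ∘ₗ
    (kβ' C F p q e).codRestrict _ fun x =>
      ((flatPres (F := F) q).mem_range_torMap (ModuleCat.of R (C.H p))).2 (lTensor_iB_kβ' p q e x)

theorem torMap_kβ (x : (tens C F).tot.H n) :
    (flatPres (F := F) q).torMap (ModuleCat.of R (C.H p)) (kβ C F p q e x) = kβ' C F p q e x :=
  congrArg Subtype.val ((LinearEquiv.ofInjective _ ((flatPres (F := F) q).torMap_injective
    (ModuleCat.of R (C.H p)))).apply_symm_apply _)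

theorem kβ_eq_zero {x : (tens C F).tot.H n} : kβ C F p q e x = 0 ↔ kβ' C F p q e x = 0 := by
  rw [← torMap_kβ]
  exact (map_eq_zero_iff _ ((flatPres (F := F) q).torMap_injective _)).symm

theorem kβ_natural [F'.IsFlat] (f : Cx.Hom C C') (g : Cx.Hom F F') (x : (tens C F).tot.H n) :
    tor₁Map (ModuleCat.ofHom (f.mapH p)) (ModuleCat.ofHom (g.mapH (q + 1))) (kβ C F p q e x) =
      kβ C' F' p q e ((tensMap f g).tot.mapH n x) := by
  apply (flatPres (F := F') q).torMap_injective (ModuleCat.of R (C'.H p))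
  let β : LinearMap.range (F.d q) →ₗ[R] LinearMap.range (F'.d q) :=
    (g.f (q + 1)).restrict fun _ h => g.map_B (n := q + 1) h
  rw [(flatPres (F := F) q).torMap_natural (flatPres (F := F') q)
    (M := ModuleCat.of R (C.H p)) (M' := ModuleCat.of R (C'.H p))
    (ModuleCat.ofHom (f.mapH p)) β (g.mapZ (q + 1)) (g.mapH (q + 1)) (fun _ => rfl) (fun _ => rfl),
    torMap_kβ, torMap_kβ]
  obtain ⟨z, rfl⟩ := Cx.cls_surjective n x
  obtain ⟨w, hw⟩ := exists_zι (bq_pr_mem_Z p q e z.2)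
  rw [kβ'_cls p q e hw, Cx.Hom.mapH_cls]
  rw [kβ'_cls (w := TensorProduct.map (f.mapZ p) β w) p q e]
  · change TensorProduct.map (f.mapH p) β _ = _
    rw [← LinearMap.comp_apply, ← LinearMap.comp_apply, LinearMap.map_comp_rTensor,
      LinearMap.rTensor_comp_map]
    rfl
  · rw [Cx.Hom.mapZ_coe, DCx.Hom.pr_tot]
    change _ = (bq F' q).lTensor _ (TensorProduct.map (f.f p) (g.f q) _)
    rw [← LinearMap.comp_apply, ← LinearMap.comp_apply, LinearMap.rTensor_comp_map,
      LinearMap.lTensor_comp_map, show bq F' q ∘ₗ g.f q = β ∘ₗ bq F q from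
        LinearMap.ext fun y => Subtype.ext (g.comm q y).symm]
    have : TensorProduct.map (f.f p) (β ∘ₗ bq F q) =
        TensorProduct.map (f.f p) β ∘ₗ (bq F q).lTensor _ := by rw [LinearMap.map_comp_lTensor]
    rw [this, LinearMap.comp_apply, ← hw, ← LinearMap.comp_apply, LinearMap.map_comp_rTensor]
    rfl

/-- A torsion element is represented by some `w` in `Z(C) ⊗ F^q`. As its image in `H(C) ⊗ Z(F)`
vanishes, the vertical differential of `w` is the horizontal differential of some `r` with values in
`Z(F)`, and `w ± r` is a total cocycle. Projection to coboundaries kills `r`, so no other torsion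
component appears. -/
theorem kβ_surjective (u : tor₁ (ModuleCat.of R (C.H p)) (ModuleCat.of R (F.H (q + 1)))) :
    ∃ x, kβ C F p q e x = u ∧ ∀ p' q' e', p' ≠ p → kβ C F (n := n) p' q' e' x = 0 := by
  set v : C.H p ⊗[R] LinearMap.range (F.d q) :=
    (flatPres (F := F) q).torMap (ModuleCat.of R (C.H p)) u with hv
  have hv0 : (iB F q).lTensor (C.H p) v = 0 :=
    ((flatPres (F := F) q).mem_range_torMap (ModuleCat.of R (C.H p))).1 ⟨u, rfl⟩
  obtain ⟨wb, hwb⟩ := LinearMap.rTensor_surjective _ (Cx.cls_surjective (K := C) p) v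
  obtain ⟨w, hw⟩ := LinearMap.lTensor_surjective (C.Z p) (F.d q).surjective_rangeRestrict wb
  suffices h : ∃ t ∈ (tens C F).tot.Z n, (tens C F).pr p q e t = (C.Z p).subtype.rTensor _ w ∧
      ∀ p' q' e', p' ≠ p → (bq F q').lTensor (C.X p') ((tens C F).pr p' q' e' t) = 0 by
    obtain ⟨t, ht, h1, h2⟩ := h
    refine ⟨(tens C F).tot.cls n ⟨t, ht⟩, ?_, fun p' q' e' hp' => ?_⟩
    · apply (flatPres (F := F) q).torMap_injective (ModuleCat.of R (C.H p))
      rw [torMap_kβ, kβ'_cls (w := wb) p q e, hwb]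
      rw [h1, ← hw, ← lTensor_rTensor]
    · rw [kβ_eq_zero, kβ'_eq_zero, h2 p' q' e' hp']
      exact zero_mem _
  have hB := mem_B_of_cls (n := p) C (F.Z (q + 1)) (w := (iB F q).lTensor _ wb) (by
    rw [← lTensor_rTensor, hwb, hv0])
  rw [← hw, lTensor_lTensor (k := (F.d q).codRestrict (F.Z (q + 1)) (F.dd q)) (fun _ => rfl)] at hB
  have hv1 : (F.d q).lTensor (C.X p) ((C.Z p).subtype.rTensor _ w) =
      (F.Z (q + 1)).subtype.lTensor _ ((C.Z p).subtype.rTensor _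
        (((F.d q).codRestrict (F.Z (q + 1)) (F.dd q)).lTensor _ w)) := by
    rw [lTensor_rTensor, lTensor_rTensor, lTensor_lTensor (k := F.d q) fun _ => rfl]
  have hh : (C.d p).rTensor (F.X q) ((C.Z p).subtype.rTensor _ w) = 0 := (zι C (F.X q) p w).2
  have hD : (tens C F).D n ((tens C F).inc p q e ((C.Z p).subtype.rTensor _ w)) =
      (-1 : R) ^ p • (tens C F).inc p (q + 1) (by omega)
        ((F.d q).lTensor (C.X p) ((C.Z p).subtype.rTensor _ w)) := by
    rw [DCx.D_inc]
    change (tens C F).inc (p + 1) q _ ((C.d p).rTensor (F.X q) _) + _ = _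
    rw [hh, map_zero, zero_add]
  -- In column `0` there is no room for the correction `r`, and none is needed: being a coboundary
  -- there means being zero.
  cases p with
  | zero =>
    have hB' : (C.Z 0).subtype.rTensor (F.Z (q + 1))
      (((F.d q).codRestrict (F.Z (q + 1)) (F.dd q)).lTensor _ w) = 0 := hB
    refine ⟨_, ?_, DCx.pr_inc_same e e _, fun p' q' e' hp' => ?_⟩
    · change (tens C F).D n _ = 0
      rw [hD, hv1, hB', map_zero, map_zero, smul_zero]
    · rw [DCx.pr_inc_of_ne _ _ hp', map_zero]
  | succ p =>
    obtain ⟨r, hr⟩ := hB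
    have hr' : (C.d p).rTensor (F.Z (q + 1)) r = _ := hr
    let r' := (F.Z (q + 1)).subtype.lTensor (C.X p) r
    have hr1 : (tens C F).h p (q + 1) r' = (F.d q).lTensor (C.X (p + 1))
        ((C.Z (p + 1)).subtype.rTensor _ w) := by
      rw [hv1, ← hr', lTensor_rTensor]
    have hr2 : (tens C F).v p (q + 1) r' = 0 :=
      lTensor_lTensor_zero (f := (F.Z (q + 1)).subtype) (g := F.d (q + 1)) (fun z => z.2) r
    have hr3 : (bq F (q + 1)).lTensor (C.X p) r' = 0 :=
      lTensor_lTensor_zero (f := (F.Z (q + 1)).subtype) (g := bq F (q + 1))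
        (fun z => Subtype.ext z.2) r
    refine ⟨(tens C F).inc (p + 1) q e ((C.Z (p + 1)).subtype.rTensor _ w) -
      (-1 : R) ^ (p + 1) • (tens C F).inc p (q + 1) (by omega) r', ?_, ?_, fun p' q' e' hp' => ?_⟩
    · change (tens C F).D n _ = 0
      rw [map_sub, hD, map_smul, DCx.D_inc, hr1, hr2, map_zero, smul_zero, add_zero, sub_self]
    · rw [map_sub, map_smul, DCx.pr_inc_same, DCx.pr_inc_of_ne _ _ (by omega), smul_zero, sub_zero]
    · rw [map_sub, map_smul, DCx.pr_inc_of_ne _ _ hp', zero_sub, map_neg, map_smul]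
      by_cases hp : p' = p
      · subst hp
        obtain rfl : q' = q + 1 := by omega
        rw [DCx.pr_inc_same, hr3, smul_zero, neg_zero]
      · rw [DCx.pr_inc_of_ne _ _ hp, map_zero, smul_zero, neg_zero]

end Beta

theorem map_cls_eq_zero_of_hPart [F.IsFlat] (p q : ℕ) {w : C.Z p ⊗[R] F.Z q}
    (h : TensorProduct.map (C.Z p).subtype (F.Z q).subtype w ∈ (C.rT (F.X q)).B p) :
    TensorProduct.map (C.cls p) (F.cls q) w = 0 := by
  rw [map_eq'] at h
  have h1 := cls_rTensor_eq_zero h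
  rw [← lTensor_rTensor] at h1
  have h2 : (C.cls p).rTensor _ w = 0 := lTensor_Z_injective (F := F) q _ (h1.trans (map_zero _).symm)
  rw [map_eq, h2, map_zero]

/-- When all entries of `D t` are products of cocycles, the vertical part comes from `Z(C) ⊗ B(F)`
and has trivial class. Subtracting it leaves a horizontal coboundary, to which
`map_cls_eq_zero_of_hPart` applies; this proves independence of the products. -/
theorem exists_vPart [F.IsFlat] {n : ℕ} {t : (tens C F).totX n}
    {w : ∀ p q, p + q = n + 1 → C.Z p ⊗[R] F.Z q}
    (ht : ∀ p q e, (tens C F).pr p q e ((tens C F).D n t) =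
      TensorProduct.map (C.Z p).subtype (F.Z q).subtype (w p q e)) (p q : ℕ) (e : p + q = n + 1) :
    ∃ w' : C.Z p ⊗[R] F.Z q, TensorProduct.map (C.cls p) (F.cls q) w' = 0 ∧
      TensorProduct.map (C.Z p).subtype (F.Z q).subtype w' = (tens C F).vPart p q e t := by
  cases q with
  | zero => exact ⟨0, map_zero _, by rw [map_zero, DCx.vPart_zero]⟩
  | succ q =>
    have h1 : (C.d p).rTensor _ ((bq F q).lTensor (C.X p) ((tens C F).pr p q (by omega) t)) = 0 :=
      bq_hPart_zero p q (by omega) (by rw [ht, bq_zz])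
    obtain ⟨w', hw'⟩ := exists_zι h1
    refine ⟨(iB F q).lTensor _ w', ?_, ?_⟩
    · rw [map_eq', lTensor_lTensor_zero (LinearMap.congr_fun (cls_iB (F := F) q)), map_zero]
    · rw [map_eq', lTensor_lTensor (k := (LinearMap.range (F.d q)).subtype) fun _ => rfl,
        ← lTensor_rTensor, hw', lTensor_lTensor (k := F.d q) fun _ => rfl, DCx.vPart_succ]

/-- The products of classes are independent. -/
theorem kα_injective [F.IsFlat] {n : ℕ}
    {x : ∀ s : {s : ℕ × ℕ // s.1 + s.2 = n}, C.H s.1.1 ⊗[R] F.H s.1.2}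
    (hx : ∑ s, kα C F s.1.1 s.1.2 s.2 (x s) = 0) : x = 0 := by
  choose w hw using fun s : {s : ℕ × ℕ // s.1 + s.2 = n} => TensorProduct.map_surjective
    (Cx.cls_surjective (K := C) s.1.1) (Cx.cls_surjective (K := F) s.1.2) (x s)
  simp only [← hw] at hx
  rw [sum_kα w, Cx.cls_eq_zero] at hx
  funext s
  rw [← hw s]
  change _ = 0
  obtain ⟨⟨p, q⟩, e⟩ := s
  cases n with
  | zero =>
    have h0 : zzPi C F w = 0 := hx
    apply map_cls_eq_zero_of_hPart
    have := congrFun h0 ⟨(p, q), e⟩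
    exact (congrArg (· ∈ (C.rT (F.X q)).B p) this).mpr (zero_mem _)
  | succ n =>
    obtain ⟨t, ht⟩ := hx
    have ht' : ∀ p q e, (tens C F).pr p q e ((tens C F).D n t) =
        TensorProduct.map (C.Z p).subtype (F.Z q).subtype (w ⟨(p, q), e⟩) :=
      fun p q e => congrFun ht ⟨(p, q), e⟩
    obtain ⟨w', h1, h2⟩ := exists_vPart ht' p q e
    have h3 : TensorProduct.map (C.cls p) (F.cls q) (w ⟨(p, q), e⟩ - (-1 : R) ^ p • w') = 0 := by
      apply map_cls_eq_zero_of_hPart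
      rw [map_sub, map_smul, h2, ← ht', DCx.pr_D, add_sub_cancel_right]
      cases p with
      | zero => rw [DCx.hPart_zero]; exact zero_mem _
      | succ p => rw [DCx.hPart_succ]; exact ⟨_, rfl⟩
    rw [map_sub, map_smul, h1, smul_zero, sub_zero] at h3
    exact h3

theorem kβ_kα [F.IsFlat] {n : ℕ}
    (x : ∀ s : {s : ℕ × ℕ // s.1 + s.2 = n}, C.H s.1.1 ⊗[R] F.H s.1.2) (p q : ℕ) (e : p + q = n) :
    kβ C F p q e (∑ s, kα C F s.1.1 s.1.2 s.2 (x s)) = 0 := by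
  choose w hw using fun s : {s : ℕ × ℕ // s.1 + s.2 = n} => TensorProduct.map_surjective
    (Cx.cls_surjective (K := C) s.1.1) (Cx.cls_surjective (K := F) s.1.2) (x s)
  simp only [← hw]
  rw [sum_kα w, kβ_eq_zero, kβ'_eq_zero]
  have := bq_zz (C := C) (F := F) p q (w ⟨(p, q), e⟩)
  have h : (bq F q).lTensor (C.X p) ((tens C F).pr p q e (zzPi C F w)) = 0 := this
  exact (congrArg (· ∈ (C.rT (LinearMap.range (F.d q))).B p) h).mpr (zero_mem _)

/-- After `exists_modify` the entries of the cocycle lie in `C ⊗ Z(F)`. The vertical part of the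
differential is then zero, hence so is the horizontal part, and the entries lie in `Z(C) ⊗ Z(F)`. -/
theorem exists_kα [F.IsFlat] {n : ℕ} {y : (tens C F).tot.H n}
    (hy : ∀ p q e, kβ C F p q e y = 0) :
    ∃ x : ∀ s : {s : ℕ × ℕ // s.1 + s.2 = n}, C.H s.1.1 ⊗[R] F.H s.1.2,
      ∑ s, kα C F s.1.1 s.1.2 s.2 (x s) = y := by
  obtain ⟨z, rfl⟩ := Cx.cls_surjective n y
  obtain ⟨b, hb, hb'⟩ := exists_modify (t := z.1) fun p q e =>
    (kβ'_eq_zero p q e).1 ((kβ_eq_zero p q e).1 (hy p q e))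
  have hD : (tens C F).D n (z.1 - b) = 0 := by
    rw [map_sub, show (tens C F).D n z.1 = 0 from z.2,
      show (tens C F).D n b = 0 from Cx.d_of_mem_B hb, sub_zero]
  have hw : ∀ s : {s : ℕ × ℕ // s.1 + s.2 = n}, ∃ w : C.Z s.1.1 ⊗[R] F.Z s.1.2,
      TensorProduct.map (C.Z s.1.1).subtype (F.Z s.1.2).subtype w =
        (tens C F).pr s.1.1 s.1.2 s.2 (z.1 - b) := by
    rintro ⟨⟨p, q⟩, e⟩
    obtain ⟨s, hs⟩ := (lTensor_exact (C.X p) (exact_subtype_bq (F := F) q)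
      (F.d q).surjective_rangeRestrict _).1 (hb' p q e)
    have h1 : (C.d p).rTensor _ s = 0 := by
      apply lTensor_Z_injective (F := F) q
      rw [map_zero, lTensor_rTensor, hs]
      have h2 := congrArg ((tens C F).pr (p + 1) q (by omega)) hD
      rw [DCx.pr_D, map_zero, DCx.hPart_succ] at h2
      have h3 : (tens C F).vPart (p + 1) q (by omega) (z.1 - b) = 0 := by
        cases q with
        | zero => rw [DCx.vPart_zero]
        | succ q =>
          rw [DCx.vPart_succ]
          have h4 := congrArg ((LinearMap.range (F.d q)).subtype.lTensor (C.X (p + 1)))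
            (hb' (p + 1) q (by omega))
          rw [map_zero, lTensor_lTensor (k := F.d q) fun _ => rfl] at h4
          exact h4
      rw [h3, smul_zero, add_zero] at h2
      exact h2
    obtain ⟨w, hw⟩ := exists_zι h1
    exact ⟨w, by rw [map_eq, hw, hs]⟩
  choose w hw using hw
  refine ⟨fun s => TensorProduct.map (C.cls s.1.1) (F.cls s.1.2) (w s), ?_⟩
  rw [sum_kα w, Cx.cls_eq_cls]
  have : zzPi C F w = z.1 - b := funext hw
  change zzPi C F w - z.1 ∈ _
  rw [this, sub_sub_cancel_left]
  exact neg_mem hb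

end Kunneth

end VietorisRips

namespace VietorisRips

/-! ### Splitting by two-term complexes -/

section TwoTerm

variable {R : Type u} [CommRing R]

theorem tor₁Map_id (M N : ModuleCat.{u} R) (x : tor₁ M N) : tor₁Map (𝟙 M) (𝟙 N) x = x := by
  have : ((Tor (ModuleCat.{u} R) 1).map (𝟙 M)).app N ≫ ((Tor (ModuleCat.{u} R) 1).obj M).map (𝟙 N) =
      𝟙 _ := by
    rw [CategoryTheory.Functor.map_id, NatTrans.id_app, CategoryTheory.Functor.map_id,
      Category.comp_id]
  exact LinearMap.congr_fun (congrArg ModuleCat.Hom.hom this) x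

theorem tor₁Map_comp {M M' M'' N N' N'' : ModuleCat.{u} R} (a : M ⟶ M') (a' : M' ⟶ M'') (b : N ⟶ N')
    (b' : N' ⟶ N'') (x : tor₁ M N) :
    tor₁Map a' b' (tor₁Map a b x) = tor₁Map (a ≫ a') (b ≫ b') x := by
  have : (((Tor (ModuleCat.{u} R) 1).map a).app N ≫ ((Tor (ModuleCat.{u} R) 1).obj M').map b) ≫
      ((Tor (ModuleCat.{u} R) 1).map a').app N' ≫ ((Tor (ModuleCat.{u} R) 1).obj M'').map b' =
      ((Tor (ModuleCat.{u} R) 1).map (a ≫ a')).app N ≫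
        ((Tor (ModuleCat.{u} R) 1).obj M'').map (b ≫ b') := by
    rw [CategoryTheory.Functor.map_comp, CategoryTheory.Functor.map_comp, NatTrans.comp_app, Category.assoc, Category.assoc,
      NatTrans.naturality_assoc]
  exact LinearMap.congr_fun (congrArg ModuleCat.Hom.hom this) x

/-- The identification of terms of equal degree. -/
def Cx.castX (C : Cx R) {m n : ℕ} (h : m = n) : C.X m →ₗ[R] C.X n := h ▸ LinearMap.id

variable {Q₀ Q₁ : Type u} [AddCommGroup Q₀] [Module R Q₀] [AddCommGroup Q₁] [Module R Q₁]

/-- The complex with `Q₁` in degree `p - 1` and `Q₀` in degree `p`. -/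
abbrev twoCx (i : Q₁ →ₗ[R] Q₀) (p : ℕ) : Cx R where
  -- All terms are cut out of the one module `Q₀ × Q₁`, so the differential has the same formula in
  -- every degree.
  X n := ({ carrier := {x | (n ≠ p → x.1 = 0) ∧ (n + 1 ≠ p → x.2 = 0)}
            add_mem' := fun {x y} hx hy => ⟨fun h => by
              rw [Prod.fst_add, hx.1 h, hy.1 h, add_zero], fun h => by
              rw [Prod.snd_add, hx.2 h, hy.2 h, add_zero]⟩
            zero_mem' := ⟨fun _ => rfl, fun _ => rfl⟩
            smul_mem' := fun c x hx => ⟨fun h => by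
              rw [Prod.smul_fst, hx.1 h, smul_zero], fun h => by
              rw [Prod.smul_snd, hx.2 h, smul_zero]⟩ } : Submodule R (Q₀ × Q₁))
  d n := (LinearMap.inl R Q₀ Q₁ ∘ₗ i ∘ₗ LinearMap.snd R Q₀ Q₁).restrict fun x hx =>
    ⟨fun h => by change i x.2 = 0; rw [hx.2 h, map_zero], fun _ => rfl⟩
  dd n x := Subtype.ext (Prod.ext (map_zero i) rfl)

variable {i : Q₁ →ₗ[R] Q₀} {p : ℕ}

theorem twoCx_subsingleton (hi : Function.Injective i) {n : ℕ} (hn : n ≠ p) :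
    Subsingleton ((twoCx i p).H n) := by
  refine subsingleton_of_forall_eq 0 fun x => ?_
  obtain ⟨⟨⟨x, hx⟩, hz⟩, rfl⟩ := Cx.cls_surjective n x
  have h2 : x.2 = 0 := hi ((congrArg (fun t => t.1.1) hz).trans (map_zero i).symm)
  have h0 : (⟨⟨x, hx⟩, hz⟩ : (twoCx i p).Z n) = 0 :=
    Subtype.ext (Subtype.ext (Prod.ext (hx.1 hn) h2))
  rw [h0, map_zero]

variable {C : Cx R} (f₀ : Q₀ →ₗ[R] C.Z p) (f₁ : ∀ m, m + 1 = p → (Q₁ →ₗ[R] C.X m))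
  (h₁ : ∀ m (h : m + 1 = p) y, C.castX h (C.d m (f₁ m h y)) = f₀ (i y))

/-- A morphism from a two-term complex. -/
def twoMap : Cx.Hom (twoCx i p) C where
  f n := ((if h : n = p then C.castX h.symm ∘ₗ (C.Z p).subtype ∘ₗ f₀ ∘ₗ LinearMap.fst R Q₀ Q₁
    else 0) + (if h : n + 1 = p then f₁ n h ∘ₗ LinearMap.snd R Q₀ Q₁ else 0)) ∘ₗ Submodule.subtype _
  comm n x := by
    obtain ⟨x, hx⟩ := x
    simp only [LinearMap.comp_apply, LinearMap.add_apply, map_add]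
    have e1 : C.d n ((if h : n = p then C.castX h.symm ∘ₗ (C.Z p).subtype ∘ₗ f₀ ∘ₗ
        LinearMap.fst R Q₀ Q₁ else 0) x) = 0 := by
      split_ifs with h
      · subst h
        exact (f₀ x.1).2
      · exact map_zero (C.d n)
    have e2 : (if h : n + 1 + 1 = p then f₁ (n + 1) h ∘ₗ LinearMap.snd R Q₀ Q₁ else 0)
        (i x.2, (0 : Q₁)) = 0 := by
      split_ifs with h
      · exact map_zero (f₁ (n + 1) h)
      · rfl
    refine Eq.trans (congrArg₂ (· + ·) ?_ e2) ((add_zero _).trans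
      (((zero_add _).symm).trans (congrArg (· + _) e1.symm)))
    split_ifs with h
    · subst h
      exact (h₁ n rfl x.2).symm
    · exact (map_zero _).symm

theorem twoMap_bijective (hp : p = 0 → Subsingleton Q₁)
    (hs : Function.Surjective (C.cls p ∘ₗ f₀)) (hk : ∀ x, C.cls p (f₀ x) = 0 → ∃ y, i y = x) :
    Function.Bijective ((twoMap f₀ f₁ h₁).mapH p) := by
  have hf : ∀ z : (twoCx i p).Z p, (twoMap f₀ f₁ h₁).mapZ p z = f₀ z.1.1.1 := fun z => by
    refine Subtype.ext ?_
    change ((if h : p = p then C.castX h.symm ∘ₗ (C.Z p).subtype ∘ₗ f₀ ∘ₗ LinearMap.fst R Q₀ Q₁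
      else 0) + (if h : p + 1 = p then f₁ p h ∘ₗ LinearMap.snd R Q₀ Q₁ else 0)) z.1.1 = _
    rw [dif_pos rfl, dif_neg (by omega), add_zero]
    rfl
  constructor
  · rw [injective_iff_map_eq_zero]
    intro x hx
    obtain ⟨z, rfl⟩ := Cx.cls_surjective p x
    rw [Cx.Hom.mapH_cls, hf] at hx
    obtain ⟨y, hy⟩ := hk _ hx
    rw [Cx.cls_eq_zero]
    have h2 : z.1.1.2 = 0 := z.1.2.2 (by omega)
    cases p with
    | zero =>
      have := hp rfl
      have h1 : z.1 = 0 := Subtype.ext (Prod.ext (by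
        rw [← hy, Subsingleton.elim y 0, map_zero]; rfl) h2)
      rw [h1]; exact zero_mem _
    | succ p =>
      exact ⟨⟨(0, y), fun _ => rfl, fun h => absurd rfl h⟩, Subtype.ext (Prod.ext hy h2.symm)⟩
  · intro y
    obtain ⟨x, rfl⟩ := hs y
    refine ⟨(twoCx i p).cls p ⟨⟨(x, 0), fun h => absurd rfl h, fun _ => rfl⟩,
      Subtype.ext (Prod.ext (map_zero i) rfl)⟩, ?_⟩
    rw [Cx.Hom.mapH_cls, hf]
    rfl

variable [IsDomain R] [IsPrincipalIdealRing R]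

variable (C p) in
-- A free resolution of `H^p(C)`, placed in degrees `p - 1` and `p`: generators are sent to
-- representing cocycles, and relations lift to cochains because the module of relations is free. In
-- degree `0` cohomology equals cocycles, which are used as they stand and need not be flat; hence
-- the condition `p ≠ 0`.
theorem exists_twoCx : ∃ (L : Cx R) (f : Cx.Hom L C), Function.Bijective (f.mapH p) ∧
    (∀ n, n ≠ p → Subsingleton (L.H n)) ∧ (p ≠ 0 → L.IsFlat) := by
  cases p with
  | zero =>
    let i : PUnit.{u + 1} →ₗ[R] C.Z 0 := 0
    refine ⟨twoCx i 0, twoMap LinearMap.id (fun _ h => absurd h (by omega))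
      (fun _ h => absurd h (by omega)), twoMap_bijective _ _ _ (fun _ => inferInstance)
      (Cx.cls_surjective 0) (fun x hx => ⟨0, ?_⟩),
      fun n hn => twoCx_subsingleton (fun _ _ _ => rfl) hn, fun h => absurd rfl h⟩
    rw [map_zero]
    have h : x.1 = 0 := Cx.cls_eq_zero.1 hx
    exact Subtype.ext h.symm
  | succ p =>
    let f₀ : (C.H (p + 1) →₀ R) →ₗ[R] C.Z (p + 1) := Finsupp.linearCombination R
      fun x => (Cx.cls_surjective (p + 1) x).choose
    have hf₀ : ∀ x, C.cls (p + 1) (f₀ (Finsupp.single x 1)) = x := fun x => by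
      rw [Finsupp.linearCombination_single, one_smul]
      exact (Cx.cls_surjective (p + 1) x).choose_spec
    let K := LinearMap.ker (C.cls (p + 1) ∘ₗ f₀)
    have hK : Module.Free R K := free_submodule K
    have hd : ∀ m (h : m + 1 = p + 1), ∃ f₁ : K →ₗ[R] C.X m,
        ∀ y, C.castX h (C.d m (f₁ y)) = f₀ (K.subtype y) := by
      intro m h
      obtain rfl : m = p := by omega
      obtain ⟨f₁, hf₁⟩ := Module.projective_lifting_property (C.d m).rangeRestrict
        (((C.Z (m + 1)).subtype ∘ₗ f₀ ∘ₗ K.subtype).codRestrict (LinearMap.range (C.d m))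
          fun y => Cx.cls_eq_zero.1 y.2) (C.d m).surjective_rangeRestrict
      exact ⟨f₁, fun y => congrArg Subtype.val (LinearMap.congr_fun hf₁ y)⟩
    choose f₁ h₁ using hd
    refine ⟨twoCx K.subtype (p + 1), twoMap f₀ f₁ h₁, twoMap_bijective _ _ _
      (fun h => absurd h (by omega)) (fun x => ⟨_, hf₀ x⟩) (fun x hx => ⟨(⟨x, hx⟩ : K), rfl⟩),
      fun n hn => twoCx_subsingleton (Submodule.injective_subtype K) hn, fun _ => ⟨fun n => ?_⟩⟩
    exact flat_submodule (M := (C.H (p + 1) →₀ R) × K) _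

/-- The only nonzero product of cohomology modules has total degree `p + q + 1`, so no cross
products land in degree `n`, and only one torsion component survives. -/
theorem kβ_bijective {L L' : Cx R} [L'.IsFlat] {n : ℕ} (p q : ℕ) (e : p + q = n)
    (hL : ∀ m, m ≠ p → Subsingleton (L.H m)) (hL' : ∀ m, m ≠ q + 1 → Subsingleton (L'.H m)) :
    Function.Bijective (kβ L L' p q e) := by
  constructor
  · rw [injective_iff_map_eq_zero]
    intro x hx
    obtain ⟨y, rfl⟩ := exists_kα (y := x) fun p' q' e' => by
      by_cases hp : p' = p
      · subst hp
        obtain rfl : q' = q := by omega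
        exact hx
      · rw [kβ_eq_zero]
        have := hL p' hp
        exact Subsingleton.elim _ _
    refine Finset.sum_eq_zero fun s _ => ?_
    have : y s = 0 := by
      by_cases hp : s.1.1 = p
      · have := hL' s.1.2 (by have := s.2; omega)
        exact Subsingleton.elim _ _
      · have := hL s.1.1 hp
        exact Subsingleton.elim _ _
    rw [this, map_zero]
  · intro u
    obtain ⟨x, hx, -⟩ := kβ_surjective p q e u
    exact ⟨x, hx⟩

variable {F : Cx R}

/-- The maps to the torsion products have compatible sections. -/
theorem exists_section [F.IsFlat] {n : ℕ} (p q : ℕ) (e : p + q = n) :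
    ∃ s : tor₁ (ModuleCat.of R (C.H p)) (ModuleCat.of R (F.H (q + 1))) →ₗ[R] (tens C F).tot.H n,
      (∀ u, kβ C F p q e (s u) = u) ∧ ∀ p' q' e' u, p' ≠ p → kβ C F p' q' e' (s u) = 0 := by
  -- The section passes to the torsion product of the two-term models, inverts the torsion map
  -- there, and pushes forward along `f ⊗ g`. Only `F` must be flat, and its model sits in degree `q
  -- + 1 ≠ 0`. The models are chosen for the individual complexes, so the section is not natural.
  obtain ⟨L, f, hf, hL, -⟩ := exists_twoCx p C
  obtain ⟨L', g, hg, hL', hF⟩ := exists_twoCx (q + 1) F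
  have := hF (by omega)
  have hβ := kβ_bijective (n := n) p q e hL hL'
  let f' := (LinearEquiv.ofBijective _ hf).symm.toLinearMap
  let g' := (LinearEquiv.ofBijective _ hg).symm.toLinearMap
  let r := tor₁Map (ModuleCat.ofHom f') (ModuleCat.ofHom g')
  let s₀ := (LinearEquiv.ofBijective _ hβ).symm.toLinearMap
  have hs₀ : ∀ u, kβ L L' p q e (s₀ u) = u :=
    fun u => (LinearEquiv.ofBijective _ hβ).apply_symm_apply u
  refine ⟨(tensMap f g).tot.mapH n ∘ₗ s₀ ∘ₗ r, fun u => ?_, fun p' q' e' u hp' => ?_⟩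
  · rw [LinearMap.comp_apply, LinearMap.comp_apply, ← kβ_natural, hs₀]
    refine (tor₁Map_comp _ _ _ _ u).trans ?_
    have h1 : ModuleCat.ofHom f' ≫ ModuleCat.ofHom (f.mapH p) = 𝟙 _ :=
      ModuleCat.hom_ext (LinearMap.ext fun x => (LinearEquiv.ofBijective _ hf).apply_symm_apply x)
    have h2 : ModuleCat.ofHom g' ≫ ModuleCat.ofHom (g.mapH (q + 1)) = 𝟙 _ :=
      ModuleCat.hom_ext (LinearMap.ext fun x => (LinearEquiv.ofBijective _ hg).apply_symm_apply x)
    rw [h1, h2, tor₁Map_id]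
  · rw [LinearMap.comp_apply, LinearMap.comp_apply, ← kβ_natural]
    have : kβ L L' p' q' e' (s₀ (r u)) = 0 := by
      rw [kβ_eq_zero]
      have := hL p' hp'
      exact Subsingleton.elim _ _
    rw [this, map_zero]

end TwoTerm

end VietorisRips

namespace VietorisRips

/-! ### Shifts and mapping cones -/

section Shift

variable {R : Type u} [CommRing R]

namespace Cx

/-- The terms of the complex shifted by one. -/
abbrev shX (L : Cx R) : ℕ → Type u
  | 0 => PUnit
  | n + 1 => L.X n

@[reducible] instance shGrp (L : Cx R) : ∀ n, AddCommGroup (L.shX n)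
  | 0 => inferInstanceAs (AddCommGroup PUnit)
  | n + 1 => L.grp n

@[reducible] instance shMod (L : Cx R) : ∀ n, Module R (L.shX n)
  | 0 => PUnit.module
  | n + 1 => L.mod n

/-- The differential of the shifted complex. -/
def shD (L : Cx R) : ∀ n, L.shX n →ₗ[R] L.shX (n + 1)
  | 0 => 0
  | n + 1 => L.d n

/-- The complex shifted by one. -/
def sh (L : Cx R) : Cx R where
  X := L.shX
  d := L.shD
  dd n x := by
    cases n with
    | zero => exact map_zero (L.d 0)
    | succ n => exact L.dd n x

variable (K L M : Cx R)

/-- The terms of the shifted complex. -/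
def shι (n : ℕ) : L.X n ≃ₗ[R] L.sh.X (n + 1) := LinearEquiv.refl R (L.X n)

instance sh_zero_subsingleton : Subsingleton (L.sh.X 0) := inferInstanceAs (Subsingleton PUnit)

variable {K L M}

theorem shι_d (n : ℕ) (x : L.X n) : L.sh.d (n + 1) (L.shι n x) = L.shι (n + 1) (L.d n x) := rfl

/-- The shift of a linear map in every degree. -/
def shF {L M : Cx R} (f : ∀ n, L.X n →ₗ[R] M.X n) : ∀ n, L.sh.X n →ₗ[R] M.sh.X n
  | 0 => 0
  | n + 1 => f n

/-- The shift of a morphism. -/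
def Hom.sh (f : Hom L M) : Hom L.sh M.sh where
  f := shF f.f
  comm n x := by
    cases n with
    | zero => exact map_zero (f.f 0)
    | succ n => exact f.comm n x

theorem shι_mem_Z {n : ℕ} {x : L.X n} : L.shι n x ∈ L.sh.Z (n + 1) ↔ x ∈ L.Z n := Iff.rfl

theorem shι_mem_B {n : ℕ} {x : L.X n} : L.shι n x ∈ L.sh.B (n + 1) ↔ x ∈ L.B n := by
  cases n with
  | zero =>
    constructor
    · rintro ⟨y, hy⟩; exact hy.symm
    · intro h; exact ⟨0, h.symm⟩
  | succ n => exact Iff.rfl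

variable (L) in
/-- The cohomology of the shifted complex. -/
def shH (n : ℕ) : L.H n ≃ₗ[R] L.sh.H (n + 1) :=
  LinearEquiv.ofBijective (Submodule.mapQ _ _ ((L.shι n).toLinearMap.restrict
    fun _ h => shι_mem_Z.2 h) fun _ h => shι_mem_B.2 h) (by
    constructor
    · rw [injective_iff_map_eq_zero]
      intro x hx
      obtain ⟨z, rfl⟩ := cls_surjective n x
      exact cls_eq_zero.2 (shι_mem_B.1 (cls_eq_zero.1 hx))
    · intro x
      obtain ⟨z, rfl⟩ := cls_surjective (n + 1) x
      exact ⟨L.cls n z, rfl⟩)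

theorem shH_natural (f : Hom L M) (n : ℕ) (x : L.H n) :
    f.sh.mapH (n + 1) (L.shH n x) = M.shH n (f.mapH n x) := by
  obtain ⟨z, rfl⟩ := cls_surjective n x
  rfl

/-- The mapping cone of a morphism `j`, which fits into an exact sequence
`0 → L[-1] → cocone j → K → 0`. -/
abbrev cocone (j : Hom K L) : Cx R where
  X n := K.X n × L.sh.X n
  d n := LinearMap.prod (-(K.d n ∘ₗ LinearMap.fst R _ _))
    (((L.shι n).toLinearMap ∘ₗ j.f n) ∘ₗ LinearMap.fst R _ _ + L.sh.d n ∘ₗ LinearMap.snd R _ _)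
  dd n x := by
    refine Prod.ext ?_ ?_
    · change -(K.d (n + 1) (-(K.d n x.1))) = 0
      rw [map_neg, K.dd, neg_zero, neg_zero]
    · change L.shι (n + 1) (j.f (n + 1) (-(K.d n x.1))) +
        L.sh.d (n + 1) (L.shι n (j.f n x.1) + L.sh.d n x.2) = 0
      rw [map_add, L.sh.dd, shι_d, map_neg, map_neg, j.comm, add_zero, neg_add_cancel]

/-- The map of mapping cones induced by a commutative square. -/
def coconeMap {K' L' : Cx R} {j : Hom K L} {j' : Hom K' L'} (f : Hom K K') (g : Hom L L')
    (h : ∀ n x, g.f n (j.f n x) = j'.f n (f.f n x)) : Hom (cocone j) (cocone j') where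
  f n := LinearMap.prodMap (f.f n) (g.sh.f n)
  comm n x := by
    refine Prod.ext ?_ ?_
    · change f.f (n + 1) (-(K.d n x.1)) = -(K'.d n (f.f n x.1))
      rw [map_neg, f.comm]
    · change g.sh.f (n + 1) (L.shι n (j.f n x.1) + L.sh.d n x.2) =
        L'.shι n (j'.f n (f.f n x.1)) + L'.sh.d n (g.sh.f n x.2)
      rw [map_add, ← h, g.sh.comm]
      rfl

theorem sh_qi {f : Hom L M} (hf : QI f) : QI f.sh := by
  refine QI.of_cone (fun a _ _ => Subsingleton.elim _ _) fun n => ?_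
  cases n with
  | zero =>
    intro b a' ha' hb
    refine ⟨0, ?_, ?_⟩
    · rw [map_zero]
      exact (hf.eq_zero ha' hb.symm).symm
    · rw [Subsingleton.elim (b - _) 0]; exact zero_mem _
  | succ n =>
    intro b a' ha' hb
    obtain ⟨a, h1, h2⟩ := hf.cone (n := n) (b := b) (a' := a') ha' hb
    exact ⟨a, h1, shι_mem_B.2 h2⟩

/-- A five lemma in elements. The cone problem for `f` is solved first; its solution is correct up
to a coboundary `d c`, and `j' c` is moved into the cone problem for `g`, which is solved next. -/
theorem coconeMap_qi {K' L' : Cx R} {j : Hom K L} {j' : Hom K' L'} {f : Hom K K'} {g : Hom L L'}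
    {h : ∀ n x, g.f n (j.f n x) = j'.f n (f.f n x)} (hf : QI f) (hg : QI g) :
    QI (coconeMap f g h) := by
  refine QI.of_cone ?_ ?_
  · rintro ⟨a₁, a₂⟩ hd h0
    have h1 : -(K.d 0 a₁) = 0 := congrArg Prod.fst hd
    have h2 : f.f 0 a₁ = 0 := congrArg Prod.fst h0
    exact Prod.ext (hf.eq_zero (neg_eq_zero.1 h1) h2) (Subsingleton.elim _ _)
  · rintro n ⟨b₁, b₂⟩ ⟨a₁', a₂'⟩ hd hb
    have hd1 : K.d (n + 1) a₁' = 0 := neg_eq_zero.1 (congrArg Prod.fst hd)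
    have hd2 : L.shι (n + 1) (j.f (n + 1) a₁') + L.sh.d (n + 1) a₂' = 0 := congrArg Prod.snd hd
    have hb1 : -(K'.d n b₁) = f.f (n + 1) a₁' := congrArg Prod.fst hb
    have hb2 : L'.shι n (j'.f n b₁) + L'.sh.d n b₂ = g.sh.f (n + 1) a₂' := congrArg Prod.snd hb
    obtain ⟨a, ha, hc⟩ := hf.cone (b := b₁) (a' := -a₁') (by rw [map_neg, hd1, neg_zero])
      (by rw [map_neg, ← hb1, neg_neg])
    have ha' : L.sh.d (n + 1) (a₂' - L.shι n (j.f n a)) = 0 := by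
      rw [map_sub, shι_d, ← j.comm, ha, map_neg, map_neg, sub_neg_eq_add]
      exact (add_comm _ _).trans hd2
    cases n with
    | zero =>
      have hc' : b₁ - f.f 0 a = 0 := hc
      have h2 : g.sh.f 1 (a₂' - L.shι 0 (j.f 0 a)) = 0 := by
        rw [map_sub, ← hb2, Subsingleton.elim b₂ 0, map_zero, add_zero]
        refine sub_eq_zero.2 (congrArg (L'.shι 0) ?_)
        refine Eq.trans ?_ (h 0 a).symm
        rw [sub_eq_zero.1 hc']
      have h3 : a₂' - L.shι 0 (j.f 0 a) = 0 := hg.eq_zero ha' h2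
      refine ⟨(a, 0), Prod.ext ?_ ?_, ?_⟩
      · change -(K.d 0 a) = a₁'
        rw [ha, neg_neg]
      · change L.shι 0 (j.f 0 a) + L.sh.d 0 0 = a₂'
        rw [map_zero, add_zero, sub_eq_zero.1 h3]
      · have : (b₁, b₂) - (coconeMap f g h).f 0 (a, 0) = 0 := Prod.ext hc' (Subsingleton.elim _ _)
        rw [this]; exact zero_mem _
    | succ m =>
      obtain ⟨c, hc⟩ := hc
      obtain ⟨a₂, h1, y, hy⟩ := (sh_qi hg).cone (b := L'.shι m (j'.f m c) + b₂) ha' (by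
        rw [map_sub, map_add, ← hb2, shι_d, ← j'.comm, hc, map_sub, map_sub]
        have : g.sh.f (m + 1 + 1) (L.shι (m + 1) (j.f (m + 1) a)) =
          L'.shι (m + 1) (j'.f (m + 1) (f.f (m + 1) a)) := congrArg (L'.shι (m + 1)) (h _ a)
        rw [this]
        abel)
      refine ⟨(a, a₂), Prod.ext ?_ ?_, (-c, y), Prod.ext ?_ ?_⟩
      · change -(K.d (m + 1) a) = a₁'
        rw [ha, neg_neg]
      · change L.shι (m + 1) (j.f (m + 1) a) + L.sh.d (m + 1) a₂ = a₂'
        rw [h1]; abel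
      · change -(K'.d m (-c)) = b₁ - f.f (m + 1) a
        rw [map_neg, neg_neg, hc]
      · change L'.shι m (j'.f m (-c)) + L'.sh.d m y = b₂ - g.sh.f (m + 1) a₂
        rw [hy, map_neg, map_neg]; abel

/-- The map from the mapping cone to the shift of a cokernel. -/
def coconeTo {j : Hom K L} (p : Hom L M) (h : ∀ n x, p.f n (j.f n x) = 0) :
    Hom (cocone j) M.sh where
  f n := p.sh.f n ∘ₗ LinearMap.snd R _ _
  comm n x := by
    change p.sh.f (n + 1) (L.shι n (j.f n x.1) + L.sh.d n x.2) = _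
    rw [map_add, p.sh.comm]
    refine Eq.trans (congrArg (fun y : M.sh.X (n + 1) => y + _) ?_) (zero_add _)
    exact h n x.1

/-- The mapping cone of an injection computes its cokernel; the shift on the right comes from `L`
sitting in the cone shifted by one. -/
theorem coconeTo_qi {j : Hom K L} {p : Hom L M} {h : ∀ n x, p.f n (j.f n x) = 0}
    (hj : ∀ n, Function.Injective (j.f n)) (hp : ∀ n, Function.Surjective (p.f n))
    (he : ∀ n x, p.f n x = 0 → ∃ y, j.f n y = x) : QI (coconeTo p h) := by
  refine QI.of_cone ?_ ?_
  · rintro ⟨a₁, a₂⟩ hd -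
    have h1 : L.shι 0 (j.f 0 a₁) + L.sh.d 0 a₂ = 0 := congrArg Prod.snd hd
    rw [Subsingleton.elim a₂ 0, map_zero, add_zero, map_eq_zero_iff _ (L.shι 0).injective] at h1
    exact Prod.ext (hj 0 (h1.trans (map_zero _).symm)) (Subsingleton.elim _ _)
  · rintro n b ⟨a₁', a₂'⟩ hd hb
    have hd2 : L.shι (n + 1) (j.f (n + 1) a₁') + L.sh.d (n + 1) a₂' = 0 := congrArg Prod.snd hd
    have hb2 : M.sh.d n b = p.sh.f (n + 1) a₂' := hb
    obtain ⟨l, hl⟩ : ∃ l, p.sh.f n l = b := by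
      cases n with
      | zero => exact ⟨0, Subsingleton.elim _ _⟩
      | succ n => exact hp n b
    obtain ⟨a, ha⟩ : ∃ a, L.shι n (j.f n a) = a₂' - L.sh.d n l := by
      refine he n _ ?_
      change p.sh.f (n + 1) (a₂' - L.sh.d n l) = 0
      rw [map_sub, p.sh.comm, hl, hb2, sub_self]
    refine ⟨(a, l), Prod.ext ?_ ?_, ?_⟩
    · change -(K.d n a) = a₁'
      refine hj (n + 1) ((L.shι (n + 1)).injective ?_)
      rw [map_neg, j.comm, map_neg, ← shι_d, ha, map_sub, L.sh.dd, sub_zero]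
      exact (eq_neg_of_add_eq_zero_left hd2).symm
    · change L.shι n (j.f n a) + L.sh.d n l = a₂'
      rw [ha, sub_add_cancel]
    · change b - p.sh.f n l ∈ _
      rw [hl, sub_self]; exact zero_mem _

theorem coconeTo_natural {K' L' M' : Cx R} {j : Hom K L} {p : Hom L M}
    {h : ∀ n x, p.f n (j.f n x) = 0} {j' : Hom K' L'} {p' : Hom L' M'}
    {h' : ∀ n x, p'.f n (j'.f n x) = 0} {f : Hom K K'} {g : Hom L L'} {k : Hom M M'}
    (hfg : ∀ n x, g.f n (j.f n x) = j'.f n (f.f n x))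
    (hgk : ∀ n x, k.f n (p.f n x) = p'.f n (g.f n x)) (n : ℕ) (x) :
    k.sh.f n ((coconeTo p h).f n x) = (coconeTo p' h').f n ((coconeMap f g hfg).f n x) := by
  cases n with
  | zero => exact Subsingleton.elim _ _
  | succ n => exact hgk n x.2

end Cx

namespace DCx

variable (A A' : DCx R)

/-- The horizontal differential of the shifted double complex. -/
def shH (p : ℕ) : ∀ q, (A.col p).sh.X q →ₗ[R] (A.col (p + 1)).sh.X q
  | 0 => 0
  | q + 1 => A.h p q

/-- The double complex shifted by one in the vertical direction. -/
abbrev sh : DCx R where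
  X p q := (A.col p).sh.X q
  h := A.shH
  v p q := (A.col p).sh.d q
  hh p q x := by
    cases q with
    | zero => exact Subsingleton.elim (α := (A.col (p + 1 + 1)).sh.X 0) _ _
    | succ q => exact A.hh p q x
  vv p q x := (A.col p).sh.dd q x
  hv p q x := by
    cases q with
    | zero => exact map_zero (A.h p 0)
    | succ q => exact A.hv p q x

variable {A A'}

/-- The shift of a morphism of double complexes. -/
def Hom.sh (f : Hom A A') : Hom A.sh A'.sh where
  f p := (f.col p).sh.f
  comm_h p q x := by
    cases q with
    | zero => exact Subsingleton.elim (α := (A'.col (p + 1)).sh.X 0) _ _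
    | succ q => exact f.comm_h p q x
  comm_v p q x := (f.col p).sh.comm q x

variable (A) in
/-- The entries of a total degree of the shifted double complex. -/
def unsh (n : ℕ) : A.sh.totX (n + 1) →ₗ[R] A.totX n :=
  LinearMap.pi fun s => ((A.col s.1.1).shι s.1.2).symm.toLinearMap ∘ₗ
    A.sh.pr s.1.1 (s.1.2 + 1) (by have := s.2; omega)

theorem pr_unsh {n p q : ℕ} (e : p + q = n) (x : A.sh.totX (n + 1)) :
    A.pr p q e (A.unsh n x) =
      ((A.col p).shι q).symm (A.sh.pr p (q + 1) (by omega) x) := rfl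

/-- The sign in the total differential depends on the horizontal degree only, so a vertical shift
passes through totalization without signs. -/
theorem unsh_D (n : ℕ) (x : A.sh.totX (n + 1)) : A.unsh (n + 1) (A.sh.D (n + 1) x) =
    A.D n (A.unsh n x) := by
  apply totX_ext
  intro p q e
  rw [pr_unsh, pr_D, pr_D, map_add, map_smul, vPart_succ]
  congr 1
  · cases p with
    | zero => rfl
    | succ p => rfl
  · cases q with
    | zero =>
      have : A.sh.pr p 0 (by omega) x = 0 := Subsingleton.elim (α := (A.col p).sh.X 0) _ _
      rw [vPart_zero, this, map_zero, map_zero]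
    | succ q => rw [vPart_succ]; rfl

theorem shX_zero_ext {n p : ℕ} (e : p + 0 = n) (x y : A.sh.totX n) :
    A.sh.pr p 0 e x = A.sh.pr p 0 e y := Subsingleton.elim (α := (A.col p).sh.X 0) _ _

theorem unsh_bijective (n : ℕ) : Function.Bijective (A.unsh n) := by
  constructor
  · intro x y h
    refine totX_ext fun p q e => ?_
    cases q with
    | zero => exact shX_zero_ext e x y
    | succ q => exact congrArg (A.pr p q (by omega)) h
  · intro y
    refine ⟨fun s => match s with
      | ⟨(p, 0), e⟩ => (0 : (A.col p).sh.X 0)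
      | ⟨(p, q + 1), e⟩ => (A.col p).shι q (A.pr p q (by simp at e; omega) y), ?_⟩
    exact totX_ext fun p q e => rfl

variable (A) in
/-- The total complex of a shifted double complex is a shifted total complex. -/
def shTot : Cx.Hom A.sh.tot A.tot.sh where
  f := fun
    | 0 => 0
    | n + 1 => (A.tot.shι n).toLinearMap ∘ₗ A.unsh n
  comm n x := by
    cases n with
    | zero =>
      have : A.unsh 0 (A.sh.D 0 x) = 0 := by
        refine totX_ext fun p q e => ?_
        obtain rfl : p = 0 := by omega
        obtain rfl : q = 0 := by omega
        have : A.sh.pr 0 0 (by omega) x = 0 := Subsingleton.elim (α := (A.col 0).sh.X 0) _ _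
        rw [pr_unsh, pr_D, hPart_zero, vPart_succ, this, map_zero, smul_zero, add_zero, map_zero,
          map_zero]
      exact this
    | succ n => exact unsh_D n x

theorem shTot_qi : Cx.QI A.shTot := by
  refine Cx.QI.of_bijective fun n => ?_
  cases n with
  | zero =>
    refine ⟨fun x y _ => totX_ext fun p q e => ?_, fun y => ⟨0, Subsingleton.elim _ _⟩⟩
    obtain rfl : q = 0 := by omega
    obtain rfl : p = 0 := by omega
    exact shX_zero_ext e x y
  | succ n => exact unsh_bijective n

theorem shTot_natural (f : Hom A A') (n : ℕ) (x : A.sh.totX n) :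
    f.tot.sh.f n (A.shTot.f n x) = A'.shTot.f n (f.sh.tot.f n x) := by
  cases n with
  | zero => exact Subsingleton.elim _ _
  | succ n => rfl

end DCx

end Shift

end VietorisRips

namespace VietorisRips

/-! ### Filtered semi-simplicial sets: a common frame for single relations and for the limit -/

/-- A semi-simplicial set whose sets of simplices carry filters. -/
structure SFilt : Type (u + 1) where
  S : ℕ → Type u
  fil : ∀ n, Filter (S n)
  δ : ∀ n, Fin (n + 2) → S (n + 1) → S n
  tendsto : ∀ n i, Filter.Tendsto (δ n i) (fil (n + 1)) (fil n)
  δδ : ∀ n (i j : Fin (n + 2)), i ≤ j → ∀ x,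
    δ n i (δ (n + 1) j.succ x) = δ n j (δ (n + 1) i.castSucc x)

namespace SFilt

/-- Morphisms of filtered semi-simplicial sets. -/
structure Hom (T T₁ : SFilt.{u}) where
  f : ∀ n, T.S n → T₁.S n
  tendsto : ∀ n, Filter.Tendsto (f n) (T.fil n) (T₁.fil n)
  comm : ∀ n i x, f n (T.δ n i x) = T₁.δ n i (f (n + 1) x)

variable (R : Type u) [CommRing R] (T T' T₁ T₁' : SFilt.{u}) (M : Type u) [AddCommGroup M] [Module R M]

/-- The complex of germs of functions. -/
abbrev cx : Cx R where
  X n := GermMod R (T.fil n) M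
  d n := alt fun i => pull R M (T.δ n i) (T.tendsto n i)
  dd n x := by
    refine alt_alt _ _ (fun i j hij x => ?_) x
    rw [pull_pull, pull_pull]
    exact pull_congr (funext fun y => T.δδ n i j hij y) _ _ x

theorem tendsto_fst (p q : ℕ) (i : Fin (p + 2)) :
    Filter.Tendsto (Prod.map (T.δ p i) (id : T'.S q → T'.S q)) (T.fil (p + 1) ×ˢ T'.fil q)
      (T.fil p ×ˢ T'.fil q) := (T.tendsto p i).prodMap Filter.tendsto_id

theorem tendsto_snd (p q : ℕ) (i : Fin (q + 2)) :
    Filter.Tendsto (Prod.map (id : T.S p → T.S p) (T'.δ q i)) (T.fil p ×ˢ T'.fil (q + 1))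
      (T.fil p ×ˢ T'.fil q) := Filter.tendsto_id.prodMap (T'.tendsto q i)

/-- The double complex of germs of functions on pairs of simplices. -/
abbrev dcx : DCx R where
  X p q := GermMod R (T.fil p ×ˢ T'.fil q) M
  h p q := alt fun i => pull R M _ (tendsto_fst T T' p q i)
  v p q := alt fun i => pull R M _ (tendsto_snd T T' p q i)
  hh p q x := by
    refine alt_alt _ _ (fun i j hij x => ?_) x
    rw [pull_pull, pull_pull]
    exact pull_congr (by funext y; exact Prod.ext (T.δδ _ _ _ hij y.1) rfl) _ _ x
  vv p q x := by
    refine alt_alt _ _ (fun i j hij x => ?_) x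
    rw [pull_pull, pull_pull]
    exact pull_congr (by funext y; exact Prod.ext rfl (T'.δδ _ _ _ hij y.2)) _ _ x
  hv p q x := by
    refine (alt_comm (fun i x => ?_) x).symm
    refine (alt_comm (fun j x => ?_) x).symm
    rw [pull_pull, pull_pull]
    rfl

variable {R T T' T₁ T₁' M} {N P : Type u} [AddCommGroup N] [Module R N] [AddCommGroup P] [Module R P]

/-- The map of complexes induced by a coefficient homomorphism. -/
def coefHom (T : SFilt.{u}) (a : M →ₗ[R] N) : Cx.Hom (T.cx R M) (T.cx R N) where
  f _ := coef a
  comm _ x := alt_comm (fun _ x => coef_pull a _ _ x) x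

namespace Hom

/-- The induced map of complexes. -/
def map (f : Hom T T₁) (a : M →ₗ[R] N) : Cx.Hom (T₁.cx R M) (T.cx R N) where
  f n := coef a ∘ₗ pull R M (f.f n) (f.tendsto n)
  comm n x := by
    refine alt_comm (b := coef a ∘ₗ pull R M _ (f.tendsto (n + 1)))
      (a := coef a ∘ₗ pull R M _ (f.tendsto n)) (fun i x => ?_) x
    simp only [LinearMap.comp_apply]
    rw [← coef_pull, pull_pull, pull_pull]
    exact congrArg (coef a) (pull_congr (funext fun y => (f.comm n i y).symm) _ _ x)

/-- The induced map of double complexes. -/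
def dmap (f : Hom T T₁) (g : Hom T' T₁') (a : M →ₗ[R] N) :
    DCx.Hom (T₁.dcx R T₁' M) (T.dcx R T' N) where
  f p q := coef a ∘ₗ pull R M _ ((f.tendsto p).prodMap (g.tendsto q))
  comm_h p q x := by
    refine alt_comm (b := coef a ∘ₗ pull R M _ ((f.tendsto (p + 1)).prodMap (g.tendsto q)))
      (a := coef a ∘ₗ pull R M _ ((f.tendsto p).prodMap (g.tendsto q))) (fun i x => ?_) x
    simp only [LinearMap.comp_apply]
    rw [← coef_pull, pull_pull, pull_pull]
    have e : Prod.map (T₁.δ p i) id ∘ Prod.map (f.f (p + 1)) (g.f q) =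
      Prod.map (f.f p) (g.f q) ∘ Prod.map (T.δ p i) id :=
      funext fun y => Prod.ext (f.comm p i y.1).symm rfl
    exact congrArg (coef a) (pull_congr e _ _ x)
  comm_v p q x := by
    refine alt_comm (b := coef a ∘ₗ pull R M _ ((f.tendsto p).prodMap (g.tendsto (q + 1))))
      (a := coef a ∘ₗ pull R M _ ((f.tendsto p).prodMap (g.tendsto q))) (fun i x => ?_) x
    simp only [LinearMap.comp_apply]
    rw [← coef_pull, pull_pull, pull_pull]
    have e : Prod.map id (T₁'.δ q i) ∘ Prod.map (f.f p) (g.f (q + 1)) =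
      Prod.map (f.f p) (g.f q) ∘ Prod.map id (T'.δ q i) :=
      funext fun y => Prod.ext rfl (g.comm q i y.2).symm
    exact congrArg (coef a) (pull_congr e _ _ x)

end Hom

end SFilt

/-! ### Cross products of germs -/

section Cross

variable {R : Type u} [CommRing R] {S S' S₁ S₁' : Type u} {F : Filter S} {F' : Filter S'}
  {F₁ : Filter S₁} {F₁' : Filter S₁'} {M N M' N' : Type u} [AddCommGroup M] [Module R M]
  [AddCommGroup N] [Module R N] [AddCommGroup M'] [Module R M'] [AddCommGroup N'] [Module R N']

/-- The cross product of functions, as a germ. -/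
def cross₀ : (S → M) →ₗ[R] (S' → N) →ₗ[R] GermMod R (F ×ˢ F') (M ⊗[R] N) :=
  LinearMap.mk₂ R (fun f g => germ R (F ×ˢ F') (M ⊗[R] N) fun s => f s.1 ⊗ₜ[R] g s.2)
    (fun f f' g => by rw [← map_add]; congr 1; funext s; exact TensorProduct.add_tmul _ _ _)
    (fun c f g => by rw [← map_smul]; congr 1)
    (fun f g g' => by rw [← map_add]; congr 1; funext s; exact TensorProduct.tmul_add _ _ _)
    (fun c f g => by rw [← map_smul]; congr 1; funext s; exact TensorProduct.tmul_smul _ _ _)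

/-- The cross product of germs, as a bilinear map. -/
def cross₁ : GermMod R F M →ₗ[R] GermMod R F' N →ₗ[R] GermMod R (F ×ˢ F') (M ⊗[R] N) :=
  (vanishing R F M).liftQ ((vanishing R F' N).liftQ (cross₀.flip) fun g hg => by
    refine LinearMap.ext fun f => ?_
    change germ R (F ×ˢ F') (M ⊗[R] N) (fun s => f s.1 ⊗ₜ[R] g s.2) = 0
    rw [germ_eq_zero]
    have hg' : ∀ᶠ s in F', g s = 0 := hg
    filter_upwards [Filter.tendsto_snd.eventually hg'] with s hs
    rw [hs, TensorProduct.tmul_zero]).flip fun f hf => by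
    refine LinearMap.ext fun y => ?_
    obtain ⟨g, rfl⟩ := germ_surjective y
    change germ R (F ×ˢ F') (M ⊗[R] N) (fun s => f s.1 ⊗ₜ[R] g s.2) = 0
    rw [germ_eq_zero]
    have hf' : ∀ᶠ s in F, f s = 0 := hf
    filter_upwards [Filter.tendsto_fst.eventually hf'] with s hs
    rw [hs, TensorProduct.zero_tmul]

variable (R F F' M N) in
/-- The cross product of germs. -/
def cross : GermMod R F M ⊗[R] GermMod R F' N →ₗ[R] GermMod R (F ×ˢ F') (M ⊗[R] N) :=
  TensorProduct.lift cross₁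

theorem cross_natural {φ : S₁ → S} {ψ : S₁' → S'} (hφ : Filter.Tendsto φ F₁ F)
    (hψ : Filter.Tendsto ψ F₁' F') (a : M →ₗ[R] M') (b : N →ₗ[R] N') (x) :
    cross R F₁ F₁' M' N' (TensorProduct.map (coef a ∘ₗ pull R M φ hφ) (coef b ∘ₗ pull R N ψ hψ) x) =
      coef (TensorProduct.map a b) (pull R (M ⊗[R] N) _ (hφ.prodMap hψ) (cross R F F' M N x)) := by
  induction x with
  | zero => simp only [map_zero]
  | add x y hx hy => simp only [map_add, hx, hy]
  | tmul x y =>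
    obtain ⟨f, rfl⟩ := germ_surjective x
    obtain ⟨g, rfl⟩ := germ_surjective y
    rfl

theorem cross_pull_fst {φ : S₁ → S} (hφ : Filter.Tendsto φ F₁ F) (x) :
    cross R F₁ F' M N ((pull R M φ hφ).rTensor _ x) =
      pull R (M ⊗[R] N) _ (hφ.prodMap Filter.tendsto_id) (cross R F F' M N x) := by
  induction x with
  | zero => simp only [map_zero]
  | add x y hx hy => simp only [map_add, hx, hy]
  | tmul x y =>
    obtain ⟨f, rfl⟩ := germ_surjective x
    obtain ⟨g, rfl⟩ := germ_surjective y
    rfl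

theorem cross_pull_snd {ψ : S₁' → S'} (hψ : Filter.Tendsto ψ F₁' F') (x) :
    cross R F F₁' M N ((pull R N ψ hψ).lTensor _ x) =
      pull R (M ⊗[R] N) _ (Filter.tendsto_id.prodMap hψ) (cross R F F' M N x) := by
  induction x with
  | zero => simp only [map_zero]
  | add x y hx hy => simp only [map_add, hx, hy]
  | tmul x y =>
    obtain ⟨f, rfl⟩ := germ_surjective x
    obtain ⟨g, rfl⟩ := germ_surjective y
    rfl

theorem alt_rTensor {A B E : Type u} [AddCommGroup A] [Module R A] [AddCommGroup B] [Module R B]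
    [AddCommGroup E] [Module R E] {m : ℕ} (c : Fin m → (A →ₗ[R] B)) :
    (alt c).rTensor E = alt fun i => (c i).rTensor E :=
  (map_sum (LinearMap.rTensorHom E) _ _).trans
    (Finset.sum_congr rfl fun _ _ => map_smul (LinearMap.rTensorHom E) _ _)

theorem alt_lTensor {A B E : Type u} [AddCommGroup A] [Module R A] [AddCommGroup B] [Module R B]
    [AddCommGroup E] [Module R E] {m : ℕ} (c : Fin m → (A →ₗ[R] B)) :
    (alt c).lTensor E = alt fun i => (c i).lTensor E :=
  (map_sum (LinearMap.lTensorHom E) _ _).trans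
    (Finset.sum_congr rfl fun _ _ => map_smul (LinearMap.lTensorHom E) _ _)

theorem tmul_eq_zero_of_subsingleton {A E : Type u} [AddCommGroup A] [Module R A] [AddCommGroup E]
    [Module R E] [Subsingleton E] (x : A ⊗[R] E) : x = 0 := by
  induction x with
  | zero => rfl
  | add x y hx hy => rw [hx, hy, add_zero]
  | tmul x y => rw [Subsingleton.elim y 0, TensorProduct.tmul_zero]

/-- The tensor product with a shifted complex is a shifted tensor product. -/
def tensSh (C K : Cx R) : DCx.Hom (tens C K.sh) (tens C K).sh where
  f p := fun
    | 0 => 0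
    | q + 1 => (((tens C K).col p).shι q).toLinearMap
  comm_h p q x := by
    cases q with
    | zero => exact Subsingleton.elim (α := ((tens C K).col (p + 1)).sh.X 0) _ _
    | succ q => rfl
  comm_v p q x := by
    cases q with
    | zero =>
      have h : x = 0 := tmul_eq_zero_of_subsingleton (E := K.sh.X 0) x
      subst h
      rw [map_zero, map_zero, map_zero, map_zero]
    | succ q => rfl

theorem tensSh_natural {C C' K K' : Cx R} (f : Cx.Hom C C') (g : Cx.Hom K K') (p q : ℕ) (x) :
    (tensSh C' K').f p q ((tensMap f g.sh).f p q x) =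
      (tensMap f g).sh.f p q ((tensSh C K).f p q x) := by
  cases q with
  | zero => exact Subsingleton.elim (α := ((tens C' K').col p).sh.X 0) _ _
  | succ q => rfl

variable (R) in
/-- The cross product of complexes of germs. -/
def crossHom (T T' : SFilt.{u}) (M N : Type u) [AddCommGroup M] [Module R M]
    [AddCommGroup N] [Module R N] :
    DCx.Hom (tens (T.cx R M) (T'.cx R N)) (T.dcx R T' (M ⊗[R] N)) where
  f p q := cross R (T.fil p) (T'.fil q) M N
  comm_h p q x := by
    change cross R (T.fil (p + 1)) (T'.fil q) M N ((alt _).rTensor _ x) = _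
    rw [alt_rTensor]
    exact alt_comm (fun i x => cross_pull_fst _ x) x
  comm_v p q x := by
    change cross R (T.fil p) (T'.fil (q + 1)) M N ((alt _).lTensor _ x) = _
    rw [alt_lTensor]
    exact alt_comm (fun i x => cross_pull_snd _ x) x

variable (R) in
/-- The cross product into the shifted double complex. -/
def crossSh (T T' : SFilt.{u}) (M N : Type u) [AddCommGroup M] [Module R M]
    [AddCommGroup N] [Module R N] :
    DCx.Hom (tens (T.cx R M) (T'.cx R N).sh) (T.dcx R T' (M ⊗[R] N)).sh :=
  (crossHom R T T' M N).sh.comp (tensSh _ _)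

theorem crossSh_natural {T T' T₁ T₁' : SFilt.{u}} (f : SFilt.Hom T T₁) (g : SFilt.Hom T' T₁')
    (a : M →ₗ[R] M') (b : N →ₗ[R] N') (p q : ℕ) (x) :
    (crossSh R T T' M' N').f p q ((tensMap (f.map a) (g.map b).sh).f p q x) =
      (f.dmap g (TensorProduct.map a b)).sh.f p q ((crossSh R T₁ T₁' M N).f p q x) := by
  refine (congrArg ((crossHom R T T' M' N').sh.f p q) (tensSh_natural (f.map a) (g.map b) p q x)).trans ?_
  cases q with
  | zero => exact Subsingleton.elim (α := ((T.dcx R T' (M' ⊗[R] N')).col p).sh.X 0) _ _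
  | succ q => exact cross_natural (f.tendsto p) (g.tendsto q) a b x

end Cross

/-! ### The canonical free presentation of a module -/

section Presentation

variable (R : Type u) [CommRing R] (N N' : Type u) [AddCommGroup N] [Module R N] [AddCommGroup N'] [Module R N']

/-- The free module on the elements of a module. -/
def Fr : Type u := N →₀ R

instance : AddCommGroup (Fr R N) := inferInstanceAs (AddCommGroup (N →₀ R))

instance : Module R (Fr R N) := inferInstanceAs (Module R (N →₀ R))

instance : Module.Free R (Fr R N) := inferInstanceAs (Module.Free R (N →₀ R))

/-- The canonical map from a free module. -/
def frAug : Fr R N →ₗ[R] N := Finsupp.linearCombination R id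

/-- The module of relations of the canonical free presentation. -/
def FrRel : Type u := LinearMap.ker (frAug R N)

instance : AddCommGroup (FrRel R N) := inferInstanceAs (AddCommGroup (LinearMap.ker (frAug R N)))

instance : Module R (FrRel R N) := inferInstanceAs (Module R (LinearMap.ker (frAug R N)))

/-- The inclusion of the module of relations. -/
def frInc : FrRel R N →ₗ[R] Fr R N := (LinearMap.ker (frAug R N)).subtype

variable {R N N'}

theorem frAug_surjective : Function.Surjective (frAug R N) :=
  fun x => ⟨(Finsupp.single x 1 : N →₀ R), (Finsupp.linearCombination_single R 1 x).trans (one_smul R x)⟩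

theorem frInc_injective : Function.Injective (frInc R N) := Submodule.injective_subtype _

theorem frInc_exact : Function.Exact (frInc R N) (frAug R N) :=
  LinearMap.exact_subtype_ker_map (frAug R N)

theorem frAug_inc (x : FrRel R N) : frAug R N (frInc R N x) = 0 := x.2

/-- The map of free modules. -/
def frMap (b : N →ₗ[R] N') : Fr R N →ₗ[R] Fr R N' := Finsupp.lmapDomain R R b

theorem frAug_map (b : N →ₗ[R] N') (x : Fr R N) : frAug R N' (frMap b x) = b (frAug R N x) := by
  have h : frAug R N' ∘ₗ frMap b = b ∘ₗ frAug R N := by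
    refine Finsupp.lhom_ext fun x r => ?_
    change Finsupp.linearCombination R id (Finsupp.mapDomain b (Finsupp.single x r)) =
      b (Finsupp.linearCombination R id (Finsupp.single x r))
    rw [Finsupp.mapDomain_single, Finsupp.linearCombination_single,
      Finsupp.linearCombination_single, id, id, map_smul]
  exact LinearMap.congr_fun h x

/-- The map of modules of relations. -/
def frRelMap (b : N →ₗ[R] N') : FrRel R N →ₗ[R] FrRel R N' :=
  (frMap b).restrict fun x hx => by
    change frAug R N' _ = 0
    rw [frAug_map, LinearMap.mem_ker.1 hx, map_zero]

theorem frInc_map (b : N →ₗ[R] N') (x : FrRel R N) :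
    frInc R N' (frRelMap b x) = frMap b (frInc R N x) := rfl

end Presentation

/-! ### The flat replacement of the complex of germs -/

namespace SFilt

variable (R : Type u) [CommRing R] (T T₁ : SFilt.{u}) (N N' : Type u) [AddCommGroup N] [Module R N]
  [AddCommGroup N'] [Module R N']

/-- A complex of flat modules representing the shifted complex of germs. -/
abbrev flatCx : Cx R := Cx.cocone (T.coefHom (frInc R N))

/-- The comparison of the flat complex with the shifted complex of germs. -/
def flatTo : Cx.Hom (T.flatCx R N) (T.cx R N).sh :=
  Cx.coconeTo (T.coefHom (frAug R N)) fun n x => by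
    obtain ⟨f, rfl⟩ := germ_surjective x
    exact germ_eq_zero.2 (.of_forall fun s => frAug_inc (f s))

/-- Germs are exact in the coefficients, so the free presentation becomes a short exact sequence of
complexes of germs, and the cone of the first map computes the last term. -/
theorem flatTo_qi : Cx.QI (T.flatTo R N) :=
  Cx.coconeTo_qi (fun _ => coef_injective frInc_injective)
    (fun _ => coef_surjective frAug_surjective)
    fun _ _ hx => coef_exact frInc_exact hx

variable {R T T₁ N N'}

/-- The functoriality of the flat complex. -/
def Hom.flatMap (f : Hom T T₁) (b : N →ₗ[R] N') : Cx.Hom (T₁.flatCx R N) (T.flatCx R N') :=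
  Cx.coconeMap (f.map (frRelMap b)) (f.map (frMap b)) fun n x => by
    obtain ⟨g, rfl⟩ := germ_surjective x
    rfl

theorem flatTo_natural (f : Hom T T₁) (b : N →ₗ[R] N') (n : ℕ) (x) :
    (f.map b).sh.f n ((T₁.flatTo R N).f n x) = (T.flatTo R N').f n ((f.flatMap b).f n x) := by
  refine Cx.coconeTo_natural _ (fun n x => ?_) n x
  obtain ⟨g, rfl⟩ := germ_surjective x
  exact congrArg (germ R (T.fil n) N') (funext fun s => (frAug_map b _).symm)

variable (R) in
/-- The comparison map from the tensor product to germs of functions on pairs. -/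
def Θ (T T' : SFilt.{u}) (M N : Type u) [AddCommGroup M] [Module R M] [AddCommGroup N]
    [Module R N] : DCx.Hom (tens (T.cx R M) (T'.flatCx R N)) (T.dcx R T' (M ⊗[R] N)).sh :=
  (crossSh R T T' M N).comp (tensMap ⟨fun _ => LinearMap.id, fun _ _ => rfl⟩ (T'.flatTo R N))

variable {T' T₁' : SFilt.{u}} {M M' : Type u} [AddCommGroup M] [Module R M] [AddCommGroup M'] [Module R M']

theorem Θ_natural (f : Hom T T₁) (g : Hom T' T₁') (a : M →ₗ[R] M') (b : N →ₗ[R] N') (p q : ℕ) (x) :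
    (Θ R T T' M' N').f p q ((tensMap (f.map a) (g.flatMap b)).f p q x) =
      (f.dmap g (TensorProduct.map a b)).sh.f p q ((Θ R T₁ T₁' M N).f p q x) := by
  refine Eq.trans ?_ (crossSh_natural f g a b p q _)
  refine congrArg ((crossSh R T T' M' N').f p q) ?_
  change TensorProduct.map LinearMap.id ((T'.flatTo R N').f q) (TensorProduct.map ((f.map a).f p) ((g.flatMap b).f q) x) =
    TensorProduct.map ((f.map a).f p) ((g.map b).sh.f q) (TensorProduct.map LinearMap.id ((T₁'.flatTo R N).f q) x)
  rw [← LinearMap.comp_apply, ← LinearMap.comp_apply, ← TensorProduct.map_comp, ← TensorProduct.map_comp,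
    LinearMap.comp_id, LinearMap.id_comp,
    show (T'.flatTo R N').f q ∘ₗ (g.flatMap b).f q = (g.map b).sh.f q ∘ₗ (T₁'.flatTo R N).f q from
      LinearMap.ext fun x => (flatTo_natural g b q x).symm]

end SFilt

section Flatness

variable {R : Type u} [CommRing R] [IsDomain R] [IsPrincipalIdealRing R]

/-- Torsion is detected point by point along the filter, and torsion-free means flat here. Freeness
is not claimed for germs, which is why the algebraic part asks only for flatness. -/
instance flat_germ {S : Type u} (F : Filter S) (M : Type u) [AddCommGroup M] [Module R M]
    [Module.Flat R M] : Module.Flat R (GermMod R F M) := by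
  rw [Module.Flat.flat_iff_torsion_eq_bot_of_isBezout]
  have h := Module.Flat.torsion_eq_bot (R := R) (M := M)
  rw [eq_bot_iff] at h ⊢
  rintro x ⟨a, ha⟩
  obtain ⟨f, rfl⟩ := germ_surjective x
  have ha' : germ R F M (a • f) = 0 := ha
  rw [germ_eq_zero] at ha'
  refine germ_eq_zero.2 ?_
  filter_upwards [ha'] with s hs
  exact h ⟨a, hs⟩

instance (L : Cx R) [L.IsFlat] : L.sh.IsFlat where
  flat
    | 0 => inferInstanceAs (Module.Flat R PUnit.{u + 1})
    | n + 1 => inferInstanceAs (Module.Flat R (L.X n))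

instance (T : SFilt.{u}) (M : Type u) [AddCommGroup M] [Module R M] [Module.Flat R M] : (T.cx R M).IsFlat where
  flat n := flat_germ (T.fil n) M

instance (T : SFilt.{u}) (N : Type u) [AddCommGroup N] [Module R N] : (T.flatCx R N).IsFlat where
  flat n := by
    have : Module.Flat R (FrRel R N) := flat_submodule (M := Fr R N) (LinearMap.ker (frAug R N))
    exact inferInstanceAs (Module.Flat R ((T.cx R (FrRel R N)).X n × (T.cx R (Fr R N)).sh.X n))

end Flatness

end VietorisRips

namespace VietorisRips

/-! ### Homomorphisms into a tensor product -/

section HomTensor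

variable {R : Type u} [CommRing R] {A M V W E P : Type u} [AddCommGroup A] [Module R A]
  [AddCommGroup M] [Module R M] [AddCommGroup V] [Module R V] [AddCommGroup W] [Module R W]
  [AddCommGroup E] [Module R E] [AddCommGroup P] [Module R P]

variable (A M) in
/-- Precomposition on `A ⊗ Hom(W, M)`. -/
def pre (g : V →ₗ[R] W) : A ⊗[R] (W →ₗ[R] M) →ₗ[R] A ⊗[R] (V →ₗ[R] M) :=
  (LinearMap.lcomp R M g).lTensor A

theorem pre_pre (g : V →ₗ[R] W) (h : E →ₗ[R] V) (x) :
    pre A M h (pre A M g x) = pre A M (g ∘ₗ h) x := by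
  rw [pre, pre, ← LinearMap.comp_apply, ← LinearMap.lTensor_comp]
  rfl

theorem pre_add (g h : V →ₗ[R] W) (x) : pre A M (g + h) x = pre A M g x + pre A M h x := by
  have : LinearMap.lcomp R M (g + h) = LinearMap.lcomp R M g + LinearMap.lcomp R M h := by
    ext f v; simp
  rw [pre, this, LinearMap.lTensor_add]
  rfl

theorem pre_zero (x) : pre A M (0 : V →ₗ[R] W) x = 0 := by
  have : LinearMap.lcomp R M (0 : V →ₗ[R] W) = 0 := by
    ext f v; simp
  rw [pre, this, LinearMap.lTensor_zero]
  rfl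

theorem pre_id (x) : pre A M (LinearMap.id : V →ₗ[R] V) x = x := by
  have : LinearMap.lcomp R M (LinearMap.id : V →ₗ[R] V) = LinearMap.id := rfl
  rw [pre, this, LinearMap.lTensor_id]
  rfl

variable (R A M V) in
/-- The comparison `A ⊗ Hom(V, M) → Hom(V, A ⊗ M)`. -/
def homT : A ⊗[R] (V →ₗ[R] M) →ₗ[R] (V →ₗ[R] A ⊗[R] M) :=
  TensorProduct.lTensorHomToHomLTensor (.id R) V A M

theorem homT_pre (g : V →ₗ[R] W) (x) : homT R A M V (pre A M g x) = homT R A M W x ∘ₗ g := by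
  induction x with
  | zero => simp only [map_zero, LinearMap.zero_comp]
  | add x y hx hy => simp only [map_add, hx, hy, LinearMap.add_comp]
  | tmul a f => rfl

variable [Module.Free R P] [Module.Finite R P]

variable (R A M P) in
/-- The comparison is invertible for finite free modules. -/
def homTEquiv : A ⊗[R] (P →ₗ[R] M) ≃ₗ[R] (P →ₗ[R] A ⊗[R] M) := lTensorHomEquivHomLTensor R P A M

theorem homTEquiv_apply (x) : homTEquiv R A M P x = homT R A M P x :=
  lTensorHomEquivHomLTensor_apply x

/-- The lift of a homomorphism factoring through a finite free module. -/
def liftT (π : V →ₗ[R] P) (b : P →ₗ[R] A ⊗[R] M) : A ⊗[R] (V →ₗ[R] M) :=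
  pre A M π ((homTEquiv R A M P).symm b)

theorem homT_liftT (π : V →ₗ[R] P) (b : P →ₗ[R] A ⊗[R] M) : homT R A M V (liftT π b) = b ∘ₗ π := by
  rw [liftT, homT_pre, ← homTEquiv_apply, LinearEquiv.apply_symm_apply]

theorem liftT_homT (π : V →ₗ[R] P) (ι : P →ₗ[R] W) (x) :
    liftT π (homT R A M W x ∘ₗ ι) = pre A M (ι ∘ₗ π) x := by
  rw [liftT, ← homT_pre, ← homTEquiv_apply, LinearEquiv.symm_apply_apply, pre_pre]

theorem pre_liftT (g : E →ₗ[R] V) (π : V →ₗ[R] P) (b : P →ₗ[R] A ⊗[R] M) :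
    pre A M g (liftT π b) = liftT (π ∘ₗ g) b := pre_pre _ _ _

theorem liftT_comp {Q : Type u} [AddCommGroup Q] [Module R Q] [Module.Free R Q] [Module.Finite R Q]
    (η : V →ₗ[R] Q) (k : Q →ₗ[R] P) (b : P →ₗ[R] A ⊗[R] M) :
    liftT (k ∘ₗ η) b = liftT η (b ∘ₗ k) := by
  obtain ⟨y, rfl⟩ := (homTEquiv R A M P).surjective b
  rw [homTEquiv_apply, liftT_homT, ← homTEquiv_apply, liftT, LinearEquiv.symm_apply_apply]

theorem liftT_zero (π : V →ₗ[R] P) : liftT π (0 : P →ₗ[R] A ⊗[R] M) = 0 := by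
  rw [liftT, map_zero, map_zero]

theorem liftT_zero' (b : P →ₗ[R] A ⊗[R] M) : liftT (0 : V →ₗ[R] P) b = 0 := pre_zero _

end HomTensor

/-! ### Chain complexes that are finite up to homotopy -/

section Chains

variable {R : Type u} [CommRing R]

/-- A chain complex of `R`-modules. -/
structure Ch (R : Type u) [CommRing R] where
  X : ℕ → Type u
  [grp : ∀ n, AddCommGroup (X n)]
  [mod : ∀ n, Module R (X n)]
  d : ∀ n, X (n + 1) →ₗ[R] X n
  dd : ∀ n x, d n (d (n + 1) x) = 0

attribute [instance] Ch.grp Ch.mod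

namespace Ch

variable (C : Ch R)

/-- The complex of cochains. -/
abbrev hom (M : Type u) [AddCommGroup M] [Module R M] : Cx R where
  X n := C.X n →ₗ[R] M
  d n := LinearMap.lcomp R M (C.d n)
  dd n f := LinearMap.ext fun x => by
    change f (C.d n (C.d (n + 1) x)) = 0
    rw [C.dd, map_zero]

/-- The complex of cochains tensored with a module. -/
abbrev tHom (A M : Type u) [AddCommGroup A] [Module R A] [AddCommGroup M] [Module R M] : Cx R where
  X n := A ⊗[R] (C.X n →ₗ[R] M)
  d n := pre A M (C.d n)
  dd n x := by
    rw [pre_pre, show C.d n ∘ₗ C.d (n + 1) = 0 from LinearMap.ext (C.dd n), pre_zero]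

/-- The comparison of complexes of cochains. -/
def comparison (A M : Type u) [AddCommGroup A] [Module R A] [AddCommGroup M] [Module R M] :
    Cx.Hom (C.tHom A M) (C.hom (A ⊗[R] M)) where
  f n := homT R A M (C.X n)
  comm n x := homT_pre (C.d n) x

/-- A homotopy from the identity to a map of finite rank. -/
structure FinHomotopy where
  P : ℕ → Type u
  Q : ℕ → Type u
  [grpP : ∀ n, AddCommGroup (P n)]
  [modP : ∀ n, Module R (P n)]
  [grpQ : ∀ n, AddCommGroup (Q n)]
  [modQ : ∀ n, Module R (Q n)]
  [freeP : ∀ n, Module.Free R (P n)]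
  [freeQ : ∀ n, Module.Free R (Q n)]
  [finP : ∀ n, Module.Finite R (P n)]
  [finQ : ∀ n, Module.Finite R (Q n)]
  s : ∀ n, C.X n →ₗ[R] C.X (n + 1)
  π : ∀ n, C.X n →ₗ[R] P n
  ι : ∀ n, P n →ₗ[R] C.X n
  k : ∀ n, Q n →ₗ[R] P n
  τ : ∀ n, Q n →ₗ[R] C.X (n + 1)
  η : ∀ n, C.X (n + 1) →ₗ[R] Q n
  dι : ∀ n, C.d n ∘ₗ ι (n + 1) = 0
  dτ : ∀ n, C.d n ∘ₗ τ n = ι n ∘ₗ k n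
  kη : ∀ n, k n ∘ₗ η n = π n ∘ₗ C.d n
  ηd : ∀ n, η n ∘ₗ C.d (n + 1) = 0
  id_zero : LinearMap.id = ι 0 ∘ₗ π 0 + C.d 0 ∘ₗ s 0
  id_succ : ∀ n, LinearMap.id = ι (n + 1) ∘ₗ π (n + 1) + τ n ∘ₗ η n + C.d (n + 1) ∘ₗ s (n + 1) +
    s n ∘ₗ C.d n

attribute [instance] FinHomotopy.grpP FinHomotopy.modP FinHomotopy.grpQ FinHomotopy.modQ
  FinHomotopy.freeP FinHomotopy.freeQ FinHomotopy.finP FinHomotopy.finQ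

variable {C} (h : C.FinHomotopy)
include h

/-- The comparison is invertible on finite free modules, and the identity is homotopic to a map
through such modules. In a cone problem the homotopy `s` is applied to `a'`, and the part of `b`
that factors through `P` and `Q` is lifted by `liftT`. -/
theorem comparison_qi_of_finHomotopy (A M : Type u) [AddCommGroup A] [Module R A] [AddCommGroup M] [Module R M] :
    Cx.QI (C.comparison A M) := by
  refine Cx.QI.of_cone (fun a hd h0 => ?_) fun n b a' hd hb => ?_
  · have hd' : pre A M (C.d 0) a = 0 := hd
    have h0' : homT R A M (C.X 0) a = 0 := h0
    rw [← pre_id (A := A) (M := M) a, h.id_zero, pre_add, ← pre_pre (C.d 0), hd', map_zero, add_zero,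
      ← liftT_homT, h0', LinearMap.zero_comp, liftT_zero]
  · have hd' : pre A M (C.d (n + 1)) a' = 0 := hd
    have hb' : b ∘ₗ C.d n = homT R A M (C.X (n + 1)) a' := hb
    have key : pre A M (C.d n) (pre A M (h.s n) a' + liftT (h.π n) (b ∘ₗ h.ι n)) = a' := by
      conv_rhs => rw [← pre_id (A := A) (M := M) a', h.id_succ n, pre_add, pre_add, pre_add,
        ← pre_pre (C.d (n + 1)), hd', map_zero, add_zero, ← liftT_homT, ← hb', LinearMap.comp_assoc,
        h.dι, LinearMap.comp_zero, liftT_zero, zero_add, ← liftT_homT, ← hb', LinearMap.comp_assoc,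
        h.dτ]
      rw [map_add, pre_pre, pre_liftT, ← h.kη, liftT_comp, LinearMap.comp_assoc]
      exact add_comm _ _
    cases n with
    | zero =>
      refine ⟨_, key, ?_⟩
      have : b - homT R A M (C.X 0) (pre A M (h.s 0) a' + liftT (h.π 0) (b ∘ₗ h.ι 0)) = 0 := by
        rw [map_add, homT_pre, homT_liftT, ← hb', LinearMap.comp_assoc, LinearMap.comp_assoc,
          ← LinearMap.comp_add, add_comm, ← h.id_zero, LinearMap.comp_id, sub_self]
      exact this
    | succ n =>
      -- The added term through `Q` is a cocycle by `ηd`, so `key` still applies; with it the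
      -- decomposition `id_succ` leaves just the coboundary of `b ∘ s`.
      refine ⟨pre A M (h.s (n + 1)) a' + liftT (h.π (n + 1)) (b ∘ₗ h.ι (n + 1)) +
        liftT (h.η n) (b ∘ₗ h.τ n), ?_, b ∘ₗ h.s n, ?_⟩
      · change pre A M (C.d (n + 1)) _ = _
        rw [map_add, key, pre_liftT, h.ηd, liftT_zero', add_zero]
      · change (b ∘ₗ h.s n) ∘ₗ C.d n = b - homT R A M (C.X (n + 1)) _
        rw [map_add, map_add, homT_pre, homT_liftT, homT_liftT, ← hb']
        have := congrArg (fun g => b ∘ₗ g) (h.id_succ n)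
        simp only [LinearMap.comp_add, LinearMap.comp_id, ← LinearMap.comp_assoc] at this
        rw [eq_sub_iff_add_eq]
        conv_rhs => rw [this]
        abel

end Ch

end Chains

/-! ### Finite-type homology gives finiteness up to homotopy -/

section FiniteType

variable {R : Type u} [CommRing R] (C : Ch R)

/-- The cycles. -/
def Ch.Z : ∀ n, Submodule R (C.X n)
  | 0 => ⊤
  | n + 1 => LinearMap.ker (C.d n)

/-- The homology in degree `n` is finitely generated. -/
def Ch.FinType (n : ℕ) : Prop :=
  ∃ (m : ℕ) (φ : (Fin m → R) →ₗ[R] C.Z n), ∀ z : C.Z n, ∃ r y, (z : C.X n) = φ r + C.d n y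

variable {C}

theorem Ch.d_mem_Z (n : ℕ) (x : C.X (n + 1)) : C.d n x ∈ C.Z n := by
  cases n with
  | zero => exact Submodule.mem_top
  | succ n => exact C.dd n x

/-- As `σ` splits the differential, subtracting `σ (d x)` from `x` gives a cycle; in degree `0`
everything is a cycle. -/
theorem Ch.exists_retraction (σ : ∀ n, LinearMap.range (C.d n) →ₗ[R] C.X (n + 1))
    (hσ : ∀ n y, C.d n (σ n y) = y) : ∃ p : ∀ n, C.X n →ₗ[R] C.Z n,
      (∀ n (z : C.Z n), p n z = z) ∧ ∀ n x, x = p (n + 1) x + σ n ((C.d n).rangeRestrict x) := by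
  have hm : ∀ n x, (LinearMap.id - σ n ∘ₗ (C.d n).rangeRestrict : C.X (n + 1) →ₗ[R] _) x ∈ C.Z (n + 1) := fun n x => by
    change C.d n (x - σ n _) = 0
    rw [map_sub, hσ]
    exact sub_self _
  refine ⟨fun
    | 0 => LinearMap.id.codRestrict _ fun x => Submodule.mem_top
    | n + 1 => (LinearMap.id - σ n ∘ₗ (C.d n).rangeRestrict).codRestrict _ (hm n), ?_, ?_⟩
  · rintro (_ | n) ⟨z, hz⟩
    · rfl
    · refine Subtype.ext ?_
      change z - σ n ((C.d n).rangeRestrict z) = z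
      have : (C.d n).rangeRestrict z = 0 := Subtype.ext hz
      rw [this, map_zero, sub_zero]
  · intro n x
    exact (sub_add_cancel _ _).symm

variable [IsDomain R] [IsPrincipalIdealRing R] [∀ n, Module.Free R (C.X n)]

/-- Cycles form a submodule of a free module, hence are projective, so the decomposition of a cycle
into finitely many generators plus a boundary can be chosen linearly. -/
theorem Ch.FinType.exists_section {n : ℕ} (h : C.FinType n) : ∃ (m : ℕ)
    (φ : (Fin m → R) →ₗ[R] C.Z n) (u : C.Z n →ₗ[R] (Fin m → R)) (w : C.Z n →ₗ[R] C.X (n + 1)),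
    ∀ z : C.Z n, (z : C.X n) = φ (u z) + C.d n (w z) := by
  obtain ⟨m, φ, hφ⟩ := h
  have : Module.Free R (C.Z n) := free_submodule _
  obtain ⟨g, hg⟩ := Module.projective_lifting_property
    (LinearMap.coprod φ ((C.d n).codRestrict (C.Z n) (C.d_mem_Z n))) LinearMap.id
    (fun z => by
      obtain ⟨r, y, hz⟩ := hφ z
      exact ⟨(r, y), Subtype.ext hz.symm⟩)
  refine ⟨m, φ, LinearMap.fst R _ _ ∘ₗ g, LinearMap.snd R _ _ ∘ₗ g, fun z => ?_⟩
  exact (congrArg Subtype.val (LinearMap.congr_fun hg z)).symm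

theorem Ch.exists_rightInverse (n : ℕ) : ∃ σ : LinearMap.range (C.d n) →ₗ[R] C.X (n + 1),
    ∀ y, C.d n (σ y) = y := by
  have : Module.Free R (LinearMap.range (C.d n)) := free_submodule _
  obtain ⟨g, hg⟩ := Module.projective_lifting_property (C.d n).rangeRestrict LinearMap.id
    (C.d n).surjective_rangeRestrict
  exact ⟨g, fun y => congrArg Subtype.val (LinearMap.congr_fun hg y)⟩

/-- `P n` is a finite free module generating the homology, and `Q n` is its submodule of relations,
i.e. of vectors that map to boundaries; it is again finite and free. Each cycle `z` is `φ (u z)`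
plus a boundary, so `u (d x)` is a relation, and this defines `η`. -/
theorem Ch.exists_finHomotopy (h : ∀ n, C.FinType n) : Nonempty C.FinHomotopy := by
  choose m φ u w huw using fun n => (h n).exists_section
  choose σ hσ using C.exists_rightInverse
  obtain ⟨p, hp, hpσ⟩ := C.exists_retraction σ hσ
  let K : ∀ n, Submodule R (Fin (m n) → R) := fun n =>
    (LinearMap.range (C.d n)).comap ((C.Z n).subtype ∘ₗ φ n)
  have hd : ∀ n x, (p n (C.d n x) : C.X n) = C.d n x := fun n x =>
    congrArg Subtype.val (hp n ⟨C.d n x, C.d_mem_Z n x⟩)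
  have hK : ∀ n x, u n (p n (C.d n x)) ∈ K n := fun n x => by
    have := huw n (p n (C.d n x))
    refine ⟨x - w n (p n (C.d n x)), ?_⟩
    rw [map_sub, sub_eq_iff_eq_add]
    exact (hd n x).symm.trans this
  -- Same boundary as `w`, but with values in the image of `σ`, so that applying `σ` to the boundary
  -- of `w z` gives back `w' z`.
  let w' := fun n => σ n ∘ₗ (C.d n).rangeRestrict ∘ₗ w n
  have hw' : ∀ n (z : C.Z n), (z : C.X n) = φ n (u n z) + C.d n (w' n z) := fun n z => by
    refine (huw n z).trans (congrArg (_ + ·) ?_)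
    exact (hσ n ((C.d n).rangeRestrict (w n z))).symm
  let e : ∀ n, K n →ₗ[R] LinearMap.range (C.d n) := fun n =>
    ((C.Z n).subtype ∘ₗ φ n).restrict fun _ hx => hx
  have hfree : ∀ n, Module.Free R (K n) := fun n => free_submodule _
  refine ⟨{
    P := fun n => Fin (m n) → R
    Q := fun n => K n
    s := fun n => w' n ∘ₗ p n
    π := fun n => u n ∘ₗ p n
    ι := fun n => (C.Z n).subtype ∘ₗ φ n
    k := fun n => (K n).subtype
    τ := fun n => σ n ∘ₗ e n
    η := fun n => (u n ∘ₗ p n ∘ₗ C.d n).codRestrict (K n) (hK n)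
    dι := fun n => LinearMap.ext fun r => (φ (n + 1) r).2
    dτ := fun n => LinearMap.ext fun r => hσ n _
    kη := fun n => rfl
    ηd := fun n => LinearMap.ext fun x => Subtype.ext ?_
    id_zero := LinearMap.ext fun x => ?_
    id_succ := fun n => LinearMap.ext fun x => ?_ }⟩
  · change u n (p n (C.d n (C.d (n + 1) x))) = 0
    rw [C.dd, map_zero, map_zero]
  · have h0 : (p 0 x : C.X 0) = x := congrArg Subtype.val (hp 0 ⟨x, Submodule.mem_top⟩)
    exact h0.symm.trans (hw' 0 (p 0 x))
  -- The boundary `d x` is split into the image of its relation and the boundary of `w (d x)`; `σ`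
  -- turns these into the terms `τ η x` and `s (d x)`, and the cycle part of `x` gives the other
  -- two.
  · have h1 : (C.d n).rangeRestrict x = e n ⟨_, hK n x⟩ +
        (C.d n).rangeRestrict (w n (p n (C.d n x))) :=
      Subtype.ext ((hd n x).symm.trans (huw n (p n (C.d n x))))
    have h2 := hpσ n x
    rw [h1, map_add, hw' (n + 1) (p (n + 1) x)] at h2
    refine h2.trans ?_
    change _ + _ + (σ n (e n ⟨_, hK n x⟩) + w' n (p n (C.d n x))) =
      _ + σ n (e n ⟨_, hK n x⟩) + _ + w' n (p n (C.d n x))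
    rw [← add_assoc, add_right_comm _ (C.d (n + 1) _)]
    rfl

theorem Ch.comparison_qi (h : ∀ n, C.FinType n) (A M : Type u) [AddCommGroup A] [Module R A]
    [AddCommGroup M] [Module R M] : Cx.QI (C.comparison A M) := by
  obtain ⟨H⟩ := C.exists_finHomotopy h
  exact comparison_qi_of_finHomotopy H A M

end FiniteType

end VietorisRips

namespace VietorisRips

/-! ### Tensor products of a module with shifts and cones -/

section General

variable {R : Type u} [CommRing R]

theorem Cx.QI.of_comp {K L M : Cx R} {g : Cx.Hom L M} {f : Cx.Hom K L} (hg : Cx.QI g)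
    (h : Cx.QI (g.comp f)) : Cx.QI f := by
  intro n
  have := h n
  rw [Cx.Hom.mapH_comp] at this
  exact (Function.Bijective.of_comp_iff' (hg n) (f.mapH n)).1 this

variable (A : Type u) [AddCommGroup A] [Module R A]

/-- The tensor product of a module with a complex. -/
abbrev Cx.lT (F : Cx R) : Cx R where
  X n := A ⊗[R] F.X n
  d n := (F.d n).lTensor A
  dd n x := by
    rw [← LinearMap.comp_apply, ← LinearMap.lTensor_comp,
      show F.d (n + 1) ∘ₗ F.d n = 0 from LinearMap.ext (F.dd n), LinearMap.lTensor_zero,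
      LinearMap.zero_apply]

/-- The tensor product of a module with a morphism. -/
def Cx.Hom.lT {F F' : Cx R} (f : Cx.Hom F F') : Cx.Hom (F.lT A) (F'.lT A) where
  f n := (f.f n).lTensor A
  comm n x := by
    rw [← LinearMap.comp_apply, ← LinearMap.comp_apply, ← LinearMap.lTensor_comp,
      ← LinearMap.lTensor_comp, show f.f (n + 1) ∘ₗ F.d n = F'.d n ∘ₗ f.f n from
        LinearMap.ext (f.comm n)]

/-- Tensor products commute with shifts. -/
def Cx.lTSh (L : Cx R) : Cx.Hom (L.sh.lT A) (L.lT A).sh where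
  f := fun
    | 0 => 0
    | n + 1 => ((L.lT A).shι n).toLinearMap
  comm n x := by
    cases n with
    | zero =>
      have h : x = 0 := tmul_eq_zero_of_subsingleton (E := L.sh.X 0) x
      subst h
      rw [map_zero, map_zero, map_zero, map_zero]
    | succ n => rfl

theorem Cx.lTSh_bijective (L : Cx R) (n : ℕ) : Function.Bijective ((L.lTSh A).f n) := by
  cases n with
  | zero =>
    refine ⟨fun x y _ => ?_, fun y => ⟨0, Subsingleton.elim (α := (L.lT A).sh.X 0) _ _⟩⟩
    rw [tmul_eq_zero_of_subsingleton (E := L.sh.X 0) x, tmul_eq_zero_of_subsingleton (E := L.sh.X 0) y]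
  | succ n => exact ((L.lT A).shι n).bijective

/-- Tensor products commute with mapping cones. -/
def Cx.lTCocone {K L : Cx R} (j : Cx.Hom K L) :
    Cx.Hom ((Cx.cocone j).lT A) (Cx.cocone (j.lT A)) where
  f n := LinearMap.prod ((LinearMap.fst R (K.X n) (L.sh.X n)).lTensor A)
    ((L.lTSh A).f n ∘ₗ (LinearMap.snd R (K.X n) (L.sh.X n)).lTensor A)
  comm n x := by
    refine TensorProduct.induction_on (R := R) (M := A) (N := K.X n × L.sh.X n) x ?_ ?_ ?_
    · simp only [map_zero]
    · intro a y
      refine Prod.ext (TensorProduct.tmul_neg a (K.d n y.1)) ?_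
      change (L.lTSh A).f (n + 1) (a ⊗ₜ (L.shι n (j.f n y.1) + L.sh.d n y.2)) =
        (L.lT A).shι n (a ⊗ₜ j.f n y.1) + (L.lT A).sh.d n ((L.lTSh A).f n (a ⊗ₜ y.2))
      rw [TensorProduct.tmul_add, map_add, ← (L.lTSh A).comm]
      rfl
    · intro x y hx hy
      rw [map_add, map_add, hx, hy, map_add, map_add]

theorem Cx.lTCocone_qi {K L : Cx R} (j : Cx.Hom K L) : Cx.QI (Cx.lTCocone A j) := by
  refine Cx.QI.of_bijective fun n => ?_
  have : ⇑((Cx.lTCocone A j).f n) = Prod.map id ((L.lTSh A).f n) ∘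
      TensorProduct.prodRight R R A (K.X n) (L.sh.X n) := by
    funext x
    refine TensorProduct.induction_on (R := R) (M := A) (N := K.X n × L.sh.X n) x ?_ ?_ ?_
    · simp only [map_zero, Function.comp_apply]
      exact Prod.ext rfl (map_zero _).symm
    · exact fun a y => rfl
    · intro x y hx hy
      rw [map_add, hx, hy]
      simp only [Function.comp_apply, map_add]
      exact Prod.ext rfl (map_add _ _ _).symm
  rw [this]
  exact (Function.bijective_id.prodMap (L.lTSh_bijective A n)).comp (LinearEquiv.bijective _)

end General

/-! ### Germs with values in a complex, tensor products and currying -/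

section GermComplexes

variable {R : Type u} [CommRing R] {S S' : Type u} (F : Filter S) (F' : Filter S')

/-- The complex of germs with values in a complex. -/
abbrev germOf (L : Cx R) : Cx R where
  X n := GermMod R F (L.X n)
  d n := coef (L.d n)
  dd n x := by
    obtain ⟨f, rfl⟩ := germ_surjective x
    exact germ_eq_zero.2 (.of_forall fun s => L.dd n (f s))

/-- The map of complexes of germs. -/
def germOfMap {K L : Cx R} (f : Cx.Hom K L) : Cx.Hom (germOf F K) (germOf F L) where
  f n := coef (f.f n)
  comm n x := by
    obtain ⟨g, rfl⟩ := germ_surjective x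
    exact congrArg (germ R F (L.X (n + 1))) (funext fun s => f.comm n (g s))

/-- The cone problem is solved at each point where its hypotheses hold, which is eventually the
case; the values elsewhere do not affect the germ. -/
theorem germOfMap_qi {K L : Cx R} {f : Cx.Hom K L} (hf : Cx.QI f) : Cx.QI (germOfMap F f) := by
  classical
  refine Cx.QI.of_cone (fun a hd h0 => ?_) fun n b a' hd hb => ?_
  · obtain ⟨α, rfl⟩ := germ_surjective a
    have hd' : ∀ᶠ s in F, K.d 0 (α s) = 0 := germ_eq_zero.1 hd
    have h0' : ∀ᶠ s in F, f.f 0 (α s) = 0 := germ_eq_zero.1 h0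
    refine germ_eq_zero.2 ?_
    filter_upwards [hd', h0'] with s h1 h2
    exact hf.eq_zero h1 h2
  · obtain ⟨β, rfl⟩ := germ_surjective b
    obtain ⟨α, rfl⟩ := germ_surjective a'
    have hd' : ∀ᶠ s in F, K.d (n + 1) (α s) = 0 := germ_eq_zero.1 hd
    have hb' : ∀ᶠ s in F, L.d n (β s) = f.f (n + 1) (α s) := germ_eq_germ.1 hb
    have key : ∀ s, ∃ a, K.d (n + 1) (α s) = 0 → L.d n (β s) = f.f (n + 1) (α s) →
        K.d n a = α s ∧ β s - f.f n a ∈ L.B n := fun s => by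
      by_cases h : K.d (n + 1) (α s) = 0 ∧ L.d n (β s) = f.f (n + 1) (α s)
      · obtain ⟨a, ha⟩ := hf.cone h.1 h.2
        exact ⟨a, fun _ _ => ha⟩
      · exact ⟨0, fun h1 h2 => absurd ⟨h1, h2⟩ h⟩
    choose a ha using key
    refine ⟨germ R F (K.X n) a, germ_eq_germ.2 ?_, ?_⟩
    · filter_upwards [hd', hb'] with s h1 h2
      exact (ha s h1 h2).1
    · cases n with
      | zero =>
        have : germ R F (L.X 0) (β - f.f 0 ∘ a) = 0 := germ_eq_zero.2 (by
          filter_upwards [hd', hb'] with s h1 h2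
          exact (ha s h1 h2).2)
        exact this
      | succ n =>
        have key : ∀ s, ∃ c, β s - f.f (n + 1) (a s) ∈ L.B (n + 1) →
            L.d n c = β s - f.f (n + 1) (a s) := fun s => by
          by_cases h : β s - f.f (n + 1) (a s) ∈ L.B (n + 1)
          · exact ⟨h.choose, fun _ => h.choose_spec⟩
          · exact ⟨0, fun h' => absurd h' h⟩
        choose c hc using key
        refine ⟨germ R F (L.X n) c, germ_eq_germ.2 ?_⟩
        filter_upwards [hd', hb'] with s h1 h2
        exact hc s (ha s h1 h2).2

variable (R) (A M W : Type u) [AddCommGroup A] [Module R A] [AddCommGroup M] [Module R M]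
  [AddCommGroup W] [Module R W]

/-- The comparison of germs with tensor products on the left. -/
def germL : A ⊗[R] GermMod R F M →ₗ[R] GermMod R F (A ⊗[R] M) :=
  TensorProduct.lift (LinearMap.mk₂ R (fun a x => coef (TensorProduct.mk R A M a) x)
    (fun a b x => by
      obtain ⟨f, rfl⟩ := germ_surjective x
      exact congrArg (germ R F (A ⊗[R] M)) (funext fun s => TensorProduct.add_tmul a b (f s)))
    (fun c a x => by
      obtain ⟨f, rfl⟩ := germ_surjective x
      exact congrArg (germ R F (A ⊗[R] M)) (funext fun s => TensorProduct.smul_tmul' c a (f s)))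
    (fun a x y => map_add _ x y) (fun c a x => map_smul _ c x))

/-- The comparison of germs with tensor products on the right. -/
def germR : GermMod R F M ⊗[R] A →ₗ[R] GermMod R F (M ⊗[R] A) :=
  coef (TensorProduct.comm R A M).toLinearMap ∘ₗ germL R F A M ∘ₗ
    (TensorProduct.comm R (GermMod R F M) A).toLinearMap

variable {R A M}

theorem germR_tmul (a : A) (f : S → M) :
    germR R F A M (germ R F M f ⊗ₜ a) = germ R F (M ⊗[R] A) fun s => f s ⊗ₜ[R] a := rfl

variable {F} in
theorem germL_pull {F₁ : Filter S'} (φ : S' → S) (h : Filter.Tendsto φ F₁ F) (x) :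
    germL R F₁ A M ((pull R M φ h).lTensor A x) = pull R (A ⊗[R] M) φ h (germL R F A M x) := by
  induction x with
  | zero => simp only [map_zero]
  | add x y hx hy => simp only [map_add, hx, hy]
  | tmul a x =>
    obtain ⟨f, rfl⟩ := germ_surjective x
    rfl

variable {F} in
theorem germR_pull {F₁ : Filter S'} (φ : S' → S) (h : Filter.Tendsto φ F₁ F) (x) :
    germR R F₁ A M ((pull R M φ h).rTensor A x) = pull R (M ⊗[R] A) φ h (germR R F A M x) := by
  induction x with
  | zero => simp only [map_zero]
  | add x y hx hy => simp only [map_add, hx, hy]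
  | tmul x a =>
    obtain ⟨f, rfl⟩ := germ_surjective x
    rfl

theorem germL_coef {N : Type u} [AddCommGroup N] [Module R N] (b : M →ₗ[R] N) (x) :
    germL R F A N ((coef b).lTensor A x) = coef (b.lTensor A) (germL R F A M x) := by
  induction x with
  | zero => simp only [map_zero]
  | add x y hx hy => simp only [map_add, hx, hy]
  | tmul a x =>
    obtain ⟨f, rfl⟩ := germ_surjective x
    rfl

theorem germR_lTensor {A' : Type u} [AddCommGroup A'] [Module R A'] (b : A →ₗ[R] A') (x) :
    germR R F A' M (b.lTensor _ x) = coef (b.lTensor M) (germR R F A M x) := by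
  induction x with
  | zero => simp only [map_zero]
  | add x y hx hy => simp only [map_add, hx, hy]
  | tmul x a =>
    obtain ⟨f, rfl⟩ := germ_surjective x
    rfl

variable (R)

/-- Germs on a product as germs with values in germs. -/
def curryL : GermMod R (F ×ˢ F') W →ₗ[R] GermMod R F (GermMod R F' W) :=
  (vanishing R (F ×ˢ F') W).liftQ (germ R F (GermMod R F' W) ∘ₗ
    (germ R F' W).compLeft S ∘ₗ (LinearEquiv.curry R W S S').toLinearMap) fun f hf => by
      refine germ_eq_zero.2 ?_
      have hf' : ∀ᶠ s in F ×ˢ F', f s = 0 := hf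
      filter_upwards [hf'.curry] with s hs
      exact germ_eq_zero.2 hs

/-- Germs on a product as germs with values in germs. -/
def curryR : GermMod R (F ×ˢ F') W →ₗ[R] GermMod R F' (GermMod R F W) :=
  curryL R F' F W ∘ₗ pull R W Prod.swap Filter.tendsto_prod_swap

variable {R W F F'}

theorem curryL_germ (f : S × S' → W) : curryL R F F' W (germ R _ W f) =
    germ R F (GermMod R F' W) fun x => germ R F' W fun y => f (x, y) := rfl

/-- For general filters a family of germs indexed by the points of `S` need not vanish on a common
neighbourhood when each member vanishes. With principal filters there is a smallest neighbourhood
and the difficulty disappears; hence `Θ` is first treated at single relations. -/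
theorem curryL_bijective (s : Set S) (t : Set S') :
    Function.Bijective (curryL R (Filter.principal s) (Filter.principal t) W) := by
  constructor
  · rw [injective_iff_map_eq_zero]
    intro x hx
    obtain ⟨f, rfl⟩ := germ_surjective x
    rw [curryL_germ, germ_eq_zero, Filter.eventually_principal] at hx
    rw [germ_eq_zero, Filter.prod_principal_principal, Filter.eventually_principal]
    rintro ⟨x, y⟩ ⟨hx', hy⟩
    have := germ_eq_zero.1 (hx x hx')
    rw [Filter.eventually_principal] at this
    exact this y hy
  · intro x
    obtain ⟨g, rfl⟩ := germ_surjective x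
    choose f hf using fun s => germ_surjective (g s)
    exact ⟨germ R _ W fun p => f p.1 p.2,
      congrArg (germ R (Filter.principal s) (GermMod R (Filter.principal t) W)) (funext hf)⟩

theorem pull_swap_bijective : Function.Bijective (pull R W (Prod.swap : S' × S → S × S')
    (Filter.tendsto_prod_swap : Filter.Tendsto _ (F' ×ˢ F) (F ×ˢ F'))) := by
  refine Function.bijective_iff_has_inverse.2 ⟨pull R W Prod.swap Filter.tendsto_prod_swap, ?_, ?_⟩
  all_goals
    intro x
    obtain ⟨f, rfl⟩ := germ_surjective x
    rfl

theorem curryR_bijective (s : Set S) (t : Set S') :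
    Function.Bijective (curryR R (Filter.principal s) (Filter.principal t) W) :=
  (curryL_bijective t s).comp pull_swap_bijective

end GermComplexes

end VietorisRips

namespace VietorisRips

theorem coef_alt {R : Type u} [CommRing R] {S : Type u} {F : Filter S} {A B : Type u}
    [AddCommGroup A] [Module R A] [AddCommGroup B] [Module R B] {m : ℕ} (c : Fin m → (A →ₗ[R] B)) :
    coef (F := F) (alt c) = alt fun i => coef (c i) := by
  let φ : (A →ₗ[R] B) →ₗ[R] GermMod R F A →ₗ[R] GermMod R F B :=
    { toFun := coef
      map_add' := fun a b => LinearMap.ext fun x => by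
        obtain ⟨f, rfl⟩ := germ_surjective x
        rfl
      map_smul' := fun r a => LinearMap.ext fun x => by
        obtain ⟨f, rfl⟩ := germ_surjective x
        rfl }
  exact (map_sum φ _ _).trans (Finset.sum_congr rfl fun _ _ => map_smul φ _ _)

/-! ### When the cross product is a quasi-isomorphism -/

namespace SFilt

variable {R : Type u} [CommRing R] (T T' : SFilt.{u})

section Left

variable (A M N W : Type u) [AddCommGroup A] [Module R A] [AddCommGroup M] [Module R M]
  [AddCommGroup N] [Module R N] [AddCommGroup W] [Module R W]

/-- The comparison of complexes of germs with tensor products on the left. -/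
def homL : Cx.Hom ((T.cx R M).lT A) (T.cx R (A ⊗[R] M)) where
  f n := germL R (T.fil n) A M
  comm n x := by
    change germL R (T.fil (n + 1)) A M ((alt _).lTensor A x) = _
    rw [alt_lTensor]
    exact alt_comm (fun i x => germL_pull _ _ x) x

/-- The comparison of complexes of germs with tensor products on the right. -/
def homR : Cx.Hom ((T.cx R M).rT A) (T.cx R (M ⊗[R] A)) where
  f n := germR R (T.fil n) A M
  comm n x := by
    change germR R (T.fil (n + 1)) A M ((alt _).rTensor A x) = _
    rw [alt_rTensor]
    exact alt_comm (fun i x => germR_pull _ _ x) x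

theorem homR_qi (h : Cx.QI (T.homL (R := R) A M)) : Cx.QI (T.homR (R := R) A M) := by
  let c : Cx.Hom ((T.cx R M).rT A) ((T.cx R M).lT A) :=
    ⟨fun n => (TensorProduct.comm R ((T.cx R M).X n) A).toLinearMap, fun n x => by
      refine TensorProduct.induction_on (R := R) (M := (T.cx R M).X n) (N := A) x ?_ ?_ ?_
      · simp only [map_zero]
      · intro x a
        rfl
      · intro x y hx hy
        rw [map_add, map_add, hx, hy, map_add, map_add]⟩
  have hc : Cx.QI c := Cx.QI.of_bijective fun n => LinearEquiv.bijective _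
  have hc' : Cx.QI (T.coefHom (TensorProduct.comm R A M).toLinearMap) :=
    Cx.QI.of_bijective fun n => ⟨coef_injective (LinearEquiv.injective _),
      coef_surjective (LinearEquiv.surjective _)⟩
  have e : T.homR (R := R) A M = Cx.Hom.comp (T.coefHom (TensorProduct.comm R A M).toLinearMap)
      (Cx.Hom.comp (T.homL A M) c) := Cx.Hom.ext' fun n x => rfl
  rw [e]
  exact hc'.comp (h.comp hc)

variable {A N W} (ρ : A ⊗[R] Fr R N →ₗ[R] W) (hρ : ∀ x, ρ ((frInc R N).lTensor A x) = 0)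

/-- The comparison of `A ⊗ F` with germs, where `F` is the flat complex. -/
def homFlat : Cx.Hom ((T.flatCx R N).lT A) (T.cx R W).sh :=
  (Cx.coconeTo (T.coefHom ρ) (j := T.coefHom ((frInc R N).lTensor A)) fun n x => by
    obtain ⟨f, rfl⟩ := germ_surjective x
    exact germ_eq_zero.2 (.of_forall fun s => hρ (f s))).comp
  ((Cx.coconeMap (j := (T.coefHom (frInc R N)).lT A)
    (j' := T.coefHom ((frInc R N).lTensor A)) (T.homL A (FrRel R N)) (T.homL A (Fr R N))
    fun n x => germL_coef (T.fil n) (frInc R N) x).comp (Cx.lTCocone A _))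

/-- The last three hypotheses say that `A ⊗` presentation remains short exact with quotient `W`. It
is used with `W` a tensor product of coefficient modules, and with `W` a module of germs in such a
tensor product. -/
theorem homFlat_qi (h : ∀ M : Type u, [AddCommGroup M] → [Module R M] → Cx.QI (T.homL (R := R) A M))
    (hi : Function.Injective ((frInc R N).lTensor A)) (hs : Function.Surjective ρ)
    (he : ∀ x, ρ x = 0 → ∃ y, (frInc R N).lTensor A y = x) : Cx.QI (T.homFlat ρ hρ) := by
  refine Cx.QI.comp (Cx.coconeTo_qi (fun n => coef_injective hi) (fun n => coef_surjective hs)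
    fun n x hx => coef_exact (fun y => ⟨fun hy => he y hy, ?_⟩) hx)
    ((Cx.coconeMap_qi (h _) (h _)).comp (Cx.lTCocone_qi A _))
  rintro ⟨z, rfl⟩
  exact hρ z

end Left

section Double

variable (L L' : Cx R)

/-- The double complex of germs with values in a complex. -/
abbrev dc : DCx R where
  X p q := GermMod R (T.fil p) (L.X q)
  h p q := alt fun i => pull R (L.X q) (T.δ p i) (T.tendsto p i)
  v _ q := coef (L.d q)
  hh p q x := (T.cx R (L.X q)).dd p x
  vv p q x := (germOf (T.fil p) L).dd q x
  hv p q x := ((T.coefHom (L.d q)).comm p x).symm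

variable {L L'} in
/-- The map of double complexes induced by a morphism of coefficient complexes. -/
def dcMap (f : Cx.Hom L L') : DCx.Hom (T.dc L) (T.dc L') where
  f _ q := coef (f.f q)
  comm_h p q x := (T.coefHom (f.f q)).comm p x
  comm_v p q x := (germOfMap (T.fil p) f).comm q x

variable {L L'} in
theorem dcMap_qi {f : Cx.Hom L L'} (hf : Cx.QI f) : Cx.QI (T.dcMap f).tot :=
  (T.dcMap f).tot_qi_of_col fun p => germOfMap_qi (T.fil p) hf

variable (M : Type u) [AddCommGroup M] [Module R M]

/-- The comparison of the tensor product of complexes with germs with values in a complex. -/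
def homD : DCx.Hom (tens (T.cx R M) L) (T.dc (L.lT M)) where
  f p q := germR R (T.fil p) (L.X q) M
  comm_h p q x := (T.homR (L.X q) M).comm p x
  comm_v p q x := germR_lTensor (T.fil p) (L.d q) x

theorem homD_qi (h : ∀ A : Type u, [AddCommGroup A] → [Module R A] → Cx.QI (T.homL (R := R) A M)) :
    Cx.QI (T.homD L M).tot :=
  (T.homD L M).tot_qi_of_row fun q => T.homR_qi (L.X q) M (h (L.X q))

variable (W : Type u) [AddCommGroup W] [Module R W]

/-- Germs on pairs as germs with values in germs. -/
def curryHom : DCx.Hom (T.dcx R T' W).sh (T.dc (T'.cx R W).sh) where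
  f p := fun
    | 0 => 0
    | q + 1 => curryL R (T.fil p) (T'.fil q) W
  comm_h p q x := by
    cases q with
    | zero =>
      exact (map_zero ((T.dc (T'.cx R W).sh).h p 0)).symm
    | succ q =>
      refine alt_comm (b := curryL R (T.fil (p + 1)) (T'.fil q) W)
        (a := curryL R (T.fil p) (T'.fil q) W) (fun i x => ?_) x
      obtain ⟨f, rfl⟩ := germ_surjective x
      rfl
  comm_v p q x := by
    cases q with
    | zero =>
      refine Eq.trans ?_ (map_zero ((T.dc (T'.cx R W).sh).v p 0)).symm
      exact map_zero (curryL R (T.fil p) (T'.fil 0) W)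
    | succ q =>
      change curryL R (T.fil p) (T'.fil (q + 1)) W (alt _ x) = coef (F := T.fil p)
        (alt fun i => pull R W (T'.δ q i) (T'.tendsto q i)) (curryL R (T.fil p) (T'.fil q) W x)
      rw [coef_alt]
      refine alt_comm (b := curryL R (T.fil p) (T'.fil (q + 1)) W)
        (a := curryL R (T.fil p) (T'.fil q) W) (fun i x => ?_) x
      obtain ⟨f, rfl⟩ := germ_surjective x
      rfl

theorem curryHom_bijective 
    (h : ∀ p q, Function.Bijective (curryL R (T.fil p) (T'.fil q) W)) (p q : ℕ) :
    Function.Bijective ((curryHom (R := R) T T' W).f p q) := by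
  cases q with
  | zero =>
    refine ⟨fun x y _ => Subsingleton.elim (α := ((T.dcx R T' W).col p).sh.X 0) _ _,
      fun y => ⟨0, ?_⟩⟩
    obtain ⟨f, rfl⟩ := germ_surjective y
    exact (germ_eq_zero.2 (.of_forall fun s => Subsingleton.elim (α := (T'.cx R W).sh.X 0) _ _)).symm
  | succ q => exact h p q

/-- Germs on pairs as germs with values in germs. -/
def curryCol (p : ℕ) : Cx.Hom ((T.dcx R T' W).col p) (T'.cx R (GermMod R (T.fil p) W)) where
  f q := curryR R (T.fil p) (T'.fil q) W
  comm q x := by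
    refine alt_comm (b := curryR R (T.fil p) (T'.fil (q + 1)) W)
      (a := curryR R (T.fil p) (T'.fil q) W) (fun i x => ?_) x
    obtain ⟨f, rfl⟩ := germ_surjective x
    rfl

end Double

section Comparison

variable {T T'} {M N : Type u} [AddCommGroup M] [Module R M] [AddCommGroup N] [Module R N]

theorem lTensor_frAug_zero (A : Type u) [AddCommGroup A] [Module R A] (x) :
    (frAug R N).lTensor A ((frInc R N).lTensor A x) = 0 := by
  rw [← LinearMap.comp_apply, ← LinearMap.lTensor_comp,
    show frAug R N ∘ₗ frInc R N = 0 from LinearMap.ext frAug_inc, LinearMap.lTensor_zero,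
    LinearMap.zero_apply]

theorem germ_shX_zero {S : Type u} (F : Filter S) (L : Cx R) (x y : GermMod R F (L.sh.X 0)) :
    x = y := by
  obtain ⟨f, rfl⟩ := germ_surjective x
  obtain ⟨g, rfl⟩ := germ_surjective y
  exact congrArg (germ R F (L.sh.X 0)) (funext fun s => Subsingleton.elim (f s) (g s))

variable (R) in
/-- Cochains with values in a tensor product are computed by tensor products of cochains. -/
def IsTame (T : SFilt.{u}) : Prop :=
  ∀ (A B : Type u) [AddCommGroup A] [Module R A] [AddCommGroup B] [Module R B],
    Cx.QI (T.homL (R := R) A B)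

/-- Read as germs on the first factor with values in germs on the second, the cross product is the
comparison for the first factor followed by the one for the second. These and currying are
quasi-isomorphisms, hence so is `Θ`. -/
theorem Θ_curry (p q : ℕ) (x) :
    (curryHom T T' (M ⊗[R] N)).f p q ((Θ R T T' M N).f p q x) =
      coef ((T'.homFlat ((frAug R N).lTensor M) (lTensor_frAug_zero M)).f q)
        (germR R (T.fil p) ((T'.flatCx R N).X q) M x) := by
  cases q with
  | zero => exact germ_shX_zero _ (T'.cx R (M ⊗[R] N)) _ _
  | succ q =>
    refine TensorProduct.induction_on (R := R) (M := GermMod R (T.fil p) M)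
      (N := (T'.flatCx R N).X (q + 1)) x ?_ ?_ ?_
    · simp only [map_zero]
    · rintro x ⟨r, y⟩
      obtain ⟨f, rfl⟩ := germ_surjective x
      obtain ⟨g, rfl⟩ := germ_surjective y
      rfl
    · intro x y hx hy
      rw [map_add, map_add, hx, hy, map_add, map_add]

/-- The comparison map is a quasi-isomorphism when cochains on both sides are well behaved. -/
theorem Θ_qi_of_isTame (hT : T.IsTame R) (hT' : T'.IsTame R)
    (hc : ∀ p q, Function.Bijective (curryL R (T.fil p) (T'.fil q) (M ⊗[R] N)))
    (hi : Function.Injective ((frInc R N).lTensor M)) : Cx.QI (Θ R T T' M N).tot := by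
  let Y := T'.homFlat ((frAug R N).lTensor M) (lTensor_frAug_zero M)
  have hY : Cx.QI Y := T'.homFlat_qi _ _ (fun B _ _ => hT' M B) hi
    (LinearMap.lTensor_surjective M frAug_surjective)
    fun x hx => (lTensor_exact M frInc_exact frAug_surjective x).1 hx
  have h1 : Cx.QI (T.dcMap Y).tot := T.dcMap_qi hY
  have h2 : Cx.QI (T.homD (T'.flatCx R N) M).tot := T.homD_qi _ M (fun A _ _ => hT A M)
  have h3 : Cx.QI (curryHom (R := R) T T' (M ⊗[R] N)).tot :=
    (curryHom T T' _).tot_qi_of_col fun p => Cx.QI.of_bijective (curryHom_bijective T T' _ hc p)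
  refine h3.of_comp ?_
  have e : Cx.Hom.comp (curryHom (R := R) T T' (M ⊗[R] N)).tot (Θ R T T' M N).tot =
      Cx.Hom.comp (T.dcMap Y).tot (T.homD (T'.flatCx R N) M).tot :=
    Cx.Hom.ext' fun n x => DCx.totX_ext fun p q e => Θ_curry p q _
  rw [e]
  exact h1.comp h2

/-- Germs with coefficients in a tensor product of modules. -/
def augR {S : Type u} (F : Filter S) (M N : Type u) [AddCommGroup M] [Module R M] [AddCommGroup N] [Module R N] :
    GermMod R F M ⊗[R] Fr R N →ₗ[R] GermMod R F (M ⊗[R] N) :=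
  germR R F N M ∘ₗ (frAug R N).lTensor _

theorem augR_inc (p : ℕ) (x) : augR (R := R) (T.fil p) M N ((frInc R N).lTensor _ x) = 0 := by
  rw [augR, LinearMap.comp_apply, lTensor_frAug_zero, map_zero]

theorem Θ_curryCol (p q : ℕ) (x) :
    (curryCol T T' (M ⊗[R] N) p).sh.f q ((Θ R T T' M N).f p q x) =
      (T'.homFlat (augR (R := R) (T.fil p) M N) (augR_inc p)).f q x := by
  cases q with
  | zero => exact Subsingleton.elim _ _
  | succ q =>
    refine TensorProduct.induction_on (R := R) (M := GermMod R (T.fil p) M)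
      (N := (T'.flatCx R N).X (q + 1)) x ?_ ?_ ?_
    · simp only [map_zero]
    · rintro x ⟨r, y⟩
      obtain ⟨f, rfl⟩ := germ_surjective x
      obtain ⟨g, rfl⟩ := germ_surjective y
      rfl
    · intro x y hx hy
      rw [map_add, map_add, hx, hy, map_add]

/-- Tameness is assumed of `T'` only, so the comparison is made on each column: germs on
`p`-simplices of `T` become the coefficients for `T'`. The price is that these coefficients must
behave well under `⊗ N`, which is expressed by `hi` and `hb`. -/
theorem Θ_qi_of_isTame_right (hT' : T'.IsTame R)
    (hc : ∀ p q, Function.Bijective (curryR R (T.fil p) (T'.fil q) (M ⊗[R] N)))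
    (hi : ∀ p, Function.Injective ((frInc R N).lTensor (GermMod R (T.fil p) M)))
    (hb : ∀ p, Function.Bijective (germR R (T.fil p) N M)) : Cx.QI (Θ R T T' M N).tot := by
  refine (Θ R T T' M N).tot_qi_of_col fun p => ?_
  have hY : Cx.QI (T'.homFlat (augR (R := R) (T.fil p) M N) (augR_inc p)) := by
    refine T'.homFlat_qi _ _ (fun B _ _ => hT' _ B) (hi p)
      ((hb p).2.comp (LinearMap.lTensor_surjective _ frAug_surjective)) fun x hx => ?_
    refine (lTensor_exact _ frInc_exact frAug_surjective x).1 ((hb p).1 ?_)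
    rw [map_zero]
    exact hx
  have h : Cx.QI (curryCol (R := R) T T' (M ⊗[R] N) p).sh :=
    Cx.sh_qi (Cx.QI.of_bijective (hc p))
  refine h.of_comp ?_
  have e : Cx.Hom.comp (curryCol (R := R) T T' (M ⊗[R] N) p).sh ((Θ R T T' M N).col p) =
      T'.homFlat (augR (R := R) (T.fil p) M N) (augR_inc p) :=
    Cx.Hom.ext' fun q x => Θ_curryCol p q x
  rw [e]
  exact hY

end Comparison

end SFilt

end VietorisRips

namespace VietorisRips

open SemiUniformSpace

/-! ### Vietoris-Rips chains of a single relation -/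

section Chains

variable (R : Type u) [CommRing R] {X : SemiUniformSpace.{u}} (U : X.Entourage)

/-- The generator of the chains on a simplex. -/
def simplexChain (n : ℕ) (s : SU.clique U.val n) : ((chains R).obj (complex U)).X n :=
  ModuleCat.freeMk (X := (complex U).obj (op (SimplexCategory.mk n))) s

/-- The face of a simplex. -/
def cliqueFace (n : ℕ) (i : Fin (n + 2)) (s : SU.clique U.val (n + 1)) : SU.clique U.val n :=
  ⟨SU.face i s.1, SU.face_clique s.2 i⟩

theorem free_map_δ (n : ℕ) (i : Fin (n + 2)) (s : SU.clique U.val (n + 1)) :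
    ((((SimplicialObject.whiskering _ _).obj (ModuleCat.free R)).obj (complex U)).δ i).hom
      (simplexChain R U (n + 1) s) = simplexChain R U n (cliqueFace U n i s) := by
  exact ModuleCat.free_map_apply _ _

theorem chains_d (n : ℕ) (s : SU.clique U.val (n + 1)) :
    (((chains R).obj (complex U)).d (n + 1) n).hom (simplexChain R U (n + 1) s) =
      ∑ i : Fin (n + 2), (-1 : R) ^ (i : ℕ) • simplexChain R U n (cliqueFace U n i s) := by
  have h : ((chains R).obj (complex U)).d (n + 1) n =
    ∑ i : Fin (n + 2), (-1 : ℤ) ^ (i : ℕ) •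
      (((SimplicialObject.whiskering _ _).obj (ModuleCat.free R)).obj (complex U)).δ i :=
    AlgebraicTopology.alternatingFaceMapComplex_obj_d _ _
  rw [h, ModuleCat.hom_sum, LinearMap.sum_apply]
  refine Finset.sum_congr rfl fun i _ => ?_
  rw [ModuleCat.hom_zsmul, LinearMap.smul_apply, free_map_δ]
  rw [← Int.cast_smul_eq_zsmul R]
  simp

theorem chains_hom_ext {M : Type u} [AddCommGroup M] [Module R M] {n : ℕ}
    {f g : ((chains R).obj (complex U)).X n →ₗ[R] M}
    (h : ∀ s, f (simplexChain R U n s) = g (simplexChain R U n s)) : f = g :=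
  Finsupp.lhom_ext' fun s => LinearMap.ext_ring (h s)

/-- The homomorphism with given values on simplices. -/
def chainsDesc {M : Type u} [AddCommGroup M] [Module R M] (n : ℕ) :
    (SU.clique U.val n → M) ≃ₗ[R] (((chains R).obj (complex U)).X n →ₗ[R] M) :=
  Finsupp.llift M R R (SU.clique U.val n)

theorem chainsDesc_apply {M : Type u} [AddCommGroup M] [Module R M] (n : ℕ)
    (f : SU.clique U.val n → M) (s) : chainsDesc R U n f (simplexChain R U n s) = f s := by
  refine (Finsupp.lift_apply M R _ f _).trans ?_
  exact (Finsupp.sum_single_index (h := fun x r => r • f x) (zero_smul R _)).trans (one_smul R _)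

instance (n : ℕ) : Module.Free R (((chains R).obj (complex U)).X n) :=
  inferInstanceAs (Module.Free R (SU.clique U.val n →₀ R))

/-- The chains as an elementary chain complex. -/
abbrev chainsCh : Ch R where
  X n := ((chains R).obj (complex U)).X n
  d n := (((chains R).obj (complex U)).d (n + 1) n).hom
  dd n x := by
    rw [← LinearMap.comp_apply, ← ModuleCat.hom_comp, HomologicalComplex.d_comp_d]
    rfl

variable {R} in
theorem chainsCh_finType {n : ℕ} (h : Module.Finite R (homologyAt R U n)) :
    (chainsCh R U).FinType n := by
  obtain ⟨m, f, hf⟩ := Module.Finite.exists_fin' R (homologyAt R U n)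
  let K := (chains R).obj (complex U)
  -- In degree `0` the differential out of the complex is the zero map `d 0 0`, so its kernel is
  -- everything, as in `Ch.Z`.
  have hZ : ∃ j, ∃ hj : (ComplexShape.down ℕ).next n = j,
      LinearMap.ker (K.d n j).hom = (chainsCh R U).Z n := by
    cases n with
    | zero =>
      refine ⟨0, ChainComplex.next_nat_zero, ?_⟩
      have : K.d 0 0 = 0 := K.shape _ _ (by simp)
      rw [this]
      exact LinearMap.ker_zero
    | succ n => exact ⟨n, ChainComplex.next_nat_succ n, rfl⟩
  obtain ⟨j, hj, hZ⟩ := hZ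
  obtain ⟨g, hg⟩ := Module.projective_lifting_property (hcls K n j hj) f (hcls_surjective n j hj)
  refine ⟨m, (LinearEquiv.ofEq _ _ hZ).toLinearMap ∘ₗ g, fun z => ?_⟩
  obtain ⟨r, hr⟩ := hf (hcls K n j hj ((LinearEquiv.ofEq _ _ hZ).symm z))
  have h0 : hcls K n j hj ((LinearEquiv.ofEq _ _ hZ).symm z - g r) = 0 := by
    rw [map_sub, ← hr, ← hg, LinearMap.comp_apply, sub_self]
  obtain ⟨y, hy⟩ := (hcls_eq_zero hj (ChainComplex.prev _ n)).1 h0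
  exact ⟨r, y, (eq_add_of_sub_eq' hy.symm)⟩

/-- The simplices of `X^U`, as a filtered semi-simplicial set. -/
abbrev level {X : SemiUniformSpace.{u}} (U : X.Entourage) : SFilt.{u} where
  S n := Fin (n + 1) → X.carrier
  fil n := Filter.principal (SU.clique U.val n)
  δ _ i := SU.face i
  tendsto _ i := Filter.tendsto_principal_principal.2 fun _ hx => SU.face_clique hx i
  δδ _ _ _ hij x := SU.face_face hij x

variable (M : Type u) [AddCommGroup M] [Module R M]

/-- Evaluation of germs as cochains. -/
def levelEval₀ (n : ℕ) : GermMod R ((level U).fil n) M →ₗ[R]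
    (((chains R).obj (complex U)).X n →ₗ[R] M) :=
  (vanishing R _ M).liftQ ((chainsDesc R U n).toLinearMap ∘ₗ LinearMap.funLeft R M Subtype.val)
    fun f hf => by
      refine chains_hom_ext R U fun s => ?_
      refine (chainsDesc_apply R U n _ s).trans ?_
      have hf' : ∀ᶠ s in Filter.principal (SU.clique U.val n), f s = 0 := hf
      exact Filter.eventually_principal.1 hf' s.1 s.2

theorem levelEval₀_apply (n : ℕ) (f : (Fin (n + 1) → X.carrier) → M) (s) :
    levelEval₀ R U M n (germ R _ M f) (simplexChain R U n s) = f s.1 := chainsDesc_apply R U n _ s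

theorem levelEval₀_bijective (n : ℕ) : Function.Bijective (levelEval₀ R U M n) := by
  classical
  constructor
  · rw [injective_iff_map_eq_zero]
    intro x hx
    obtain ⟨f, rfl⟩ := germ_surjective x
    refine germ_eq_zero.2 (Filter.eventually_principal.2 fun s hs => ?_)
    rw [← levelEval₀_apply R U M n f ⟨s, hs⟩, hx]
    rfl
  · intro c
    refine ⟨germ R _ M fun s => if h : s ∈ SU.clique U.val n then c (simplexChain R U n ⟨s, h⟩)
      else 0, chains_hom_ext R U fun s => ?_⟩
    rw [levelEval₀_apply, dif_pos s.2]

/-- Evaluation of germs as cochains. -/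
def levelEval : Cx.Hom ((level U).cx R M) ((chainsCh R U).hom M) where
  f n := levelEval₀ R U M n
  comm n x := by
    obtain ⟨f, rfl⟩ := germ_surjective x
    refine chains_hom_ext R U fun s => ?_
    change levelEval₀ R U M (n + 1) (alt _ (germ R _ M f)) (simplexChain R U (n + 1) s) =
      levelEval₀ R U M n (germ R _ M f)
        ((((chains R).obj (complex U)).d (n + 1) n).hom (simplexChain R U (n + 1) s))
    rw [chains_d, map_sum, alt_apply, map_sum, LinearMap.sum_apply]
    refine Finset.sum_congr rfl fun i _ => ?_
    rw [map_smul, map_smul, levelEval₀_apply, LinearMap.smul_apply, pull_germ, levelEval₀_apply]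
    rfl

variable {M} in
theorem levelEval_qi : Cx.QI (levelEval R U M) := Cx.QI.of_bijective fun n => levelEval₀_bijective R U M n

variable [IsDomain R] [IsPrincipalIdealRing R]

variable {R U} in
/-- Cochains on a relation with homology of finite type commute with tensor products. -/
theorem level_isTame (h : ∀ n, Module.Finite R (homologyAt R U n)) : (level U).IsTame R := by
  intro A B _ _ _ _
  have h1 : Cx.QI ((chainsCh R U).comparison A B) := Ch.comparison_qi (fun n => chainsCh_finType U (h n)) A B
  let c : Cx.Hom (((level U).cx R B).lT A) ((chainsCh R U).tHom A B) :=
    ⟨fun n => (levelEval₀ R U B n).lTensor A, fun n x => ((levelEval R U B).lT A).comm n x⟩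
  have hc : Cx.QI c := Cx.QI.of_bijective fun n =>
    (LinearEquiv.lTensor A (LinearEquiv.ofBijective _ (levelEval₀_bijective R U B n))).bijective
  refine (levelEval_qi R U (M := A ⊗[R] B)).of_comp ?_
  have e : Cx.Hom.comp (levelEval R U (A ⊗[R] B)) ((level U).homL A B) =
      Cx.Hom.comp ((chainsCh R U).comparison A B) c := by
    refine Cx.Hom.ext' fun n x => ?_
    refine TensorProduct.induction_on (R := R) (M := A) (N := ((level U).cx R B).X n) x ?_ ?_ ?_
    · simp only [map_zero]
    · intro a x
      obtain ⟨f, rfl⟩ := germ_surjective x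
      refine chains_hom_ext R U fun s => ?_
      refine (levelEval₀_apply R U (A ⊗[R] B) n _ s).trans ?_
      exact congrArg (a ⊗ₜ[R] ·) (levelEval₀_apply R U B n f s).symm
    · intro x y hx hy
      rw [map_add, map_add, hx, hy]
  rw [e]
  exact h1.comp hc

end Chains

/-! ### Coefficient modules: torsion and finite generation -/

section Coefficients

variable {R : Type u} [CommRing R]

/-- Injectivity is thereby independent of the presentation, so the canonical presentation can be
exchanged for a finite one and back. -/
theorem FlatPres.lTensor_injective {B Z N : Type u} [AddCommGroup B] [Module R B] [AddCommGroup Z]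
    [Module R Z] [AddCommGroup N] [Module R N] {i : B →ₗ[R] Z} {p : Z →ₗ[R] N} (S : FlatPres i p)
    (M : ModuleCat.{u} R) : Function.Injective (i.lTensor M) ↔
      Subsingleton (tor₁ M (ModuleCat.of R N)) := by
  rw [injective_iff_map_eq_zero]
  constructor
  · intro h
    refine subsingleton_of_forall_eq 0 fun x => S.torMap_injective M ?_
    rw [map_zero]
    exact h _ ((S.mem_range_torMap M).1 ⟨x, rfl⟩)
  · intro h y hy
    obtain ⟨x, rfl⟩ := (S.mem_range_torMap M).2 hy
    rw [Subsingleton.elim x 0, map_zero]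

theorem frFlatPres (N : Type u) [AddCommGroup N] [Module R N] : FlatPres (frInc R N) (frAug R N) :=
  ⟨frInc_injective, frInc_exact, frAug_surjective, inferInstance⟩

variable {S : Type u} (F : Filter S) (M N P : Type u) [AddCommGroup M] [Module R M] [AddCommGroup N]
  [Module R N] [AddCommGroup P] [Module R P]

theorem germR_bijective_of_free [Module.Free R P] [Module.Finite R P] :
    Function.Bijective (germR R F P M) := by
  classical
  let b := Module.Free.chooseBasis R P
  have key : ∀ f : Module.Free.ChooseBasisIndex R P → S → M,
      germR R F P M (∑ i, germ R F M (f i) ⊗ₜ b i) = germ R F (M ⊗[R] P) fun s => ∑ i, f i s ⊗ₜ b i := by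
    intro f
    rw [map_sum]
    simp only [germR_tmul]
    rw [← map_sum]
    congr 1
    funext s
    rw [Finset.sum_apply]
  have rep : ∀ (A : Type u) [AddCommGroup A] [Module R A] (x : A ⊗[R] P),
      ∃ f : Module.Free.ChooseBasisIndex R P → A, x = ∑ i, f i ⊗ₜ b i := by
    intro A _ _ x
    obtain ⟨f, hf⟩ := TensorProduct.eq_repr_basis_right b x
    refine ⟨f, ?_⟩
    rw [← hf]
    exact Finsupp.sum_fintype _ _ fun i => TensorProduct.zero_tmul _ _
  have rep0 : ∀ (f : Module.Free.ChooseBasisIndex R P → M), ∑ i, f i ⊗ₜ[R] b i = 0 → ∀ i, f i = 0 := by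
    intro f hf i
    have := TensorProduct.sum_tmul_basis_right_eq_zero b (Finsupp.equivFunOnFinite.symm f) (by
      rw [← hf]
      exact Finsupp.sum_fintype _ _ fun i => TensorProduct.zero_tmul _ _)
    exact DFunLike.congr_fun this i
  constructor
  · rw [injective_iff_map_eq_zero]
    intro x hx
    obtain ⟨y, rfl⟩ := rep _ x
    choose f hf using fun i => germ_surjective (y i)
    simp only [← hf] at hx ⊢
    rw [key, germ_eq_zero] at hx
    refine Finset.sum_eq_zero fun i _ => ?_
    rw [germ_eq_zero.2 (hx.mono fun s hs => rep0 (fun i => f i s) hs i), TensorProduct.zero_tmul]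
  · intro x
    obtain ⟨h, rfl⟩ := germ_surjective x
    choose f hf using fun s => rep M (h s)
    refine ⟨∑ i, germ R F M (fun s => f s i) ⊗ₜ b i, ?_⟩
    rw [key]
    exact congrArg (germ R F (M ⊗[R] P)) (funext fun s => (hf s).symm)

variable [IsDomain R] [IsPrincipalIdealRing R]

theorem exists_finite_presentation [Module.Finite R N] : ∃ (B Z : Type u) (_ : AddCommGroup B) (_ : Module R B)
    (_ : AddCommGroup Z) (_ : Module R Z) (i : B →ₗ[R] Z) (p : Z →ₗ[R] N), FlatPres i p ∧
    Module.Free R B ∧ Module.Finite R B ∧ Module.Free R Z ∧ Module.Finite R Z := by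
  obtain ⟨m, p, hp⟩ := Module.Finite.exists_fin' R N
  exact ⟨LinearMap.ker p, Fin m → R, inferInstance, inferInstance, inferInstance, inferInstance,
    (LinearMap.ker p).subtype, p, ⟨Submodule.injective_subtype _, LinearMap.exact_subtype_ker_map p, hp,
      inferInstance⟩, free_submodule _, inferInstance, inferInstance, inferInstance⟩

/-- Reduction to the finite free case along a finite free presentation: both sides are right exact
in `N`. -/
theorem germR_bijective_of_finite [Module.Finite R N] : Function.Bijective (germR R F N M) := by
  obtain ⟨B, Z, _, _, _, _, i, p, hip, _, _, _, _⟩ := exists_finite_presentation (R := R) N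
  have hB := germR_bijective_of_free (R := R) F M B
  have hZ := germR_bijective_of_free (R := R) F M Z
  constructor
  · rw [injective_iff_map_eq_zero]
    intro x hx
    obtain ⟨z, rfl⟩ := LinearMap.lTensor_surjective _ hip.surj x
    rw [germR_lTensor] at hx
    obtain ⟨y, hy⟩ := coef_exact (lTensor_exact M hip.exact hip.surj) hx
    obtain ⟨w, rfl⟩ := hB.2 y
    rw [← germR_lTensor] at hy
    rw [← hZ.1 hy]
    exact ((lTensor_exact (GermMod R F M) hip.exact hip.surj) _).2 ⟨w, rfl⟩
  · intro x
    obtain ⟨y, rfl⟩ := coef_surjective (LinearMap.lTensor_surjective M hip.surj) x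
    obtain ⟨z, rfl⟩ := hZ.2 y
    exact ⟨_, germR_lTensor F p z⟩

/-- Vanishing of `Tor_1(M, N)` passes to germs with values in `M`: for a finite presentation germs
commute with the tensor products, and germs preserve injections. -/
theorem germ_lTensor_injective [Module.Finite R N]
    (h : Function.Injective ((frInc R N).lTensor M)) :
    Function.Injective ((frInc R N).lTensor (GermMod R F M)) := by
  obtain ⟨B, Z, _, _, _, _, i, p, hip, _, _, _, _⟩ := exists_finite_presentation (R := R) N
  have hB := germR_bijective_of_free (R := R) F M B
  have hi : Function.Injective (i.lTensor M) :=
    (hip.lTensor_injective (ModuleCat.of R M)).2 (((frFlatPres N).lTensor_injective (ModuleCat.of R M)).1 h)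
  have hi' : Function.Injective (i.lTensor (GermMod R F M)) := by
    refine Function.Injective.of_comp (f := germR R F Z M) fun x y hxy => hB.1 (coef_injective hi ?_)
    rw [← germR_lTensor, ← germR_lTensor]
    exact hxy
  exact ((frFlatPres N).lTensor_injective (ModuleCat.of R (GermMod R F M))).2
    ((hip.lTensor_injective (ModuleCat.of R (GermMod R F M))).1 hi')

end Coefficients

/-! ### The cross product for a pair of relations -/

section Levels

variable {R : Type u} [CommRing R] [IsDomain R] [IsPrincipalIdealRing R] {X Y : SemiUniformSpace.{u}}
  (U : X.Entourage) (V : Y.Entourage) (M N : Type u) [AddCommGroup M] [Module R M]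
  [AddCommGroup N] [Module R N]

theorem Θ_level_qi (hi : Function.Injective ((frInc R N).lTensor M))
    (hV : ∀ n, Module.Finite R (homologyAt R V n))
    (h : (∀ n, Module.Finite R (homologyAt R U n)) ∨ Module.Finite R N) :
    Cx.QI (SFilt.Θ R (level U) (level V) M N).tot := by
  rcases h with hU | hN
  · exact SFilt.Θ_qi_of_isTame (level_isTame hU) (level_isTame hV)
      (fun p q => curryL_bijective _ _) hi
  · exact SFilt.Θ_qi_of_isTame_right (level_isTame hV) (fun p q => curryR_bijective _ _)
      (fun p => germ_lTensor_injective _ M N hi) fun p => germR_bijective_of_finite _ M N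

end Levels

end VietorisRips

namespace VietorisRips

open SemiUniformSpace

/-! ### Quasi-isomorphisms in the limit -/

section Approximation

variable {R : Type u} [CommRing R] {ι : Type u} (l : Filter ι)

/-- A surjection `k` all of whose kernel elements are eventually killed by `ρ i`. -/
def Approx {A B : Type u} [AddCommGroup A] [Module R A] [AddCommGroup B] [Module R B]
    {C : ι → Type u} [∀ i, AddCommGroup (C i)] [∀ i, Module R (C i)]
    (k : A →ₗ[R] B) (ρ : ∀ i, A →ₗ[R] C i) : Prop :=
  Function.Surjective k ∧ ∀ x, k x = 0 → ∀ᶠ i in l, ρ i x = 0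

variable {l} {A B A' B' : Type u} [AddCommGroup A] [Module R A] [AddCommGroup B] [Module R B]
  [AddCommGroup A'] [Module R A'] [AddCommGroup B'] [Module R B']
  {C C' : ι → Type u} [∀ i, AddCommGroup (C i)] [∀ i, Module R (C i)]
  [∀ i, AddCommGroup (C' i)] [∀ i, Module R (C' i)]
  {k : A →ₗ[R] B} {ρ : ∀ i, A →ₗ[R] C i} {k' : A' →ₗ[R] B'} {ρ' : ∀ i, A' →ₗ[R] C' i}

theorem Approx.prodMap (h : Approx l k ρ) (h' : Approx l k' ρ') :
    Approx l (k.prodMap k') (fun i => (ρ i).prodMap (ρ' i)) := by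
  refine ⟨h.1.prodMap h'.1, ?_⟩
  rintro ⟨x, y⟩ hxy
  filter_upwards [h.2 x (congrArg Prod.fst hxy), h'.2 y (congrArg Prod.snd hxy)] with i hi hi'
  exact Prod.ext hi hi'

/-- The kernel of a tensor product of surjections is generated by the kernels of the factors. A
tensor is a finite sum, so finitely many elements have to be killed. -/
theorem Approx.tensorMap (h : Approx l k ρ) (h' : Approx l k' ρ') :
    Approx l (TensorProduct.map k k') (fun i => TensorProduct.map (ρ i) (ρ' i)) := by
  refine ⟨TensorProduct.map_surjective h.1 h'.1, fun x hx => ?_⟩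
  have hx' : x ∈ LinearMap.ker (TensorProduct.map k k') := hx
  rw [TensorProduct.map_ker (LinearMap.exact_subtype_ker_map k) h.1
    (LinearMap.exact_subtype_ker_map k') h'.1] at hx'
  obtain ⟨_, ⟨y, rfl⟩, _, ⟨z, rfl⟩, rfl⟩ := Submodule.mem_sup.1 hx'
  have hy : ∀ᶠ i in l, TensorProduct.map (ρ i) (ρ' i) ((LinearMap.ker k').subtype.lTensor A y) = 0 := by
    clear hx hx'
    induction y with
    | zero => exact .of_forall fun i => by simp only [map_zero]
    | tmul a b =>
      filter_upwards [h'.2 b b.2] with i hi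
      change ρ i a ⊗ₜ[R] ρ' i b = 0
      rw [hi, TensorProduct.tmul_zero]
    | add y y' hy hy' =>
      filter_upwards [hy, hy'] with i hi hi'
      rw [map_add, map_add, hi, hi', add_zero]
  have hz : ∀ᶠ i in l, TensorProduct.map (ρ i) (ρ' i) ((LinearMap.ker k).subtype.rTensor A' z) = 0 := by
    clear hx hx'
    induction z with
    | zero => exact .of_forall fun i => by simp only [map_zero]
    | tmul a b =>
      filter_upwards [h.2 a a.2] with i hi
      change ρ i a ⊗ₜ[R] ρ' i b = 0
      rw [hi, TensorProduct.zero_tmul]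
    | add y y' hy hy' =>
      filter_upwards [hy, hy'] with i hi hi'
      rw [map_add, map_add, hi, hi', add_zero]
  filter_upwards [hy, hz] with i hi hi'
  rw [map_add, hi, hi', add_zero]

/-- A total degree has finitely many entries, so the eventual conditions on them hold
simultaneously. -/
theorem DCx.approx_tot {E E' : DCx R} {G : ι → DCx R} {f : DCx.Hom E E'} {g : ∀ i, DCx.Hom E (G i)}
    (h : ∀ p q, Approx l (f.f p q) (fun i => (g i).f p q)) (n : ℕ) :
    Approx l (f.tot.f n) (fun i => (g i).tot.f n) := by
  constructor
  · intro y
    choose x hx using fun p q => (h p q).1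
    refine ⟨fun s => x s.1.1 s.1.2 (y s), ?_⟩
    exact DCx.totX_ext fun p q e => hx p q _
  · intro x hx
    have : ∀ᶠ i in l, ∀ s : {s : ℕ × ℕ // s.1 + s.2 = n}, (g i).f s.1.1 s.1.2 (x s) = 0 :=
      Filter.eventually_all.2 fun s => (h s.1.1 s.1.2).2 (x s) (congrFun hx s)
    filter_upwards [this] with i hi
    exact funext hi

theorem Cx.approx_sh {E E' : Cx R} {G : ι → Cx R} {f : Cx.Hom E E'} {g : ∀ i, Cx.Hom E (G i)}
    (h : ∀ n, Approx l (f.f n) (fun i => (g i).f n)) (n : ℕ) :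
    Approx l (f.sh.f n) (fun i => (g i).sh.f n) := by
  cases n with
  | zero => exact ⟨fun y => ⟨0, Subsingleton.elim _ _⟩, fun x _ => .of_forall fun i => Subsingleton.elim _ _⟩
  | succ n => exact h n

/-- This replaces the exactness of direct limits. The data of a cone problem for `f` lift to `K₀`
and `L₀`; the finitely many equations they satisfy in the limit hold eventually at stage `i`, in
particular at some `i` where `f₁ i` is a quasi-isomorphism. The problem is solved there and the
solution mapped back by `κ`. -/
theorem Cx.QI.of_approx {K L K₀ L₀ : Cx R} {f : Cx.Hom K L} {f₀ : Cx.Hom K₀ L₀} {K₁ L₁ : ι → Cx R}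
    {f₁ : ∀ i, Cx.Hom (K₁ i) (L₁ i)} {k : Cx.Hom K₀ K} {m : Cx.Hom L₀ L}
    {ρ : ∀ i, Cx.Hom K₀ (K₁ i)} {σ : ∀ i, Cx.Hom L₀ (L₁ i)}
    {κ : ∀ i, Cx.Hom (K₁ i) K} {μ : ∀ i, Cx.Hom (L₁ i) L}
    (hk : ∀ n, Approx l (k.f n) (fun i => (ρ i).f n)) (hm : ∀ n, Approx l (m.f n) (fun i => (σ i).f n))
    (hκ : ∀ i n x, (κ i).f n ((ρ i).f n x) = k.f n x) (hμ : ∀ i n x, (μ i).f n ((σ i).f n x) = m.f n x)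
    (hf : ∀ n x, f.f n (k.f n x) = m.f n (f₀.f n x))
    (hρ : ∀ i n x, (f₁ i).f n ((ρ i).f n x) = (σ i).f n (f₀.f n x))
    (hκμ : ∀ i n x, f.f n ((κ i).f n x) = (μ i).f n ((f₁ i).f n x))
    (h : ∃ᶠ i in l, QI (f₁ i)) : QI f := by
  refine QI.of_cone ?_ ?_
  · intro a ha hfa
    obtain ⟨a, rfl⟩ := (hk 0).1 a
    obtain ⟨i, hi, h1, h2⟩ := (h.and_eventually (((hk 1).2 (K₀.d 0 a) (by rw [k.comm, ha])).and
      ((hm 0).2 (f₀.f 0 a) (by rw [← hf, hfa])))).exists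
    rw [← hκ i, hi.eq_zero (by rw [← (ρ i).comm, h1]) ((hρ i 0 a).trans h2), map_zero]
  · intro n b a' ha' hb
    obtain ⟨b, rfl⟩ := (hm n).1 b
    obtain ⟨a', rfl⟩ := (hk (n + 1)).1 a'
    obtain ⟨i, hi, h1, h2⟩ := (h.and_eventually (((hk (n + 1 + 1)).2 (K₀.d _ a') (by rw [k.comm, ha'])).and
      ((hm (n + 1)).2 (L₀.d n b - f₀.f _ a') (by rw [map_sub, ← hf, ← hb, m.comm, sub_self])))).exists
    obtain ⟨a, h3, h4⟩ := hi.cone (b := (σ i).f n b) (a' := (ρ i).f (n + 1) a')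
      (by rw [← (ρ i).comm, h1])
      (by rw [hρ, ← (σ i).comm]; rw [map_sub] at h2; exact sub_eq_zero.1 h2)
    refine ⟨(κ i).f n a, by rw [← (κ i).comm, h3, hκ], ?_⟩
    rw [hκμ, ← hμ i, ← map_sub]
    exact (μ i).map_B h4

end Approximation

namespace SFilt

variable {R : Type u} [CommRing R] {M N : Type u} [AddCommGroup M] [Module R M] [AddCommGroup N] [Module R N]

/-- Composition of morphisms. -/
def Hom.comp {T T₁ T₂ : SFilt.{u}} (g : Hom T₁ T₂) (f : Hom T T₁) : Hom T T₂ where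
  f n := g.f n ∘ f.f n
  tendsto n := (g.tendsto n).comp (f.tendsto n)
  comm n i x := by
    change g.f n (f.f n _) = _
    rw [f.comm, g.comm]
    rfl

theorem Hom.map_id_comp {T T₁ T₂ : SFilt.{u}} (g : Hom T₁ T₂) (f : Hom T T₁) (n : ℕ) (x) :
    (f.map (LinearMap.id (R := R) (M := M))).f n ((g.map LinearMap.id).f n x) =
      ((g.comp f).map LinearMap.id).f n x := by
  obtain ⟨x, rfl⟩ := germ_surjective x
  rfl

theorem Hom.dmap_id_comp {T T₁ T₂ T' T₁' T₂' : SFilt.{u}} (g : Hom T₁ T₂) (f : Hom T T₁)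
    (g' : Hom T₁' T₂') (f' : Hom T' T₁') (p q : ℕ) (x) :
    (f.dmap f' (LinearMap.id (R := R) (M := M))).f p q ((g.dmap g' LinearMap.id).f p q x) =
      ((g.comp f).dmap (g'.comp f') LinearMap.id).f p q x := by
  obtain ⟨x, rfl⟩ := germ_surjective x
  rfl

theorem frMap_id : frMap (LinearMap.id : N →ₗ[R] N) = LinearMap.id := by
  refine LinearMap.ext fun x => ?_
  exact Finsupp.mapDomain_id

theorem frRelMap_id : frRelMap (LinearMap.id : N →ₗ[R] N) = LinearMap.id := by
  refine LinearMap.ext fun x => frInc_injective ?_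
  rw [frInc_map, frMap_id]
  rfl

theorem Hom.flatMap_id {T T₁ : SFilt.{u}} (f : Hom T T₁) : f.flatMap (LinearMap.id (R := R) (M := N)) =
    Cx.coconeMap (f.map LinearMap.id) (f.map LinearMap.id) fun n x => by
      obtain ⟨g, rfl⟩ := germ_surjective x
      rfl := by
  simp only [flatMap, frMap_id, frRelMap_id]

theorem Hom.flatMap_id_comp {T T₁ T₂ : SFilt.{u}} (g : Hom T₁ T₂) (f : Hom T T₁) (n : ℕ) (x) :
    (f.flatMap (LinearMap.id (R := R) (M := N))).f n ((g.flatMap LinearMap.id).f n x) =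
      ((g.comp f).flatMap LinearMap.id).f n x := by
  rw [flatMap_id, flatMap_id, flatMap_id]
  refine Prod.ext (Hom.map_id_comp g f n x.1) ?_
  cases n with
  | zero => exact Subsingleton.elim (α := (T.cx R (Fr R N)).sh.X 0) _ _
  | succ n => exact Hom.map_id_comp g f n x.2

section Pullback

variable {T T₁ T₂ T' T₁' T₂' : SFilt.{u}} (g : Hom T₁ T₂) (f : Hom T T₁) (g' : Hom T₁' T₂') (f' : Hom T' T₁')

variable (R M N) in
/-- Pullback on the tensor product. -/
def tensPull : DCx.Hom (tens (T₁.cx R M) (T₁'.flatCx R N)) (tens (T.cx R M) (T'.flatCx R N)) :=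
  tensMap (f.map LinearMap.id) (f'.flatMap LinearMap.id)

variable (R M) in
/-- Pullback on the shifted double complex of germs on pairs. -/
def dPull : DCx.Hom (T₁.dcx R T₁' M).sh (T.dcx R T' M).sh := (f.dmap f' LinearMap.id).sh

theorem tensPull_comp (p q : ℕ) (x) : (tensPull R M N f f').f p q ((tensPull R M N g g').f p q x) =
    (tensPull R M N (g.comp f) (g'.comp f')).f p q x := by
  change TensorProduct.map ((f.map _).f p) ((f'.flatMap _).f q)
    (TensorProduct.map ((g.map _).f p) ((g'.flatMap _).f q) x) = TensorProduct.map _ _ x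
  rw [← LinearMap.comp_apply, ← TensorProduct.map_comp]
  refine congrFun (congrArg DFunLike.coe (congrArg₂ TensorProduct.map ?_ ?_)) x
  · exact LinearMap.ext fun x => SFilt.Hom.map_id_comp g f p x
  · exact LinearMap.ext fun x => SFilt.Hom.flatMap_id_comp g' f' q x

theorem dPull_comp (p q : ℕ) (x) : (dPull R M f f').f p q ((dPull R M g g').f p q x) =
    (dPull R M (g.comp f) (g'.comp f')).f p q x := by
  cases q with
  | zero => exact Subsingleton.elim (α := ((T.dcx R T' M).col p).sh.X 0) _ _
  | succ q => exact SFilt.Hom.dmap_id_comp g f g' f' p q _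

theorem Θ_pull (p q : ℕ) (x) : (SFilt.Θ R T T' M N).f p q ((tensPull R M N f f').f p q x) =
    (dPull R (M ⊗[R] N) f f').f p q ((SFilt.Θ R T₁ T₁' M N).f p q x) := by
  have := SFilt.Θ_natural f f' (LinearMap.id (R := R) (M := M)) (LinearMap.id (R := R) (M := N)) p q x
  rw [TensorProduct.map_id] at this
  exact this

end Pullback

end SFilt

/-- Tuples of points, with the filters of neighbourhoods of the diagonals. -/
abbrev tuples (X : SemiUniformSpace.{u}) : SFilt.{u} where
  S n := Fin (n + 1) → X.carrier
  fil n := SU.cliqueFilter X n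
  δ _ i := SU.face i
  tendsto n i := SU.tendsto_face n i
  δδ _ _ _ hij x := SU.face_face hij x

/-! ### From relations to germs near the diagonal -/

section Limit

variable {X Y : SemiUniformSpace.{u}}

/-- The comparison with a relation. -/
def toLevel (U : X.Entourage) : SFilt.Hom (tuples X) (level U) where
  f _ := id
  tendsto _ := Filter.tendsto_principal.2 (SU.eventually_clique.2 ⟨U.val, U.mem, fun _ hx => hx⟩)
  comm _ _ _ := rfl

/-- The comparison of two relations. -/
def levelMap {U V : X.Entourage} (h : U ≤ V) : SFilt.Hom (level V) (level U) where
  f _ := id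
  tendsto n := Filter.tendsto_principal_principal.2 (SU.clique_mono h n)
  comm _ _ _ := rfl

instance : OrderBot X.Entourage where
  bot := ⟨Set.univ, Filter.univ_mem⟩
  bot_le _ := Set.subset_univ _

instance : SemilatticeSup X.Entourage where
  sup U V := ⟨U.val ∩ V.val, Filter.inter_mem U.mem V.mem⟩
  le_sup_left _ _ := Set.inter_subset_left
  le_sup_right _ _ := Set.inter_subset_right
  sup_le _ _ _ h h' := Set.subset_inter h h'

variable {R : Type u} [CommRing R] {M N : Type u} [AddCommGroup M] [Module R M] [AddCommGroup N] [Module R N]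

theorem approx_map (n : ℕ) : Approx (Filter.atTop : Filter X.Entourage)
    (((toLevel (⊥ : X.Entourage)).map (LinearMap.id (R := R) (M := M))).f n)
    (fun U => ((levelMap (bot_le (a := U))).map LinearMap.id).f n) := by
  constructor
  · intro x
    obtain ⟨f, rfl⟩ := germ_surjective x
    exact ⟨germ R ((level (⊥ : X.Entourage)).fil n) M f, rfl⟩
  · intro x hx
    obtain ⟨f, rfl⟩ := germ_surjective x
    have hx' : germ R (SU.cliqueFilter X n) M f = 0 := hx
    obtain ⟨U, hU, h⟩ := SU.eventually_clique.1 (germ_eq_zero.1 hx')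
    filter_upwards [Filter.eventually_ge_atTop (⟨U, hU⟩ : X.Entourage)] with V hV
    change germ R ((level V).fil n) M f = 0
    exact germ_eq_zero.2 (Filter.eventually_principal.2 fun s hs => h s (SU.clique_mono hV n hs))

theorem approx_flatMap (n : ℕ) : Approx (Filter.atTop : Filter X.Entourage)
    (((toLevel (⊥ : X.Entourage)).flatMap (LinearMap.id (R := R) (M := N))).f n)
    (fun U => ((levelMap (bot_le (a := U))).flatMap LinearMap.id).f n) := by
  simp only [SFilt.Hom.flatMap_id]
  exact (approx_map n).prodMap (Cx.approx_sh (fun n => approx_map n) n)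

theorem Approx.tendsto {ι ι' : Type u} {l : Filter ι} {l' : Filter ι'} {φ : ι' → ι} (hφ : Filter.Tendsto φ l' l)
    {A B : Type u} [AddCommGroup A] [Module R A] [AddCommGroup B] [Module R B]
    {C : ι → Type u} [∀ i, AddCommGroup (C i)] [∀ i, Module R (C i)]
    {k : A →ₗ[R] B} {ρ : ∀ i, A →ₗ[R] C i} (h : Approx l k ρ) : Approx l' k (fun i => ρ (φ i)) :=
  ⟨h.1, fun x hx => hφ.eventually (h.2 x hx)⟩

theorem approx_dmap (p q : ℕ) : Approx (Filter.atTop ×ˢ Filter.atTop : Filter (X.Entourage × Y.Entourage))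
    (((toLevel (⊥ : X.Entourage)).dmap (toLevel (⊥ : Y.Entourage)) (LinearMap.id (R := R) (M := M))).f p q)
    (fun U => ((levelMap (bot_le (a := U.1))).dmap (levelMap (bot_le (a := U.2))) LinearMap.id).f p q) := by
  constructor
  · intro x
    obtain ⟨f, rfl⟩ := germ_surjective x
    exact ⟨germ R ((level (⊥ : X.Entourage)).fil p ×ˢ (level (⊥ : Y.Entourage)).fil q) M f, rfl⟩
  · intro x hx
    obtain ⟨f, rfl⟩ := germ_surjective x
    have hx' : germ R (SU.cliqueFilter X p ×ˢ SU.cliqueFilter Y q) M f = 0 := hx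
    obtain ⟨P, hP, Q, hQ, h⟩ := Filter.eventually_prod_iff.1 (germ_eq_zero.1 hx')
    obtain ⟨U, hU, hU'⟩ := SU.eventually_clique.1 hP
    obtain ⟨V, hV, hV'⟩ := SU.eventually_clique.1 hQ
    filter_upwards [(Filter.eventually_ge_atTop (⟨U, hU⟩ : X.Entourage)).prod_mk
      (Filter.eventually_ge_atTop (⟨V, hV⟩ : Y.Entourage))] with W hW
    change germ R ((level W.1).fil p ×ˢ (level W.2).fil q) M f = 0
    refine germ_eq_zero.2 (Filter.eventually_prod_iff.2 ⟨_, Filter.mem_principal_self _, _,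
      Filter.mem_principal_self _, fun {s} hs {t} ht => ?_⟩)
    exact h (hU' s (SU.clique_mono hW.1 p hs)) (hV' t (SU.clique_mono hW.2 q ht))

/-- Pairs of relations, ordered by reverse inclusion. -/
abbrev smallPairs (X Y : SemiUniformSpace.{u}) : Filter (X.Entourage × Y.Entourage) :=
  Filter.atTop ×ˢ Filter.atTop

variable (R M N) (X Y)

/-- Pullback from the coarsest relations on the tensor product. -/
abbrev tensBot := SFilt.tensPull R M N (toLevel (⊥ : X.Entourage)) (toLevel (⊥ : Y.Entourage))

/-- Pullback from the coarsest relations on germs on pairs. -/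
abbrev dBot := SFilt.dPull R M (toLevel (⊥ : X.Entourage)) (toLevel (⊥ : Y.Entourage))

variable {X Y} (U : X.Entourage × Y.Entourage)

/-- Restriction from the coarsest relations on the tensor product. -/
abbrev tensRes := SFilt.tensPull R M N (levelMap (bot_le (a := U.1))) (levelMap (bot_le (a := U.2)))

/-- Restriction from the coarsest relations on germs on pairs. -/
abbrev dRes := SFilt.dPull R M (levelMap (bot_le (a := U.1))) (levelMap (bot_le (a := U.2)))

theorem approx_tensPull (p q : ℕ) : Approx (smallPairs X Y)
    ((tensBot X Y R M N).f p q) (fun U => (tensRes R M N U).f p q) := by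
  have h1 := Approx.tendsto (l' := smallPairs X Y) Filter.tendsto_fst (approx_map (X := X) (R := R) (M := M) p)
  have h2 := Approx.tendsto (l' := smallPairs X Y) Filter.tendsto_snd (approx_flatMap (X := Y) (R := R) (N := N) q)
  exact h1.tensorMap h2

theorem approx_dPull (p q : ℕ) : Approx (smallPairs X Y)
    ((dBot X Y R M).f p q) (fun U => (dRes R M U).f p q) := by
  cases q with
  | zero => exact ⟨fun y => ⟨0, Subsingleton.elim (α := (((tuples X).dcx R (tuples Y) M).col p).sh.X 0) _ _⟩,
      fun x _ => .of_forall fun i =>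
        Subsingleton.elim (α := (((level i.1).dcx R (level i.2) M).col p).sh.X 0) _ _⟩
  | succ q => exact approx_dmap p q

/-- The level `⊥`, the relation `Set.univ`, serves as common source: its germs are plain functions,
which restrict to every relation and to germs near the diagonal. -/
theorem Θ_qi_of_levels (h : ∃ᶠ U : X.Entourage × Y.Entourage in smallPairs X Y,
    Cx.QI (SFilt.Θ R (level U.1) (level U.2) M N).tot) :
    Cx.QI (SFilt.Θ R (tuples X) (tuples Y) M N).tot :=
  Cx.QI.of_approx (l := smallPairs X Y)
    (f := (SFilt.Θ R (tuples X) (tuples Y) M N).tot)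
    (f₀ := (SFilt.Θ R (level ⊥) (level ⊥) M N).tot)
    (f₁ := fun U => (SFilt.Θ R (level U.1) (level U.2) M N).tot)
    (k := (tensBot X Y R M N).tot) (m := (dBot X Y R (M ⊗[R] N)).tot)
    (ρ := fun U => (tensRes R M N U).tot) (σ := fun U => (dRes R (M ⊗[R] N) U).tot)
    (κ := fun U => (SFilt.tensPull R M N (toLevel U.1) (toLevel U.2)).tot)
    (μ := fun U => (SFilt.dPull R (M ⊗[R] N) (toLevel U.1) (toLevel U.2)).tot)
    (DCx.approx_tot (approx_tensPull R M N)) (DCx.approx_tot (approx_dPull R (M ⊗[R] N)))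
    (fun _ _ _ => DCx.totX_ext fun p q _ => SFilt.tensPull_comp _ _ _ _ p q _)
    (fun _ _ _ => DCx.totX_ext fun p q _ => SFilt.dPull_comp _ _ _ _ p q _)
    (fun _ _ => DCx.totX_ext fun p q _ => SFilt.Θ_pull _ _ p q _)
    (fun _ _ _ => DCx.totX_ext fun p q _ => SFilt.Θ_pull _ _ p q _)
    (fun _ _ _ => DCx.totX_ext fun p q _ => SFilt.Θ_pull _ _ p q _) h

variable {R M N}

variable [IsDomain R] [IsPrincipalIdealRing R]

/-- Being generated by relations of finite type means that good relations exist below any given one,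
so good pairs are frequent. In the second alternative only the relation on `Y` has to be improved.
-/
theorem Θ_qi {G G' : ModuleCat.{u} R} (h : KunnethHypotheses X Y G G') :
    Cx.QI (SFilt.Θ R (tuples X) (tuples Y) G G').tot := by
  have hi : Function.Injective ((frInc R G').lTensor G) :=
    ((frFlatPres G').lTensor_injective G).2 (ModuleCat.subsingleton_of_isZero h.tor_eq_zero)
  refine Θ_qi_of_levels R G G' ?_
  rw [smallPairs, Filter.prod_atTop_atTop_eq, Filter.frequently_atTop]
  rintro ⟨U₀, V₀⟩
  rcases h.finiteType with ⟨⟨B, hB, hfB⟩, ⟨B', hB', hfB'⟩⟩ | ⟨⟨B', hB', hfB'⟩, hG⟩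
  · obtain ⟨U, hU, hU'⟩ := hB U₀
    obtain ⟨V, hV, hV'⟩ := hB' V₀
    exact ⟨(U, V), ⟨hU', hV'⟩, Θ_level_qi U V G G' hi (hfB' V hV) (.inl (hfB U hU))⟩
  · obtain ⟨V, hV, hV'⟩ := hB' V₀
    exact ⟨(U₀, V), ⟨le_rfl, hV'⟩, Θ_level_qi U₀ V G G' hi (hfB' V hV) (.inr hG)⟩

end Limit

end VietorisRips

namespace VietorisRips

open SemiUniformSpace

/-! ### Vietoris-Rips cohomology as cohomology of germs -/

variable {R : Type u} [CommRing R] {X Y : SemiUniformSpace.{u}} {G G' : ModuleCat.{u} R}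

/-- The morphism of filtered semi-simplicial sets induced by a uniformly continuous map. -/
def tuplesHom (f : UniformMap X Y) : SFilt.Hom (tuples X) (tuples Y) where
  f _ x := f.toFun ∘ x
  tendsto n := SU.tendsto_map f n
  comm _ _ _ := rfl

/-- The morphism of filtered semi-simplicial sets induced by a map compatible with relations. -/
def levelHom (U : X.Entourage) (V : Y.Entourage) (f : X.carrier → Y.carrier)
    (h : ∀ p ∈ U.val, (f p.1, f p.2) ∈ V.val) : SFilt.Hom (level U) (level V) where
  f _ x := f ∘ x
  tendsto _ := Filter.tendsto_principal_principal.2 fun _ hx => SU.clique_map h hx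
  comm _ _ _ := rfl

section Level

variable (U : X.Entourage) (V : Y.Entourage)

variable (G) in
/-- The cocycle of a germ that is a cocycle. -/
def levelCocycle (n : ℕ) : ((level U).cx R G).Z n →ₗ[R]
    LinearMap.ker ((cochains ((chains R).obj (complex U)) G).d n (n + 1)).hom :=
  ((levelEval R U G).f n).restrict fun x hx => by
    have h : ((chainsCh R U).hom G).d n ((levelEval R U G).f n x) = 0 := by
      rw [← (levelEval R U G).comm, Cx.mem_Z.1 hx, map_zero]
    exact h

variable (G) in
theorem levelCocycle_surjective (n : ℕ) : Function.Surjective (levelCocycle G U n) := by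
  rintro ⟨c, hc⟩
  obtain ⟨x, hx⟩ := (levelEval₀_bijective R U G n).2 c
  refine ⟨⟨x, ?_⟩, Subtype.ext hx⟩
  refine (levelEval₀_bijective R U G (n + 1)).1 ?_
  rw [map_zero]
  refine ((levelEval R U G).comm n x).trans ?_
  change ((chainsCh R U).hom G).d n (levelEval₀ R U G n x) = 0
  rw [hx]
  exact hc

theorem levelCocycle_mem_B {n : ℕ} {x : ((level U).cx R G).Z n} :
    hcls (cochains ((chains R).obj (complex U)) G) n (n + 1) (CochainComplex.next ℕ n) (levelCocycle G U n x) = 0 ↔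
      (x : ((level U).cx R G).X n) ∈ ((level U).cx R G).B n := by
  cases n with
  | zero =>
    rw [hcls_eq_zero _ CochainComplex.prev_nat_zero]
    have hd : (cochains ((chains R).obj (complex U)) G).d 0 0 = 0 :=
      (cochains ((chains R).obj (complex U)) G).shape 0 0 (by simp)
    rw [hd]
    constructor
    · rintro ⟨y, hy⟩
      refine (levelEval₀_bijective R U G 0).1 ?_
      rw [map_zero]
      exact hy.symm
    · intro h
      refine ⟨0, ?_⟩
      have h' : (x : ((level U).cx R G).X 0) = 0 := h
      change 0 = levelEval₀ R U G 0 x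
      rw [h', map_zero]
  | succ n =>
    rw [hcls_eq_zero _ (CochainComplex.prev_nat_succ n)]
    constructor
    · rintro ⟨y, hy⟩
      obtain ⟨y, rfl⟩ := (levelEval₀_bijective R U G n).2 y
      exact ⟨y, (levelEval₀_bijective R U G (n + 1)).1 (((levelEval R U G).comm n y).trans hy)⟩
    · rintro ⟨y, hy⟩
      refine ⟨levelEval₀ R U G n y, ?_⟩
      refine ((levelEval R U G).comm n y).symm.trans ?_
      rw [hy]
      rfl

variable (G) in
/-- The cohomology of a Vietoris-Rips complex in terms of germs. -/
def levelIso (n : ℕ) : ((level U).cx R G).H n ≃ₗ[R] cohomologyAt U G n :=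
  LinearEquiv.ofBijective ((((level U).cx R G).B n).submoduleOf (((level U).cx R G).Z n) |>.liftQ
    (hcls (cochains ((chains R).obj (complex U)) G) n (n + 1) (CochainComplex.next ℕ n) ∘ₗ levelCocycle G U n)
    fun x hx => (levelCocycle_mem_B U).2 hx) (by
    constructor
    · rw [injective_iff_map_eq_zero]
      intro x hx
      obtain ⟨z, rfl⟩ := Cx.cls_surjective n x
      exact Cx.cls_eq_zero.2 ((levelCocycle_mem_B U).1 hx)
    · intro x
      obtain ⟨y, rfl⟩ := hcls_surjective n (n + 1) (CochainComplex.next ℕ n) x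
      obtain ⟨z, rfl⟩ := levelCocycle_surjective G U n y
      exact ⟨((level U).cx R G).cls n z, rfl⟩)

theorem levelEval_natural (f : X.carrier → Y.carrier) (h : ∀ p ∈ U.val, (f p.1, f p.2) ∈ V.val)
    (φ : G ⟶ G') (n : ℕ) (x) :
    ((cochainsMap ((chains R).map (complexMap U V f h)) φ).f n).hom (levelEval₀ R V G n x) =
      levelEval₀ R U G' n (((levelHom U V f h).map φ.hom).f n x) := by
  obtain ⟨g, rfl⟩ := germ_surjective x
  refine chains_hom_ext R U fun s => ?_
  have e : (((chains R).map (complexMap U V f h)).f n).hom (simplexChain R U n s) =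
      simplexChain R V n ⟨f ∘ s.1, SU.clique_map h s.2⟩ := ModuleCat.free_map_apply _ _
  change φ.hom (levelEval₀ R V G n (germ R ((level V).fil n) G g)
    ((((chains R).map (complexMap U V f h)).f n).hom (simplexChain R U n s))) = _
  rw [e, levelEval₀_apply]
  exact (levelEval₀_apply R U G' n (fun t => φ.hom (g (f ∘ t))) s).symm

theorem levelIso_natural (f : X.carrier → Y.carrier) (h : ∀ p ∈ U.val, (f p.1, f p.2) ∈ V.val)
    (φ : G ⟶ G') (n : ℕ) (x) :
    (cohomologyAtMap U V f h φ n).hom (levelIso G V n x) =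
      levelIso G' U n (((levelHom U V f h).map φ.hom).mapH n x) := by
  obtain ⟨z, rfl⟩ := Cx.cls_surjective n x
  refine (hcls_natural _ n (n + 1) (CochainComplex.next ℕ n) (levelCocycle G V n z)
    (hom_map_ker _ n (n + 1) _)).trans ?_
  exact congrArg (hcls (cochains ((chains R).obj (complex U)) G') n (n + 1) (CochainComplex.next ℕ n))
    (Subtype.ext (levelEval_natural U V f h φ n z))

end Level

variable (X G) in
/-- The map from the cohomology of a Vietoris-Rips complex to the cohomology of germs. -/
def levelToGerm (n : ℕ) (U : X.Entourage) : cohomologyAt U G n →ₗ[R] (SU.germCx R X G).H n :=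
  ((toLevel U).map (LinearMap.id (R := R) (M := G))).mapH n ∘ₗ (levelIso G U n).symm.toLinearMap

theorem levelToGerm_iso (n : ℕ) (U : X.Entourage) (x) : levelToGerm X G n U (levelIso G U n x) =
    ((toLevel U).map (LinearMap.id (R := R) (M := G))).mapH n x :=
  congrArg _ ((levelIso G U n).symm_apply_apply x)

theorem levelToGerm_transition (n : ℕ) (U V : X.Entourage) (h : U ≤ V) (x) :
    levelToGerm X G n V (transition X G n U V h x) = levelToGerm X G n U x := by
  obtain ⟨x, rfl⟩ := (levelIso G U n).surjective x
  rw [transition, levelIso_natural, levelToGerm_iso, levelToGerm_iso]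
  obtain ⟨⟨z, hz⟩, rfl⟩ := Cx.cls_surjective n x
  obtain ⟨f, rfl⟩ := germ_surjective z
  rfl

open Classical in
variable (X G) in
/-- The comparison of Vietoris-Rips cohomology with the cohomology of germs. -/
def toGerm (n : ℕ) : cohomologyNat X G n →ₗ[R] (SU.germCx R X G).H n :=
  Module.DirectLimit.lift R X.Entourage _ _ (levelToGerm X G n) (levelToGerm_transition n)

open Classical in
theorem toGerm_of (n : ℕ) (U : X.Entourage) (x) :
    toGerm X G n (Module.DirectLimit.of R X.Entourage (fun U => cohomologyAt U G n)
      (transition X G n) U x) = levelToGerm X G n U x := Module.DirectLimit.lift_of _ _ _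

theorem toLevel_surjective {n : ℕ} (U : X.Entourage) (y : (SU.germCx R X G).X n) :
    ∃ x, ((toLevel U).map (LinearMap.id (R := R) (M := G))).f n x = y := by
  obtain ⟨f, rfl⟩ := germ_surjective y
  exact ⟨germ R ((level U).fil n) G f, rfl⟩

theorem exists_level_eq_zero {n : ℕ} (U : X.Entourage) {x : ((level U).cx R G).X n}
    (hx : ((toLevel U).map (LinearMap.id (R := R) (M := G))).f n x = 0) :
    ∃ V, ∃ h : U ≤ V, ((levelMap h).map (LinearMap.id (R := R) (M := G))).f n x = 0 := by
  obtain ⟨f, rfl⟩ := germ_surjective x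
  have hx' : germ R (SU.cliqueFilter X n) G f = 0 := hx
  obtain ⟨V, hV, h⟩ := SU.eventually_clique.1 (germ_eq_zero.1 hx')
  refine ⟨U ⊔ ⟨V, hV⟩, le_sup_left, ?_⟩
  change germ R ((level (U ⊔ ⟨V, hV⟩)).fil n) G f = 0
  exact germ_eq_zero.2 (Filter.eventually_principal.2 fun s hs =>
    h s (SU.clique_mono Set.inter_subset_right n hs))

theorem exists_level_mem_B {n : ℕ} (U : X.Entourage) {x : ((level U).cx R G).X n}
    (hx : ((toLevel U).map (LinearMap.id (R := R) (M := G))).f n x ∈ (SU.germCx R X G).B n) :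
    ∃ V, ∃ h : U ≤ V, ((levelMap h).map (LinearMap.id (R := R) (M := G))).f n x ∈ ((level V).cx R G).B n := by
  cases n with
  | zero => exact exists_level_eq_zero U hx
  | succ n =>
    obtain ⟨y, hy⟩ := hx
    obtain ⟨y, rfl⟩ := toLevel_surjective U y
    obtain ⟨V, h, hV⟩ := exists_level_eq_zero U (x := x - ((level U).cx R G).d n y) (by
      rw [map_sub, ((toLevel U).map (LinearMap.id (R := R) (M := G))).comm]
      exact sub_eq_zero.2 hy.symm)
    rw [map_sub, ((levelMap h).map (LinearMap.id (R := R) (M := G))).comm, sub_eq_zero] at hV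
    exact ⟨V, h, _, hV.symm⟩

theorem exists_level_cocycle {n : ℕ} (z : (SU.germCx R X G).Z n) : ∃ U, ∃ x : ((level U).cx R G).Z n,
    ((toLevel U).map (LinearMap.id (R := R) (M := G))).mapZ n x = z := by
  obtain ⟨z, hz⟩ := z
  obtain ⟨x, rfl⟩ := toLevel_surjective ⊥ z
  obtain ⟨V, h, hV⟩ := exists_level_eq_zero ⊥ (x := ((level (⊥ : X.Entourage)).cx R G).d n x) (by
    rw [((toLevel ⊥).map (LinearMap.id (R := R) (M := G))).comm]
    exact hz)
  rw [((levelMap h).map (LinearMap.id (R := R) (M := G))).comm] at hV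
  exact ⟨V, ⟨_, hV⟩, Subtype.ext (SFilt.Hom.map_id_comp (levelMap h) (toLevel V) n x)⟩

variable (G) in
-- A germ is represented by a function on all tuples, and an equation between germs holds on the
-- cliques of some relation. Hence a cocycle of germs is a cocycle at some level, and a coboundary
-- of germs is a coboundary at a smaller one.
theorem toGerm_bijective (n : ℕ) : Function.Bijective (toGerm X G n) := by
  classical
  constructor
  · rw [injective_iff_map_eq_zero]
    intro x hx
    obtain ⟨U, x, rfl⟩ := Module.DirectLimit.exists_of x
    obtain ⟨x, rfl⟩ := (levelIso G U n).surjective x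
    rw [toGerm_of, levelToGerm_iso] at hx
    obtain ⟨z, rfl⟩ := Cx.cls_surjective n x
    obtain ⟨V, h, hV⟩ := exists_level_mem_B U (Cx.cls_eq_zero.1 hx)
    have e : transition X G n U V h (levelIso G U n (((level U).cx R G).cls n z)) = 0 := by
      rw [transition, levelIso_natural]
      refine (congrArg (levelIso G V n) ?_).trans (map_zero _)
      exact Cx.cls_eq_zero.2 hV
    rw [← Module.DirectLimit.of_f (hij := h), e, map_zero]
  · intro y
    obtain ⟨z, rfl⟩ := Cx.cls_surjective n y
    obtain ⟨U, x, rfl⟩ := exists_level_cocycle z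
    exact ⟨Module.DirectLimit.of R X.Entourage (fun U => cohomologyAt U G n) (transition X G n) U (levelIso G U n (((level U).cx R G).cls n x)),
      (toGerm_of n U _).trans (levelToGerm_iso n U _)⟩

variable (X G) in
/-- Vietoris-Rips cohomology is the cohomology of germs of functions near the diagonal. -/
def germIso (n : ℕ) : cohomologyNat X G n ≃ₗ[R] (SU.germCx R X G).H n :=
  LinearEquiv.ofBijective (toGerm X G n) (toGerm_bijective G n)

theorem germIso_natural (f : UniformMap X Y) (φ : G ⟶ G') (n : ℕ) (x) :
    germIso X G' n (cohomologyNatMap f φ n x) = (SU.germMap f φ.hom).mapH n (germIso Y G n x) := by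
  classical
  obtain ⟨V, x, rfl⟩ := Module.DirectLimit.exists_of x
  obtain ⟨x, rfl⟩ := (levelIso G V n).surjective x
  change toGerm X G' n (Module.DirectLimit.lift R Y.Entourage _ _ _ _ _) =
    (SU.germMap f φ.hom).mapH n (toGerm Y G n _)
  rw [Module.DirectLimit.lift_of, toGerm_of, levelToGerm_iso, LinearMap.comp_apply, toGerm_of]
  refine (congrArg (levelToGerm X G' n (f.pullback V)) (levelIso_natural (f.pullback V) V f.toFun
    (fun _ hp => hp) φ n x)).trans ?_
  rw [levelToGerm_iso]
  obtain ⟨⟨z, hz⟩, rfl⟩ := Cx.cls_surjective n x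
  obtain ⟨g, rfl⟩ := germ_surjective z
  rfl

end VietorisRips

namespace VietorisRips

open SemiUniformSpace

/-! ### Cohomology of the product in terms of a tensor product of complexes -/

section Product

variable {R : Type u} [CommRing R]

theorem pairFilter_eq (X Y : SemiUniformSpace.{u}) (p q : ℕ) :
    SU.pairFilter X Y p q = SU.cliqueFilter X p ×ˢ SU.cliqueFilter Y q := by
  ext s
  rw [Filter.mem_prod_iff]
  constructor
  · rintro ⟨U, hU, V, hV, h⟩
    exact ⟨_, SU.eventually_clique.2 ⟨U, hU, fun _ hx => hx⟩, _,
      SU.eventually_clique.2 ⟨V, hV, fun _ hx => hx⟩, h⟩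
  · rintro ⟨S, ⟨U, hU, _, _, hS⟩, T, ⟨V, hV, _, _, hT⟩, h⟩
    exact ⟨U, hU, V, hV, (Set.prod_mono hS hT).trans h⟩

theorem tendsto_pair (X Y : SemiUniformSpace.{u}) (p q : ℕ) : Filter.Tendsto id (SU.pairFilter X Y p q)
    (SU.cliqueFilter X p ×ˢ SU.cliqueFilter Y q) := (pairFilter_eq X Y p q).le

theorem pull_id_bijective {S : Type u} {F F' : Filter S} (e : F = F') (h : Filter.Tendsto id F' F)
    (M : Type u) [AddCommGroup M] [Module R M] : Function.Bijective (pull R M id h) := by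
  subst e
  constructor
  · intro x y hxy
    rwa [pull_id, pull_id] at hxy
  · exact fun x => ⟨x, pull_id _ _⟩

variable (R) in
/-- The identification of two descriptions of germs on pairs. -/
def pairHom (X Y : SemiUniformSpace.{u}) (M : Type u) [AddCommGroup M] [Module R M] :
    DCx.Hom ((tuples X).dcx R (tuples Y) M) (SU.pairCx R X Y M) where
  f p q := pull R M id (tendsto_pair X Y p q)
  comm_h p q x := by
    refine alt_comm (b := pull R M id (tendsto_pair X Y (p + 1) q))
      (a := pull R M id (tendsto_pair X Y p q)) (fun i x => ?_) x
    rw [pull_pull, pull_pull]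
    rfl
  comm_v p q x := by
    refine alt_comm (b := pull R M id (tendsto_pair X Y p (q + 1)))
      (a := pull R M id (tendsto_pair X Y p q)) (fun i x => ?_) x
    rw [pull_pull, pull_pull]
    rfl

theorem pairHom_bijective (X Y : SemiUniformSpace.{u}) (M : Type u) [AddCommGroup M] [Module R M]
    (p q : ℕ) : Function.Bijective ((pairHom R X Y M).f p q) :=
  pull_id_bijective (pairFilter_eq X Y p q).symm (tendsto_pair X Y p q) M

theorem DCx.tot_qi_of_bijective {A A' : DCx R} {f : DCx.Hom A A'}
    (h : ∀ p q, Function.Bijective (f.f p q)) : Cx.QI f.tot := by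
  refine Cx.QI.of_bijective fun n => ⟨fun x y hxy => ?_, fun y => ?_⟩
  · exact DCx.totX_ext fun p q e => (h p q).1 (congrArg (A'.pr p q e) hxy)
  · choose x hx using fun s : {s : ℕ × ℕ // s.1 + s.2 = n} => (h s.1.1 s.1.2).2 (y s)
    exact ⟨x, funext hx⟩

theorem Cx.Hom.mapH_comm {K L K' L' : Cx R} {a : Cx.Hom K L} {b : Cx.Hom L L'} {c : Cx.Hom K K'}
    {d : Cx.Hom K' L'} (h : ∀ n x, b.f n (a.f n x) = d.f n (c.f n x)) (n : ℕ) (x : K.H n) :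
    b.mapH n (a.mapH n x) = d.mapH n (c.mapH n x) := by
  obtain ⟨z, rfl⟩ := Cx.cls_surjective n x
  exact congrArg (L'.cls n) (Subtype.ext (h n z))

variable (X Y X₁ Y₁ : SemiUniformSpace.{u}) (G G' G₁ G₁' : ModuleCat.{u} R)

/-- The tensor product of complexes that computes the cohomology of the product. -/
abbrev kTens : DCx R := tens ((tuples X).cx R G) ((tuples Y).flatCx R G')

/-- The comparison of the tensor product with the cohomology of the product. -/
def kProd (n : ℕ) : (kTens X Y G G').tot.H (n + 1) →ₗ[R] cohomologyNat (X.prod Y) (tensorCoeff G G') n :=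
  -- Read from the bottom: the cross product `Θ`, the shift taken out of the total complex and
  -- undone, the two descriptions of germs on pairs, Eilenberg-Zilber, and germs read as
  -- Vietoris-Rips cohomology.
  (germIso (X.prod Y) (tensorCoeff G G') n).symm.toLinearMap ∘ₗ
    (SU.ez R X Y (G ⊗[R] G') n).toLinearMap ∘ₗ
      (pairHom R X Y (G ⊗[R] G')).tot.mapH n ∘ₗ
        (((tuples X).dcx R (tuples Y) (G ⊗[R] G')).tot.shH n).symm.toLinearMap ∘ₗ
          ((tuples X).dcx R (tuples Y) (G ⊗[R] G')).shTot.mapH (n + 1) ∘ₗ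
            (SFilt.Θ R (tuples X) (tuples Y) G G').tot.mapH (n + 1)

variable {X Y X₁ Y₁ G G' G₁ G₁'}

theorem kProd_bijective [IsDomain R] [IsPrincipalIdealRing R] (h : KunnethHypotheses X Y G G') (n : ℕ) :
    Function.Bijective (kProd X Y G G' n) := by
  simp only [kProd, LinearMap.coe_comp, LinearEquiv.coe_coe]
  exact (LinearEquiv.bijective _).comp ((LinearEquiv.bijective _).comp
    ((DCx.tot_qi_of_bijective (pairHom_bijective X Y (G ⊗[R] G')) n).comp ((LinearEquiv.bijective _).comp
      ((DCx.shTot_qi (n + 1)).comp (Θ_qi h (n + 1))))))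

/-- The map of tensor products. -/
abbrev kTensMap (f : UniformMap X X₁) (g : UniformMap Y Y₁) (φ : G ⟶ G₁) (ψ : G' ⟶ G₁') :
    DCx.Hom (kTens X₁ Y₁ G G') (kTens X Y G₁ G₁') :=
  tensMap ((tuplesHom f).map φ.hom) ((tuplesHom g).flatMap ψ.hom)

theorem kProd_natural (f : UniformMap X X₁) (g : UniformMap Y Y₁) (φ : G ⟶ G₁) (ψ : G' ⟶ G₁') (n : ℕ) (x) :
    cohomologyNatMap (f.prodMap g) (tensorCoeffMap φ ψ) n (kProd X₁ Y₁ G G' n x) =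
      kProd X Y G₁ G₁' n ((kTensMap f g φ ψ).tot.mapH (n + 1) x) := by
  apply (germIso (X.prod Y) (tensorCoeff G₁ G₁') n).injective
  rw [germIso_natural]
  simp only [kProd, LinearMap.comp_apply, LinearEquiv.coe_coe, LinearEquiv.apply_symm_apply]
  let a := TensorProduct.map φ.hom ψ.hom
  let d := (tuplesHom f).dmap (tuplesHom g) a
  have h1 : ∀ y, (SFilt.Θ R (tuples X) (tuples Y) G₁ G₁').tot.mapH (n + 1)
      ((kTensMap f g φ ψ).tot.mapH (n + 1) y) =
      d.sh.tot.mapH (n + 1) ((SFilt.Θ R (tuples X₁) (tuples Y₁) G G').tot.mapH (n + 1) y) :=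
    Cx.Hom.mapH_comm (fun n x => DCx.totX_ext fun p q e =>
      SFilt.Θ_natural (tuplesHom f) (tuplesHom g) φ.hom ψ.hom p q (DCx.pr _ p q e x)) (n + 1)
  have h2 : ∀ y, ((tuples X).dcx R (tuples Y) (G₁ ⊗[R] G₁')).shTot.mapH (n + 1)
      (d.sh.tot.mapH (n + 1) y) = d.tot.sh.mapH (n + 1)
        (((tuples X₁).dcx R (tuples Y₁) (G ⊗[R] G')).shTot.mapH (n + 1) y) :=
    Cx.Hom.mapH_comm (fun n x => (DCx.shTot_natural d n x).symm) (n + 1)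
  have h3 : ∀ y, (((tuples X).dcx R (tuples Y) (G₁ ⊗[R] G₁')).tot.shH n).symm (d.tot.sh.mapH (n + 1) y) =
      d.tot.mapH n ((((tuples X₁).dcx R (tuples Y₁) (G ⊗[R] G')).tot.shH n).symm y) := fun y => by
    rw [LinearEquiv.symm_apply_eq, ← Cx.shH_natural, LinearEquiv.apply_symm_apply]
  have h4 : ∀ y, (pairHom R X Y (G₁ ⊗[R] G₁')).tot.mapH n (d.tot.mapH n y) =
      (SU.pairMap f g a).tot.mapH n ((pairHom R X₁ Y₁ (G ⊗[R] G')).tot.mapH n y) :=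
    Cx.Hom.mapH_comm (fun n x => DCx.totX_ext fun p q e => by
      change pull R (G₁ ⊗[R] G₁') id (tendsto_pair X Y p q) (coef a (pull R (G ⊗[R] G') _
          (((tuplesHom f).tendsto p).prodMap ((tuplesHom g).tendsto q)) _)) =
        coef a (pull R (G ⊗[R] G') _ (SU.tendsto_pair_map f g p q)
          (pull R (G ⊗[R] G') id (tendsto_pair X₁ Y₁ p q) _))
      rw [← coef_pull, pull_pull, pull_pull]
      rfl) n
  rw [h1, h2, h3, h4]
  exact SU.ez_natural f g a n _

/-- The shifted complex of germs on pairs is zero in degree `0`. This is needed for `q = -1`, where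
the sequence forces `Tor_1(H^0, H^0)` to vanish. -/
theorem kTens_subsingleton [IsDomain R] [IsPrincipalIdealRing R] (h : KunnethHypotheses X Y G G') :
    Subsingleton ((kTens X Y G G').tot.H 0) := by
  refine ⟨fun x y => (Θ_qi h 0).1 ((DCx.shTot_qi 0).1 ?_)⟩
  obtain ⟨a, ha⟩ := Cx.cls_surjective 0
    (((tuples X).dcx R (tuples Y) (G ⊗[R] G')).shTot.mapH 0 ((SFilt.Θ R (tuples X) (tuples Y) G G').tot.mapH 0 x))
  obtain ⟨b, hb⟩ := Cx.cls_surjective 0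
    (((tuples X).dcx R (tuples Y) (G ⊗[R] G')).shTot.mapH 0 ((SFilt.Θ R (tuples X) (tuples Y) G G').tot.mapH 0 y))
  rw [← ha, ← hb]
  exact congrArg _ (Subtype.ext (Subsingleton.elim
    (α := ((tuples X).dcx R (tuples Y) (G ⊗[R] G')).tot.sh.X 0) _ _))

variable (Y G') in
/-- The cohomology in terms of the flat complex. -/
def flatIso (n : ℕ) : cohomologyNat Y G' n ≃ₗ[R] ((tuples Y).flatCx R G').H (n + 1) :=
  ((germIso Y G' n).trans (((tuples Y).cx R G').shH n)).trans
    (LinearEquiv.ofBijective _ ((tuples Y).flatTo_qi R G' (n + 1))).symm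

theorem flatIso_natural (g : UniformMap Y Y₁) (ψ : G' ⟶ G₁') (n : ℕ) (x) :
    flatIso Y G₁' n (cohomologyNatMap g ψ n x) =
      ((tuplesHom g).flatMap ψ.hom).mapH (n + 1) (flatIso Y₁ G' n x) := by
  have hy : ∀ y, ((tuples Y).flatTo R G₁').mapH (n + 1) (((tuplesHom g).flatMap ψ.hom).mapH (n + 1) y) =
      ((tuplesHom g).map ψ.hom).sh.mapH (n + 1) (((tuples Y₁).flatTo R G').mapH (n + 1) y) :=
    Cx.Hom.mapH_comm (fun n x => (SFilt.flatTo_natural (tuplesHom g) ψ.hom n x).symm) (n + 1)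
  refine (LinearEquiv.symm_apply_eq _).2 ?_
  refine Eq.trans ?_ (hy _).symm
  have hz : ((tuples Y₁).flatTo R G').mapH (n + 1) (flatIso Y₁ G' n x) =
      ((tuples Y₁).cx R G').shH n (germIso Y₁ G' n x) :=
    (LinearEquiv.ofBijective _ ((tuples Y₁).flatTo_qi R G' (n + 1))).apply_symm_apply _
  rw [hz, Cx.shH_natural]
  exact congrArg (((tuples Y).cx R G₁').shH n) (germIso_natural g ψ n x)

instance flat_H_zero_subsingleton : Subsingleton (((tuples Y).flatCx R G').H 0) := by
  refine ⟨fun x y => ((tuples Y).flatTo_qi R G' 0).1 ?_⟩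
  obtain ⟨a, ha⟩ := Cx.cls_surjective 0 (((tuples Y).flatTo R G').mapH 0 x)
  obtain ⟨b, hb⟩ := Cx.cls_surjective 0 (((tuples Y).flatTo R G').mapH 0 y)
  rw [← ha, ← hb]
  exact congrArg _ (Subtype.ext (Subsingleton.elim (α := ((tuples Y).cx R G').sh.X 0) _ _))

end Product

end VietorisRips

namespace VietorisRips

open SemiUniformSpace

/-! ### Direct sums over pairs of integers -/

section Families

variable {R : Type u} [CommRing R] {M M' : ℤ × ℤ → Type u} [∀ p, AddCommGroup (M p)] [∀ p, Module R (M p)]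
  [∀ p, AddCommGroup (M' p)] [∀ p, Module R (M' p)]

/-- A pair of natural numbers as a pair of integers. -/
def intPair {q : ℤ} {n : ℕ} (e : q = n) (s : {s : ℕ × ℕ // s.1 + s.2 = n}) : {p : ℤ × ℤ // p.1 + p.2 = q} :=
  ⟨(Int.ofNat s.1.1, Int.ofNat s.1.2), by
    have h : ((s.1.1 + s.1.2 : ℕ) : ℤ) = n := congrArg Nat.cast s.2
    exact h.trans e.symm⟩

theorem intPair_injective {q : ℤ} {n : ℕ} (e : q = n) : Function.Injective (intPair e) := by
  intro s t h
  have h' : (Int.ofNat s.1.1, Int.ofNat s.1.2) = (Int.ofNat t.1.1, Int.ofNat t.1.2) := congrArg Subtype.val h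
  exact Subtype.ext (Prod.ext (Int.ofNat.inj (congrArg Prod.fst h')) (Int.ofNat.inj (congrArg Prod.snd h')))

variable (R M) in
/-- The components with non-negative indices. -/
def natFam {q : ℤ} {n : ℕ} (e : q = n) : (⨁ p : {p : ℤ × ℤ // p.1 + p.2 = q}, M p.1) →ₗ[R]
    ∀ s : {s : ℕ × ℕ // s.1 + s.2 = n}, M (Int.ofNat s.1.1, Int.ofNat s.1.2) :=
  LinearMap.pi fun s => DirectSum.component R {p : ℤ × ℤ // p.1 + p.2 = q} (fun p => M p.1) (intPair e s)

theorem natFam_lmap {q : ℤ} {n : ℕ} (e : q = n) (f : ∀ p, M p →ₗ[R] M' p)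
    (x : ⨁ p : {p : ℤ × ℤ // p.1 + p.2 = q}, M p.1) (s) :
    natFam R M' e (DirectSum.lmap (fun p => f p.1) x) s = f _ (natFam R M e x s) :=
  DirectSum.lmap_apply (fun p : {p : ℤ × ℤ // p.1 + p.2 = q} => f p.1) x (intPair e s)

theorem natFam_bijective {q : ℤ} {n : ℕ} (e : q = n)
    (h : ∀ p : ℤ × ℤ, (p.1 < 0 ∨ p.2 < 0) → Subsingleton (M p)) : Function.Bijective (natFam R M e) := by
  classical
  constructor
  · intro x y hxy
    refine DFinsupp.ext fun p => ?_
    by_cases hp : p.1.1 < 0 ∨ p.1.2 < 0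
    · have := h p.1 hp
      exact Subsingleton.elim _ _
    · rw [not_or, not_lt, not_lt] at hp
      obtain ⟨⟨p, q⟩, hpq⟩ := p
      obtain ⟨i, hi⟩ := Int.eq_ofNat_of_zero_le hp.1
      obtain ⟨j, hj⟩ := Int.eq_ofNat_of_zero_le hp.2
      dsimp only at hi hj
      subst hi hj
      have hs : i + j = n := by
        have : (i : ℤ) + j = n := hpq.trans e
        exact_mod_cast this
      exact congrFun hxy ⟨(i, j), hs⟩
  · intro y
    refine ⟨∑ s, DirectSum.lof R {p : ℤ × ℤ // p.1 + p.2 = q} (fun p => M p.1) (intPair e s) (y s), ?_⟩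
    funext t
    rw [map_sum, Finset.sum_apply]
    refine (Finset.sum_eq_single t (fun s _ hs => ?_) (by simp)).trans ?_
    · refine (DirectSum.component.of (M := fun p : {p : ℤ × ℤ // p.1 + p.2 = q} => M p.1) R _ _ _).trans ?_
      exact dif_neg fun h => hs (intPair_injective e h)
    · exact DirectSum.component.lof_self (M := fun p : {p : ℤ × ℤ // p.1 + p.2 = q} => M p.1) R _ _

end Families

/-! ### The Künneth maps in non-negative degrees -/

section Maps

variable {R : Type u} [CommRing R]

theorem tor₁Map_bijective {M M' N N' : ModuleCat.{u} R} (a : M ≃ₗ[R] M') (b : N ≃ₗ[R] N') :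
    Function.Bijective (tor₁Map (ModuleCat.ofHom a.toLinearMap) (ModuleCat.ofHom b.toLinearMap)) := by
  refine Function.bijective_iff_has_inverse.2
    ⟨tor₁Map (ModuleCat.ofHom a.symm.toLinearMap) (ModuleCat.ofHom b.symm.toLinearMap),
      fun x => ?_, fun x => ?_⟩
  · refine (tor₁Map_comp _ _ _ _ x).trans ?_
    rw [← ModuleCat.ofHom_comp, ← ModuleCat.ofHom_comp, LinearEquiv.symm_comp, LinearEquiv.symm_comp]
    exact tor₁Map_id M N x
  · refine (tor₁Map_comp _ _ _ _ x).trans ?_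
    rw [← ModuleCat.ofHom_comp, ← ModuleCat.ofHom_comp, LinearEquiv.comp_symm, LinearEquiv.comp_symm]
    exact tor₁Map_id M' N' x

/-- The isomorphism of torsion products induced by isomorphisms. -/
def tor₁Equiv {M M' N N' : ModuleCat.{u} R} (a : M ≃ₗ[R] M') (b : N ≃ₗ[R] N') : tor₁ M N ≃ₗ[R] tor₁ M' N' :=
  LinearEquiv.ofBijective _ (tor₁Map_bijective a b)

theorem tor₁Equiv_natural {M M' N N' A A' B B' : ModuleCat.{u} R} (a : M ≃ₗ[R] M') (b : N ≃ₗ[R] N')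
    (a' : A ≃ₗ[R] A') (b' : B ≃ₗ[R] B') {f : M ⟶ A} {g : N ⟶ B} {f' : M' ⟶ A'} {g' : N' ⟶ B'}
    (hf : ∀ x, a' (f.hom x) = f'.hom (a x)) (hg : ∀ x, b' (g.hom x) = g'.hom (b x)) (x : tor₁ M N) :
    tor₁Equiv a' b' (tor₁Map f g x) = tor₁Map f' g' (tor₁Equiv a b x) := by
  refine (tor₁Map_comp _ _ _ _ x).trans (Eq.trans ?_ (tor₁Map_comp _ _ _ _ x).symm)
  refine congrFun (congrArg DFunLike.coe (congrArg₂ tor₁Map ?_ ?_)) x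
  · exact ModuleCat.hom_ext (LinearMap.ext hf)
  · exact ModuleCat.hom_ext (LinearMap.ext hg)

theorem tor₁_subsingleton_left {M N : ModuleCat.{u} R} [Subsingleton M] : Subsingleton (tor₁ M N) := by
  have h : Subsingleton (FrRel R N ⊗[R] M) := subsingleton_of_forall_eq 0 tmul_eq_zero_of_subsingleton
  have : Subsingleton (M ⊗[R] FrRel R N) := (TensorProduct.comm R M (FrRel R N)).injective.subsingleton
  exact ((frFlatPres N).torMap_injective M).subsingleton

theorem tor₁_subsingleton_right {M N : ModuleCat.{u} R} [Subsingleton N] : Subsingleton (tor₁ M N) := by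
  have h : FlatPres (LinearMap.id : PUnit.{u + 1} →ₗ[R] PUnit.{u + 1}) (0 : PUnit.{u + 1} →ₗ[R] N) :=
    ⟨Function.injective_id, fun x => ⟨fun _ => ⟨x, rfl⟩, fun _ => Subsingleton.elim _ _⟩,
      fun y => ⟨0, Subsingleton.elim _ _⟩, inferInstance⟩
  refine (h.lTensor_injective M).1 ?_
  rw [LinearMap.lTensor_id]
  exact Function.injective_id

theorem exists_kα_of_index [IsDomain R] [IsPrincipalIdealRing R] {C F : Cx R} [F.IsFlat] {n : ℕ}
    {y : (tens C F).tot.H n} (hy : ∀ s : {s : ℕ × ℕ // s.1 + s.2 = n}, kβ C F s.1.1 s.1.2 s.2 y = 0) :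
    ∃ x : ∀ s : {s : ℕ × ℕ // s.1 + s.2 = n}, C.H s.1.1 ⊗[R] F.H s.1.2,
      ∑ s, kα C F s.1.1 s.1.2 s.2 (x s) = y :=
  exists_kα fun p q e => by
    have h := hy ⟨(p, q), e⟩
    dsimp only at h
    exact h

variable (X Y X₁ Y₁ : SemiUniformSpace.{u}) (G G' G₁ G₁' : ModuleCat.{u} R)

/-- The families of elements of tensor products of cohomology modules. -/
abbrev TensFam (n : ℕ) : Type u := ∀ s : {s : ℕ × ℕ // s.1 + s.2 = n},
  cohomologyNat X G s.1.1 ⊗[R] cohomologyNat Y G' s.1.2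

/-- The families of elements of torsion products of cohomology modules. -/
abbrev TorFam (n : ℕ) : Type u := ∀ s : {s : ℕ × ℕ // s.1 + s.2 = n},
  tor₁ (cohomologyNat X G s.1.1) (cohomologyNat Y G' s.1.2)

/-- The tensor products in terms of the flat complex. -/
def kTensor (n : ℕ) : ∀ i j : ℕ, i + j = n + 1 →
    (TensFam X Y G G' n →ₗ[R] ((tuples X).cx R G).H i ⊗[R] ((tuples Y).flatCx R G').H j)
  | _, 0, _ => 0
  | i, j + 1, e => TensorProduct.map (germIso X G i).toLinearMap (flatIso Y G' j).toLinearMap ∘ₗ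
      LinearMap.proj (⟨(i, j), by omega⟩ : {s : ℕ × ℕ // s.1 + s.2 = n})

/-- The sum of the cross products, in the tensor product of complexes. -/
def kSum (n : ℕ) : TensFam X Y G G' n →ₗ[R] (kTens X Y G G').tot.H (n + 1) :=
  ∑ t : {t : ℕ × ℕ // t.1 + t.2 = n + 1}, kα ((tuples X).cx R G) ((tuples Y).flatCx R G') t.1.1 t.1.2 t.2 ∘ₗ
    kTensor X Y G G' n t.1.1 t.1.2 t.2

theorem kSum_apply (n : ℕ) (x) : kSum X Y G G' n x =
    ∑ t : {t : ℕ × ℕ // t.1 + t.2 = n + 1}, kα ((tuples X).cx R G) ((tuples Y).flatCx R G') t.1.1 t.1.2 t.2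
      (kTensor X Y G G' n t.1.1 t.1.2 t.2 x) := by
  rw [kSum, LinearMap.sum_apply]
  rfl

variable {X Y X₁ Y₁ G G' G₁ G₁'}

theorem kTensor_ext {n : ℕ} {x y : TensFam X Y G G' n}
    (h : ∀ i j e, kTensor X Y G G' n i j e x = kTensor X Y G G' n i j e y) : x = y := by
  funext ⟨⟨i, j⟩, e⟩
  exact (TensorProduct.congr (germIso X G i) (flatIso Y G' j)).injective (h i (j + 1) (by omega))

theorem exists_kTensor {n : ℕ} (w : ∀ t : {t : ℕ × ℕ // t.1 + t.2 = n + 1},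
    ((tuples X).cx R G).H t.1.1 ⊗[R] ((tuples Y).flatCx R G').H t.1.2) :
    ∃ x, ∀ t, kTensor X Y G G' n t.1.1 t.1.2 t.2 x = w t := by
  refine ⟨fun s => (TensorProduct.congr (germIso X G s.1.1) (flatIso Y G' s.1.2)).symm
    (w ⟨(s.1.1, s.1.2 + 1), by have := s.2; dsimp only; omega⟩), ?_⟩
  rintro ⟨⟨i, j⟩, e⟩
  cases j with
  | zero => exact (tmul_eq_zero_of_subsingleton _).symm
  | succ j => exact (TensorProduct.congr (germIso X G i) (flatIso Y G' j)).apply_symm_apply _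

/-- The map of families of elements of tensor products. -/
def tensFamMap (f : UniformMap X X₁) (g : UniformMap Y Y₁) (φ : G ⟶ G₁) (ψ : G' ⟶ G₁') (n : ℕ) :
    TensFam X₁ Y₁ G G' n →ₗ[R] TensFam X Y G₁ G₁' n :=
  LinearMap.pi fun s => TensorProduct.map (cohomologyNatMap f φ s.1.1) (cohomologyNatMap g ψ s.1.2) ∘ₗ
    LinearMap.proj s

theorem kSum_natural (f : UniformMap X X₁) (g : UniformMap Y Y₁) (φ : G ⟶ G₁) (ψ : G' ⟶ G₁') (n : ℕ) (x) :
    (kTensMap f g φ ψ).tot.mapH (n + 1) (kSum X₁ Y₁ G G' n x) =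
      kSum X Y G₁ G₁' n (tensFamMap f g φ ψ n x) := by
  rw [kSum_apply, kSum_apply, map_sum]
  refine Finset.sum_congr rfl fun t _ => ?_
  refine (kα_natural _ _ t.1.1 t.1.2 t.2 _).trans (congrArg _ ?_)
  obtain ⟨⟨i, j⟩, e⟩ := t
  cases j with
  | zero => exact map_zero (TensorProduct.map (((tuplesHom f).map φ.hom).mapH i) (((tuplesHom g).flatMap ψ.hom).mapH 0))
  | succ j =>
    change TensorProduct.map _ _ (TensorProduct.map _ _ (x ⟨(i, j), _⟩)) =
      TensorProduct.map _ _ (TensorProduct.map _ _ (x ⟨(i, j), _⟩))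
    rw [← LinearMap.comp_apply, ← TensorProduct.map_comp, ← LinearMap.comp_apply (TensorProduct.map _ _),
      ← TensorProduct.map_comp]
    refine congrFun (congrArg DFunLike.coe (congrArg₂ TensorProduct.map ?_ ?_)) _
    · exact LinearMap.ext fun x => (germIso_natural f φ i x).symm
    · exact LinearMap.ext fun x => (flatIso_natural g ψ j x).symm

variable [IsDomain R] [IsPrincipalIdealRing R]

theorem kSum_injective (n : ℕ) : Function.Injective (kSum X Y G G' n) := by
  rw [injective_iff_map_eq_zero]
  intro x hx
  rw [kSum_apply] at hx
  have := kα_injective (x := fun t => kTensor X Y G G' n t.1.1 t.1.2 t.2 x) hx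
  exact kTensor_ext fun i j e => (congrFun this ⟨(i, j), e⟩).trans (map_zero _).symm

variable (X Y G G') in
/-- The torsion products in terms of the flat complex. -/
def torIso (i j : ℕ) : tor₁ (cohomologyNat X G i) (cohomologyNat Y G' j) ≃ₗ[R]
    tor₁ (ModuleCat.of R (((tuples X).cx R G).H i)) (ModuleCat.of R (((tuples Y).flatCx R G').H (j + 1))) :=
  tor₁Equiv (M := cohomologyNat X G i) (N := cohomologyNat Y G' j)
    (M' := ModuleCat.of R (((tuples X).cx R G).H i))
    (N' := ModuleCat.of R (((tuples Y).flatCx R G').H (j + 1))) (germIso X G i) (flatIso Y G' j)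

variable (X Y G G') in
/-- The maps to the torsion products. -/
def kTor (n : ℕ) : (kTens X Y G G').tot.H n →ₗ[R] TorFam X Y G G' n :=
  LinearMap.pi fun s => (torIso X Y G G' s.1.1 s.1.2).symm.toLinearMap ∘ₗ
    kβ ((tuples X).cx R G) ((tuples Y).flatCx R G') s.1.1 s.1.2 s.2

theorem torIso_kTor {n : ℕ} (x : (kTens X Y G G').tot.H n) (s : {s : ℕ × ℕ // s.1 + s.2 = n}) : torIso X Y G G' s.1.1 s.1.2 (kTor X Y G G' n x s) =
    kβ ((tuples X).cx R G) ((tuples Y).flatCx R G') s.1.1 s.1.2 s.2 x :=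
  (torIso X Y G G' s.1.1 s.1.2).apply_symm_apply _

theorem kTor_kSum (n : ℕ) (x) : kTor X Y G G' (n + 1) (kSum X Y G G' n x) = 0 := by
  funext s
  apply (torIso X Y G G' s.1.1 s.1.2).injective
  rw [torIso_kTor, kSum_apply, kβ_kα (fun t => kTensor X Y G G' n t.1.1 t.1.2 t.2 x)]
  exact (map_zero _).symm

theorem kβ_eq_zero_of_kTor {n : ℕ} {y : (kTens X Y G G').tot.H n} (hy : kTor X Y G G' n y = 0)
    (s : {s : ℕ × ℕ // s.1 + s.2 = n}) :
    kβ ((tuples X).cx R G) ((tuples Y).flatCx R G') s.1.1 s.1.2 s.2 y = 0 := by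
  have h : kTor X Y G G' n y s = 0 := congrFun hy s
  rw [← torIso_kTor, h]
  exact (torIso X Y G G' s.1.1 s.1.2).map_zero

theorem exists_kSum {n : ℕ} {y : (kTens X Y G G').tot.H (n + 1)} (hy : kTor X Y G G' (n + 1) y = 0) :
    ∃ x, kSum X Y G G' n x = y := by
  obtain ⟨w, hw⟩ := exists_kα_of_index (C := (tuples X).cx R G) (F := (tuples Y).flatCx R G')
    (kβ_eq_zero_of_kTor hy)
  obtain ⟨x, hx⟩ := exists_kTensor w
  refine ⟨x, ?_⟩
  rw [kSum_apply, ← hw]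
  exact Finset.sum_congr rfl fun t _ => congrArg _ (hx t)

variable (X Y G G') in
-- The sections for the individual torsion components may be added up, since each has zero image in
-- all other components.
theorem exists_kTor_section (n : ℕ) : ∃ s : TorFam X Y G G' n →ₗ[R] (kTens X Y G G').tot.H n,
    ∀ u, kTor X Y G G' n (s u) = u := by
  choose σ h₁ h₂ using fun s : {s : ℕ × ℕ // s.1 + s.2 = n} =>
    exists_section (C := (tuples X).cx R G) (F := (tuples Y).flatCx R G') s.1.1 s.1.2 s.2
  refine ⟨∑ s, σ s ∘ₗ (torIso X Y G G' s.1.1 s.1.2).toLinearMap ∘ₗ LinearMap.proj s, fun u => ?_⟩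
  funext t
  apply (torIso X Y G G' t.1.1 t.1.2).injective
  rw [torIso_kTor, LinearMap.sum_apply, map_sum]
  refine (Finset.sum_eq_single t (fun s _ hs => ?_) (by simp)).trans (h₁ t _)
  refine h₂ s _ _ _ _ fun h => hs (Subtype.ext (Prod.ext h.symm ?_))
  have := s.2
  have := t.2
  omega

/-- The map of families of elements of torsion products. -/
def torFamMap (f : UniformMap X X₁) (g : UniformMap Y Y₁) (φ : G ⟶ G₁) (ψ : G' ⟶ G₁') (n : ℕ) :
    TorFam X₁ Y₁ G G' n →ₗ[R] TorFam X Y G₁ G₁' n :=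
  LinearMap.pi fun s => tor₁Map (ModuleCat.ofHom (cohomologyNatMap f φ s.1.1))
    (ModuleCat.ofHom (cohomologyNatMap g ψ s.1.2)) ∘ₗ LinearMap.proj s

theorem kTor_natural (f : UniformMap X X₁) (g : UniformMap Y Y₁) (φ : G ⟶ G₁) (ψ : G' ⟶ G₁') (n : ℕ) (x) :
    torFamMap f g φ ψ n (kTor X₁ Y₁ G G' n x) =
      kTor X Y G₁ G₁' n ((kTensMap f g φ ψ).tot.mapH n x) := by
  funext s
  apply (torIso X Y G₁ G₁' s.1.1 s.1.2).injective
  rw [torIso_kTor]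
  refine Eq.trans ?_ (kβ_natural s.1.1 s.1.2 s.2 ((tuplesHom f).map φ.hom) ((tuplesHom g).flatMap ψ.hom) x)
  rw [← torIso_kTor]
  exact tor₁Equiv_natural _ _ _ _ (fun x => germIso_natural f φ s.1.1 x)
    (fun x => flatIso_natural g ψ s.1.2 x) _

end Maps

end VietorisRips

namespace VietorisRips

open SemiUniformSpace

/-! ### The Künneth sequence and its splitting -/

variable {R : Type u} [CommRing R]

theorem cohomology_subsingleton (X : SemiUniformSpace.{u}) (G : ModuleCat.{u} R) {q : ℤ} (hq : q < 0) :
    Subsingleton (cohomology X G q) := by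
  cases q with
  | ofNat n => exact absurd hq (by simp)
  | negSucc n => exact inferInstanceAs (Subsingleton PUnit)

variable (X Y X₁ Y₁ : SemiUniformSpace.{u}) (G G' G₁ G₁' : ModuleCat.{u} R)

/-- The tensor products of cohomology modules. -/
abbrev tensorAt (p : ℤ × ℤ) : Type u := cohomology X G p.1 ⊗[R] cohomology Y G' p.2

/-- The torsion products of cohomology modules. -/
abbrev torAt (p : ℤ × ℤ) : Type u := tor₁ (cohomology X G p.1) (cohomology Y G' p.2)

theorem tensorAt_subsingleton (p : ℤ × ℤ) (h : p.1 < 0 ∨ p.2 < 0) : Subsingleton (tensorAt X Y G G' p) := by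
  rcases h with h | h
  · have := cohomology_subsingleton X G h
    have h' : Subsingleton (cohomology Y G' p.2 ⊗[R] cohomology X G p.1) :=
      subsingleton_of_forall_eq 0 tmul_eq_zero_of_subsingleton
    exact (TensorProduct.comm R (cohomology X G p.1) (cohomology Y G' p.2)).injective.subsingleton
  · have := cohomology_subsingleton Y G' h
    exact subsingleton_of_forall_eq 0 tmul_eq_zero_of_subsingleton

theorem torAt_subsingleton (p : ℤ × ℤ) (h : p.1 < 0 ∨ p.2 < 0) : Subsingleton (torAt X Y G G' p) := by
  rcases h with h | h
  · have := cohomology_subsingleton X G h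
    exact tor₁_subsingleton_left
  · have := cohomology_subsingleton Y G' h
    exact tor₁_subsingleton_right

/-- The tensor term in non-negative degrees. -/
def tensorTermIso (n : ℕ) : tensorTerm X Y G G' (Int.ofNat n) ≃ₗ[R] TensFam X Y G G' n :=
  LinearEquiv.ofBijective (natFam R (tensorAt X Y G G') (q := Int.ofNat n) (n := n) rfl)
    (natFam_bijective _ (tensorAt_subsingleton X Y G G'))

/-- The torsion term in non-negative degrees. -/
def torTermIso (q : ℤ) (n : ℕ) (e : q + 1 = n) : torTerm X Y G G' q ≃ₗ[R] TorFam X Y G G' n :=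
  LinearEquiv.ofBijective (natFam R (torAt X Y G G') e) (natFam_bijective e (torAt_subsingleton X Y G G'))

variable {X Y X₁ Y₁ G G' G₁ G₁'} (f : UniformMap X X₁) (g : UniformMap Y Y₁) (φ : G ⟶ G₁) (ψ : G' ⟶ G₁')

theorem tensorTermIso_natural (n : ℕ) (x) : tensorTermIso X Y G₁ G₁' n (tensorTermMap f g φ ψ (Int.ofNat n) x) =
    tensFamMap f g φ ψ n (tensorTermIso X₁ Y₁ G G' n x) :=
  funext fun s => natFam_lmap (M := tensorAt X₁ Y₁ G G') (M' := tensorAt X Y G₁ G₁') (q := Int.ofNat n) (n := n) rfl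
    (fun p => TensorProduct.map (cohomologyMap f φ p.1) (cohomologyMap g ψ p.2)) x s

theorem torTermIso_natural (q : ℤ) (n : ℕ) (e : q + 1 = n) (x) :
    torTermIso X Y G₁ G₁' q n e (torTermMap f g φ ψ q x) =
      torFamMap f g φ ψ n (torTermIso X₁ Y₁ G G' q n e x) :=
  funext fun s => natFam_lmap (M := torAt X₁ Y₁ G G') (M' := torAt X Y G₁ G₁') e
    (fun p => tor₁Map (ModuleCat.ofHom (cohomologyMap f φ p.1)) (ModuleCat.ofHom (cohomologyMap g ψ p.2))) x s

theorem tensorTerm_subsingleton (n : ℕ) : Subsingleton (tensorTerm X Y G G' (Int.negSucc n)) := by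
  refine ⟨fun x y => DFinsupp.ext fun p => ?_⟩
  have := tensorAt_subsingleton X Y G G' p.1 (by
    have h : p.1.1 + p.1.2 < 0 := by rw [p.2]; exact Int.negSucc_lt_zero n
    omega)
  exact Subsingleton.elim (α := tensorAt X Y G G' p.1) _ _

/-- The cross product. -/
def kunnethα (X Y : SemiUniformSpace.{u}) (G G' : ModuleCat.{u} R) :
    ∀ q : ℤ, tensorTerm X Y G G' q →ₗ[R] productTerm X Y G G' q
  | Int.ofNat n => kProd X Y G G' n ∘ₗ kSum X Y G G' n ∘ₗ (tensorTermIso X Y G G' n).toLinearMap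
  | Int.negSucc _ => 0

theorem kunnethα_natural (q : ℤ) : productTermMap f g φ ψ q ∘ₗ kunnethα X₁ Y₁ G G' q =
    kunnethα X Y G₁ G₁' q ∘ₗ tensorTermMap f g φ ψ q := by
  refine LinearMap.ext fun x => ?_
  cases q with
  | ofNat n =>
    refine (kProd_natural f g φ ψ n _).trans (congrArg (kProd X Y G₁ G₁' n) ?_)
    refine (kSum_natural f g φ ψ n _).trans (congrArg (kSum X Y G₁ G₁' n) ?_)
    exact (tensorTermIso_natural f g φ ψ n x).symm
  | negSucc n => exact Subsingleton.elim (α := PUnit) _ _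

variable [IsDomain R] [IsPrincipalIdealRing R]

/-- Below `q = -1` an index is negative. For `q = -1` the term is `Tor_1(H^0, H^0)`, which vanishes
because the section embeds it into the degree `0` cohomology of the tensor product, and that is zero
by `kTens_subsingleton`. -/
theorem torTerm_subsingleton (h : KunnethHypotheses X Y G G') (n : ℕ) :
    Subsingleton (torTerm X Y G G' (Int.negSucc n)) := by
  cases n with
  | zero =>
    have h0 := kTens_subsingleton h
    obtain ⟨s, hs⟩ := exists_kTor_section X Y G G' 0
    have h1 : Subsingleton (TorFam X Y G G' 0) := ⟨fun x y => by
      rw [← hs x, ← hs y, Subsingleton.elim (s x) (s y)]⟩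
    exact (torTermIso X Y G G' (Int.negSucc 0) 0 rfl).injective.subsingleton
  | succ n =>
    refine ⟨fun x y => DFinsupp.ext fun p => ?_⟩
    have := torAt_subsingleton X Y G G' p.1 (by
      have h : p.1.1 + p.1.2 < 0 := by
        rw [p.2]
        omega
      omega)
    exact Subsingleton.elim (α := torAt X Y G G' p.1) _ _

/-- The cohomology of the product in terms of a tensor product of complexes. -/
def kProdIso (h : KunnethHypotheses X Y G G') (n : ℕ) :
    (kTens X Y G G').tot.H (n + 1) ≃ₗ[R] cohomologyNat (X.prod Y) (tensorCoeff G G') n :=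
  LinearEquiv.ofBijective (kProd X Y G G' n) (kProd_bijective h n)

/-- The map to the torsion term. -/
def kunnethβ (h : KunnethHypotheses X Y G G') : ∀ q : ℤ, productTerm X Y G G' q →ₗ[R] torTerm X Y G G' q
  | Int.ofNat n => (torTermIso X Y G G' (Int.ofNat n) (n + 1) rfl).symm.toLinearMap ∘ₗ kTor X Y G G' (n + 1) ∘ₗ
      (kProdIso h n).symm.toLinearMap
  | Int.negSucc _ => 0

theorem torTermIso_kunnethβ (h : KunnethHypotheses X Y G G') (n : ℕ) (y : (kTens X Y G G').tot.H (n + 1)) :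
    torTermIso X Y G G' (Int.ofNat n) (n + 1) rfl (kunnethβ h (Int.ofNat n) (kProdIso h n y)) =
      kTor X Y G G' (n + 1) y := by
  change torTermIso X Y G G' (Int.ofNat n) (n + 1) rfl ((torTermIso X Y G G' (Int.ofNat n) (n + 1) rfl).symm
    (kTor X Y G G' (n + 1) ((kProdIso h n).symm (kProdIso h n y)))) = _
  rw [LinearEquiv.symm_apply_apply, LinearEquiv.apply_symm_apply]

theorem kunnethα_injective (h : KunnethHypotheses X Y G G') (q : ℤ) : Function.Injective (kunnethα X Y G G' q) := by
  cases q with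
  | ofNat n => exact (kProd_bijective h n).1.comp ((kSum_injective n).comp (tensorTermIso X Y G G' n).injective)
  | negSucc n =>
    have := tensorTerm_subsingleton (X := X) (Y := Y) (G := G) (G' := G') n
    exact Function.injective_of_subsingleton _

theorem kunneth_exact (h : KunnethHypotheses X Y G G') (q : ℤ) :
    Function.Exact (kunnethα X Y G G' q) (kunnethβ h q) := by
  cases q with
  | ofNat n =>
    intro y
    obtain ⟨y, rfl⟩ := (kProdIso h n).surjective y
    have hβ : kunnethβ h (Int.ofNat n) (kProdIso h n y) = 0 ↔ kTor X Y G G' (n + 1) y = 0 := by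
      change (torTermIso X Y G G' (Int.ofNat n) (n + 1) rfl).symm (kTor X Y G G' (n + 1)
        ((kProdIso h n).symm (kProdIso h n y))) = 0 ↔ _
      rw [LinearEquiv.symm_apply_apply]
      exact LinearEquiv.map_eq_zero_iff _
    refine hβ.trans ⟨fun hy => ?_, ?_⟩
    · obtain ⟨x, rfl⟩ := exists_kSum hy
      exact ⟨(tensorTermIso X Y G G' n).symm x,
        congrArg (kProd X Y G G' n) (congrArg (kSum X Y G G' n) ((tensorTermIso X Y G G' n).apply_symm_apply x))⟩
    · rintro ⟨x, hx⟩
      rw [← (kProdIso h n).injective hx]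
      exact kTor_kSum n _
  | negSucc n =>
    intro y
    exact ⟨fun _ => ⟨0, Subsingleton.elim (α := PUnit) _ _⟩, fun _ => rfl⟩

theorem exists_kunnethβ_section (h : KunnethHypotheses X Y G G') (q : ℤ) :
    ∃ s : torTerm X Y G G' q →ₗ[R] productTerm X Y G G' q, kunnethβ h q ∘ₗ s = LinearMap.id := by
  cases q with
  | ofNat n =>
    obtain ⟨s, hs⟩ := exists_kTor_section X Y G G' (n + 1)
    refine ⟨(kProdIso h n).toLinearMap ∘ₗ s ∘ₗ (torTermIso X Y G G' (Int.ofNat n) (n + 1) rfl).toLinearMap,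
      LinearMap.ext fun u => ?_⟩
    change (torTermIso X Y G G' (Int.ofNat n) (n + 1) rfl).symm (kTor X Y G G' (n + 1)
        ((kProdIso h n).symm (kProdIso h n (s (torTermIso X Y G G' (Int.ofNat n) (n + 1) rfl u))))) = u
    rw [LinearEquiv.symm_apply_apply, hs, LinearEquiv.symm_apply_apply]
  | negSucc n =>
    have := torTerm_subsingleton h n
    exact ⟨0, LinearMap.ext fun u => Subsingleton.elim _ _⟩

theorem kunnethβ_natural (h : KunnethHypotheses X₁ Y₁ G G') (h₁ : KunnethHypotheses X Y G₁ G₁') (q : ℤ) :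
    torTermMap f g φ ψ q ∘ₗ kunnethβ h q = kunnethβ h₁ q ∘ₗ productTermMap f g φ ψ q := by
  refine LinearMap.ext fun y => ?_
  cases q with
  | ofNat n =>
    obtain ⟨y, rfl⟩ := (kProdIso h n).surjective y
    apply (torTermIso X Y G₁ G₁' (Int.ofNat n) (n + 1) rfl).injective
    refine (torTermIso_natural f g φ ψ (Int.ofNat n) (n + 1) rfl _).trans ?_
    rw [torTermIso_kunnethβ, kTor_natural, ← torTermIso_kunnethβ h₁]
    exact congrArg (fun z => torTermIso X Y G₁ G₁' (Int.ofNat n) (n + 1) rfl (kunnethβ h₁ (Int.ofNat n) z))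
      (kProd_natural f g φ ψ n y).symm
  | negSucc n =>
    have := torTerm_subsingleton h₁ n
    exact Subsingleton.elim _ _

variable (R) in
/-- The Künneth sequence. -/
def kunneth : NaturalKunnethSequence.{u} R where
  α {X Y G G'} _ := kunnethα X Y G G'
  β h := kunnethβ h
  injective h := kunnethα_injective h
  exact h := kunneth_exact h
  surjective h q y := by
    obtain ⟨s, hs⟩ := exists_kunnethβ_section h q
    exact ⟨s y, LinearMap.congr_fun hs y⟩
  natural_α _ _ f g φ ψ := kunnethα_natural f g φ ψ
  natural_β h h₁ f g φ ψ := kunnethβ_natural f g φ ψ h h₁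

variable (R) in
theorem kunneth_splits : (kunneth.{u} R).Splits := fun h q => exists_kunnethβ_section h q

end VietorisRips

namespace VietorisRips

open SemiUniformSpace

/-! ### Low-degree cochains -/

section LowDegrees

variable {R : Type u} [CommRing R] {X : SemiUniformSpace.{u}} {M : Type u} [AddCommGroup M] [Module R M]

theorem germCx_d (n : ℕ) (f : (Fin (n + 1) → X.carrier) → M) :
    (SU.germCx R X M).d n (germ R (SU.cliqueFilter X n) M f) = germ R (SU.cliqueFilter X (n + 1)) M
      fun x => ∑ i : Fin (n + 2), (-1 : R) ^ (i : ℕ) • f (SU.face i x) := by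
  change alt _ (germ R (SU.cliqueFilter X n) M f) = _
  rw [alt_apply]
  simp only [pull_germ, ← map_smul, ← map_sum]
  congr 1
  funext x
  rw [Finset.sum_apply]
  rfl

variable (R)

theorem sum_face_one (f : (Fin 1 → X.carrier) → M) (x : Fin 2 → X.carrier) :
    ∑ i : Fin 2, (-1 : R) ^ (i : ℕ) • f (SU.face i x) = f ![x 1] - f ![x 0] := by
  have h0 : SU.face 0 x = ![x 1] := by ext k; fin_cases k; rfl
  have h1 : SU.face 1 x = ![x 0] := by ext k; fin_cases k; rfl
  rw [Fin.sum_univ_two, h0, h1]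
  simp [sub_eq_add_neg]

theorem sum_face_two (f : (Fin 2 → X.carrier) → M) (x : Fin 3 → X.carrier) :
    ∑ i : Fin 3, (-1 : R) ^ (i : ℕ) • f (SU.face i x) =
      f ![x 1, x 2] - f ![x 0, x 2] + f ![x 0, x 1] := by
  have h0 : SU.face 0 x = ![x 1, x 2] := by ext k; fin_cases k <;> rfl
  have h1 : SU.face 1 x = ![x 0, x 2] := by ext k; fin_cases k <;> rfl
  have h2 : SU.face 2 x = ![x 0, x 1] := by ext k; fin_cases k <;> rfl
  rw [Fin.sum_univ_three, h0, h1, h2]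
  simp [sub_eq_add_neg]

theorem sum_face_three (f : (Fin 3 → X.carrier) → M) (x : Fin 4 → X.carrier) :
    ∑ i : Fin 4, (-1 : R) ^ (i : ℕ) • f (SU.face i x) =
      f ![x 1, x 2, x 3] - f ![x 0, x 2, x 3] + f ![x 0, x 1, x 3] - f ![x 0, x 1, x 2] := by
  have h0 : SU.face 0 x = ![x 1, x 2, x 3] := by ext k; fin_cases k <;> rfl
  have h1 : SU.face 1 x = ![x 0, x 2, x 3] := by ext k; fin_cases k <;> rfl
  have h2 : SU.face 2 x = ![x 0, x 1, x 3] := by ext k; fin_cases k <;> rfl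
  have h3 : SU.face 3 x = ![x 0, x 1, x 2] := by ext k; fin_cases k <;> rfl
  rw [Fin.sum_univ_four, h0, h1, h2, h3]
  simp [sub_eq_add_neg, pow_succ]

end LowDegrees

/-! ### Semi-uniform spaces of graphs -/

section Graphs

/-- The semi-uniform space of a graph. -/
def graphSpace (V : Type) (r : V → V → Prop) : SemiUniformSpace.{0} where
  carrier := V
  entourages := Filter.principal {p | p.1 = p.2 ∨ r p.1 p.2 ∨ r p.2 p.1}
  diag_mem _ hU _ := hU (.inl rfl)
  inv_mem _ hU _ hp := hU (hp.elim (fun h => .inl h.symm) fun h => .inr h.symm)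

variable {V W : Type} (r : V → V → Prop) (t : W → W → Prop)

/-- The adjacency-or-equality relation of a graph. -/
def Near (a b : V) : Prop := a = b ∨ r a b ∨ r b a

variable {r t}

theorem near_rfl {a : V} : Near r a a := .inl rfl

theorem Near.symm {a b : V} (h : Near r a b) : Near r b a := h.elim (fun h => .inl h.symm) fun h => .inr h.symm

theorem eventually_graph {n : ℕ} {P : (Fin (n + 1) → V) → Prop} :
    (∀ᶠ x in SU.cliqueFilter (graphSpace V r) n, P x) ↔
      ∀ x : Fin (n + 1) → V, (∀ i j, i < j → Near r (x i) (x j)) → P x := by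
  refine SU.eventually_clique.trans ⟨fun ⟨U, hU, h⟩ x hx => h x fun i j hij => hU (hx i j hij), fun h =>
    ⟨_, Filter.mem_principal_self _, fun x hx => h x hx⟩⟩

/-- A graph homomorphism as a uniformly continuous map. -/
def graphMap (f : V → W) (hf : ∀ a b, r a b → t (f a) (f b)) : UniformMap (graphSpace V r) (graphSpace W t) where
  toFun := f
  preimage_mem _ hU _ hp := hU (hp.elim (fun h => .inl (congrArg f h))
    fun h => .inr (h.imp (hf _ _) (hf _ _)))

variable {M : Type} [AddCommGroup M]

theorem graph_H_one_subsingleton (h : ∀ F : V → V → M,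
    (∀ a b c, Near r a b → Near r a c → Near r b c → F b c - F a c + F a b = 0) →
      ∃ g : V → M, ∀ a b, Near r a b → F a b = g b - g a) :
    Subsingleton ((SU.germCx ℤ (graphSpace V r) M).H 1) := by
  refine subsingleton_of_forall_eq 0 fun y => ?_
  obtain ⟨⟨z, hz⟩, rfl⟩ := Cx.cls_surjective 1 y
  obtain ⟨f, rfl⟩ := germ_surjective z
  have hz' := eventually_graph.1 (germ_eq_zero.1 ((germCx_d 1 f).symm.trans hz))
  obtain ⟨g, hg⟩ := h (fun a b => f ![a, b]) fun a b c hab hac hbc => by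
    have := hz' ![a, b, c] (by
      intro i j hij
      fin_cases i <;> fin_cases j <;> first | exact absurd hij (by decide) | assumption)
    exact (sum_face_two ℤ (X := graphSpace V r) f _).symm.trans this
  refine Cx.cls_eq_zero.2 ⟨germ ℤ (SU.cliqueFilter (graphSpace V r) 0) M fun x => g (x 0), ?_⟩
  rw [germCx_d]
  refine germ_eq_germ.2 (eventually_graph.2 fun x hx => ?_)
  refine (sum_face_one ℤ (X := graphSpace V r) (fun x => g (x 0)) x).trans ?_
  refine (hg _ _ (hx 0 1 (by decide))).symm.trans (congrArg f ?_)
  ext k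
  fin_cases k <;> rfl

theorem graph_H_two_subsingleton (h : ∀ F : V → V → V → M,
    (∀ a b c d, Near r a b → Near r a c → Near r a d → Near r b c → Near r b d → Near r c d →
      F b c d - F a c d + F a b d - F a b c = 0) →
      ∃ g : V → V → M, ∀ a b c, Near r a b → Near r a c → Near r b c → F a b c = g b c - g a c + g a b) :
    Subsingleton ((SU.germCx ℤ (graphSpace V r) M).H 2) := by
  refine subsingleton_of_forall_eq 0 fun y => ?_
  obtain ⟨⟨z, hz⟩, rfl⟩ := Cx.cls_surjective 2 y
  obtain ⟨f, rfl⟩ := germ_surjective z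
  have hz' := eventually_graph.1 (germ_eq_zero.1 ((germCx_d 2 f).symm.trans hz))
  obtain ⟨g, hg⟩ := h (fun a b c => f ![a, b, c]) fun a b c d hab hac had hbc hbd hcd => by
    have := hz' ![a, b, c, d] (by
      intro i j hij
      fin_cases i <;> fin_cases j <;> first | exact absurd hij (by decide) | assumption)
    exact (sum_face_three ℤ (X := graphSpace V r) f _).symm.trans this
  refine Cx.cls_eq_zero.2 ⟨germ ℤ (SU.cliqueFilter (graphSpace V r) 1) M fun x => g (x 0) (x 1), ?_⟩
  rw [germCx_d]
  refine germ_eq_germ.2 (eventually_graph.2 fun x hx => ?_)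
  refine (sum_face_two ℤ (X := graphSpace V r) (fun x => g (x 0) (x 1)) x).trans ?_
  refine (hg _ _ _ (hx 0 1 (by decide)) (hx 0 2 (by decide)) (hx 1 2 (by decide))).symm.trans (congrArg f ?_)
  ext k
  fin_cases k <;> rfl

end Graphs

/-! ### A point, a circle and a projective plane -/

section Examples

/-- The one-point space. -/
abbrev pointSpace : SemiUniformSpace.{0} := graphSpace Unit fun _ _ => False

theorem point_H_one (M : Type) [AddCommGroup M] : Subsingleton ((SU.germCx ℤ pointSpace M).H 1) :=
  graph_H_one_subsingleton fun F hF => ⟨fun _ => 0, fun a b _ => by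
    have := hF () () () near_rfl near_rfl near_rfl
    simpa using this⟩

theorem point_H_two (M : Type) [AddCommGroup M] : Subsingleton ((SU.germCx ℤ pointSpace M).H 2) :=
  graph_H_two_subsingleton fun F _ => ⟨fun _ _ => F () () (), fun a b c _ _ _ => by simp⟩

/-- A cycle of length four. -/
abbrev squareSpace : SemiUniformSpace.{0} := graphSpace (ZMod 4) fun a b => b = a + 1

/-- A cycle of length four contains no triangles, so every clique of three entries is degenerate;
the complex is a circle. -/
theorem square_triangle : ∀ a b c : ZMod 4, Near (fun a b => b = a + 1) a b → Near (fun a b => b = a + 1) a c →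
    Near (fun a b => b = a + 1) b c → a = b ∨ b = c ∨ a = c := by
  unfold Near
  decide

theorem square_H_two (M : Type) [AddCommGroup M] : Subsingleton ((SU.germCx ℤ squareSpace M).H 2) := by
  refine graph_H_two_subsingleton fun F hF => ?_
  have h1 : ∀ a x, Near (fun a b : ZMod 4 => b = a + 1) a x → F a x x = F x x x := fun a x h => by
    have := hF a x x x h h h near_rfl near_rfl near_rfl
    rw [sub_add_cancel, sub_eq_zero] at this
    exact this.symm
  -- The even endpoint of an edge, the same for both orientations. Coning the edge from it gives the
  -- primitive `F (base a b) a b`.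
  let base : ZMod 4 → ZMod 4 → ZMod 4 := fun a b => if a = 0 ∨ a = 2 then a else b
  have hb : ∀ a b, Near (fun a b : ZMod 4 => b = a + 1) a b →
      (if a = 0 ∨ a = 2 then a else b) = (if b = 0 ∨ b = 2 then b else a) ∧
        ((if a = 0 ∨ a = 2 then a else b) = a ∨ (if a = 0 ∨ a = 2 then a else b) = b) := by
    unfold Near
    decide
  have hd : ∀ a, base a a = a := fun a => ite_self a
  refine ⟨fun a b => F (base a b) a b, fun a b c hab hac hbc => ?_⟩
  rcases square_triangle a b c hab hac hbc with rfl | rfl | rfl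
  · have := hF a a a c near_rfl near_rfl hac near_rfl hac hac
    rw [sub_self, zero_add, sub_eq_zero] at this
    simp only [hd, sub_self, zero_add]
    exact this
  · simp only [hd, sub_add_cancel]
    exact h1 a b hab
  · have e : base b a = base a b := (hb a b hab).1.symm
    simp only [hd, e]
    rcases (hb a b hab).2 with h | h
    · have h : base a b = a := h
      have := hF a a b a near_rfl hab near_rfl hab near_rfl hab.symm
      rw [sub_self, zero_add, sub_eq_zero] at this
      rw [h, this, sub_add_cancel]
    · have h : base a b = b := h
      have := hF b a b a hab.symm near_rfl hab.symm hab near_rfl hab.symm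
      rw [h1 b a hab.symm] at this
      rw [h, ← sub_eq_zero, ← this]
      abel

/-- A triangulated projective plane. -/
abbrev PlaneVertex : Type := Option (ZMod 8 ⊕ ZMod 4)

/-- The double covering of the inner circle by the outer circle. -/
abbrev wrap (i : ZMod 8) : ZMod 4 := ZMod.castHom (by decide : 4 ∣ 8) (ZMod 4) i

theorem wrap_add_four : ∀ i, wrap (i + 4) = wrap i := by decide

theorem eq_val_wrap : ∀ i : ZMod 8, i = ((wrap i).val : ZMod 8) ∨ i = ((wrap i).val : ZMod 8) + 4 := by decide

theorem wrap_val : ∀ j : ZMod 4, wrap (j.val : ZMod 8) = j := by decide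

/-- The oriented edges of a triangulated projective plane. -/
def planeEdge : PlaneVertex → PlaneVertex → Prop
  | none, some (.inl _) => True
  | some (.inl i), some (.inl j) => j = i + 1
  | some (.inl i), some (.inr j) => j = wrap i ∨ j = wrap i + 1
  | some (.inr j), some (.inr k) => k = j + 1
  | _, _ => False

instance : DecidableRel planeEdge := by
  intro a b
  rcases a with _ | a | a <;> rcases b with _ | b | b <;> unfold planeEdge <;> infer_instance

/-- The projective plane. -/
abbrev planeSpace : SemiUniformSpace.{0} := graphSpace PlaneVertex planeEdge

theorem plane_H_one : Subsingleton ((SU.germCx ℤ planeSpace ℤ).H 1) := by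
  refine graph_H_one_subsingleton fun F hF => ?_
  have hrefl : ∀ a, F a a = 0 := fun a => by simpa using hF a a a near_rfl near_rfl near_rfl
  have hsymm : ∀ a b, Near planeEdge a b → F b a = - F a b := fun a b h => by
    have := hF a b a h near_rfl h.symm
    rw [hrefl] at this
    omega
  let O (i : ZMod 8) : PlaneVertex := some (.inl i)
  let P (j : ZMod 4) : PlaneVertex := some (.inr j)
  -- `A i` is the potential at the inner vertex `wrap i` obtained along the path from the centre
  -- through the outer vertex `i`. It has to be shown that the two outer vertices over an inner one
  -- give the same value.
  let A (i : ZMod 8) : ℤ := F none (O i) + F (O i) (P (wrap i))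
  have zo : ∀ i, Near planeEdge none (O i) := fun i => .inr (.inl trivial)
  have oo : ∀ i, Near planeEdge (O i) (O (i + 1)) := fun i => .inr (.inl rfl)
  have op : ∀ i, Near planeEdge (O i) (P (wrap i)) := fun i => .inr (.inl (.inl rfl))
  have op' : ∀ i, Near planeEdge (O i) (P (wrap i + 1)) := fun i => .inr (.inl (.inr rfl))
  have pp : ∀ j, Near planeEdge (P j) (P (j + 1)) := fun i => .inr (.inl rfl)
  have hw : ∀ i, wrap (i + 1) = wrap i + 1 := fun i => by simp [wrap]
  have hoo : ∀ i, F (O i) (O (i + 1)) = F none (O (i + 1)) - F none (O i) := fun i => by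
    have := hF none (O i) (O (i + 1)) (zo _) (zo _) (oo _)
    omega
  have hop : ∀ i, F none (O i) + F (O i) (P (wrap i + 1)) = A (i + 1) := fun i => by
    have h1 := hF (O i) (O (i + 1)) (P (wrap (i + 1))) (oo _) (by rw [hw]; exact op' i) (op _)
    have h2 := hoo i
    have h3 : A (i + 1) = F none (O (i + 1)) + F (O (i + 1)) (P (wrap (i + 1))) := rfl
    rw [← hw i]
    omega
  have hpp : ∀ i, F (P (wrap i)) (P (wrap i + 1)) = A (i + 1) - A i := fun i => by
    have h1 := hF (O i) (P (wrap i)) (P (wrap i + 1)) (op _) (op' _) (pp _)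
    have h2 := hop i
    have h3 : A i = F none (O i) + F (O i) (P (wrap i)) := rfl
    omega
  have hD : ∀ i, A (i + 1 + 4) - A (i + 1) = A (i + 4) - A i := fun i => by
    have h1 := hpp i
    have h2 := hpp (i + 4)
    rw [wrap_add_four, add_right_comm] at h2
    omega
  -- The difference `A (i + 4) - A i` does not depend on `i`, yet replacing `i` by `i + 4` reverses
  -- its sign. So twice it is zero, and it vanishes in `ℤ`; modulo two this argument breaks down.
  have hA : ∀ i, A (i + 4) = A i := fun i => by
    have h1 := hD i
    have h2 := hD (i + 1)
    have h3 := hD (i + 1 + 1)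
    have h4 := hD (i + 1 + 1 + 1)
    have e1 : i + 1 + 1 + 1 + 1 = i + 4 := by ring
    have e2 : i + 4 + 4 = i := by
      rw [add_assoc]
      exact add_zero i
    rw [e1, e2] at h4
    omega
  let l (j : ZMod 4) : ZMod 8 := (j.val : ZMod 8)
  have hl : ∀ i, A (l (wrap i)) = A i := fun i => by
    rcases eq_val_wrap i with h | h
    · exact congrArg A h.symm
    · exact (hA _).symm.trans (congrArg A h.symm)
  let g : PlaneVertex → ℤ
    | none => 0
    | some (.inl i) => F none (O i)
    | some (.inr j) => A (l j)
  have key : ∀ a b, planeEdge a b → F a b = g b - g a := by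
    rintro (_ | i | j) (_ | i' | j') h
    · exact h.elim
    · exact (sub_zero _).symm
    · exact h.elim
    · exact h.elim
    · obtain rfl : i' = i + 1 := h
      exact hoo i
    · change F (O i) (P j') = A (l j') - F none (O i)
      obtain rfl | rfl : j' = wrap i ∨ j' = wrap i + 1 := h
      · rw [hl]
        exact (add_sub_cancel_left _ _).symm
      · rw [← hw, hl, hw, ← hop]
        exact (add_sub_cancel_left _ _).symm
    · exact h.elim
    · exact h.elim
    · obtain rfl : j' = j + 1 := h
      change F (P j) (P (j + 1)) = A (l (j + 1)) - A (l j)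
      have h1 := hpp (l j)
      have h2 := hl (l j + 1)
      have h3 : wrap (l j) = j := wrap_val j
      rw [hw, h3] at h2
      rw [h3] at h1
      rw [h1, h2]
  refine ⟨g, fun a b h => ?_⟩
  rcases h with rfl | h | h
  · rw [hrefl, sub_self]
  · exact key a b h
  · rw [hsymm b a (.inr (.inl h)), key b a h, neg_sub]

end Examples

end VietorisRips

namespace VietorisRips

open SemiUniformSpace

/-! ### The failure of natural splittings -/

theorem graph_generatedByFiniteType (V : Type) [Finite V] (r : V → V → Prop) :
    GeneratedByFiniteType ℤ (graphSpace V r) := by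
  let U : (graphSpace V r).Entourage := ⟨_, Filter.mem_principal_self _⟩
  refine ⟨{U}, fun W => ⟨U, rfl, W.mem⟩, ?_⟩
  rintro _ rfl n
  have hV : Finite (graphSpace V r).carrier := ‹Finite V›
  let K := (chains ℤ).obj (complex U)
  have h : Module.Finite ℤ (K.X n) :=
    inferInstanceAs (Module.Finite ℤ ({x : Fin (n + 1) → (graphSpace V r).carrier // ∀ i j, i < j → (x i, x j) ∈ U.val} →₀ ℤ))
  exact Module.Finite.of_surjective (hcls K n _ rfl) (hcls_surjective n _ rfl)

/-- The coefficients of the counterexample. -/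
abbrev intCoeff : ModuleCat.{0} ℤ := ModuleCat.of ℤ ℤ

/-- The coefficients modulo two. -/
abbrev modTwo : ModuleCat.{0} ℤ := ModuleCat.of ℤ (ZMod 2)

theorem tor_intCoeff (N : ModuleCat.{0} ℤ) : Limits.IsZero (tor₁ intCoeff N) := by
  have h : Function.Injective ((frInc ℤ N).lTensor ℤ) :=
    Module.Flat.lTensor_preserves_injective_linearMap _ frInc_injective
  have := ((frFlatPres (R := ℤ) N).lTensor_injective intCoeff).1 h
  exact ModuleCat.isZero_of_subsingleton _

theorem kunnethHypotheses_point (X : SemiUniformSpace.{0}) : KunnethHypotheses X pointSpace intCoeff modTwo :=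
  ⟨tor_intCoeff _, .inr ⟨graph_generatedByFiniteType Unit _, inferInstanceAs (Module.Finite ℤ (ZMod 2))⟩⟩

theorem cohomologyNat_subsingleton {X : SemiUniformSpace.{0}} {M : Type} [AddCommGroup M] {n : ℕ}
    (h : Subsingleton ((SU.germCx ℤ X M).H n)) : Subsingleton (cohomologyNat X (ModuleCat.of ℤ M) n) :=
  (germIso X (ModuleCat.of ℤ M) n).injective.subsingleton

section Vanishing

variable {R : Type u} [CommRing R] {X Y : SemiUniformSpace.{u}} {G G' : ModuleCat.{u} R} {n : ℕ}

theorem tensorTerm_subsingleton_of (h : ∀ i j, i + j = n → Subsingleton (cohomologyNat X G i) ∨ Subsingleton (cohomologyNat Y G' j)) :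
    Subsingleton (tensorTerm X Y G G' (Int.ofNat n)) := by
  have : Subsingleton (TensFam X Y G G' n) := @Pi.instSubsingleton _ _ fun s => by
    rcases h s.1.1 s.1.2 s.2 with h | h
    · have h' : Subsingleton (cohomologyNat Y G' s.1.2 ⊗[R] cohomologyNat X G s.1.1) :=
        subsingleton_of_forall_eq 0 tmul_eq_zero_of_subsingleton
      exact (TensorProduct.comm R (cohomologyNat X G s.1.1) (cohomologyNat Y G' s.1.2)).injective.subsingleton
    · exact subsingleton_of_forall_eq 0 tmul_eq_zero_of_subsingleton
  exact (tensorTermIso X Y G G' n).injective.subsingleton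

theorem torTerm_subsingleton_of (h : ∀ i j, i + j = n + 1 → Subsingleton (cohomologyNat X G i) ∨ Subsingleton (cohomologyNat Y G' j)) :
    Subsingleton (torTerm X Y G G' (Int.ofNat n)) := by
  have : Subsingleton (TorFam X Y G G' (n + 1)) := @Pi.instSubsingleton _ _ fun s => by
    rcases h s.1.1 s.1.2 s.2 with h | h
    · exact tor₁_subsingleton_left
    · exact tor₁_subsingleton_right
  exact (torTermIso X Y G G' (Int.ofNat n) (n + 1) rfl).injective.subsingleton

/-- With zero tensor term `β` is injective for `(X₁, Y₁)`, so the section inverts it. Naturality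
then makes the map between the products factor through the torsion term of `(X, Y)`, which is zero.
-/
theorem not_splitsCanonically_of (K : NaturalKunnethSequence.{u} R) {X₁ Y₁ : SemiUniformSpace.{u}} {q : ℤ}
    (h : KunnethHypotheses X₁ Y₁ G G') (h₁ : KunnethHypotheses X Y G G') {f : UniformMap X X₁} {g : UniformMap Y Y₁}
    (ht : Subsingleton (tensorTerm X₁ Y₁ G G' q)) (ht₁ : Subsingleton (torTerm X Y G G' q))
    (hfg : productTermMap f g (𝟙 G) (𝟙 G') q ≠ 0) : ¬ K.SplitsCanonically G G' := by
  rintro ⟨s, hs, hnat⟩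
  refine hfg (LinearMap.ext fun x => ?_)
  have hinj : Function.Injective (K.β h q) := by
    rw [injective_iff_map_eq_zero]
    intro x hx
    obtain ⟨y, rfl⟩ := (K.exact h q x).1 hx
    rw [Subsingleton.elim y 0, map_zero]
  have hx : s h q (K.β h q x) = x := hinj (LinearMap.congr_fun (hs h q) _)
  rw [← hx]
  refine (LinearMap.congr_fun (hnat h h₁ f g q) _).trans ?_
  rw [LinearMap.comp_apply, Subsingleton.elim (torTermMap f g (𝟙 G) (𝟙 G') q _) 0, map_zero]
  rfl

end Vanishing

theorem tensorTerm_plane_point : Subsingleton (tensorTerm planeSpace pointSpace intCoeff modTwo (Int.ofNat 1)) :=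
  tensorTerm_subsingleton_of fun i j e => by
    obtain ⟨rfl, rfl⟩ | ⟨rfl, rfl⟩ : (i = 0 ∧ j = 1) ∨ (i = 1 ∧ j = 0) := by omega
    · exact .inr (cohomologyNat_subsingleton (point_H_one (ZMod 2)))
    · exact .inl (cohomologyNat_subsingleton plane_H_one)

theorem torTerm_square_point : Subsingleton (torTerm squareSpace pointSpace intCoeff modTwo (Int.ofNat 1)) :=
  torTerm_subsingleton_of fun i j e => by
    obtain ⟨rfl, rfl⟩ | ⟨rfl, rfl⟩ | ⟨rfl, rfl⟩ : (i = 0 ∧ j = 2) ∨ (i = 1 ∧ j = 1) ∨ (i = 2 ∧ j = 0) := by omega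
    · exact .inr (cohomologyNat_subsingleton (point_H_two (ZMod 2)))
    · exact .inr (cohomologyNat_subsingleton (point_H_one (ZMod 2)))
    · exact .inl (cohomologyNat_subsingleton (square_H_two ℤ))

/-- A cocycle modulo two on the projective plane that is nontrivial on the inner circle. -/
def planeCocycle : PlaneVertex → PlaneVertex → ZMod 2
  | some (.inl i), some (.inr j) | some (.inr j), some (.inl i) =>
    if (if j = wrap i then i else i + 1).val < 4 then 0 else 1
  | some (.inr j), some (.inr k) => if j = 3 ∧ k = 0 ∨ j = 0 ∧ k = 3 then 1 else 0
  | _, _ => 0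

theorem planeCocycle_eq : ∀ a b c : PlaneVertex, Near planeEdge a b → Near planeEdge a c → Near planeEdge b c →
    planeCocycle b c - planeCocycle a c + planeCocycle a b = 0 := by
  unfold Near
  decide +kernel

/-- The sum round the inner circle would be zero for a coboundary, so the value `1` detects a
nonzero class there. -/
theorem planeCocycle_square : planeCocycle (some (.inr 0)) (some (.inr (0 + 1))) +
    planeCocycle (some (.inr 1)) (some (.inr (1 + 1))) + planeCocycle (some (.inr 2)) (some (.inr (2 + 1))) +
    planeCocycle (some (.inr 3)) (some (.inr (3 + 1))) = 1 := by decide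

/-- The inclusion of the inner circle. -/
def innerCircle : UniformMap squareSpace planeSpace := graphMap (fun j => some (.inr j)) fun _ _ h => h

/-- The identity of the point. -/
def pointId : UniformMap pointSpace pointSpace := graphMap id fun _ _ h => h

/-- The class modulo two of the projective plane, as a function on pairs. -/
def planeCochain (x : Fin 2 → (planeSpace.prod pointSpace).carrier) : tensorCoeff intCoeff modTwo :=
  (1 : ℤ) ⊗ₜ[ℤ] planeCocycle (x 0).1 (x 1).1

theorem planeCochain_mem : germ ℤ (SU.cliqueFilter (planeSpace.prod pointSpace) 1) (tensorCoeff intCoeff modTwo) planeCochain ∈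
    (SU.germCx ℤ (planeSpace.prod pointSpace) (tensorCoeff intCoeff modTwo)).Z 1 := by
  change (SU.germCx ℤ (planeSpace.prod pointSpace) (tensorCoeff intCoeff modTwo)).d 1 _ = 0
  rw [germCx_d]
  refine germ_eq_zero.2 (SU.eventually_clique.2 ⟨prodRel {p | Near planeEdge p.1 p.2} Set.univ,
    ⟨_, Filter.mem_principal_self _, _, Filter.univ_mem, subset_rfl⟩, fun x hx => ?_⟩)
  refine (sum_face_two ℤ planeCochain x).trans ?_
  change (1 : ℤ) ⊗ₜ[ℤ] planeCocycle (x 1).1 (x 2).1 - (1 : ℤ) ⊗ₜ[ℤ] planeCocycle (x 0).1 (x 2).1 +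
    (1 : ℤ) ⊗ₜ[ℤ] planeCocycle (x 0).1 (x 1).1 = 0
  rw [← TensorProduct.tmul_sub, ← TensorProduct.tmul_add,
    planeCocycle_eq _ _ _ (hx 0 1 (by decide)).1 (hx 0 2 (by decide)).1 (hx 1 2 (by decide)).1,
    TensorProduct.tmul_zero]

/-- Were the restricted class the coboundary of some `g`, the sum of its values round the inner
circle would telescope to zero; but it is `1 ⊗ 1`, which is nonzero in `ℤ ⊗ ZMod 2`. -/
theorem productTermMap_innerCircle_ne_zero :
    productTermMap innerCircle pointId (𝟙 intCoeff) (𝟙 modTwo) (Int.ofNat 1) ≠ 0 := by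
  intro h0
  obtain ⟨c, hc⟩ := (germIso (planeSpace.prod pointSpace) (tensorCoeff intCoeff modTwo) 1).surjective
    ((SU.germCx ℤ (planeSpace.prod pointSpace) (tensorCoeff intCoeff modTwo)).cls 1 ⟨_, planeCochain_mem⟩)
  have h1 : cohomologyNatMap (innerCircle.prodMap pointId) (tensorCoeffMap (𝟙 intCoeff) (𝟙 modTwo)) 1 c = 0 :=
    LinearMap.congr_fun h0 c
  have h2 := germIso_natural (innerCircle.prodMap pointId) (tensorCoeffMap (𝟙 intCoeff) (𝟙 modTwo)) 1 c
  rw [h1, map_zero, hc] at h2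
  obtain ⟨y, hy⟩ := Cx.cls_eq_zero.1 h2.symm
  obtain ⟨g, rfl⟩ := germ_surjective y
  have h3 := (germCx_d 0 g).symm.trans hy
  obtain ⟨W, ⟨U, hU, V, hV, hW⟩, h4⟩ := SU.eventually_clique.1 (germ_eq_germ.1 h3)
  have h5 : ∀ j : ZMod 4, g ![(j + 1, ())] - g ![(j, ())] =
      (1 : ℤ) ⊗ₜ[ℤ] planeCocycle (some (.inr j)) (some (.inr (j + 1))) := fun j => by
    refine (sum_face_one ℤ g ![(j, ()), (j + 1, ())]).symm.trans (h4 ![(j, ()), (j + 1, ())] ?_)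
    intro i k hik
    fin_cases i <;> fin_cases k <;> first
      | exact absurd hik (by decide)
      | exact hW ⟨hU (.inr (.inl rfl)), pointSpace.diag_mem V hV ()⟩
  have h6 : (1 : ℤ) ⊗ₜ[ℤ] (1 : ZMod 2) = 0 := by
    rw [← planeCocycle_square, TensorProduct.tmul_add, TensorProduct.tmul_add, TensorProduct.tmul_add]
    refine (congrArg₂ _ (congrArg₂ _ (congrArg₂ _ (h5 0) (h5 1)) (h5 2)) (h5 3)).symm.trans ?_
    change g ![((1 : ZMod 4), ())] - g ![((0 : ZMod 4), ())] + (g ![((2 : ZMod 4), ())] - g ![((1 : ZMod 4), ())]) +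
      (g ![((3 : ZMod 4), ())] - g ![((2 : ZMod 4), ())]) + (g ![((0 : ZMod 4), ())] - g ![((3 : ZMod 4), ())]) = 0
    abel
  have h7 := congrArg (TensorProduct.lid ℤ (ZMod 2)) h6
  rw [TensorProduct.lid_tmul, map_zero, one_smul] at h7
  exact one_ne_zero h7

theorem not_splitsCanonically (K : NaturalKunnethSequence.{0} ℤ) : ¬ K.SplitsCanonically intCoeff modTwo :=
  not_splitsCanonically_of K (kunnethHypotheses_point planeSpace) (kunnethHypotheses_point squareSpace)
    tensorTerm_plane_point torTerm_square_point productTermMap_innerCircle_ne_zero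

end VietorisRips

end

theorem mainTheorem1 :
    (∀ (R : Type u) [CommRing R] [IsDomain R] [IsPrincipalIdealRing R],
      ∃ K : VietorisRips.NaturalKunnethSequence.{u} R, K.Splits) ∧
    (∃ G G' : ModuleCat.{0} ℤ, Limits.IsZero (VietorisRips.tor₁ G G') ∧
      ∀ K : VietorisRips.NaturalKunnethSequence.{0} ℤ, ¬ K.SplitsCanonically G G') :=
  ⟨fun R _ _ _ => ⟨VietorisRips.kunneth R, VietorisRips.kunneth_splits R⟩,
    VietorisRips.intCoeff, VietorisRips.modTwo, VietorisRips.tor_intCoeff _, VietorisRips.not_splitsCanonically⟩
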